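/- Let $R$ be a commutative ring with identity, $q^{1/2}\in R$ a fixed invertible element, write $\overline q=q^{-1}$, suppose that $\alpha=q+\overline q$ is invertible in $R$, and put $\beta=\alpha^{-1}$. Let $\Sigma=\Sigma_{0,n+1}$ be displayed as the plane (equivalently, a large open disk) with the punctures $\mathsf p_k=(k,0)$, $k=1,\dots,n$, and let $\mathcal S_n=\mathcal S(\Sigma;R)$ be its Kauffman bracket skein algebra: the free $R$-module on isotopy classes of framed links in $\Sigma\times(0,1)$ modulo $L_\times=q^{1/2}L_\infty+q^{-1/2}L_0$ (where $L_\infty$ joins the two regions swept out when the overcrossing strand is turned counterclockwise) and $L\sqcup\bigcirc=-(q+\overline q)L$, with the product $L_1L_2$ given by stacking $L_1$ above $L_2$. For a nonempty $I=\{i_1<\dots<i_r\}\subseteq\{1,\dots,n\}$ let $t_I=t_{i_1\cdots i_r}\in\mathcal S_n$ be the class (with vertical framing) of the simple closed curve bounding a disk that contains exactly the punctures $\mathsf p_i$, $i\in I$, and does not meet the vertical rays going up from the punctures $\mathsf p_k$, $k\notin I$. For distinct indices put $$s_{ij}=t_{ij}+\beta t_it_j,\qquad s_{ijk}=t_{ijk}+\beta(t_it_{jk}+t_jt_{ik}+t_kt_{ij})+2\beta^2t_it_jt_k,$$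 which depend only on the set of indices, and put $s_{ii}=\alpha-\beta t_i^2$. Say that $(i_1,\dots,i_m)$ is in cyclic order if some cyclic rotation of it is strictly increasing. Then the following identities hold in $\mathcal S_n$. (1) The elements $t_1,\dots,t_n$ are central. For $(i_1,\dots,i_4)$, $(i_1,\dots,i_5)$, $(i_1,\dots,i_6)$ in cyclic order, respectively, $$s_{i_3i_4}s_{i_1i_2}=s_{i_1i_2}s_{i_3i_4},\quad s_{i_3i_4i_5}s_{i_1i_2}=s_{i_1i_2}s_{i_3i_4i_5},\quad s_{i_1i_2i_3}s_{i_4i_5i_6}=s_{i_4i_5i_6}s_{i_1i_2i_3}.$$ (2) For $(i_1,i_2,i_3)$ in cyclic order, $$qs_{i_2i_3}s_{i_1i_2}-\overline qs_{i_1i_2}s_{i_2i_3}=(q-\overline q)(s_{i_2i_2}s_{i_1i_3}+t_{i_2}s_{i_1i_2i_3}).$$ For $(i_1,\dots,i_4)$ in cyclic order, $$s_{i_2i_4}s_{i_1i_3}-s_{i_1i_3}s_{i_2i_4}=(q^2-\overline q^2)(s_{i_1i_4}s_{i_2i_3}-s_{i_1i_2}s_{i_3i_4}).$$ (3) For $(i_1,i_2,i_3)$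 in cyclic order, $$s_{i_1i_2i_3}s_{i_1i_2}-s_{i_1i_2}s_{i_1i_2i_3}=\beta(q-\overline q)\big(qt_{i_2}(s_{i_1i_2}s_{i_1i_3}-s_{i_1i_1}s_{i_2i_3}-t_{i_1}s_{i_1i_2i_3})-\overline qt_{i_1}(s_{i_1i_2}s_{i_2i_3}-s_{i_2i_2}s_{i_1i_3}-t_{i_2}s_{i_1i_2i_3})\big).$$ For $(i_1,\dots,i_4)$ in cyclic order, $$qs_{i_2i_3i_4}s_{i_1i_2}-\overline qs_{i_1i_2}s_{i_2i_3i_4}=(q-\overline q)\big(s_{i_2i_2}s_{i_1i_3i_4}+\beta t_{i_2}(s_{i_1i_3}s_{i_2i_4}+(1-q^2)s_{i_1i_2}s_{i_3i_4}-\overline q^2s_{i_1i_4}s_{i_2i_3})\big),$$ $$\overline qs_{i_1i_3i_4}s_{i_1i_2}-qs_{i_1i_2}s_{i_1i_3i_4}=(\overline q-q)\big(s_{i_1i_1}s_{i_2i_3i_4}+\beta t_{i_1}(s_{i_1i_3}s_{i_2i_4}+(1-q^2)s_{i_1i_2}s_{i_3i_4}-\overline q^2s_{i_1i_4}s_{i_2i_3})\big),$$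 $$s_{i_1i_2i_4}s_{i_1i_3}-s_{i_1i_3}s_{i_1i_2i_4}=(q-\overline q)\big(\overline qs_{i_1i_4}s_{i_1i_2i_3}-qs_{i_1i_2}s_{i_1i_3i_4}+(q-\overline q)s_{i_1i_1}s_{i_2i_3i_4}+\beta t_{i_1}((q-\overline q)s_{i_1i_3}s_{i_2i_4}+(q-\overline q-q^3)s_{i_1i_2}s_{i_3i_4}+(\overline q^3+q-\overline q)s_{i_1i_4}s_{i_2i_3})\big).$$ For $(i_1,\dots,i_5)$ in cyclic order, $$s_{i_2i_4i_5}s_{i_1i_3}-s_{i_1i_3}s_{i_2i_4i_5}=(q^2-\overline q^2)(s_{i_2i_3}s_{i_1i_4i_5}-s_{i_1i_2}s_{i_3i_4i_5}).$$ -/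

import Mathlib

open Set Topology

/-! # The Kauffman bracket skein algebra of a planar surface -/

namespace PlanarSkein

noncomputable section

/-- The ambient space `ℝ² × ℝ`: a point is `((x, y), z)`, with `z` the height. The projection to
the plane is `Prod.fst`. -/
abbrev Space : Type := (ℝ × ℝ) × ℝ

/-- First coordinate of the `k`-th puncture; `Fin n` stands for `{1, …, n}`. -/
def pos {n : ℕ} (k : Fin n) : ℝ := (k : ℕ) + 1

/-- The planar surface `Σ_{0,n+1}` (its interior): the plane with the `n` points
`(1, 0), …, (n, 0)` removed. -/
def surface (n : ℕ) : Set (ℝ × ℝ) := {p | ∀ k : Fin n, p ≠ (pos k, 0)}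

/-- The thickened surface `Σ × (0,1)`. -/
def thickened (n : ℕ) : Set Space := surface n ×ˢ Ioo (0 : ℝ) 1

/-- The projection to the plane is locally injective on `X`. For a polygonal curve this says that
there are no vertical edges and that the projection does not fold back at a vertex, so that the
vertical direction is nowhere tangent and is a framing. -/
def LocInj (X : Set Space) : Prop := ∀ p ∈ X, ∃ U ∈ 𝓝 p, InjOn Prod.fst (X ∩ U)

/-- Near `p`, the set `X` is the union of two segments that leave `p` in distinct directions. -/
def TwoRaysAt (X : Set Space) (p : Space) : Prop :=
  ∃ u v : Space, ¬ SameRay ℝ u v ∧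
    ∃ U ∈ 𝓝 p, X ∩ U = (segment ℝ p (p + u) ∪ segment ℝ p (p + v)) ∩ U

/-- A (possibly empty) polygonal link in `Σ × (0,1)` with vertical framing: a compact polygonal
`1`-manifold without boundary whose projection to `Σ` is an immersion. -/
@[ext] structure Link (n : ℕ) where
  carrier : Set Space
  isCompact : IsCompact carrier
  subset : carrier ⊆ thickened n
  polygonal : ∀ p ∈ carrier, TwoRaysAt carrier p
  immersed : LocInj carrier

/-- The triangle (with its interior) spanned by three points of space. -/
def triangle (a b c : Space) : Set Space := convexHull ℝ {a, b, c}

/-- The tetrahedron spanned by four points of space. -/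
def tetra (a b c d : Space) : Set Space := convexHull ℝ {a, b, c, d}

/-- The elementary `Δ`-move of knot theory: the segment `ab` of `L` is pushed across a triangle
`abc ⊆ Σ × (0,1)` that meets `L` in `ab` only. Local injectivity of the projection on the union of
`L` and the triangle says that the vertical framing is carried along (no kink is created or
removed at `a` or `b`). -/
def DeltaMove {n : ℕ} (L L' : Link n) : Prop :=
  ∃ a b c : Space, triangle a b c ⊆ thickened n ∧
    L.carrier ∩ triangle a b c = segment ℝ a b ∧
    LocInj (L.carrier ∪ triangle a b c) ∧
    L'.carrier = (L.carrier \ segment ℝ a b) ∪ (segment ℝ a c ∪ segment ℝ c b)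

/-- A vertical isotopy: the heights of the points of `L` are changed continuously, while points with
the same projection keep their order. -/
def HeightMove {n : ℕ} (L L' : Link n) : Prop :=
  ∃ h : Space → ℝ, ContinuousOn h L.carrier ∧
    (∀ p ∈ L.carrier, ∀ p' ∈ L.carrier, p.1 = p'.1 → p.2 < p'.2 → h p < h p') ∧
    L'.carrier = (fun p => (p.1, h p)) '' L.carrier

def Move {n : ℕ} (L L' : Link n) : Prop := DeltaMove L L' ∨ HeightMove L L'

/-! ### Stacking -/

/-- The affine change of height `z ↦ c z + d`. -/
def rescale (c d : ℝ) (p : Space) : Space := (p.1, c * p.2 + d)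

theorem rescale_segment (c d : ℝ) (p q : Space) :
    rescale c d '' segment ℝ p q = segment ℝ (rescale c d p) (rescale c d q) := by
  ext x
  simp only [segment, mem_image, mem_ofPred_eq]
  constructor
  · rintro ⟨_, ⟨s, t, hs, ht, hst, rfl⟩, rfl⟩
    refine ⟨s, t, hs, ht, hst, ?_⟩
    simp only [rescale, Prod.ext_iff, Prod.fst_add, Prod.snd_add, Prod.smul_fst, Prod.smul_snd,
      smul_eq_mul, true_and]
    linear_combination d * hst
  · rintro ⟨s, t, hs, ht, hst, rfl⟩
    refine ⟨_, ⟨s, t, hs, ht, hst, rfl⟩, ?_⟩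
    simp only [rescale, Prod.ext_iff, Prod.fst_add, Prod.snd_add, Prod.smul_fst, Prod.smul_snd,
      smul_eq_mul, true_and]
    linear_combination -d * hst

/-- `rescale` as an affine map. -/
def rescaleAffine (c d : ℝ) : Space →ᵃ[ℝ] Space where
  toFun := rescale c d
  linear := LinearMap.prodMap LinearMap.id (c • LinearMap.id)
  map_vadd' := by
    intro p v
    simp [rescale, Prod.ext_iff]
    ring

theorem rescale_convexHull (c d : ℝ) (s : Set Space) :
    rescale c d '' convexHull ℝ s = convexHull ℝ (rescale c d '' s) :=
  (rescaleAffine c d).image_convexHull s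

theorem rescale_triangle (c d : ℝ) (p q r : Space) :
    rescale c d '' triangle p q r =
      triangle (rescale c d p) (rescale c d q) (rescale c d r) := by
  simp only [triangle, rescale_convexHull, image_insert_eq, image_singleton]

theorem continuous_rescale (c d : ℝ) : Continuous (rescale c d) := by
  unfold rescale; fun_prop

/-- `rescale` as a homeomorphism. -/
def rescaleHomeo (c d : ℝ) (hc : c ≠ 0) : Space ≃ₜ Space where
  toFun := rescale c d
  invFun := rescale c⁻¹ (-(c⁻¹ * d))
  left_inv := by
    intro p; simp only [rescale, Prod.ext_iff, true_and]; field_simp; ring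
  right_inv := by
    intro p; simp only [rescale, Prod.ext_iff, true_and]; field_simp; ring
  continuous_toFun := continuous_rescale _ _
  continuous_invFun := continuous_rescale _ _

theorem rescale_injective (c d : ℝ) (hc : c ≠ 0) : Function.Injective (rescale c d) :=
  (rescaleHomeo c d hc).injective

theorem LocInj.mono {X Y : Set Space} (h : LocInj Y) (hXY : X ⊆ Y) : LocInj X := fun p hp => by
  obtain ⟨U, hU, hi⟩ := h p (hXY hp)
  exact ⟨U, hU, hi.mono (inter_subset_inter_left _ hXY)⟩

theorem LocInj.rescale {X : Set Space} (h : LocInj X) (c d : ℝ) (hc : c ≠ 0) :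
    LocInj (rescale c d '' X) := by
  rintro _ ⟨p, hp, rfl⟩
  obtain ⟨U, hU, hi⟩ := h p hp
  refine ⟨PlanarSkein.rescale c d '' U, (rescaleHomeo c d hc).isOpenMap.image_mem_nhds hU, ?_⟩
  rw [← image_inter (rescale_injective c d hc)]
  rintro _ ⟨x, hx, rfl⟩ _ ⟨y, hy, rfl⟩ hxy
  rw [hi hx hy hxy]

theorem LocInj.union {X Y : Set Space} (hX : LocInj X) (hY : LocInj Y) (cX : IsClosed X)
    (cY : IsClosed Y) (hd : Disjoint X Y) : LocInj (X ∪ Y) := by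
  have aux : ∀ {A B : Set Space}, LocInj A → IsClosed B → Disjoint A B → ∀ p ∈ A,
      ∃ U ∈ 𝓝 p, InjOn Prod.fst ((A ∪ B) ∩ U) := by
    intro A B hA cB hAB p hp
    obtain ⟨U, hU, hi⟩ := hA p hp
    refine ⟨U ∩ Bᶜ, Filter.inter_mem hU (cB.isOpen_compl.mem_nhds
      (disjoint_left.mp hAB hp)), hi.mono ?_⟩
    rintro x ⟨hx | hx, hxU, hxB⟩
    · exact ⟨hx, hxU⟩
    · exact absurd hx hxB
  rintro p (hp | hp)
  · exact aux hX cY hd p hp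
  · rw [union_comm]; exact aux hY cX hd.symm p hp

theorem TwoRaysAt.rescale {X : Set Space} {p : Space} (h : TwoRaysAt X p) (c d : ℝ) (hc : c ≠ 0) :
    TwoRaysAt (rescale c d '' X) (rescale c d p) := by
  obtain ⟨u, v, huv, U, hU, hX⟩ := h
  have hl : Function.Injective (LinearMap.prodMap (LinearMap.id : (ℝ × ℝ) →ₗ[ℝ] (ℝ × ℝ))
      (c • (LinearMap.id : ℝ →ₗ[ℝ] ℝ))) := by
    rintro ⟨x, y⟩ ⟨x', y'⟩ hxy
    simpa [hc] using hxy
  have hadd : ∀ w : Space, PlanarSkein.rescale c d p +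
      LinearMap.prodMap (LinearMap.id : (ℝ × ℝ) →ₗ[ℝ] (ℝ × ℝ)) (c • (LinearMap.id : ℝ →ₗ[ℝ] ℝ)) w =
      PlanarSkein.rescale c d (p + w) := by
    intro w
    simp [PlanarSkein.rescale, Prod.ext_iff]
    ring
  refine ⟨LinearMap.prodMap (LinearMap.id : (ℝ × ℝ) →ₗ[ℝ] (ℝ × ℝ)) (c • (LinearMap.id : ℝ →ₗ[ℝ] ℝ)) u,
    LinearMap.prodMap (LinearMap.id : (ℝ × ℝ) →ₗ[ℝ] (ℝ × ℝ)) (c • (LinearMap.id : ℝ →ₗ[ℝ] ℝ)) v, ?_,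
    PlanarSkein.rescale c d '' U, (rescaleHomeo c d hc).isOpenMap.image_mem_nhds hU, ?_⟩
  · rwa [hl.sameRay_map_iff]
  · rw [← image_inter (rescale_injective c d hc), hX, image_inter (rescale_injective c d hc),
      image_union, rescale_segment, rescale_segment, hadd, hadd]

theorem TwoRaysAt.union {X Y : Set Space} {p : Space} (h : TwoRaysAt X p) (cY : IsClosed Y)
    (hp : p ∉ Y) : TwoRaysAt (X ∪ Y) p := by
  obtain ⟨u, v, huv, U, hU, hX⟩ := h
  refine ⟨u, v, huv, U ∩ Yᶜ, Filter.inter_mem hU (cY.isOpen_compl.mem_nhds hp), ?_⟩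
  have : (X ∪ Y) ∩ (U ∩ Yᶜ) = (X ∩ U) ∩ Yᶜ := by
    ext x; simp only [mem_inter_iff, mem_union, mem_compl_iff]; tauto
  rw [this, hX, inter_assoc]

/-- The upper half: `z ↦ (z + 1) / 2`. -/
abbrev up : Space → Space := rescale (1 / 2) (1 / 2)

/-- The lower half: `z ↦ z / 2`. -/
abbrev down : Space → Space := rescale (1 / 2) 0

theorem up_gt {n : ℕ} {X : Set Space} (hX : X ⊆ thickened n) {p : Space} (hp : p ∈ up '' X) :
    p ∈ thickened n ∧ 1 / 2 < p.2 := by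
  obtain ⟨q, hq, rfl⟩ := hp
  obtain ⟨h1, h2, h3⟩ := hX hq
  simp only [rescale, thickened, mem_prod, mem_Ioo]
  exact ⟨⟨h1, by linarith, by linarith⟩, by linarith⟩

theorem down_lt {n : ℕ} {X : Set Space} (hX : X ⊆ thickened n) {p : Space} (hp : p ∈ down '' X) :
    p ∈ thickened n ∧ p.2 < 1 / 2 := by
  obtain ⟨q, hq, rfl⟩ := hp
  obtain ⟨h1, h2, h3⟩ := hX hq
  simp only [rescale, thickened, mem_prod, mem_Ioo]
  exact ⟨⟨h1, by linarith, by linarith⟩, by linarith⟩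

theorem disjoint_up_down {n : ℕ} {X Y : Set Space} (hX : X ⊆ thickened n) (hY : Y ⊆ thickened n) :
    Disjoint (up '' X) (down '' Y) :=
  disjoint_left.mpr fun _ h h' => lt_asymm (up_gt hX h).2 (down_lt hY h').2

/-- The stacked link `L L'`, with `L` drawn above `L'`. -/
def Link.stack {n : ℕ} (L L' : Link n) : Link n where
  carrier := up '' L.carrier ∪ down '' L'.carrier
  isCompact := (L.isCompact.image (continuous_rescale _ _)).union
    (L'.isCompact.image (continuous_rescale _ _))
  subset := by
    rintro p (hp | hp)
    · exact (up_gt L.subset hp).1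
    · exact (down_lt L'.subset hp).1
  polygonal := by
    have hd := disjoint_up_down L.subset L'.subset
    rintro p (hp | hp)
    · have hp' := disjoint_left.mp hd hp
      obtain ⟨q, hq, rfl⟩ := hp
      exact ((L.polygonal q hq).rescale _ _ (by norm_num)).union
        (L'.isCompact.image (continuous_rescale _ _)).isClosed hp'
    · have hp' := disjoint_right.mp hd hp
      obtain ⟨q, hq, rfl⟩ := hp
      rw [union_comm]
      exact ((L'.polygonal q hq).rescale _ _ (by norm_num)).union
        (L.isCompact.image (continuous_rescale _ _)).isClosed hp'
  immersed := (L.immersed.rescale _ _ (by norm_num)).union (L'.immersed.rescale _ _ (by norm_num))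
    (L.isCompact.image (continuous_rescale _ _)).isClosed
    (L'.isCompact.image (continuous_rescale _ _)).isClosed (disjoint_up_down L.subset L'.subset)

/-- The empty link. -/
def Link.empty (n : ℕ) : Link n where
  carrier := ∅
  isCompact := isCompact_empty
  subset := empty_subset _
  polygonal := fun _ h => h.elim
  immersed := fun _ h => h.elim

theorem isCompact_triangle (a b c : Space) : IsCompact (triangle a b c) :=
  (Set.toFinite _).isCompact_convexHull ℝ

theorem segment_subset_triangle (a b c : Space) : segment ℝ a b ⊆ triangle a b c :=
  (convex_convexHull ℝ _).segment_subset (subset_convexHull ℝ _ (by simp))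
    (subset_convexHull ℝ _ (by simp))

theorem DeltaMove.of_image {n : ℕ} {L L' M M' : Link n} (h : DeltaMove L L') (d : ℝ)
    {Y : Set Space} (hY : IsClosed Y)
    (hT : ∀ X ⊆ thickened n, rescale (1 / 2) d '' X ⊆ thickened n ∧
      Disjoint (rescale (1 / 2) d '' X) Y)
    (hM : M.carrier = rescale (1 / 2) d '' L.carrier ∪ Y)
    (hM' : M'.carrier = rescale (1 / 2) d '' L'.carrier ∪ Y) : DeltaMove M M' := by
  obtain ⟨a, b, c, h1, h2, h3, h4⟩ := h
  have inj := rescale_injective (1 / 2) d (by norm_num)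
  obtain ⟨k1, k2⟩ := hT _ h1
  have k3 := (hT _ ((segment_subset_triangle a b c).trans h1)).2
  refine ⟨rescale (1 / 2) d a, rescale (1 / 2) d b, rescale (1 / 2) d c, ?_, ?_, ?_, ?_⟩
  · rwa [← rescale_triangle]
  · rw [← rescale_triangle, hM, union_inter_distrib_right, ← image_inter inj, h2,
      k2.symm.inter_eq, union_empty, rescale_segment]
  · rw [← rescale_triangle, hM, union_right_comm, ← image_union]
    refine (h3.rescale _ _ (by norm_num)).union ?_ ?_ hY ?_
    · exact M.immersed.mono (by rw [hM]; exact subset_union_right)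
    · exact ((L.isCompact.union (isCompact_triangle a b c)).image
        (continuous_rescale _ _)).isClosed
    · exact (hT _ (union_subset L.subset h1)).2
  · rw [hM', hM, h4, image_union, image_union, image_sdiff inj, ← rescale_segment,
      ← rescale_segment, ← rescale_segment, union_sdiff_distrib, k3.symm.sdiff_eq_left]
    ac_rfl

theorem HeightMove.of_image {n : ℕ} {L L' M M' : Link n} (h : HeightMove L L') (d : ℝ)
    {N : Link n} (e : ℝ) {P : ℝ → Prop}
    (hP : ∀ K : Link n, ∀ p ∈ K.carrier, P (rescale (1 / 2) d p).2)
    (hP' : ∀ K : Link n, ∀ p ∈ K.carrier, ¬ P (rescale (1 / 2) e p).2)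
    (ho : (∀ s t, P s → ¬ P t → s < t) ∨ (∀ s t, P s → ¬ P t → t < s))
    (hM : M.carrier = rescale (1 / 2) d '' L.carrier ∪ rescale (1 / 2) e '' N.carrier)
    (hM' : M'.carrier = rescale (1 / 2) d '' L'.carrier ∪ rescale (1 / 2) e '' N.carrier) :
    HeightMove M M' := by
  classical
  obtain ⟨h, h1, h2, h3⟩ := h
  let g : Space → ℝ := fun p => if P p.2 then 1 / 2 * h (rescale 2 (-2 * d) p) + d else p.2
  have hinv : ∀ p, rescale 2 (-2 * d) (rescale (1 / 2) d p) = p := by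
    intro p; simp only [rescale, Prod.ext_iff, true_and]; ring
  have g1 : ∀ p ∈ L.carrier, g (rescale (1 / 2) d p) = 1 / 2 * h p + d := by
    intro p hp
    simp only [g, if_pos (hP L p hp), hinv]
  have g2 : ∀ p ∈ N.carrier, g (rescale (1 / 2) e p) = (rescale (1 / 2) e p).2 := by
    intro p hp
    simp only [g, if_neg (hP' N p hp)]
  have g1' : ∀ p ∈ L.carrier, P (g (rescale (1 / 2) d p)) := by
    intro p hp
    have : (p.1, h p) ∈ L'.carrier := by rw [h3]; exact ⟨p, hp, rfl⟩
    rw [g1 p hp]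
    exact hP L' _ this
  have cont : ContinuousOn g M.carrier := by
    rw [hM]
    refine ContinuousOn.union_of_isClosed ?_ ?_
      (L.isCompact.image (continuous_rescale _ _)).isClosed
      (N.isCompact.image (continuous_rescale _ _)).isClosed
    · have : ContinuousOn (fun p => 1 / 2 * h (rescale 2 (-2 * d) p) + d)
          (rescale (1 / 2) d '' L.carrier) := by
        refine ContinuousOn.add (ContinuousOn.mul continuousOn_const
          (h1.comp (continuous_rescale _ _).continuousOn ?_)) continuousOn_const
        rintro _ ⟨p, hp, rfl⟩
        rwa [hinv]
      refine this.congr ?_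
      rintro _ ⟨p, hp, rfl⟩
      simp only [g, if_pos (hP L p hp)]
    · refine (continuous_snd.continuousOn).congr ?_
      rintro _ ⟨p, hp, rfl⟩
      exact g2 p hp
  refine ⟨g, cont, ?_, ?_⟩
  · rw [hM]
    rintro _ (⟨p, hp, rfl⟩ | ⟨p, hp, rfl⟩) _ (⟨q, hq, rfl⟩ | ⟨q, hq, rfl⟩) hpq hlt
    · rw [g1 p hp, g1 q hq]
      have := h2 p hp q hq hpq (by simp only [rescale] at hlt; linarith)
      linarith
    · have hp1 := hP L p hp
      have hq1 := hP' N q hq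
      rcases ho with ho | ho
      · rw [g2 q hq]; exact ho _ _ (g1' p hp) hq1
      · exact absurd hlt (lt_asymm (ho _ _ hp1 hq1))
    · have hp1 := hP' N p hp
      have hq1 := hP L q hq
      rcases ho with ho | ho
      · exact absurd hlt (lt_asymm (ho _ _ hq1 hp1))
      · rw [g2 p hp]; exact ho _ _ (g1' q hq) hp1
    · rw [g2 p hp, g2 q hq]; exact hlt
  · rw [hM', hM, h3, image_union, image_image, image_image, image_image]
    congr 1
    · refine image_congr fun p hp => ?_
      rw [g1 p hp]; rfl
    · refine image_congr fun p hp => ?_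
      rw [g2 p hp]

theorem Move.stack_left {n : ℕ} {L L' : Link n} (N : Link n) (h : Move L L') :
    Move (L.stack N) (L'.stack N) := by
  rcases h with h | h
  · exact Or.inl (h.of_image (1 / 2) (N.isCompact.image (continuous_rescale (1 / 2) 0)).isClosed
      (fun X hX => ⟨fun p hp => (up_gt hX hp).1, disjoint_up_down hX N.subset⟩) rfl rfl)
  · refine Or.inr (h.of_image (1 / 2) 0 (N := N) (P := fun z => 1 / 2 < z)
      (fun K p hp => (up_gt K.subset ⟨p, hp, rfl⟩).2)
      (fun K p hp => (down_lt K.subset ⟨p, hp, rfl⟩).2.le.not_gt)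
      (Or.inr fun s t hs ht => (not_lt.mp ht).trans_lt hs) rfl rfl)

theorem Move.stack_right {n : ℕ} {L L' : Link n} (N : Link n) (h : Move L L') :
    Move (N.stack L) (N.stack L') := by
  rcases h with h | h
  · exact Or.inl (h.of_image 0 (N.isCompact.image (continuous_rescale (1 / 2) (1 / 2))).isClosed
      (fun X hX => ⟨fun p hp => (down_lt hX hp).1, (disjoint_up_down N.subset hX).symm⟩)
      (union_comm _ _) (union_comm _ _))
  · refine Or.inr (h.of_image 0 (1 / 2) (N := N) (P := fun z => z < 1 / 2)
      (fun K p hp => (down_lt K.subset ⟨p, hp, rfl⟩).2)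
      (fun K p hp => (up_gt K.subset ⟨p, hp, rfl⟩).2.le.not_gt)
      (Or.inl fun s t hs ht => hs.trans_le (not_lt.mp ht)) (union_comm _ _) (union_comm _ _))

/-- Isotopy of links in `Σ × (0,1)` with vertical framing: the equivalence relation generated by
the moves, that is, regular isotopy of link diagrams in `Σ`. (Every framed link is isotopic to a
vertically framed one. The only further move of framed link diagrams, which exchanges two kinks of
the same writhe and opposite rotation, holds in the skein algebra: by the skein relations each of
them can be removed at the cost of the same factor `-q^{3/2}` or `-q^{-3/2}`.) -/
instance isotopy (n : ℕ) : Setoid (Link n) := Relation.EqvGen.setoid Move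

/-- Isotopy classes of links. -/
def LinkClass (n : ℕ) : Type := Quotient (isotopy n)

theorem isotopic_of_move {n : ℕ} {L L' : Link n} (h : Move L L') : L ≈ L' :=
  Relation.EqvGen.rel _ _ h

theorem isotopic_stack {n : ℕ} {L L' N N' : Link n} (h : L ≈ L') (h' : N ≈ N') :
    L.stack N ≈ L'.stack N' := by
  refine Setoid.trans (b := L'.stack N) ?_ ?_
  · clear h'
    change Relation.EqvGen Move _ _ at h
    induction h with
    | rel _ _ h => exact isotopic_of_move (h.stack_left N)
    | refl _ => exact Setoid.refl _
    | symm _ _ _ ih => exact Setoid.symm ih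
    | trans _ _ _ _ _ ih ih' => exact Setoid.trans ih ih'
  · clear h
    change Relation.EqvGen Move _ _ at h'
    induction h' with
    | rel _ _ h => exact isotopic_of_move (h.stack_right L')
    | refl _ => exact Setoid.refl _
    | symm _ _ _ ih => exact Setoid.symm ih
    | trans _ _ _ _ _ ih ih' => exact Setoid.trans ih ih'

theorem stack_assoc_move {n : ℕ} (L M N : Link n) :
    Move ((L.stack M).stack N) (L.stack (M.stack N)) := by
  refine Or.inr ⟨fun p => max (p.2 / 2) (max (p.2 - 1 / 4) (2 * p.2 - 1)),
    Continuous.continuousOn (by fun_prop), ?_, ?_⟩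
  · intro p _ q _ _ hlt
    refine max_lt_max (by linarith) (max_lt_max (by linarith) (by linarith))
  · simp only [Link.stack, image_union, image_image]
    rw [union_assoc]
    congr 1
    · refine image_congr fun p hp => ?_
      obtain ⟨h1, h2, h3⟩ := L.subset hp
      simp only [rescale, Prod.ext_iff, true_and]
      rw [max_eq_right (a := _ / 2), max_eq_right]
      · ring
      · linarith
      · exact le_max_of_le_left (by linarith)
    congr 1
    · refine image_congr fun p hp => ?_
      obtain ⟨h1, h2, h3⟩ := M.subset hp
      simp only [rescale, Prod.ext_iff, true_and]
      rw [max_eq_right (a := _ / 2), max_eq_left]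
      · ring
      · linarith
      · exact le_max_of_le_left (by linarith)
    · refine image_congr fun p hp => ?_
      obtain ⟨h1, h2, h3⟩ := N.subset hp
      simp only [rescale, Prod.ext_iff, true_and]
      rw [max_eq_left]
      · ring
      · exact max_le (by linarith) (by linarith)

theorem empty_stack_move {n : ℕ} (L : Link n) : Move ((Link.empty n).stack L) L := by
  refine Or.inr ⟨fun p => 2 * p.2, Continuous.continuousOn (by fun_prop), ?_, ?_⟩
  · intro p _ q _ _ hlt
    linarith
  · simp [Link.stack, Link.empty, image_image, rescale]

theorem stack_empty_move {n : ℕ} (L : Link n) : Move (L.stack (Link.empty n)) L := by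
  refine Or.inr ⟨fun p => 2 * p.2 - 1, Continuous.continuousOn (by fun_prop), ?_, ?_⟩
  · intro p _ q _ _ hlt
    linarith
  · simp [Link.stack, Link.empty, image_image, rescale, mul_add]

/-- Isotopy classes of links form a monoid under stacking, the first factor being on top. -/
instance (n : ℕ) : Monoid (LinkClass n) where
  mul := Quotient.map₂ Link.stack fun _ _ h _ _ h' => isotopic_stack h h'
  one := Quotient.mk _ (Link.empty n)
  mul_assoc := by
    rintro ⟨L⟩ ⟨M⟩ ⟨N⟩
    exact Quotient.sound (isotopic_of_move (stack_assoc_move L M N))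
  one_mul := by
    rintro ⟨L⟩
    exact Quotient.sound (isotopic_of_move (empty_stack_move L))
  mul_one := by
    rintro ⟨L⟩
    exact Quotient.sound (isotopic_of_move (stack_empty_move L))

/-! ### Skein relations -/

/-- `(L, L∞, L0)` is a skein triple: the three links agree outside a tetrahedron `abcd`, inside
which `L` consists of the edge `ac` and, crossing below it, the edge `bd`, while `L∞` consists of
`bc`, `da` and `L0` of `ab`, `cd`. The projections of `a, b, c, d` are in counterclockwise order,
so that the regions swept out when the overcrossing edge `ac` turns counterclockwise are those at
the sides `ab` and `cd`; these are joined in `L∞`. The last condition says that at `a, b, c, d` the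
links leave the projected quadrilateral (whose roof consists of the triangles `abc` and `acd`),
so that the vertical framing is the same. -/
def SkeinTriple {n : ℕ} (L Linf L0 : Link n) : Prop :=
  ∃ a b c d : Space, tetra a b c d ⊆ thickened n ∧
    (∃ p ∈ openSegment ℝ a c, ∃ p' ∈ openSegment ℝ b d, p.1 = p'.1 ∧ p'.2 < p.2) ∧
    0 < (c.1.1 - a.1.1) * (d.1.2 - b.1.2) - (c.1.2 - a.1.2) * (d.1.1 - b.1.1) ∧
    L.carrier ∩ tetra a b c d = segment ℝ a c ∪ segment ℝ b d ∧
    Linf.carrier = (L.carrier \ tetra a b c d) ∪ (segment ℝ b c ∪ segment ℝ d a) ∧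
    L0.carrier = (L.carrier \ tetra a b c d) ∪ (segment ℝ a b ∪ segment ℝ c d) ∧
    LocInj ((L.carrier \ tetra a b c d) ∪ (triangle a b c ∪ triangle a c d))

/-- `L'` is the disjoint union of `L` and a trivial circle, the boundary of a triangle in
`Σ × (0,1)` that is disjoint from `L`. -/
def AddCircle {n : ℕ} (L L' : Link n) : Prop :=
  ∃ a b c : Space, triangle a b c ⊆ thickened n ∧ LocInj (triangle a b c) ∧
    Disjoint L.carrier (triangle a b c) ∧
    L'.carrier = L.carrier ∪ (segment ℝ a b ∪ segment ℝ b c ∪ segment ℝ c a)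

variable {R : Type*} [CommRing R]

/-- The element `q`, where `r` is the fixed square root `q^{1/2}`. -/
def qpos (r : Rˣ) : R := (r : R) ^ 2

/-- The element `q⁻¹`. -/
def qneg (r : Rˣ) : R := (↑r⁻¹ : R) ^ 2

/-- `α = q + q⁻¹`. -/
def alpha (r : Rˣ) : R := qpos r + qneg r

/-- `β = α⁻¹` (used only when `α` is invertible). -/
def beta (r : Rˣ) : R := Ring.inverse (alpha r)

/-- The class of a link in the free `R`-module on isotopy classes of links. -/
def Link.toFree (R : Type*) [CommRing R] {n : ℕ} (L : Link n) : MonoidAlgebra R (LinkClass n) :=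
  MonoidAlgebra.of R (LinkClass n) (Quotient.mk _ L)

/-- The Kauffman bracket skein relations `L = q^{1/2} L∞ + q^{-1/2} L0` and
`L ⊔ O = -(q + q⁻¹) L`. -/
inductive SkeinRel (n : ℕ) (r : Rˣ) :
    MonoidAlgebra R (LinkClass n) → MonoidAlgebra R (LinkClass n) → Prop
  | crossing (L Linf L0 : Link n) (h : SkeinTriple L Linf L0) :
      SkeinRel n r (L.toFree R) ((r : R) • Linf.toFree R + (↑r⁻¹ : R) • L0.toFree R)
  | circle (L L' : Link n) (h : AddCircle L L') :
      SkeinRel n r (L'.toFree R) (-alpha r • L.toFree R)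

/-- The Kauffman bracket skein algebra `𝒮(Σ_{0,n+1}; R)`: the free module on isotopy classes of
links, with the stacking product, modulo the skein relations. (Stacking a link above or below a
skein relation gives a skein relation, so the submodule spanned by the relations is the two-sided
ideal generated by them.) -/
abbrev Skein (n : ℕ) (r : Rˣ) : Type _ := RingQuot (SkeinRel n r)

/-- The class of a link in the skein algebra. -/
def Link.toSkein {n : ℕ} (r : Rˣ) (L : Link n) : Skein n r :=
  RingQuot.mkRingHom (SkeinRel n r) (L.toFree R)

/-! ### The curves `t_I` -/

/-- The upper arc of the curve around the punctures in `I`: it has height `1` over `pos i` for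
`i ∈ I`, and passes below every other puncture. -/
def upper {n : ℕ} (I : Finset (Fin n)) (hI : I.Nonempty) (x : ℝ) : ℝ :=
  I.sup' hI fun i => 1 - 2 * |x - pos i|

/-- The lower arc of the curve around the punctures in `I`; it passes below all punctures in `I`.
It meets the upper arc at one unit to the left of the first and to the right of the last puncture
in `I`. -/
def lower {n : ℕ} (I : Finset (Fin n)) (hI : I.Nonempty) (x : ℝ) : ℝ :=
  2 * |x - (pos (I.min' hI) + pos (I.max' hI)) / 2| - (pos (I.max' hI) - pos (I.min' hI)) - 3

/-- The boundary of the region between the lower and the upper arc, at height `1/2`. The region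
contains the puncture `(pos i, 0)` if and only if `i ∈ I`, and it does not meet the upward ray from
any other puncture. -/
def curve {n : ℕ} (I : Finset (Fin n)) (hI : I.Nonempty) : Set Space :=
  {p | lower I hI p.1.1 ≤ p.1.2 ∧ p.1.2 ≤ upper I hI p.1.1 ∧
    (p.1.2 = lower I hI p.1.1 ∨ p.1.2 = upper I hI p.1.1) ∧ p.2 = 1 / 2}

section CurveFacts

variable {n : ℕ} (I : Finset (Fin n)) (hI : I.Nonempty)

theorem pos_min_le {i : Fin n} (hi : i ∈ I) : pos (I.min' hI) ≤ pos i := by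
  have h := Fin.le_def.mp (I.min'_le i hi)
  have : ((I.min' hI : ℕ) : ℝ) ≤ (i : ℕ) := by exact_mod_cast h
  simp only [pos]; linarith

theorem pos_le_max {i : Fin n} (hi : i ∈ I) : pos i ≤ pos (I.max' hI) := by
  have h := Fin.le_def.mp (I.le_max' i hi)
  have : ((i : ℕ) : ℝ) ≤ (I.max' hI : ℕ) := by exact_mod_cast h
  simp only [pos]; linarith

theorem one_le_abs_pos {i k : Fin n} (h : i ≠ k) : 1 ≤ |pos k - pos i| := by
  have h' : ((k : ℕ) : ℤ) - ((i : ℕ) : ℤ) ≠ 0 := fun e => h (Fin.ext (by omega))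
  have h2 := Int.one_le_abs h'
  have h3 : (1 : ℝ) ≤ |(((k : ℕ) : ℤ) - ((i : ℕ) : ℤ) : ℝ)| := by exact_mod_cast h2
  simpa [pos] using h3

theorem le_upper {i : Fin n} (hi : i ∈ I) (x : ℝ) : 1 - 2 * |x - pos i| ≤ upper I hI x :=
  Finset.le_sup' (fun i => 1 - 2 * |x - pos i|) hi

theorem continuous_upper : Continuous (upper I hI) := by
  unfold upper
  exact Continuous.finset_sup'_apply hI fun i _ => by fun_prop

theorem continuous_lower : Continuous (lower I hI) := by
  unfold lower; fun_prop

theorem upper_puncture {k : Fin n} (hk : k ∈ I) : 0 < upper I hI (pos k) := by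
  have := le_upper I hI hk (pos k)
  simp at this
  linarith

theorem upper_not_mem {k : Fin n} (hk : k ∉ I) : upper I hI (pos k) < 0 := by
  refine (Finset.sup'_lt_iff hI).mpr fun i hi => ?_
  have := one_le_abs_pos (i := i) (k := k) (by rintro rfl; exact hk hi)
  linarith

theorem lower_eq (x : ℝ) : lower I hI x =
    -3 + 2 * max (pos (I.min' hI) - x) (x - pos (I.max' hI)) := by
  have := pos_min_le I hI (I.max'_mem hI)
  unfold lower
  rcases le_total x ((pos (I.min' hI) + pos (I.max' hI)) / 2) with h | h
  · rw [abs_of_nonpos (by linarith), max_eq_left (by linarith)]; ring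
  · rw [abs_of_nonneg (by linarith), max_eq_right (by linarith)]; ring

theorem lower_puncture {k : Fin n} (hk : k ∈ I) : lower I hI (pos k) < 0 := by
  have := pos_min_le I hI hk
  have := pos_le_max I hI hk
  rw [lower_eq]
  have : max (pos (I.min' hI) - pos k) (pos k - pos (I.max' hI)) ≤ 0 :=
    max_le (by linarith) (by linarith)
  linarith

theorem upper_left {x : ℝ} (hx : x ≤ pos (I.min' hI)) :
    upper I hI x = 1 - 2 * (pos (I.min' hI) - x) := by
  apply le_antisymm
  · refine Finset.sup'_le hI _ fun i hi => ?_
    have := pos_min_le I hI hi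
    rw [abs_of_nonpos (by linarith)]; linarith
  · have := le_upper I hI (I.min'_mem hI) x
    rw [abs_of_nonpos (by linarith)] at this; linarith

theorem upper_right {x : ℝ} (hx : pos (I.max' hI) ≤ x) :
    upper I hI x = 1 - 2 * (x - pos (I.max' hI)) := by
  apply le_antisymm
  · refine Finset.sup'_le hI _ fun i hi => ?_
    have := pos_le_max I hI hi
    rw [abs_of_nonneg (by linarith)]; linarith
  · have := le_upper I hI (I.max'_mem hI) x
    rw [abs_of_nonneg (by linarith)] at this; linarith

theorem lower_left {x : ℝ} (hx : x ≤ pos (I.min' hI)) :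
    lower I hI x = -3 + 2 * (pos (I.min' hI) - x) := by
  have := pos_min_le I hI (I.max'_mem hI)
  rw [lower_eq, max_eq_left (by linarith)]

theorem lower_right {x : ℝ} (hx : pos (I.max' hI) ≤ x) :
    lower I hI x = -3 + 2 * (x - pos (I.max' hI)) := by
  have := pos_min_le I hI (I.max'_mem hI)
  rw [lower_eq, max_eq_right (by linarith)]

theorem lower_lt_upper {x : ℝ} (h1 : pos (I.min' hI) ≤ x) (h2 : x ≤ pos (I.max' hI)) :
    lower I hI x < upper I hI x := by
  have a := le_upper I hI (I.min'_mem hI) x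
  have b := le_upper I hI (I.max'_mem hI) x
  rw [abs_of_nonneg (by linarith)] at a
  rw [abs_of_nonpos (by linarith)] at b
  rw [lower_eq]
  rcases max_choice (pos (I.min' hI) - x) (x - pos (I.max' hI)) with h | h <;> rw [h] <;> linarith

/-- `f` is affine on a right neighbourhood of `0`. -/
def PLRight (f : ℝ → ℝ) : Prop := ∃ m : ℝ, ∀ᶠ s in 𝓝[≥] (0 : ℝ), f s = f 0 + m * s

theorem PLRight.max {f g : ℝ → ℝ} (hf : PLRight f) (hg : PLRight g) (cf : Continuous f)
    (cg : Continuous g) : PLRight fun s => max (f s) (g s) := by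
  obtain ⟨a, ha⟩ := hf
  obtain ⟨b, hb⟩ := hg
  rcases lt_trichotomy (f 0) (g 0) with h | h | h
  · refine ⟨b, ?_⟩
    have : ∀ᶠ s in 𝓝[≥] (0 : ℝ), f s < g s :=
      nhdsWithin_le_nhds ((isOpen_lt cf cg).mem_nhds h)
    filter_upwards [this, hb] with s h1 h2
    rw [max_eq_right h1.le, max_eq_right h.le, h2]
  · refine ⟨Max.max a b, ?_⟩
    filter_upwards [ha, hb, self_mem_nhdsWithin] with s h1 h2 h3
    rw [h1, h2, h, max_self, max_add_add_left, max_mul_of_nonneg _ _ h3]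
  · refine ⟨a, ?_⟩
    have : ∀ᶠ s in 𝓝[≥] (0 : ℝ), g s < f s :=
      nhdsWithin_le_nhds ((isOpen_lt cg cf).mem_nhds h)
    filter_upwards [this, ha] with s h1 h2
    rw [max_eq_left h1.le, max_eq_left h.le, h2]

theorem PLRight.affine (a b : ℝ) : PLRight fun s => a + b * s :=
  ⟨b, Filter.Eventually.of_forall fun s => by ring⟩

theorem plRight_tent (x e k : ℝ) : PLRight fun s => 1 - 2 * |x + e * s - k| := by
  rcases lt_trichotomy (x - k) 0 with h | h | h
  · refine ⟨2 * e, ?_⟩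
    have : ∀ᶠ s in 𝓝[≥] (0 : ℝ), x + e * s - k < 0 :=
      nhdsWithin_le_nhds ((isOpen_lt (by fun_prop) continuous_const).mem_nhds (by simpa using h))
    filter_upwards [this] with s hs
    rw [abs_of_neg hs, abs_of_neg (by simpa using h)]; ring
  · refine ⟨-2 * |e|, ?_⟩
    filter_upwards [self_mem_nhdsWithin] with s hs
    have e1 : x + e * s - k = e * s := by linarith
    have e2 : x + e * 0 - k = 0 := by linarith
    rw [e1, e2, abs_mul, abs_of_nonneg (show (0 : ℝ) ≤ s from hs), abs_zero]; ring
  · refine ⟨-2 * e, ?_⟩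
    have : ∀ᶠ s in 𝓝[≥] (0 : ℝ), 0 < x + e * s - k :=
      nhdsWithin_le_nhds ((isOpen_lt continuous_const (by fun_prop)).mem_nhds (by simpa using h))
    filter_upwards [this] with s hs
    rw [abs_of_pos hs, abs_of_pos (by simpa using h)]; ring

theorem plRight_upper (x e : ℝ) : PLRight fun s => upper I hI (x + e * s) := by
  have h : ∀ (J : Finset (Fin n)) (hJ : J.Nonempty),
      PLRight (fun s => upper J hJ (x + e * s)) := by
    intro J hJ
    induction hJ using Finset.Nonempty.cons_induction with
    | singleton a => simpa [upper] using plRight_tent x e (pos a)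
    | cons a s ha hs ih =>
      have := (plRight_tent x e (pos a)).max ih (by fun_prop)
        ((continuous_upper s hs).comp (by fun_prop))
      simpa only [upper, Finset.sup'_cons hs] using this
  exact h I hI

theorem plRight_lower (x e : ℝ) : PLRight fun s => lower I hI (x + e * s) := by
  obtain ⟨m, hm⟩ := plRight_tent x e ((pos (I.min' hI) + pos (I.max' hI)) / 2)
  refine ⟨-m, ?_⟩
  filter_upwards [hm] with s hs
  simp only [lower]
  linarith

/-- A piecewise linear graph at height `1/2` consists of two segments near each point. -/
theorem twoRays_graph {f : ℝ → ℝ} (hf : ∀ x e, PLRight fun s => f (x + e * s)) {X : Set Space}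
    {p : Space} (hp : p.2 = 1 / 2) (hpf : p.1.2 = f p.1.1)
    (hX : ∀ᶠ q in 𝓝 p, q ∈ X ↔ q.1.2 = f q.1.1 ∧ q.2 = 1 / 2) : TwoRaysAt X p := by
  obtain ⟨⟨x, y⟩, z⟩ := p
  simp only at hp hpf
  subst hp hpf
  obtain ⟨a, ha⟩ := hf x 1
  obtain ⟨b, hb⟩ := hf x (-1)
  rw [(nhdsGE_basis (0 : ℝ)).eventually_iff] at ha hb
  obtain ⟨e1, he1, ha⟩ := ha
  obtain ⟨e2, he2, hb⟩ := hb
  refine ⟨((1, a), 0), ((-1, b), 0), ?_, _, Filter.inter_mem hX (show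
    {q : Space | |q.1.1 - x| < min 1 (min e1 e2)} ∈ 𝓝 _ from
    (isOpen_lt (by fun_prop) continuous_const).mem_nhds (by simp [he1, he2])), ?_⟩
  · intro h
    have := h.map (LinearMap.fst ℝ ℝ ℝ ∘ₗ LinearMap.fst ℝ (ℝ × ℝ) ℝ)
    simp only [LinearMap.coe_comp, Function.comp_apply, LinearMap.fst_apply] at this
    have h2 := this.exists_pos (by norm_num) (by norm_num)
    obtain ⟨r, s, hr, hs, h3⟩ := h2
    simp only [smul_eq_mul] at h3
    linarith
  · ext ⟨⟨u, v⟩, w⟩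
    simp only [mem_inter_iff, mem_union, mem_ofPred_eq, segment_eq_image', mem_image, Prod.ext_iff,
      Prod.fst_add, Prod.snd_add, Prod.smul_fst, Prod.smul_snd, Prod.fst_sub, Prod.snd_sub,
      smul_eq_mul, lt_min_iff]
    refine and_congr_left ?_
    rintro ⟨h1, h2, h3, h4⟩
    rw [h1]
    rw [abs_lt] at h2 h3 h4
    have A : ∀ t, 0 ≤ t → t < e1 → f (x + t) = f x + a * t := fun t h h' => by
      simpa using ha ⟨h, h'⟩
    have B : ∀ t, 0 ≤ t → t < e2 → f (x - t) = f x + b * t := fun t h h' => by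
      simpa [sub_eq_add_neg] using hb ⟨h, h'⟩
    constructor
    · rintro ⟨rfl, rfl⟩
      rcases le_total x u with h | h
      · refine Or.inl ⟨u - x, ⟨by linarith, by linarith⟩, ⟨by ring, ?_⟩, by ring⟩
        have := A (u - x) (by linarith) (by linarith)
        rw [show x + (u - x) = u by ring] at this
        rw [this]; ring
      · refine Or.inr ⟨x - u, ⟨by linarith, by linarith⟩, ⟨by ring, ?_⟩, by ring⟩
        have := B (x - u) (by linarith) (by linarith)
        rw [show x - (x - u) = u by ring] at this
        rw [this]; ring
    · rintro (⟨t, ⟨t0, t1⟩, ⟨q1, q2⟩, q3⟩ | ⟨t, ⟨t0, t1⟩, ⟨q1, q2⟩, q3⟩)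
      · have := A t t0 (by linarith)
        rw [show x + t = u by linarith] at this
        exact ⟨by rw [this]; linarith, by linarith⟩
      · have := B t t0 (by linarith)
        rw [show x - t = u by linarith] at this
        exact ⟨by rw [this]; linarith, by linarith⟩

/-- A wedge of two rays with slopes `±2`. -/
theorem twoRays_wedge {X : Set Space} {x₀ y₀ e : ℝ} (he : e = 1 ∨ e = -1)
    (hX : ∀ᶠ q in 𝓝 (((x₀, y₀), 1 / 2) : Space), q ∈ X ↔
      0 ≤ e * (q.1.1 - x₀) ∧ (q.1.2 = y₀ + 2 * (e * (q.1.1 - x₀)) ∨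
        q.1.2 = y₀ - 2 * (e * (q.1.1 - x₀))) ∧ q.2 = 1 / 2) :
    TwoRaysAt X ((x₀, y₀), 1 / 2) := by
  have hee : e * e = 1 := by rcases he with rfl | rfl <;> norm_num
  refine ⟨((e, 2), 0), ((e, -2), 0), ?_, _, Filter.inter_mem hX (show
    {q : Space | |q.1.1 - x₀| < 1} ∈ 𝓝 _ from
    (isOpen_lt (by fun_prop) continuous_const).mem_nhds (by simp)), ?_⟩
  · intro h
    have := h.map (LinearMap.snd ℝ ℝ ℝ ∘ₗ LinearMap.fst ℝ (ℝ × ℝ) ℝ)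
    simp only [LinearMap.coe_comp, Function.comp_apply, LinearMap.fst_apply,
      LinearMap.snd_apply] at this
    have h2 := this.exists_pos (by norm_num) (by norm_num)
    obtain ⟨r, s, hr, hs, h3⟩ := h2
    simp only [smul_eq_mul] at h3
    linarith
  · ext ⟨⟨u, v⟩, w⟩
    simp only [mem_inter_iff, mem_union, mem_ofPred_eq, segment_eq_image', mem_image, Prod.ext_iff,
      Prod.fst_add, Prod.snd_add, Prod.smul_fst, Prod.smul_snd, Prod.fst_sub, Prod.snd_sub,
      smul_eq_mul]
    refine and_congr_left ?_
    rintro ⟨h1, h2⟩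
    rw [h1]
    rw [abs_lt] at h2
    have hb : e * (u - x₀) ≤ 1 := by
      rcases he with rfl | rfl <;> linarith
    have hu : x₀ + e * (u - x₀) * e = u := by
      linear_combination (u - x₀) * hee
    constructor
    · rintro ⟨h0, h | h, rfl⟩
      · exact Or.inl ⟨e * (u - x₀), ⟨h0, hb⟩, ⟨by linarith, by linarith⟩, by ring⟩
      · exact Or.inr ⟨e * (u - x₀), ⟨h0, hb⟩, ⟨by linarith, by linarith⟩, by ring⟩
    · rintro (⟨t, ⟨t0, t1⟩, ⟨q1, q2⟩, q3⟩ | ⟨t, ⟨t0, t1⟩, ⟨q1, q2⟩, q3⟩)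
      · have : e * (u - x₀) = t := by linear_combination -e * q1 + t * hee
        rw [this]
        exact ⟨t0, Or.inl (by linarith), by linarith⟩
      · have : e * (u - x₀) = t := by linear_combination -e * q1 + t * hee
        rw [this]
        exact ⟨t0, Or.inr (by linarith), by linarith⟩

theorem curve_twoRays {p : Space} (hp : p ∈ curve I hI) : TwoRaysAt (curve I hI) p := by
  have cu := continuous_upper I hI
  have cl := continuous_lower I hI
  obtain ⟨h1, h2, h3, h4⟩ := hp
  rcases (h1.trans h2).lt_or_eq with hlt | heq
  · rcases h3 with h3 | h3
    · refine twoRays_graph (plRight_lower I hI) h4 h3 ?_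
      have : ∀ᶠ q : Space in 𝓝 p, q.1.2 < upper I hI q.1.1 :=
        (isOpen_lt (by fun_prop) (by fun_prop)).mem_nhds (by simpa [h3] using hlt)
      filter_upwards [this] with q hq
      constructor
      · rintro ⟨-, -, h | h, h'⟩
        · exact ⟨h, h'⟩
        · exact absurd h hq.ne
      · rintro ⟨h, h'⟩
        exact ⟨h.ge, hq.le, Or.inl h, h'⟩
    · refine twoRays_graph (plRight_upper I hI) h4 h3 ?_
      have : ∀ᶠ q : Space in 𝓝 p, lower I hI q.1.1 < q.1.2 :=
        (isOpen_lt (by fun_prop) (by fun_prop)).mem_nhds (by simpa [h3] using hlt)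
      filter_upwards [this] with q hq
      constructor
      · rintro ⟨-, -, h | h, h'⟩
        · exact absurd h hq.ne'
        · exact ⟨h, h'⟩
      · rintro ⟨h, h'⟩
        exact ⟨hq.le, h.le, Or.inr h, h'⟩
  · obtain ⟨⟨x, y⟩, z⟩ := p
    simp only at h1 h2 h3 h4 heq
    subst h4
    rcases lt_or_ge x (pos (I.min' hI)) with hx | hx
    · rw [lower_left I hI hx.le, upper_left I hI hx.le] at *
      have hx' : pos (I.min' hI) = x + 1 := by linarith
      refine twoRays_wedge (e := 1) (Or.inl rfl) ?_
      have : ∀ᶠ q : Space in 𝓝 ((x, y), 1 / 2), q.1.1 < pos (I.min' hI) :=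
        (isOpen_lt (by fun_prop) (by fun_prop)).mem_nhds hx
      filter_upwards [this] with q hq
      have hy : y = -1 := by rw [hx'] at h1 h2; linarith
      simp only [curve, mem_ofPred_eq, lower_left I hI hq.le, upper_left I hI hq.le]
      rw [hx', hy]
      constructor
      · rintro ⟨k1, k2, k3, k4⟩
        refine ⟨by linarith, ?_, k4⟩
        rcases k3 with k3 | k3
        · right; linarith
        · left; linarith
      · rintro ⟨k1, k2, k4⟩
        rcases k2 with k3 | k3
        · exact ⟨by linarith, by linarith, Or.inr (by linarith), k4⟩
        · exact ⟨by linarith, by linarith, Or.inl (by linarith), k4⟩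
    · rcases le_or_gt x (pos (I.max' hI)) with hx2 | hx2
      · exact absurd heq (lower_lt_upper I hI hx hx2).ne
      · rw [lower_right I hI hx2.le, upper_right I hI hx2.le] at *
        have hx' : pos (I.max' hI) = x - 1 := by linarith
        refine twoRays_wedge (e := -1) (Or.inr rfl) ?_
        have : ∀ᶠ q : Space in 𝓝 ((x, y), 1 / 2), pos (I.max' hI) < q.1.1 :=
          (isOpen_lt (by fun_prop) (by fun_prop)).mem_nhds hx2
        filter_upwards [this] with q hq
        have hy : y = -1 := by rw [hx'] at h1 h2; linarith
        simp only [curve, mem_ofPred_eq, lower_right I hI hq.le, upper_right I hI hq.le]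
        rw [hx', hy]
        constructor
        · rintro ⟨k1, k2, k3, k4⟩
          refine ⟨by linarith, ?_, k4⟩
          rcases k3 with k3 | k3
          · right; linarith
          · left; linarith
        · rintro ⟨k1, k2, k4⟩
          rcases k2 with k3 | k3
          · exact ⟨by linarith, by linarith, Or.inr (by linarith), k4⟩
          · exact ⟨by linarith, by linarith, Or.inl (by linarith), k4⟩

theorem isCompact_curve : IsCompact (curve I hI) := by
  have cu := continuous_upper I hI
  have cl := continuous_lower I hI
  have hcl : IsClosed (curve I hI) := by
    have c1 : IsClosed {p : Space | lower I hI p.1.1 ≤ p.1.2} :=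
      isClosed_le (by fun_prop) (by fun_prop)
    have c2 : IsClosed {p : Space | p.1.2 ≤ upper I hI p.1.1} :=
      isClosed_le (by fun_prop) (by fun_prop)
    have c3 : IsClosed {p : Space | p.1.2 = lower I hI p.1.1} :=
      isClosed_eq (by fun_prop) (by fun_prop)
    have c4 : IsClosed {p : Space | p.1.2 = upper I hI p.1.1} :=
      isClosed_eq (by fun_prop) (by fun_prop)
    have c5 : IsClosed {p : Space | p.2 = 1 / 2} := isClosed_eq (by fun_prop) (by fun_prop)
    exact c1.inter (c2.inter ((c3.union c4).inter c5))
  refine IsCompact.of_isClosed_subset (s := (Icc (pos (I.min' hI) - 1) (pos (I.max' hI) + 1) ×ˢ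
    Icc (-3 - 2 * (pos (I.max' hI) - pos (I.min' hI) + 2)) 1) ×ˢ Icc (1 / 2 : ℝ) (1 / 2))
    ((isCompact_Icc.prod isCompact_Icc).prod isCompact_Icc) hcl ?_
  rintro ⟨⟨x, y⟩, z⟩ ⟨h1, h2, -, h4⟩
  have hmm := pos_min_le I hI (I.max'_mem hI)
  simp only at h1 h2 h4
  have hu : upper I hI x ≤ 1 := Finset.sup'_le hI _ fun i _ => by
    have := abs_nonneg (x - pos i)
    linarith
  have hx1 : pos (I.min' hI) - 1 ≤ x := by
    by_contra! h
    rw [lower_left I hI (by linarith)] at h1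
    rw [upper_left I hI (by linarith)] at h2
    linarith
  have hx2 : x ≤ pos (I.max' hI) + 1 := by
    by_contra! h
    rw [lower_right I hI (by linarith)] at h1
    rw [upper_right I hI (by linarith)] at h2
    linarith
  have hl : -3 - 2 * (pos (I.max' hI) - pos (I.min' hI) + 2) ≤ lower I hI x := by
    rw [lower_eq]
    have := le_max_left (pos (I.min' hI) - x) (x - pos (I.max' hI))
    linarith
  exact ⟨⟨⟨hx1, hx2⟩, ⟨by linarith, by linarith⟩⟩, ⟨h4.ge, h4.le⟩⟩

end CurveFacts

/-- The curve `t_I`, as a link. -/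
def tLink {n : ℕ} (I : Finset (Fin n)) (hI : I.Nonempty) : Link n where
  carrier := curve I hI
  isCompact := isCompact_curve I hI
  subset := by
    rintro p ⟨h1, h2, h3, h4⟩
    refine ⟨?_, by rw [h4]; norm_num, by rw [h4]; norm_num⟩
    intro k hk
    rw [hk] at h1 h2 h3
    by_cases hkI : k ∈ I
    · have a := upper_puncture I hI hkI
      have b := lower_puncture I hI hkI
      rcases h3 with h3 | h3
      · exact b.ne' h3
      · exact a.ne h3
    · exact absurd h2 (upper_not_mem I hI hkI).not_ge
  polygonal := fun _ hp => curve_twoRays I hI hp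
  immersed := fun _ _ => ⟨univ, Filter.univ_mem, fun x hx y hy hxy =>
    Prod.ext hxy (hx.1.2.2.2.trans hy.1.2.2.2.symm)⟩

/-! ### The generators -/

variable {n : ℕ} (r : Rˣ)

/-- The element `t_i`. -/
def t₁ (i : Fin n) : Skein n r := (tLink {i} (by simp)).toSkein r

/-- The element `t_{ij}`; it depends only on the set `{i, j}`. -/
def t₂ (i j : Fin n) : Skein n r := (tLink {i, j} (by simp)).toSkein r

/-- The element `t_{ijk}`; it depends only on the set `{i, j, k}`. -/
def t₃ (i j k : Fin n) : Skein n r := (tLink {i, j, k} (by simp)).toSkein r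

/-- `s_{ij} = t_{ij} + β t_i t_j` for `i ≠ j`, and, by convention, `s_{ii} = α - β t_i²`. -/
def s₂ (i j : Fin n) : Skein n r :=
  if i = j then algebraMap R _ (alpha r) - beta r • t₁ r i ^ 2
  else t₂ r i j + beta r • (t₁ r i * t₁ r j)

/-- `s_{ijk} = t_{ijk} + β (t_i t_{jk} + t_j t_{ik} + t_k t_{ij}) + 2 β² t_i t_j t_k`, for distinct
`i, j, k`. -/
def s₃ (i j k : Fin n) : Skein n r :=
  t₃ r i j k + beta r • (t₁ r i * t₂ r j k + t₁ r j * t₂ r i k + t₁ r k * t₂ r i j) +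
    (2 * beta r ^ 2) • (t₁ r i * t₁ r j * t₁ r k)

/-- `(i 0, …, i (m - 1))` is in cyclic order: a cyclic rotation of it is strictly increasing. -/
def CyclicOrder {m n : ℕ} [NeZero m] (i : Fin m → Fin n) : Prop :=
  ∃ v : Fin m, StrictMono fun j => i (j + v)

end

end PlanarSkein

open PlanarSkein

set_option linter.all false

namespace PlanarSkein

/-! ### Germs of polygonal curves -/

/-! Each identity involves at most six punctures, and `s_I` arises from `t_I` by adding polynomials
with central coefficients. So everything follows from the products of finitely many pairs of curves
`t_I`, `t_J` with `|I|, |J| ≤ 3`, together with the centrality of the `t_i`. The latter holds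
because `t_i` shrinks into any neighbourhood of its puncture, and there it avoids the projection of
any given link (`t₁_mul_comm`).

A product is computed from a diagram. Each `t_I` is drawn as a comb: a horizontal body below the
punctures, with a tooth around every puncture in `I`. Two combs that cannot be made disjoint are
drawn with two or four crossings, in pairs of opposite kinds, so the states of the skein expansion
have integral powers of `q` as coefficients. The opposite product has the same states with `q` and
`q⁻¹` exchanged. Most states that matter are disjoint unions of combs. A few connected curves are
not combs; they need no name, because they can be eliminated between the two orders of a product
(`Bigon`) or between several products. The curve `F` around four punctures is eliminated too: its
coefficient in `t_{13} t_{24}` is `α`, four states giving `2(q + q⁻¹)` and one state with a trivial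
circle giving `-(q + q⁻¹)` (`combs_four_cross`).

The isotopies are made finite. A flat polygonal curve along the edges and diagonals of a grid is a
natural number, whose binary digits are the edges. A `Δ`-move across half of a cell without
punctures adds three bits, and its legality is a test on a small window of bits (`legal_sound`,
`flippable_sound`). Smoothings and trivial circles have similar descriptions (`crossing_sound`,
`circle_sound`). A search for isotopies needs no proof of its own: every accepted step is sound, and
only the final equality of numbers is checked (`chase_sound`). All diagrams are then evaluated by
`decide`.

The grid is adapted to the chosen punctures: they occupy the slots `1, …, m`, and all other
punctures lie in cells that the moves never enter (`freeGrid_chart`). The given curve `t_I` is cut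
into its left end, teeth, gaps and right end, and each piece is straightened by a few triangles
(`partial_left`, `Partial.tooth`, `Partial.gap`, `Partial.right`). Hence the combs do represent the
generators (`exists_charted`).

What remains is algebra over the centre. From the product formulas, `q q⁻¹ = 1` and `(q + q⁻¹) β =
1`, every identity is checked by comparing coefficients of monomials (`pair_pair_three` to
`triple_pair_five`). Combs depend on the linear order of the punctures, so the products are computed
separately for every rotation of the indices. -/

theorem twoRaysAt_iff {X : Set Space} {p : Space} : TwoRaysAt X p ↔
    ∃ u v : Space, ¬ SameRay ℝ u v ∧
      ∀ᶠ x in 𝓝 p, x ∈ X ↔ x ∈ segment ℝ p (p + u) ∪ segment ℝ p (p + v) := by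
  constructor
  · rintro ⟨u, v, huv, U, hU, h⟩
    refine ⟨u, v, huv, ?_⟩
    filter_upwards [hU] with x hx
    have := Set.ext_iff.mp h x
    simpa [hx] using this
  · rintro ⟨u, v, huv, h⟩
    refine ⟨u, v, huv, _, h, ?_⟩
    ext x
    simp only [mem_inter_iff]
    exact and_congr_left fun hx => hx

theorem TwoRaysAt.congr {X Y : Set Space} {p : Space} (h : TwoRaysAt X p)
    (hXY : ∀ᶠ x in 𝓝 p, x ∈ Y ↔ x ∈ X) : TwoRaysAt Y p := by
  obtain ⟨u, v, huv, h⟩ := twoRaysAt_iff.mp h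
  refine twoRaysAt_iff.mpr ⟨u, v, huv, ?_⟩
  filter_upwards [h, hXY] with x h1 h2
  rw [h2, h1]

theorem eventually_notMem {X : Set Space} {p : Space} (hX : IsClosed X) (hp : p ∉ X) :
    ∀ᶠ x in 𝓝 p, x ∉ X := hX.isOpen_compl.mem_nhds hp

theorem isClosed_segment (a b : Space) : IsClosed (segment ℝ a b) := by
  rw [← convexHull_pair]
  exact ((Set.toFinite _).isCompact_convexHull ℝ).isClosed

theorem isCompact_segment (a b : Space) : IsCompact (segment ℝ a b) := by
  rw [← convexHull_pair]
  exact (Set.toFinite _).isCompact_convexHull ℝ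

theorem mem_segment_add {a w x : Space} :
    x ∈ segment ℝ a (a + w) ↔ ∃ t : ℝ, 0 ≤ t ∧ t ≤ 1 ∧ x = a + t • w := by
  rw [segment_eq_image']
  simp only [mem_image, mem_Icc, add_sub_cancel_left, and_assoc]
  exact exists_congr fun t => by rw [eq_comm (a := x)]

/-- The germ of a segment at an endpoint depends on its direction only. -/
theorem eventually_segment_iff (a : Space) {u w : Space} (hu : u ≠ 0) (hw : w ≠ 0)
    (h : SameRay ℝ u w) :
    ∀ᶠ x in 𝓝 a, x ∈ segment ℝ a (a + u) ↔ x ∈ segment ℝ a (a + w) := by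
  obtain ⟨r, s, hr, hs, hrs⟩ := h.exists_pos hu hw
  have key : ∀ {u w : Space} {r s : ℝ}, u ≠ 0 → 0 < r → 0 < s → r • u = s • w →
      ∀ᶠ x in 𝓝 a, x ∈ segment ℝ a (a + u) → x ∈ segment ℝ a (a + w) := by
    intro u w r s hu hr hs hrs
    -- A point `a + t u` closer to `a` than `‖u‖ r / s` has `t < r / s`. Since `u = (s / r) w`, its
    -- parameter along `w` is `t s / r < 1`.
    have hpos : 0 < ‖u‖ * (r / s) := by positivity
    have : ∀ᶠ x in 𝓝 a, ‖x - a‖ < ‖u‖ * (r / s) := by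
      refine (isOpen_lt (by fun_prop) continuous_const).mem_nhds ?_
      rw [Set.mem_setOf_eq, sub_self, norm_zero]; exact hpos
    filter_upwards [this] with x hx h
    obtain ⟨t, t0, t1, rfl⟩ := mem_segment_add.mp h
    rw [add_sub_cancel_left, norm_smul, Real.norm_of_nonneg t0, mul_comm] at hx
    have ht : t < r / s := lt_of_mul_lt_mul_left hx (norm_nonneg _)
    refine mem_segment_add.mpr ⟨t * (s / r), by positivity, ?_, ?_⟩
    · rw [lt_div_iff₀ hs] at ht
      rw [mul_div_assoc', div_le_one hr]; exact ht.le
    · have : u = (s / r) • w := by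
        rw [div_eq_inv_mul, mul_smul, ← hrs, smul_smul, inv_mul_cancel₀ hr.ne', one_smul]
      rw [mul_smul, ← this]
  filter_upwards [key hu hr hs hrs, key hw hs hr hrs.symm] with x h1 h2
  exact ⟨h1, h2⟩

/-- What holds near `a` holds along an initial piece of each ray from `a`. Thus germs can be
compared at a single point `a + t w`. -/
theorem exists_small (a w : Space) {P : Space → Prop} (h : ∀ᶠ x in 𝓝 a, P x) :
    ∃ t : ℝ, 0 < t ∧ t ≤ 1 ∧ ∀ s : ℝ, 0 ≤ s → s ≤ t → P (a + s • w) := by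
  have hc : Filter.Tendsto (fun s : ℝ => a + s • w) (𝓝 0) (𝓝 a) := by
    have : Continuous (fun s : ℝ => a + s • w) := by fun_prop
    simpa using this.tendsto 0
  obtain ⟨e, he, hb⟩ := Metric.eventually_nhds_iff.mp (hc.eventually h)
  refine ⟨min 1 (e / 2), by positivity, min_le_left _ _, fun s s0 s1 => hb ?_⟩
  have := s1.trans (min_le_right _ _)
  rw [Real.dist_eq, sub_zero, abs_of_nonneg s0]; linarith

/-- Replacing the segment `ab` of a polygonal curve by a segment `ac` in a new direction. -/
theorem TwoRaysAt.swap {X Y : Set Space} {a b c : Space} (h : TwoRaysAt X a) (hb : b ≠ a)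
    (hc : c ≠ a) (hab : segment ℝ a b ⊆ X)
    (hac : ∀ᶠ x in 𝓝 a, x ∈ segment ℝ a c → x ∈ X → x = a)
    (hY : ∀ᶠ x in 𝓝 a, x ∈ Y ↔ (x ∈ X ∧ x ∉ segment ℝ a b) ∨ x ∈ segment ℝ a c) :
    TwoRaysAt Y a := by
  obtain ⟨u, v, huv, h⟩ := twoRaysAt_iff.mp h
  have hb' : b - a ≠ 0 := sub_ne_zero.mpr hb
  have hc' : c - a ≠ 0 := sub_ne_zero.mpr hc
  have e1 : segment ℝ a b = segment ℝ a (a + (b - a)) := by rw [add_sub_cancel]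
  have e2 : segment ℝ a c = segment ℝ a (a + (c - a)) := by rw [add_sub_cancel]
  have hu : u ≠ 0 := by rintro rfl; exact huv (SameRay.zero_left _)
  have hv : v ≠ 0 := by rintro rfl; exact huv (SameRay.zero_right _)
  -- A point of `ab` close to `a` lies on one of the two rays of the germ of `X`, so `ab` leaves `a`
  -- along that ray.
  have ray : SameRay ℝ (b - a) u ∨ SameRay ℝ (b - a) v := by
    obtain ⟨t, t0, t1, ht⟩ := exists_small a (b - a) h
    have hmem : a + t • (b - a) ∈ X := hab (by rw [e1, mem_segment_add]; exact ⟨t, t0.le, t1, rfl⟩)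
    have aux : ∀ w : Space, a + t • (b - a) ∈ segment ℝ a (a + w) → SameRay ℝ (b - a) w := by
      intro w hw
      obtain ⟨s, s0, s1, hs⟩ := mem_segment_add.mp hw
      have hs := add_left_cancel hs
      rcases s0.eq_or_lt with rfl | s0
      · rw [zero_smul] at hs
        exact absurd (smul_eq_zero.mp hs) (by simp [t0.ne', hb'])
      · exact Or.inr (Or.inr ⟨t, s, t0, s0, hs⟩)
    exact ((ht t t0.le le_rfl).mp hmem).imp (aux u) (aux v)
  wlog hr : SameRay ℝ (b - a) u generalizing u v
  · refine this v u (fun h => huv h.symm) ?_ hv hu ray.symm (ray.resolve_left hr)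
    filter_upwards [h] with x hx
    rw [hx, union_comm]
  have hXu := eventually_segment_iff a hb' hu hr
  have hdisj : ∀ x, x ∈ segment ℝ a (a + u) → x ∈ segment ℝ a (a + v) → x = a := by
    intro x h1 h2
    obtain ⟨s, s0, -, rfl⟩ := mem_segment_add.mp h1
    obtain ⟨t, t0, -, ht⟩ := mem_segment_add.mp h2
    have ht := add_left_cancel ht
    rcases s0.eq_or_lt with rfl | s0
    · simp
    rcases t0.eq_or_lt with rfl | t0
    · rw [ht]; simp
    exact absurd (Or.inr (Or.inr ⟨s, t, s0, t0, ht⟩)) huv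
  refine twoRaysAt_iff.mpr ⟨c - a, v, ?_, ?_⟩
  -- If `ac` left along the remaining ray `v`, its points near `a` would lie on `X`, and by `hac`
  -- only `a` itself does.
  · intro hcv
    obtain ⟨t, t0, t1, ht⟩ := exists_small a (c - a)
      (h.and (hac.and (eventually_segment_iff a hc' hv hcv)))
    obtain ⟨k1, k2, k3⟩ := ht t t0.le le_rfl
    have hm : a + t • (c - a) ∈ segment ℝ a (a + (c - a)) :=
      mem_segment_add.mpr ⟨t, t0.le, t1, rfl⟩
    have := k2 (by rwa [e2]) (k1.mpr (Or.inr (k3.mp hm)))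
    rw [add_eq_left] at this
    exact absurd (smul_eq_zero.mp this) (by simp [t0.ne', hc'])
  · filter_upwards [h, hXu, hY] with x h1 h2 h3
    rw [h3, h1, e1, h2, ← e2]
    simp only [mem_union]
    constructor
    · rintro (⟨k | k, k'⟩ | k)
      · exact absurd k k'
      · exact Or.inr k
      · exact Or.inl k
    · rintro (k | k)
      · exact Or.inr k
      · by_cases hx : x ∈ segment ℝ a (a + u)
        · right; rw [hdisj x hx k]; exact left_mem_segment ℝ a c
        · exact Or.inl ⟨Or.inr k, hx⟩

theorem twoRaysAt_of_corner {X : Set Space} {a b c : Space}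
    (h : ∀ᶠ x in 𝓝 a, x ∈ X ↔ x ∈ segment ℝ a b ∪ segment ℝ a c)
    (hr : ¬ SameRay ℝ (b - a) (c - a)) : TwoRaysAt X a :=
  twoRaysAt_iff.mpr ⟨b - a, c - a, hr, by simpa only [add_sub_cancel] using h⟩

theorem segment_union_of_mem {a b p : Space} (hp : p ∈ segment ℝ a b) :
    segment ℝ p a ∪ segment ℝ p b = segment ℝ a b := by
  rw [segment_symm ℝ p a]
  refine Subset.antisymm (union_subset ?_ ?_) fun x hx => ?_
  · exact (convex_segment a b).segment_subset (left_mem_segment ℝ a b) hp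
  · exact (convex_segment a b).segment_subset hp (right_mem_segment ℝ a b)
  · rw [segment_eq_image'] at hx hp
    obtain ⟨s, ⟨s0, s1⟩, rfl⟩ := hx
    obtain ⟨t, ⟨t0, t1⟩, rfl⟩ := hp
    rcases le_total s t with h | h
    · left
      rw [segment_eq_image']
      rcases t0.eq_or_lt with rfl | t0
      · exact ⟨0, by simp, by simp [show s = 0 by linarith]⟩
      · refine ⟨s / t, ⟨by positivity, (div_le_one t0).mpr h⟩, ?_⟩
        simp only [add_sub_cancel_left, smul_smul]
        rw [div_mul_cancel₀ _ t0.ne']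
    · right
      rw [segment_eq_image']
      rcases t1.eq_or_lt with rfl | t1
      · exact ⟨0, by simp, by simp [show s = 1 by linarith]⟩
      · refine ⟨(s - t) / (1 - t), ⟨div_nonneg (by linarith) (by linarith),
          (div_le_one (by linarith)).mpr (by linarith)⟩, ?_⟩
        have : b - (a + t • (b - a)) = (1 - t) • (b - a) := by module
        simp only [this, smul_smul]
        rw [div_mul_cancel₀ _ (by linarith)]
        module

/-- The two rays at an interior point are positive multiples of `-(b - a)` and `b - a`, which do not
have the same direction. -/
theorem twoRaysAt_of_mem_openSegment {X : Set Space} {a b p : Space} (hab : a ≠ b)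
    (hp : p ∈ openSegment ℝ a b) (h : ∀ᶠ x in 𝓝 p, x ∈ X ↔ x ∈ segment ℝ a b) :
    TwoRaysAt X p := by
  refine twoRaysAt_of_corner (b := a) (c := b) ?_ ?_
  · rwa [segment_union_of_mem (openSegment_subset_segment ℝ a b hp)]
  · rw [openSegment_eq_image'] at hp
    obtain ⟨t, ⟨t0, t1⟩, rfl⟩ := hp
    have e1 : a - (a + t • (b - a)) = (-t) • (b - a) := by module
    have e2 : b - (a + t • (b - a)) = (1 - t) • (b - a) := by module
    simp only [e1, e2]
    intro hs
    have hba : b - a ≠ 0 := sub_ne_zero.mpr hab.symm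
    have := hs.exists_pos (by simp [hba, t0.ne']) (by simp [hba]; linarith)
    obtain ⟨r, s, hr, hs, h⟩ := this
    rw [smul_smul, smul_smul, ← sub_eq_zero, ← sub_smul] at h
    have h := (smul_eq_zero.mp h).resolve_right hba
    nlinarith [mul_pos hr t0, mul_pos hs (sub_pos.mpr t1)]

/-! ### Flat links -/

theorem locInj_of_injOn {X : Set Space} (h : InjOn Prod.fst X) : LocInj X :=
  fun _ _ => ⟨univ, Filter.univ_mem, by simpa using h⟩

/-- At the constant height `1/2` the framing conditions in the moves become automatic. This is why
the isotopies of curves are carried out on flat links. -/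
theorem injOn_fst_of_flat {X : Set Space} (h : ∀ x ∈ X, x.2 = 1 / 2) : InjOn Prod.fst X :=
  fun x hx y hy hxy => Prod.ext hxy ((h x hx).trans (h y hy).symm)

/-- The pairwise intersections of the sides of a triangle. -/
structure Nondeg (a b c : Space) : Prop where
  ab : a ≠ b
  bc : b ≠ c
  ca : c ≠ a
  at_a : segment ℝ a b ∩ segment ℝ a c ⊆ {a}
  at_b : segment ℝ b a ∩ segment ℝ b c ⊆ {b}
  at_c : segment ℝ c a ∩ segment ℝ c b ⊆ {c}

theorem Nondeg.rotate {a b c : Space} (h : Nondeg a b c) : Nondeg b c a where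
  ab := h.bc
  bc := h.ca
  ca := h.ab
  at_a := fun _ hx => h.at_b hx.symm
  at_b := fun _ hx => h.at_c hx.symm
  at_c := fun _ hx => h.at_a hx

theorem triangle_rotate (a b c : Space) : triangle a b c = triangle b c a := by
  simp only [triangle]; congr 1; ext; simp; tauto

theorem sides_subset_triangle (a b c : Space) :
    segment ℝ a b ⊆ triangle a b c ∧ segment ℝ a c ⊆ triangle a b c ∧
      segment ℝ c b ⊆ triangle a b c := by
  have h := convex_convexHull ℝ ({a, b, c} : Set Space)
  have hs := subset_convexHull ℝ ({a, b, c} : Set Space)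
  exact ⟨h.segment_subset (hs (by simp)) (hs (by simp)),
    h.segment_subset (hs (by simp)) (hs (by simp)), h.segment_subset (hs (by simp)) (hs (by simp))⟩

theorem mem_segment_cases {a b p : Space} (hp : p ∈ segment ℝ a b) :
    p = a ∨ p = b ∨ p ∈ openSegment ℝ a b := by
  rw [← insert_endpoints_openSegment ℝ a b] at hp
  simpa using hp

/-- Sides in the same direction would share an initial piece, contrary to `Nondeg.at_a`. -/
theorem sameRay_sub_iff_aux {a b c : Space} (h : Nondeg a b c) : ¬ SameRay ℝ (b - a) (c - a) := by
  intro hs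
  obtain ⟨t, t0, t1, ht⟩ := exists_small a (b - a) (eventually_segment_iff a
    (sub_ne_zero.mpr h.ab.symm) (sub_ne_zero.mpr h.ca) hs)
  have hm : a + t • (b - a) ∈ segment ℝ a (a + (b - a)) := mem_segment_add.mpr ⟨t, t0.le, t1, rfl⟩
  have hm' := (ht t t0.le le_rfl).mp hm
  rw [add_sub_cancel] at hm hm'
  have := h.at_a ⟨hm, hm'⟩
  rw [mem_singleton_iff, add_eq_left] at this
  exact absurd (smul_eq_zero.mp this) (by simp [t0.ne', sub_ne_zero.mpr h.ab.symm])

/-- The `Δ`-move on a flat link, from `ab` to `acb`. -/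
theorem exists_delta {n : ℕ} (L : Link n) {a b c : Space} {Y : Set Space} (hn : Nondeg a b c)
    (hT : triangle a b c ⊆ thickened n) (hL : L.carrier ∩ triangle a b c = segment ℝ a b)
    (flatL : ∀ x ∈ L.carrier, x.2 = 1 / 2) (flatT : ∀ x ∈ triangle a b c, x.2 = 1 / 2)
    (hY : Y = (L.carrier \ segment ℝ a b) ∪ (segment ℝ a c ∪ segment ℝ c b)) (cY : IsCompact Y) :
    ∃ L' : Link n, L'.carrier = Y ∧ L ≈ L' := by
  obtain ⟨Tab, Tac, Tcb⟩ := sides_subset_triangle a b c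
  have hYL : Y ⊆ L.carrier ∪ triangle a b c := by
    rw [hY]
    rintro x (hx | hx | hx)
    exacts [Or.inl hx.1, Or.inr (Tac hx), Or.inr (Tcb hx)]
  have flatU : ∀ x ∈ L.carrier ∪ triangle a b c, x.2 = 1 / 2 := by
    rintro x (hx | hx)
    exacts [flatL x hx, flatT x hx]
  have hab : segment ℝ a b ⊆ L.carrier := by rw [← hL]; exact inter_subset_left
  have hLab : ∀ x ∈ L.carrier, x ∈ triangle a b c → x ∈ segment ℝ a b := by
    intro x h1 h2; rw [← hL]; exact ⟨h1, h2⟩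
  have cL := L.isCompact.isClosed
  have cac := isClosed_segment a c
  have ccb := isClosed_segment c b
  -- As `L` meets the triangle in `ab` only and the sides meet in vertices only, the new sides touch
  -- `L` at `a` and `b` only. So the germ changes there by a swap of one ray, and `c` is a new
  -- corner.
  have mem_ac : ∀ x, x ∈ segment ℝ a c → x ∈ L.carrier → x = a := fun x h1 h2 =>
    hn.at_a ⟨hLab x h2 (Tac h1), h1⟩
  have mem_cb : ∀ x, x ∈ segment ℝ c b → x ∈ L.carrier → x = b := fun x h1 h2 =>
    hn.at_b ⟨by rw [segment_symm]; exact hLab x h2 (Tcb h1), by rwa [segment_symm]⟩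
  refine ⟨⟨Y, cY, ?_, ?_, locInj_of_injOn (injOn_fst_of_flat fun x hx => flatU x (hYL hx))⟩, rfl,
    isotopic_of_move (Or.inl ⟨a, b, c, hT, hL,
      locInj_of_injOn (injOn_fst_of_flat flatU), hY⟩)⟩
  · exact hYL.trans (union_subset L.subset hT)
  · intro p hp
    have at_a : TwoRaysAt Y a := by
      refine (L.polygonal a (hab (left_mem_segment ℝ a b))).swap (b := b) (c := c) hn.ab.symm hn.ca
        hab (Filter.Eventually.of_forall mem_ac) ?_
      filter_upwards [eventually_notMem ccb (p := a) fun h =>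
        hn.ab (hn.at_b ⟨right_mem_segment ℝ b a, by rwa [segment_symm]⟩)] with x hx
      rw [hY]
      simp only [mem_union, mem_sdiff, hx, or_false]
    have at_b : TwoRaysAt Y b := by
      refine (L.polygonal b (hab (right_mem_segment ℝ a b))).swap (b := a) (c := c) hn.ab
        hn.bc.symm (by rwa [segment_symm])
        (Filter.Eventually.of_forall fun x h1 => mem_cb x (by rwa [segment_symm])) ?_
      filter_upwards [eventually_notMem cac (p := b) fun h =>
        hn.ab.symm (hn.at_a ⟨right_mem_segment ℝ a b, h⟩)] with x hx
      rw [hY, segment_symm ℝ b a, segment_symm ℝ b c]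
      simp only [mem_union, mem_sdiff, hx, false_or]
    by_cases hpa : p = a
    · rw [hpa]; exact at_a
    by_cases hpb : p = b
    · rw [hpb]; exact at_b
    have hab' : IsClosed (segment ℝ a b) := isClosed_segment a b
    by_cases h1 : p ∈ segment ℝ a c
    · have hpL : p ∉ L.carrier := fun h => hpa (mem_ac p h1 h)
      rcases mem_segment_cases h1 with h | rfl | h
      · exact absurd h hpa
      · refine twoRaysAt_of_corner (b := a) (c := b) ?_ (sameRay_sub_iff_aux hn.rotate.rotate)
        filter_upwards [eventually_notMem cL hpL] with x hx
        rw [hY, segment_symm ℝ a p]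
        simp only [mem_union, mem_sdiff, hx, false_and, false_or]
      · refine twoRaysAt_of_mem_openSegment hn.ca.symm h ?_
        by_cases h2 : p ∈ segment ℝ c b
        · exfalso
          have : p = c := hn.at_c ⟨by rwa [segment_symm], h2⟩
          rw [this] at h
          exact absurd h (right_mem_openSegment_iff.not.mpr hn.ca.symm)
        · filter_upwards [eventually_notMem cL hpL, eventually_notMem ccb h2] with x hx hx'
          rw [hY]
          simp only [mem_union, mem_sdiff, hx, hx', false_and, false_or, or_false]
    by_cases h2 : p ∈ segment ℝ c b
    · have hpL : p ∉ L.carrier := fun h => hpb (mem_cb p h2 h)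
      rcases mem_segment_cases h2 with h | h | h
      · exact absurd (h ▸ right_mem_segment ℝ a c) h1
      · exact absurd h hpb
      · refine twoRaysAt_of_mem_openSegment hn.bc.symm h ?_
        filter_upwards [eventually_notMem cL hpL, eventually_notMem cac h1] with x hx hx'
        rw [hY]
        simp only [mem_union, mem_sdiff, hx, hx', false_and, false_or]
    · rw [hY] at hp
      have hp' : p ∈ L.carrier ∧ p ∉ segment ℝ a b := by
        rcases hp with hp | hp | hp
        exacts [hp, absurd hp h1, absurd hp h2]
      refine (L.polygonal p hp'.1).congr ?_
      filter_upwards [eventually_notMem cac h1, eventually_notMem ccb h2,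
        eventually_notMem hab' hp'.2] with x k1 k2 k3
      rw [hY]
      simp only [mem_union, mem_sdiff, k1, k2, k3, not_false_eq_true, and_true, or_false]

/-- The inverse `Δ`-move on a flat link, from `acb` to `ab`. -/
theorem exists_delta_symm {n : ℕ} (L : Link n) {a b c : Space} {Y : Set Space} (hn : Nondeg a b c)
    (hT : triangle a b c ⊆ thickened n)
    (hL : L.carrier ∩ triangle a b c = segment ℝ a c ∪ segment ℝ c b)
    (flatL : ∀ x ∈ L.carrier, x.2 = 1 / 2) (flatT : ∀ x ∈ triangle a b c, x.2 = 1 / 2)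
    (hY : Y = (L.carrier \ (segment ℝ a c ∪ segment ℝ c b)) ∪ segment ℝ a b) (cY : IsCompact Y) :
    ∃ L' : Link n, L'.carrier = Y ∧ L ≈ L' := by
  obtain ⟨Tab, Tac, Tcb⟩ := sides_subset_triangle a b c
  have hYL : Y ⊆ L.carrier ∪ triangle a b c := by
    rw [hY]
    rintro x (hx | hx)
    exacts [Or.inl hx.1, Or.inr (Tab hx)]
  have flatU : ∀ x ∈ L.carrier ∪ triangle a b c, x.2 = 1 / 2 := by
    rintro x (hx | hx)
    exacts [flatL x hx, flatT x hx]
  have hsub : segment ℝ a c ∪ segment ℝ c b ⊆ L.carrier := by rw [← hL]; exact inter_subset_left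
  have hac := (union_subset_iff.mp hsub).1
  have hcb := (union_subset_iff.mp hsub).2
  have hLab : ∀ x ∈ L.carrier, x ∈ triangle a b c → x ∈ segment ℝ a c ∪ segment ℝ c b := by
    intro x h1 h2; rw [← hL]; exact ⟨h1, h2⟩
  have cac := isClosed_segment a c
  have ccb := isClosed_segment c b
  have cab := isClosed_segment a b
  have cL := L.isCompact.isClosed
  have mem_ab : ∀ x, x ∈ segment ℝ a b → x ∈ L.carrier → x = a ∨ x = b := fun x h1 h2 => by
    rcases hLab x h2 (Tab h1) with h | h
    · exact Or.inl (hn.at_a ⟨h1, h⟩)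
    · exact Or.inr (hn.at_b ⟨by rwa [segment_symm], by rwa [segment_symm]⟩)
  have polyY : ∀ p ∈ Y, TwoRaysAt Y p := by
    intro p hp
    by_cases hpa : p = a
    · rw [hpa]
      refine (L.polygonal a (hac (left_mem_segment ℝ a c))).swap (b := c) (c := b) hn.ca
        hn.ab.symm hac ?_ ?_
      · filter_upwards [isOpen_ne.mem_nhds hn.ab] with x hx h1 h2
        exact (mem_ab x h1 h2).resolve_right hx
      · filter_upwards [eventually_notMem ccb (p := a) fun h =>
          hn.ab (hn.at_b ⟨right_mem_segment ℝ b a, by rwa [segment_symm]⟩)] with x hx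
        rw [hY]
        simp only [mem_union, mem_sdiff, hx, or_false]
    by_cases hpb : p = b
    · rw [hpb]
      refine (L.polygonal b (hcb (right_mem_segment ℝ c b))).swap (b := c) (c := a) hn.bc.symm
        hn.ab (by rwa [segment_symm]) ?_ ?_
      · filter_upwards [isOpen_ne.mem_nhds hn.ab.symm] with x hx h1 h2
        exact (mem_ab x (by rwa [segment_symm]) h2).resolve_left hx
      · filter_upwards [eventually_notMem cac (p := b) fun h =>
          hn.ab.symm (hn.at_a ⟨right_mem_segment ℝ a b, h⟩)] with x hx
        rw [hY, segment_symm ℝ b a, segment_symm ℝ b c]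
        simp only [mem_union, mem_sdiff, hx, false_or]
    by_cases h1 : p ∈ segment ℝ a b
    · have hpL : p ∉ L.carrier := fun h => (mem_ab p h1 h).elim hpa hpb
      rcases mem_segment_cases h1 with h | h | h
      · exact absurd h hpa
      · exact absurd h hpb
      · refine twoRaysAt_of_mem_openSegment hn.ab h ?_
        filter_upwards [eventually_notMem cL hpL] with x hx
        rw [hY]
        simp only [mem_union, mem_sdiff, hx, false_and, false_or]
    · rw [hY] at hp
      have hp' := hp.resolve_right h1
      refine (L.polygonal p hp'.1).congr ?_
      filter_upwards [eventually_notMem cab h1, eventually_notMem (cac.union ccb) hp'.2]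
        with x k1 k2
      rw [hY]
      simp only [mem_union] at k2
      simp only [mem_union, mem_sdiff, k1, k2, not_false_eq_true, and_true, or_false]
  let L' : Link n := ⟨Y, cY, hYL.trans (union_subset L.subset hT), polyY,
    locInj_of_injOn (injOn_fst_of_flat fun x hx => flatU x (hYL hx))⟩
  -- `DeltaMove` goes from `ab` to `acb` only, so the move is exhibited from `L'` to `L` and
  -- reversed in the isotopy relation.
  refine ⟨L', rfl, Setoid.symm (isotopic_of_move (Or.inl ⟨a, b, c, hT, ?_, ?_, ?_⟩))⟩
  · change Y ∩ _ = _
    rw [hY]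
    refine Subset.antisymm ?_ fun x hx => ⟨Or.inr hx, Tab hx⟩
    rintro x ⟨hx | hx, hxT⟩
    · exact absurd (hLab x hx.1 hxT) hx.2
    · exact hx
  · refine locInj_of_injOn (injOn_fst_of_flat ?_)
    rintro x (hx | hx)
    exacts [flatU x (hYL hx), flatT x hx]
  · change L.carrier = (Y \ _) ∪ _
    rw [hY]
    ext x
    constructor
    · intro hx
      by_cases h : x ∈ segment ℝ a c ∪ segment ℝ c b
      · exact Or.inr h
      · refine Or.inl ⟨Or.inl ⟨hx, h⟩, fun h' => ?_⟩
        rcases mem_ab x h' hx with rfl | rfl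
        · exact h (Or.inl (left_mem_segment ℝ _ _))
        · exact h (Or.inr (right_mem_segment ℝ _ _))
    · rintro (⟨hx | hx, hx'⟩ | hx)
      · exact hx.1
      · exact absurd hx hx'
      · exact hsub hx

end PlanarSkein

namespace PlanarSkein

/-! ### Classes of links in the skein algebra -/

section Classes

variable {R : Type*} [CommRing R] {n : ℕ} (r : Rˣ)

theorem toSkein_eq {L M : Link n} (h : L ≈ M) : L.toSkein r = M.toSkein r := by
  simp only [Link.toSkein, Link.toFree, Quotient.sound h]

theorem toSkein_stack (L M : Link n) : (L.stack M).toSkein r = L.toSkein r * M.toSkein r := by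
  exact (congrArg (RingQuot.mkRingHom (SkeinRel n r)) (map_mul (MonoidAlgebra.of R (LinkClass n))
    (show LinkClass n from Quotient.mk _ L) (show LinkClass n from Quotient.mk _ M))).trans (map_mul (RingQuot.mkRingHom (SkeinRel n r)) _ _)

theorem mkRingHom_smul (c : R) (x : MonoidAlgebra R (LinkClass n)) :
    RingQuot.mkRingHom (SkeinRel n r) (c • x) = c • RingQuot.mkRingHom (SkeinRel n r) x := by
  rw [← RingQuot.mkAlgHom_coe R]
  exact map_smul (RingQuot.mkAlgHom R (SkeinRel n r)) c x

theorem toSkein_crossing {L Linf L0 : Link n} (h : SkeinTriple L Linf L0) :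
    L.toSkein r = (r : R) • Linf.toSkein r + (↑r⁻¹ : R) • L0.toSkein r := by
  rw [Link.toSkein, RingQuot.mkRingHom_rel (SkeinRel.crossing L Linf L0 h), map_add,
    mkRingHom_smul, mkRingHom_smul]
  rfl

theorem toSkein_circle {L M : Link n} (h : AddCircle L M) :
    M.toSkein r = -alpha r • L.toSkein r := by
  rw [Link.toSkein, RingQuot.mkRingHom_rel (SkeinRel.circle L M h), mkRingHom_smul]
  rfl

theorem skein_induction {p : Skein n r → Prop} (x : Skein n r) (hl : ∀ L : Link n, p (L.toSkein r))
    (ha : ∀ x y, p x → p y → p (x + y)) (hs : ∀ (c : R) x, p x → p (c • x)) : p x := by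
  obtain ⟨x, rfl⟩ := RingQuot.mkRingHom_surjective (SkeinRel n r) x
  induction x using MonoidAlgebra.induction_on with
  | of g =>
    obtain ⟨L, rfl⟩ := Quotient.exists_rep g
    exact hl L
  | add f g hf hg => rw [map_add]; exact ha _ _ hf hg
  | smul c f hf => rw [mkRingHom_smul]; exact hs _ _ hf

end Classes

/-! ### Links with disjoint projections -/

/-- No point of `L` lies above or below a point of `M`, so the heights of the two links may be
exchanged by one vertical move. It lowers the upper half by `1/2` and raises the lower half by
`1/2`. -/
theorem stack_comm {n : ℕ} {L M : Link n}
    (h : ∀ p ∈ L.carrier, ∀ p' ∈ M.carrier, p.1 ≠ p'.1) : L.stack M ≈ M.stack L := by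
  classical
  refine isotopic_of_move (Or.inr
    ⟨fun p => if 1 / 2 < p.2 then p.2 - 1 / 2 else p.2 + 1 / 2, ?_, ?_, ?_⟩)
  · refine ContinuousOn.union_of_isClosed ?_ ?_
      (L.isCompact.image (continuous_rescale _ _)).isClosed
      (M.isCompact.image (continuous_rescale _ _)).isClosed
    · refine (continuous_snd.sub continuous_const).continuousOn.congr (f := fun p : Space => p.2 - 1/2)
        fun p hp => ?_
      simp only [if_pos (up_gt L.subset hp).2]
    · refine (continuous_snd.add continuous_const).continuousOn.congr (f := fun p : Space => p.2 + 1/2)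
        fun p hp => ?_
      simp only [if_neg (down_lt M.subset hp).2.le.not_gt]
  · rintro p (hp | hp) p' (hp' | hp') h1 h2
    · simp only [if_pos (up_gt L.subset hp).2, if_pos (up_gt L.subset hp').2]; linarith
    · obtain ⟨x, hx, rfl⟩ := hp
      obtain ⟨y, hy, rfl⟩ := hp'
      exact absurd h1 (h x hx y hy)
    · obtain ⟨x, hx, rfl⟩ := hp
      obtain ⟨y, hy, rfl⟩ := hp'
      exact absurd h1.symm (h y hy x hx)
    · simp only [if_neg (down_lt M.subset hp).2.le.not_gt,
        if_neg (down_lt M.subset hp').2.le.not_gt]; linarith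
  · simp only [Link.stack, image_union, image_image]
    rw [union_comm]
    congr 1
    · refine image_congr fun p hp => ?_
      simp only [if_pos (up_gt L.subset (mem_image_of_mem _ hp)).2]
      simp only [rescale, Prod.ext_iff, true_and]; ring
    · refine image_congr fun p hp => ?_
      simp only [if_neg (down_lt M.subset (mem_image_of_mem _ hp)).2.le.not_gt]
      simp only [rescale, Prod.ext_iff, true_and]; ring

/-- For disjoint flat links the stacking is undone by the vertical move to the constant height
`1/2`. -/
theorem exists_union {n : ℕ} {L M : Link n} (hL : ∀ p ∈ L.carrier, p.2 = 1 / 2)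
    (hM : ∀ p ∈ M.carrier, p.2 = 1 / 2) (hd : Disjoint L.carrier M.carrier) :
    ∃ N : Link n, N.carrier = L.carrier ∪ M.carrier ∧ L.stack M ≈ N := by
  have cL := L.isCompact.isClosed
  have cM := M.isCompact.isClosed
  refine ⟨⟨L.carrier ∪ M.carrier, L.isCompact.union M.isCompact, union_subset L.subset M.subset,
    ?_, L.immersed.union M.immersed cL cM hd⟩, rfl, isotopic_of_move (Or.inr
      ⟨fun _ => 1 / 2, continuousOn_const, ?_, ?_⟩)⟩
  · rintro p (hp | hp)
    · exact (L.polygonal p hp).union cM (disjoint_left.mp hd hp)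
    · rw [union_comm]; exact (M.polygonal p hp).union cL (disjoint_right.mp hd hp)
  · rintro _ (⟨x, hx, rfl⟩ | ⟨x, hx, rfl⟩) _ (⟨y, hy, rfl⟩ | ⟨y, hy, rfl⟩) h1 h2
    · simp only [rescale, hL x hx, hL y hy] at h2; exact absurd h2 (lt_irrefl _)
    · exact absurd (Prod.ext h1 ((hL x hx).trans (hM y hy).symm) : x = y)
        fun h => disjoint_left.mp hd hx (h ▸ hy)
    · exact absurd (Prod.ext h1 ((hM x hx).trans (hL y hy).symm) : x = y)
        fun h => disjoint_left.mp hd hy (h ▸ hx)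
    · simp only [rescale, hM x hx, hM y hy] at h2; exact absurd h2 (lt_irrefl _)
  · simp only [Link.stack, image_union, image_image, rescale]
    congr 1
    · refine (image_id _).symm.trans (image_congr fun p hp => Prod.ext rfl (hL p hp))
    · refine (image_id _).symm.trans (image_congr fun p hp => Prod.ext rfl (hM p hp))

/-! ### Flattening -/

theorem sameRay_smul {u v : Space} {t : ℝ} (ht : 0 < t) (h : SameRay ℝ (t • u) (t • v)) :
    SameRay ℝ u v := by
  rcases h with h | h | ⟨a, b, ha, hb, h⟩
  · exact Or.inl ((smul_eq_zero.mp h).resolve_left ht.ne')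
  · exact Or.inr (Or.inl ((smul_eq_zero.mp h).resolve_left ht.ne'))
  · refine Or.inr (Or.inr ⟨a * t, b * t, by positivity, by positivity, ?_⟩)
    rw [mul_smul, mul_smul, h]

/-- Short pieces of both rays lie in `X`, where the projection is injective; hence their projections
are nondegenerate and have distinct directions. Compactness of `X` excludes other points of `X` over
a neighbourhood of the projection of `p`. -/
theorem twoRaysAt_flatten {X : Set Space} (cX : IsCompact X) (hi : InjOn Prod.fst X) {p : Space}
    (hp : p ∈ X) (h : TwoRaysAt X p) :
    TwoRaysAt (rescale 0 (1 / 2) '' X) (rescale 0 (1 / 2) p) := by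
  obtain ⟨u, v, huv, h⟩ := twoRaysAt_iff.mp h
  obtain ⟨t1, ht1, -, h1⟩ := exists_small p u h
  obtain ⟨t2, ht2, -, h2⟩ := exists_small p v h
  obtain ⟨t, ht, ht', k1, k2⟩ : ∃ t : ℝ, 0 < t ∧ t ≤ 1 ∧ t ≤ t1 ∧ t ≤ t2 :=
    ⟨min 1 (min t1 t2), by positivity, min_le_left _ _, (min_le_right _ _).trans (min_le_left _ _),
      (min_le_right _ _).trans (min_le_right _ _)⟩
  have hu : u ≠ 0 := by rintro rfl; exact huv (SameRay.zero_left _)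
  have hv : v ≠ 0 := by rintro rfl; exact huv (SameRay.zero_right _)
  have mem_u : ∀ s : ℝ, 0 ≤ s → s ≤ t → p + s • u ∈ X := fun s s0 s1 =>
    (h1 s s0 (s1.trans k1)).mpr (Or.inl (mem_segment_add.mpr ⟨s, s0, s1.trans ht', rfl⟩))
  have mem_v : ∀ s : ℝ, 0 ≤ s → s ≤ t → p + s • v ∈ X := fun s s0 s1 =>
    (h2 s s0 (s1.trans k2)).mpr (Or.inr (mem_segment_add.mpr ⟨s, s0, s1.trans ht', rfl⟩))
  have seg_u : segment ℝ p (p + t • u) ⊆ X := fun x hx => by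
    obtain ⟨s, s0, s1, rfl⟩ := mem_segment_add.mp hx
    rw [smul_smul]
    exact mem_u _ (by positivity) (mul_le_of_le_one_left ht.le s1)
  have seg_v : segment ℝ p (p + t • v) ⊆ X := fun x hx => by
    obtain ⟨s, s0, s1, rfl⟩ := mem_segment_add.mp hx
    rw [smul_smul]
    exact mem_v _ (by positivity) (mul_le_of_le_one_left ht.le s1)
  have ev : ∀ᶠ x in 𝓝 p, x ∈ X ↔ x ∈ segment ℝ p (p + t • u) ∪ segment ℝ p (p + t • v) := by
    filter_upwards [h, eventually_segment_iff p hu (smul_ne_zero ht.ne' hu)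
      (SameRay.sameRay_pos_smul_right _ ht), eventually_segment_iff p hv (smul_ne_zero ht.ne' hv)
      (SameRay.sameRay_pos_smul_right _ ht)] with x a b c
    rw [a, mem_union, mem_union, b, c]
  have add_flat : ∀ w : Space, rescale 0 (1 / 2) (p + w) = rescale 0 (1 / 2) p + (w.1, 0) := by
    intro w; simp [rescale]
  refine twoRaysAt_iff.mpr ⟨((t • u).1, 0), ((t • v).1, 0), ?_, ?_⟩
  · intro hs
    have inj : ∀ s s' : ℝ, 0 ≤ s → s ≤ 1 → 0 ≤ s' → s' ≤ 1 →
        s • (t • u).1 = s' • (t • v).1 → s • (t • u) = s' • (t • v) := by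
      intro s s' a b a' b' e
      have := @hi (p + s • t • u)
        (by rw [smul_smul]; exact mem_u _ (by positivity) (mul_le_of_le_one_left ht.le b)) (p + s' • t • v)
        (by rw [smul_smul]; exact mem_v _ (by positivity) (mul_le_of_le_one_left ht.le b'))
        (by simpa using e)
      exact add_left_cancel this
    rcases hs with hs | hs | ⟨a, b, ha, hb, hs⟩
    · have := inj 1 0 (by simp) le_rfl le_rfl (by simp) (by simpa using congrArg Prod.fst hs)
      simp only [one_smul, zero_smul] at this
      exact (smul_ne_zero ht.ne' hu) this
    · have := inj 0 1 le_rfl (by simp) (by simp) le_rfl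
        (by simpa using (congrArg Prod.fst hs).symm)
      simp only [one_smul, zero_smul] at this
      exact (smul_ne_zero ht.ne' hv) this.symm
    · have hab : 0 < a + b := by positivity
      have e := congrArg Prod.fst hs
      simp only [Prod.smul_fst] at e
      -- Division by `a + b` brings both parameters into `[0, 1]`, where the two rays are known to
      -- lie in `X`.
      have := inj (a / (a + b)) (b / (a + b)) (by positivity)
        ((div_le_one hab).mpr (by linarith)) (by positivity) ((div_le_one hab).mpr (by linarith))
        (by simp only [div_eq_inv_mul, mul_smul, Prod.smul_fst, e])
      exact huv (sameRay_smul ht (Or.inr (Or.inr ⟨_, _, by positivity, by positivity, this⟩)))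
  · rw [eventually_nhds_iff] at ev
    obtain ⟨U, hU, oU, pU⟩ := ev
    -- The part of `X` outside `U` has compact projection, which misses that of `p` by injectivity.
    -- So points of `X` that project close to `p` lie in `U`.
    have cK : IsCompact (Prod.fst '' (X \ U)) := (cX.diff oU).image continuous_fst
    have hK : (rescale 0 (1 / 2) p).1 ∉ Prod.fst '' (X \ U) := by
      rintro ⟨x, hx, e⟩
      exact hx.2 (by rw [hi hx.1 hp e]; exact pU)
    filter_upwards [(cK.isClosed.isOpen_compl.preimage continuous_fst).mem_nhds hK] with y hy
    rw [← add_flat, ← add_flat, ← rescale_segment, ← rescale_segment, ← image_union]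
    constructor
    · rintro ⟨x, hx, rfl⟩
      have hxU : x ∈ U := by
        by_contra hxU
        exact hy ⟨x, ⟨hx, hxU⟩, rfl⟩
      exact ⟨x, (hU x hxU).mp hx, rfl⟩
    · rintro ⟨x, hx, rfl⟩
      exact ⟨x, hx.elim (fun h => seg_u h) (fun h => seg_v h), rfl⟩

theorem exists_flatten {n : ℕ} (L : Link n) (hi : InjOn Prod.fst L.carrier) :
    ∃ M : Link n, M.carrier = rescale 0 (1 / 2) '' L.carrier ∧ L ≈ M := by
  refine ⟨⟨rescale 0 (1 / 2) '' L.carrier, L.isCompact.image (continuous_rescale _ _), ?_, ?_, ?_⟩,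
    rfl, isotopic_of_move (Or.inr ⟨fun _ => 1 / 2, continuousOn_const, ?_, ?_⟩)⟩
  · rintro _ ⟨p, hp, rfl⟩
    exact ⟨(L.subset hp).1, by norm_num [rescale]⟩
  · rintro _ ⟨p, hp, rfl⟩
    exact twoRaysAt_flatten L.isCompact hi hp (L.polygonal p hp)
  · refine locInj_of_injOn ?_
    rintro _ ⟨p, hp, rfl⟩ _ ⟨p', hp', rfl⟩ h
    rw [hi hp hp' h]
  · intro p hp p' hp' h1 h2
    rw [hi hp hp' h1] at h2
    exact absurd h2 (lt_irrefl _)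
  · exact image_congr fun p _ => by simp [rescale]

/-! ### Smoothing a crossing -/

/-- The finite set of double points, with `p` itself removed, is closed, and its complement is a
neighbourhood of `p` without two points over each other. -/
theorem locInj_of_finite {X : Set Space}
    (h : {x ∈ X | ∃ y ∈ X, y ≠ x ∧ y.1 = x.1}.Finite) : LocInj X := by
  intro p _
  refine ⟨({x ∈ X | ∃ y ∈ X, y ≠ x ∧ y.1 = x.1} \ {p})ᶜ,
    (h.subset sdiff_subset).isClosed.isOpen_compl.mem_nhds (by simp), ?_⟩
  rintro x ⟨hx, hx'⟩ y ⟨hy, hy'⟩ hxy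
  by_contra hne
  have e1 : x = p := by
    by_contra h; exact hx' ⟨⟨hx, y, hy, fun h => hne h.symm, hxy.symm⟩, h⟩
  have e2 : y = p := by
    by_contra h; exact hy' ⟨⟨hy, x, hx, hne, hxy⟩, h⟩
  exact hne (e1.trans e2.symm)

/-- The edges of a tetrahedron meet in its vertices only. -/
structure TetraIndep (a b c d : Space) : Prop where
  bc : b ≠ c
  da : d ≠ a
  ac : a ≠ c
  bd : b ≠ d
  bc_ac : segment ℝ b c ∩ segment ℝ a c ⊆ {c}
  bc_bd : segment ℝ b c ∩ segment ℝ b d ⊆ {b}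
  da_ac : segment ℝ d a ∩ segment ℝ a c ⊆ {a}
  da_bd : segment ℝ d a ∩ segment ℝ b d ⊆ {d}
  ac_bd : Disjoint (segment ℝ a c) (segment ℝ b d)
  bc_da : Disjoint (segment ℝ b c) (segment ℝ d a)

theorem tetra_segments (a b c d : Space) : segment ℝ a c ⊆ tetra a b c d ∧
    segment ℝ b d ⊆ tetra a b c d ∧ segment ℝ b c ⊆ tetra a b c d ∧
    segment ℝ d a ⊆ tetra a b c d := by
  have h := convex_convexHull ℝ ({a, b, c, d} : Set Space)
  have hs := subset_convexHull ℝ ({a, b, c, d} : Set Space)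
  refine ⟨?_, ?_, ?_, ?_⟩ <;>
    exact h.segment_subset (hs (by simp)) (hs (by simp))

/-- At each of `a, b, c, d` one ray of the crossing is swapped for a ray of the smoothing. All other
germs are those of `L` or of an interior point of a new segment. Exchanging `b` and `d` gives the
other smoothing. -/
theorem polygonal_smoothing {n : ℕ} (L : Link n) {a b c d : Space} (hi : TetraIndep a b c d)
    (hL : L.carrier ∩ tetra a b c d = segment ℝ a c ∪ segment ℝ b d) :
    ∀ p ∈ (L.carrier \ tetra a b c d) ∪ (segment ℝ b c ∪ segment ℝ d a),
      TwoRaysAt ((L.carrier \ tetra a b c d) ∪ (segment ℝ b c ∪ segment ℝ d a)) p := by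
  obtain ⟨T1, T2, T3, T4⟩ := tetra_segments a b c d
  have s1 : segment ℝ a c ⊆ L.carrier := fun x hx =>
    (show x ∈ L.carrier ∩ tetra a b c d by rw [hL]; exact Or.inl hx).1
  have s2 : segment ℝ b d ⊆ L.carrier := fun x hx =>
    (show x ∈ L.carrier ∩ tetra a b c d by rw [hL]; exact Or.inr hx).1
  have hT : ∀ x ∈ L.carrier, x ∈ tetra a b c d ↔ x ∈ segment ℝ a c ∪ segment ℝ b d := by
    intro x hx
    rw [← hL]; exact ⟨fun h => ⟨hx, h⟩, fun h => h.2⟩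
  have cL := L.isCompact.isClosed
  have hmem : ∀ x, x ∈ (L.carrier \ tetra a b c d) ∪ (segment ℝ b c ∪ segment ℝ d a) ↔
      (x ∈ L.carrier ∧ x ∉ segment ℝ a c ∧ x ∉ segment ℝ b d) ∨
        x ∈ segment ℝ b c ∨ x ∈ segment ℝ d a := by
    intro x
    simp only [mem_union, mem_sdiff]
    refine or_congr_left (and_congr_right fun hx => ?_)
    rw [hT x hx]; simp only [mem_union, not_or]
  have bcL : ∀ x ∈ segment ℝ b c, x ∈ L.carrier → x = b ∨ x = c := by
    intro x hx hxL
    rcases (hT x hxL).mp (T3 hx) with h | h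
    · exact Or.inr (hi.bc_ac ⟨hx, h⟩)
    · exact Or.inl (hi.bc_bd ⟨hx, h⟩)
  have daL : ∀ x ∈ segment ℝ d a, x ∈ L.carrier → x = d ∨ x = a := by
    intro x hx hxL
    rcases (hT x hxL).mp (T4 hx) with h | h
    · exact Or.inr (hi.da_ac ⟨hx, h⟩)
    · exact Or.inl (hi.da_bd ⟨hx, h⟩)
  have ma := left_mem_segment ℝ a c
  have mc := right_mem_segment ℝ a c
  have mb := left_mem_segment ℝ b d
  have md := right_mem_segment ℝ b d
  have nL := fun (x y : Space) => isClosed_segment x y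
  have dis := disjoint_left.mp hi.ac_bd
  have dis' := disjoint_left.mp hi.bc_da
  have mb' := left_mem_segment ℝ b c
  have mc' := right_mem_segment ℝ b c
  have md' := left_mem_segment ℝ d a
  have ma' := right_mem_segment ℝ d a
  intro p hp
  by_cases h1 : p ∈ segment ℝ b c
  · rcases mem_segment_cases h1 with rfl | rfl | h
    · refine (L.polygonal p (s2 mb)).swap (b := d) (c := c) hi.bd.symm hi.bc.symm s2 ?_ ?_
      · filter_upwards [isOpen_ne.mem_nhds hi.bc] with x hx k1 k2
        exact (bcL x k1 k2).resolve_right hx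
      · filter_upwards [eventually_notMem (nL a c) fun h => dis h mb,
          eventually_notMem (nL d a) (dis' mb')] with x k1 k2
        rw [hmem]; simp only [k1, k2, not_false_eq_true, true_and, or_false]
    · refine (L.polygonal p (s1 mc)).swap (b := a) (c := b) hi.ac hi.bc
        (by rwa [segment_symm]) ?_ ?_
      · filter_upwards [isOpen_ne.mem_nhds hi.bc.symm] with x hx k1 k2
        exact (bcL x (by rwa [segment_symm]) k2).resolve_left hx
      · filter_upwards [eventually_notMem (nL b d) (dis mc),
          eventually_notMem (nL d a) (dis' mc')] with x k1 k2
        rw [hmem, segment_symm ℝ p a, segment_symm ℝ p b]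
        simp only [k1, k2, not_false_eq_true, and_true, or_false]
    · refine twoRaysAt_of_mem_openSegment hi.bc h ?_
      have hpL : p ∉ L.carrier := fun hpL => by
        rcases bcL p h1 hpL with rfl | rfl
        · exact absurd h (left_mem_openSegment_iff.not.mpr hi.bc)
        · exact absurd h (right_mem_openSegment_iff.not.mpr hi.bc)
      filter_upwards [eventually_notMem cL hpL, eventually_notMem (nL d a) (dis' h1)] with x k1 k2
      rw [hmem]; simp only [k1, k2, false_and, false_or, or_false]
  by_cases h2 : p ∈ segment ℝ d a
  · rcases mem_segment_cases h2 with rfl | rfl | h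
    · refine (L.polygonal p (s2 md)).swap (b := b) (c := a) hi.bd hi.da.symm
        (by rwa [segment_symm]) ?_ ?_
      · filter_upwards [isOpen_ne.mem_nhds hi.da] with x hx k1 k2
        exact (daL x k1 k2).resolve_right hx
      · filter_upwards [eventually_notMem (nL a c) fun h => dis h md,
          eventually_notMem (nL b c) h1] with x k1 k2
        rw [hmem, segment_symm ℝ p b]; simp only [k1, k2, not_false_eq_true, true_and, false_or]
    · refine (L.polygonal p (s1 ma)).swap (b := c) (c := d) hi.ac.symm hi.da s1 ?_ ?_
      · filter_upwards [isOpen_ne.mem_nhds hi.da.symm] with x hx k1 k2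
        exact (daL x (by rwa [segment_symm]) k2).resolve_left hx
      · filter_upwards [eventually_notMem (nL b d) (dis ma),
          eventually_notMem (nL b c) h1] with x k1 k2
        rw [hmem, segment_symm ℝ p d]
        simp only [k1, k2, not_false_eq_true, and_true, false_or]
    · refine twoRaysAt_of_mem_openSegment hi.da h ?_
      have hpL : p ∉ L.carrier := fun hpL => by
        rcases daL p h2 hpL with rfl | rfl
        · exact absurd h (left_mem_openSegment_iff.not.mpr hi.da)
        · exact absurd h (right_mem_openSegment_iff.not.mpr hi.da)
      filter_upwards [eventually_notMem cL hpL, eventually_notMem (nL b c) h1] with x k1 k2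
      rw [hmem]; simp only [k1, k2, false_and, false_or]
  · have hp' := ((hmem p).mp hp).resolve_right (fun h => h.elim h1 h2)
    refine (L.polygonal p hp'.1).congr ?_
    filter_upwards [eventually_notMem (nL b c) h1, eventually_notMem (nL d a) h2,
      eventually_notMem (nL a c) hp'.2.1, eventually_notMem (nL b d) hp'.2.2] with x k1 k2 k3 k4
    rw [hmem]; simp only [k1, k2, k3, k4, not_false_eq_true, and_true, or_false]

end PlanarSkein

namespace PlanarSkein

/-! ### Grids and their edges -/

/-- A grid in the plane: the vertical lines `x = gx i` and the horizontal lines `y = gy j`. -/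
structure Grid where
  gx : ℕ → ℝ
  gy : ℕ → ℝ
  hx : StrictMono gx
  hy : StrictMono gy

/-- The code of an edge that starts in the cell `(i, j)`: `d = 0` is its bottom side, `d = 1` its
left side, `d = 2` its rising diagonal, `d = 3` its falling diagonal. -/
def code (d i j : ℕ) : ℕ := 1024 * d + 64 * j + i

/-- One endpoint of the edge with code `k`. -/
def src (k : ℕ) : ℕ × ℕ := if k / 1024 = 3 then (k % 64 + 1, k / 64 % 16) else (k % 64, k / 64 % 16)

/-- The other endpoint of the edge with code `k`. -/
def tgt (k : ℕ) : ℕ × ℕ :=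
  if k / 1024 = 0 then (k % 64 + 1, k / 64 % 16) else
  if k / 1024 = 2 then (k % 64 + 1, k / 64 % 16 + 1) else (k % 64, k / 64 % 16 + 1)

theorem exists_code {k : ℕ} (hk : k < 4096) :
    ∃ d i j, d < 4 ∧ i < 64 ∧ j < 16 ∧ k = code d i j :=
  ⟨k / 1024, k % 64, k / 64 % 16, by omega, by omega, by omega, by unfold code; omega⟩

theorem src_code {d i j : ℕ} (hd : d < 4) (hi : i < 64) (hj : j < 16) :
    src (code d i j) = if d = 3 then (i + 1, j) else (i, j) := by
  have e1 : code d i j / 1024 = d := by unfold code; omega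
  have e2 : code d i j % 64 = i := by unfold code; omega
  have e3 : code d i j / 64 % 16 = j := by unfold code; omega
  rw [src, e1, e2, e3]

theorem tgt_code {d i j : ℕ} (hd : d < 4) (hi : i < 64) (hj : j < 16) :
    tgt (code d i j) = if d = 0 then (i + 1, j) else if d = 2 then (i + 1, j + 1)
      else (i, j + 1) := by
  have e1 : code d i j / 1024 = d := by unfold code; omega
  have e2 : code d i j % 64 = i := by unfold code; omega
  have e3 : code d i j / 64 % 16 = j := by unfold code; omega
  rw [tgt, e1, e2, e3]

/-- `x` lies strictly between two consecutive values of `g`. -/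
def Between (g : ℕ → ℝ) (i : ℕ) (x : ℝ) : Prop := g i < x ∧ x < g (i + 1)

theorem Between.unique {g : ℕ → ℝ} (hg : StrictMono g) {i j : ℕ} {x : ℝ} (hi : Between g i x)
    (hj : g j ≤ x) (hj' : x ≤ g (j + 1)) : i = j := by
  have h1 := hg.lt_iff_lt.mp (hi.1.trans_le hj')
  have h2 := hg.lt_iff_lt.mp (hj.trans_lt hi.2)
  omega

theorem Between.ne {g : ℕ → ℝ} (hg : StrictMono g) {i : ℕ} {x : ℝ} (hi : Between g i x) (m : ℕ) :
    x ≠ g m := by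
  rintro rfl
  have h1 := hg.lt_iff_lt.mp hi.1
  have h2 := hg.lt_iff_lt.mp hi.2
  omega

theorem eq_or_eq_succ {g : ℕ → ℝ} (hg : StrictMono g) {i m : ℕ} (h1 : g i ≤ g m)
    (h2 : g m ≤ g (i + 1)) : m = i ∨ m = i + 1 := by
  have h1 := hg.le_iff_le.mp h1
  have h2 := hg.le_iff_le.mp h2
  omega

namespace Grid

variable (G : Grid)

/-- The vertex `v` of the grid, lifted to the height `h v`. -/
def pt (h : ℕ × ℕ → ℝ) (v : ℕ × ℕ) : Space := ((G.gx v.1, G.gy v.2), h v)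

/-- The lifted edge with code `k`. -/
def edge (h : ℕ × ℕ → ℝ) (k : ℕ) : Set Space := segment ℝ (G.pt h (src k)) (G.pt h (tgt k))

/-- The union of the lifted edges whose codes are the binary digits of `S`. -/
def real (h : ℕ × ℕ → ℝ) (S : ℕ) : Set Space := {x | ∃ k < 4096, S.testBit k ∧ x ∈ G.edge h k}

/-- The position of a point in the interior of the edge with code `code d i j`. -/
def Inner (d i j : ℕ) (p : ℝ × ℝ) : Prop :=
  (d = 0 ∧ Between G.gx i p.1 ∧ p.2 = G.gy j) ∨
  (d = 1 ∧ p.1 = G.gx i ∧ Between G.gy j p.2) ∨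
  (d = 2 ∧ Between G.gx i p.1 ∧ Between G.gy j p.2 ∧
    (p.1 - G.gx i) * (G.gy (j + 1) - G.gy j) = (p.2 - G.gy j) * (G.gx (i + 1) - G.gx i)) ∨
  (d = 3 ∧ Between G.gx i p.1 ∧ Between G.gy j p.2 ∧
    (G.gx (i + 1) - p.1) * (G.gy (j + 1) - G.gy j) = (p.2 - G.gy j) * (G.gx (i + 1) - G.gx i))

variable {G} {h : ℕ × ℕ → ℝ}

theorem mem_real {S : ℕ} {x : Space} :
    x ∈ G.real h S ↔ ∃ k < 4096, S.testBit k ∧ x ∈ G.edge h k := Iff.rfl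

theorem pt_injective {v w : ℕ × ℕ} {h h' : ℕ × ℕ → ℝ} (e : (G.pt h v).1 = (G.pt h' w).1) :
    v = w := by
  simp only [pt, Prod.mk.injEq] at e
  exact Prod.ext (G.hx.injective e.1) (G.hy.injective e.2)

theorem src_ne_tgt {k : ℕ} (hk : k < 4096) : src k ≠ tgt k := by
  obtain ⟨d, i, j, hd, hi, hj, rfl⟩ := exists_code hk
  rw [src_code hd hi hj, tgt_code hd hi hj]
  interval_cases d <;> simp

theorem injOn_segment {a b : Space} (hab : a.1 ≠ b.1) : InjOn Prod.fst (segment ℝ a b) := by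
  rw [segment_eq_image']
  rintro _ ⟨s, -, rfl⟩ _ ⟨t, -, rfl⟩ e
  simp only [Prod.fst_add, Prod.smul_fst, Prod.fst_sub, add_right_inj] at e
  have : s = t := by
    rw [← sub_eq_zero, ← sub_smul] at e
    exact sub_eq_zero.mp ((smul_eq_zero.mp e).resolve_right (sub_ne_zero.mpr hab.symm))
  rw [this]

theorem injOn_edge {k : ℕ} (hk : k < 4096) : InjOn Prod.fst (G.edge h k) :=
  injOn_segment fun e => src_ne_tgt hk (pt_injective e)

/-- Away from its endpoints an edge is described by strict inequalities between grid lines and one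
equation. Intersections of edges thus reduce to the uniqueness of the cell that contains a point. -/
theorem mem_edge_cases {d i j : ℕ} (hd : d < 4) (hi : i < 64) (hj : j < 16) {x : Space}
    (hx : x ∈ G.edge h (code d i j)) :
    (∃ v, x = G.pt h v ∧ (v = src (code d i j) ∨ v = tgt (code d i j))) ∨ G.Inner d i j x.1 := by
  rcases mem_segment_cases hx with rfl | rfl | hx
  · exact Or.inl ⟨_, rfl, Or.inl rfl⟩
  · exact Or.inl ⟨_, rfl, Or.inr rfl⟩
  right
  rw [openSegment_eq_image', src_code hd hi hj, tgt_code hd hi hj] at hx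
  obtain ⟨t, ⟨t0, t1⟩, rfl⟩ := hx
  have px := G.hx (Nat.lt_succ_self i)
  have py := G.hy (Nat.lt_succ_self j)
  simp only [Nat.succ_eq_add_one] at px py
  have b1 : ∀ {a b : ℝ}, a < b → a < a + t * (b - a) ∧ a + t * (b - a) < b := fun {a b} hab =>
    ⟨by nlinarith, by nlinarith⟩
  have b2 : ∀ {a b : ℝ}, a < b → a < b + t * (a - b) ∧ b + t * (a - b) < b := fun {a b} hab =>
    ⟨by nlinarith, by nlinarith⟩
  interval_cases d <;>
    simp only [pt, Inner, Between, Prod.fst_add, Prod.snd_add, Prod.smul_fst, Prod.smul_snd,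
      Prod.fst_sub, Prod.snd_sub, smul_eq_mul, sub_self, mul_zero, add_zero, if_true,
      OfNat.zero_ne_ofNat, OfNat.one_ne_ofNat, if_false, zero_ne_one, one_ne_zero, false_and,
      true_and, or_false, false_or, OfNat.ofNat_ne_zero, OfNat.ofNat_ne_one,
      show ¬ (2 = 3) by omega, show ¬ (3 = 2) by omega]
  · exact ⟨b1 px, trivial⟩
  · exact b1 py
  · exact ⟨b1 px, b1 py, by ring⟩
  · exact ⟨b2 px, b1 py, by ring⟩

/-- Two edges meet in a common vertex only, unless they are the diagonals of a cell. -/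
theorem edge_inter {k k' : ℕ} (hk : k < 4096) (hk' : k' < 4096) {x y : Space}
    (hx : x ∈ G.edge h k) (hy : y ∈ G.edge h k') (hxy : x.1 = y.1) :
    (∃ v, x = G.pt h v ∧ y = G.pt h v ∧ (v = src k ∨ v = tgt k) ∧ (v = src k' ∨ v = tgt k')) ∨
      k = k' ∨
      (∃ i < 64, ∃ j < 16, ((k = code 2 i j ∧ k' = code 3 i j) ∨ (k = code 3 i j ∧ k' = code 2 i j)) ∧
        x.1 = ((G.gx i + G.gx (i + 1)) / 2, (G.gy j + G.gy (j + 1)) / 2)) := by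
  obtain ⟨d, i, j, hd, hi, hj, rfl⟩ := exists_code hk
  obtain ⟨d', i', j', hd', hi', hj', rfl⟩ := exists_code hk'
  rcases mem_edge_cases hd hi hj hx with ⟨v, rfl, hv⟩ | hx'
  · rcases mem_edge_cases hd' hi' hj' hy with ⟨w, rfl, hw⟩ | hy'
    · obtain rfl := pt_injective hxy
      exact Or.inl ⟨v, rfl, rfl, hv, hw⟩
    · exfalso
      rw [← hxy] at hy'
      rcases hy' with ⟨-, h1, -⟩ | ⟨-, -, h1⟩ | ⟨-, h1, -⟩ | ⟨-, h1, -⟩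
      exacts [h1.ne G.hx _ rfl, h1.ne G.hy _ rfl, h1.ne G.hx _ rfl, h1.ne G.hx _ rfl]
  · rcases mem_edge_cases hd' hi' hj' hy with ⟨w, rfl, hw⟩ | hy'
    · exfalso
      rw [hxy] at hx'
      rcases hx' with ⟨-, h1, -⟩ | ⟨-, -, h1⟩ | ⟨-, h1, -⟩ | ⟨-, h1, -⟩
      exacts [h1.ne G.hx _ rfl, h1.ne G.hy _ rfl, h1.ne G.hx _ rfl, h1.ne G.hx _ rfl]
    · right
      rw [← hxy] at hy'
      clear hx hy hxy
      obtain ⟨⟨a, b⟩, z⟩ := x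
      simp only [Inner] at hx' hy'
      have ux : ∀ {i i' : ℕ}, Between G.gx i a → Between G.gx i' a → i = i' := fun h h' =>
        h.unique G.hx h'.1.le h'.2.le
      have uy : ∀ {i i' : ℕ}, Between G.gy i b → Between G.gy i' b → i = i' := fun h h' =>
        h.unique G.hy h'.1.le h'.2.le
      have px := sub_pos.mpr (G.hx (Nat.lt_succ_self i))
      have py := sub_pos.mpr (G.hy (Nat.lt_succ_self j))
      -- A point on both diagonals of a cell is its centre.
      have mid : (a - G.gx i) * (G.gy (j + 1) - G.gy j) = (b - G.gy j) * (G.gx (i + 1) - G.gx i) →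
          (G.gx (i + 1) - a) * (G.gy (j + 1) - G.gy j) = (b - G.gy j) * (G.gx (i + 1) - G.gx i) →
          (a, b) = ((G.gx i + G.gx (i + 1)) / 2, (G.gy j + G.gy (j + 1)) / 2) := by
        intro e1 e2
        have h1 : a - G.gx i = G.gx (i + 1) - a := mul_right_cancel₀ py.ne' (e1.trans e2.symm)
        have h2 : 2 * (b - G.gy j) = G.gy (j + 1) - G.gy j :=
          mul_right_cancel₀ px.ne' (by
            have : (G.gx (i + 1) - G.gx i) = 2 * (a - G.gx i) := by linarith
            linear_combination -2 * e1 - (G.gy (j + 1) - G.gy j) * this)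
        exact Prod.ext (by simp only; linarith) (by simp only; linarith)
      rcases hx' with ⟨rfl, h1, h2⟩ | ⟨rfl, h1, h2⟩ | ⟨rfl, h1, h2, h3⟩ | ⟨rfl, h1, h2, h3⟩ <;>
      rcases hy' with ⟨rfl, k1, k2⟩ | ⟨rfl, k1, k2⟩ | ⟨rfl, k1, k2, k3⟩ | ⟨rfl, k1, k2, k3⟩
      · left; rw [ux h1 k1, G.hy.injective (h2.symm.trans k2)]
      · exact absurd k1 (h1.ne G.hx _)
      · exact absurd h2 (k2.ne G.hy _)
      · exact absurd h2 (k2.ne G.hy _)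
      · exact absurd h1 (k1.ne G.hx _)
      · left; rw [uy h2 k2, G.hx.injective (h1.symm.trans k1)]
      · exact absurd h1 (k1.ne G.hx _)
      · exact absurd h1 (k1.ne G.hx _)
      · exact absurd k2 (h2.ne G.hy _)
      · exact absurd k1 (h1.ne G.hx _)
      · left; rw [ux h1 k1, uy h2 k2]
      · obtain rfl := ux h1 k1; obtain rfl := uy h2 k2
        exact Or.inr ⟨i, hi, j, hj, Or.inl ⟨rfl, rfl⟩, mid h3 k3⟩
      · exact absurd k2 (h2.ne G.hy _)
      · exact absurd k1 (h1.ne G.hx _)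
      · obtain rfl := ux h1 k1; obtain rfl := uy h2 k2
        exact Or.inr ⟨i, hi, j, hj, Or.inr ⟨rfl, rfl⟩, mid k3 h3⟩
      · left; rw [ux h1 k1, uy h2 k2]

/-- The closed cell `(i, j)`. -/
def cell (G : Grid) (i j : ℕ) : Set (ℝ × ℝ) :=
  Icc (G.gx i) (G.gx (i + 1)) ×ˢ Icc (G.gy j) (G.gy (j + 1))

/-- The corners of the cell `(i, j)`. -/
def Corner (i j : ℕ) (v : ℕ × ℕ) : Prop := (v.1 = i ∨ v.1 = i + 1) ∧ (v.2 = j ∨ v.2 = j + 1)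

/-- A closed cell meets the interiors of its own four sides and two diagonals only; every other edge
meets it in corners. -/
theorem edge_inter_cell {k i j : ℕ} (hk : k < 4096) {x : Space} (hx : x ∈ G.edge h k)
    (hc : x.1 ∈ G.cell i j) :
    (∃ v, x = G.pt h v ∧ (v = src k ∨ v = tgt k) ∧ Corner i j v) ∨
      (k = code 0 i j ∧ G.Inner 0 i j x.1) ∨ (k = code 0 i (j + 1) ∧ G.Inner 0 i (j + 1) x.1) ∨
      (k = code 1 i j ∧ G.Inner 1 i j x.1) ∨ (k = code 1 (i + 1) j ∧ G.Inner 1 (i + 1) j x.1) ∨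
      k = code 2 i j ∨ k = code 3 i j := by
  obtain ⟨d, i', j', hd, hi, hj, rfl⟩ := exists_code hk
  obtain ⟨⟨c1, c2⟩, c3, c4⟩ := hc
  rcases mem_edge_cases hd hi hj hx with ⟨v, rfl, hv⟩ | hx'
  · exact Or.inl ⟨v, rfl, hv, eq_or_eq_succ G.hx c1 c2, eq_or_eq_succ G.hy c3 c4⟩
  · right
    have hx2 := hx'
    rcases hx' with ⟨rfl, h1, h2⟩ | ⟨rfl, h1, h2⟩ | ⟨rfl, h1, h2, h3⟩ | ⟨rfl, h1, h2, h3⟩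
    · obtain rfl := h1.unique G.hx c1 c2
      rw [h2] at c3 c4
      rcases eq_or_eq_succ G.hy c3 c4 with rfl | rfl
      · exact Or.inl ⟨rfl, hx2⟩
      · exact Or.inr (Or.inl ⟨rfl, hx2⟩)
    · obtain rfl := h2.unique G.hy c3 c4
      rw [h1] at c1 c2
      rcases eq_or_eq_succ G.hx c1 c2 with rfl | rfl
      · exact Or.inr (Or.inr (Or.inl ⟨rfl, hx2⟩))
      · exact Or.inr (Or.inr (Or.inr (Or.inl ⟨rfl, hx2⟩)))
    · rw [h1.unique G.hx c1 c2, h2.unique G.hy c3 c4]; simp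
    · rw [h1.unique G.hx c1 c2, h2.unique G.hy c3 c4]; simp

theorem pt_mem_cell {i j : ℕ} {v : ℕ × ℕ} (hv : Corner i j v) : (G.pt h v).1 ∈ G.cell i j := by
  have hx := (G.hx (Nat.lt_succ_self i)).le
  have hy := (G.hy (Nat.lt_succ_self j)).le
  obtain ⟨v1, v2⟩ := v
  obtain ⟨h1 | h1, h2 | h2⟩ := hv <;> simp only at h1 h2 <;> subst h1 h2 <;>
    exact ⟨⟨by first | exact le_rfl | exact hx, by first | exact le_rfl | exact hx⟩,
      by first | exact le_rfl | exact hy, by first | exact le_rfl | exact hy⟩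

theorem convex_cell (i j : ℕ) : Convex ℝ {x : Space | x.1 ∈ G.cell i j} :=
  ((convex_Icc _ _).prod (convex_Icc _ _)).linear_preimage (LinearMap.fst ℝ (ℝ × ℝ) ℝ)

theorem triangle_subset_cell {i j : ℕ} {u v w : ℕ × ℕ} (hu : Corner i j u) (hv : Corner i j v)
    (hw : Corner i j w) {x : Space} (hx : x ∈ triangle (G.pt h u) (G.pt h v) (G.pt h w)) :
    x.1 ∈ G.cell i j := by
  refine convexHull_min ?_ (convex_cell (G := G) i j) hx
  rintro _ (rfl | rfl | rfl)
  exacts [pt_mem_cell hu, pt_mem_cell hv, pt_mem_cell hw]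

theorem mem_triangle {a b c x : Space} : x ∈ triangle a b c ↔
    ∃ s t : ℝ, 0 ≤ s ∧ 0 ≤ t ∧ s + t ≤ 1 ∧ x = a + s • (b - a) + t • (c - a) := by
  rw [triangle, convexHull_insert (by simp), convexHull_pair]
  simp only [mem_convexJoin, mem_singleton_iff, exists_eq_left]
  constructor
  · rintro ⟨y, hy, hx⟩
    rw [segment_eq_image'] at hy hx
    obtain ⟨s, ⟨s0, s1⟩, rfl⟩ := hy
    obtain ⟨t, ⟨t0, t1⟩, rfl⟩ := hx
    refine ⟨t * (1 - s), t * s, mul_nonneg t0 (by linarith), mul_nonneg t0 s0, by linarith, ?_⟩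
    simp only
    module
  · rintro ⟨s, t, s0, t0, hst, rfl⟩
    rcases (add_nonneg s0 t0).eq_or_lt with h | h
    · have hs : s = 0 := by linarith
      have ht : t = 0 := by linarith
      subst hs ht
      exact ⟨b, left_mem_segment ℝ b c, by simp [left_mem_segment]⟩
    · refine ⟨b + (t / (s + t)) • (c - b), ?_, ?_⟩
      · rw [segment_eq_image']
        exact ⟨t / (s + t), ⟨by positivity, (div_le_one h).mpr (by linarith)⟩, rfl⟩
      · rw [segment_eq_image']
        refine ⟨s + t, ⟨h.le, hst⟩, ?_⟩
        simp only
        have : b + (t / (s + t)) • (c - b) - a = (b - a) + (t / (s + t)) • (c - b) := by module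
        rw [this, smul_add, smul_smul, mul_div_cancel₀ _ h.ne']
        module

end Grid

end PlanarSkein

/-! ### Triangular halves of cells and their `Δ`-moves -/

namespace PlanarSkein

/-- For a common point `a + s (b - a) = a + t (c - a)` of two sides, eliminating `t` shows that `s`
times the determinant vanishes. The determinants at the other vertices agree with this one up to
sign. -/
theorem nondeg_of_det {a b c : Space}
    (h : (b.1.1 - a.1.1) * (c.1.2 - a.1.2) - (b.1.2 - a.1.2) * (c.1.1 - a.1.1) ≠ 0) :
    Nondeg a b c := by
  have aux : ∀ {a b c : Space},
      (b.1.1 - a.1.1) * (c.1.2 - a.1.2) - (b.1.2 - a.1.2) * (c.1.1 - a.1.1) ≠ 0 →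
      a ≠ b ∧ segment ℝ a b ∩ segment ℝ a c ⊆ {a} := by
    intro a b c h
    refine ⟨by rintro rfl; simp at h, ?_⟩
    rintro x ⟨h1, h2⟩
    rw [segment_eq_image'] at h1 h2
    obtain ⟨s, -, rfl⟩ := h1
    obtain ⟨t, -, e⟩ := h2
    have e := add_left_cancel e
    have e1 := congrArg (fun y : Space => y.1.1) e
    have e2 := congrArg (fun y : Space => y.1.2) e
    simp only [Prod.smul_fst, Prod.smul_snd, Prod.fst_sub, Prod.snd_sub, smul_eq_mul] at e1 e2
    have : s * ((b.1.1 - a.1.1) * (c.1.2 - a.1.2) - (b.1.2 - a.1.2) * (c.1.1 - a.1.1)) = 0 := by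
      linear_combination (c.1.1 - a.1.1) * e2 - (c.1.2 - a.1.2) * e1
    have hs := (mul_eq_zero.mp this).resolve_right h
    simp [hs]
  have h2 : (a.1.1 - b.1.1) * (c.1.2 - b.1.2) - (a.1.2 - b.1.2) * (c.1.1 - b.1.1) ≠ 0 := by
    intro e; apply h; linear_combination -e
  have h3 : (a.1.1 - c.1.1) * (b.1.2 - c.1.2) - (a.1.2 - c.1.2) * (b.1.1 - c.1.1) ≠ 0 := by
    intro e; apply h; linear_combination e
  have h4 : (c.1.1 - b.1.1) * (a.1.2 - b.1.2) - (c.1.2 - b.1.2) * (a.1.1 - b.1.1) ≠ 0 := by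
    intro e; apply h; linear_combination e
  exact ⟨(aux h).1, (aux h4).1, (aux h3).1.symm.symm, (aux h).2, (aux h2).2, (aux h3).2⟩

/-- The constant height `1/2`. -/
noncomputable def flat : ℕ × ℕ → ℝ := fun _ => 1 / 2

section Rep

variable {R : Type*} [CommRing R] {n : ℕ} (r : Rˣ) (G : Grid)

/-- `x` is the class of the link at height `1/2` that consists of the edges in `S`. -/
def Rep (S : ℕ) (x : Skein n r) : Prop :=
  ∃ L : Link n, L.carrier = G.real flat S ∧ L.toSkein r = x

end Rep

namespace Grid

variable {G : Grid} {h : ℕ × ℕ → ℝ}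

theorem flat_segment {a b : Space} (ha : a.2 = 1 / 2) (hb : b.2 = 1 / 2) {x : Space}
    (hx : x ∈ segment ℝ a b) : x.2 = 1 / 2 := by
  rw [segment_eq_image'] at hx
  obtain ⟨t, -, rfl⟩ := hx
  simp [ha, hb]

theorem real_flat {S : ℕ} {x : Space} (hx : x ∈ G.real flat S) : x.2 = 1 / 2 := by
  obtain ⟨k, -, -, hx⟩ := hx
  exact flat_segment (by simp [pt, flat]) (by simp [pt, flat]) hx

theorem isCompact_real (h : ℕ × ℕ → ℝ) (S : ℕ) : IsCompact (G.real h S) := by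
  have : G.real h S = ⋃ k ∈ ((Finset.range 4096).filter fun k => S.testBit k), G.edge h k := by
    ext x; simp [real, and_assoc]
  rw [this]
  exact Finset.isCompact_biUnion _ fun k _ => isCompact_segment _ _

theorem triangle_flat {a b c x : Space} (ha : a.2 = 1 / 2) (hb : b.2 = 1 / 2) (hc : c.2 = 1 / 2)
    (hx : x ∈ triangle a b c) : x.2 = 1 / 2 := by
  obtain ⟨s, t, -, -, -, rfl⟩ := mem_triangle.mp hx
  simp [ha, hb, hc]

/-- The triangle has its right angle at `(cx, cy)`. In the coordinates `s, t` from this corner, with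
`s + t ≤ 1`, the two sides of the cell away from it are reached at `s = 1` or `t = 1` only, that is,
in a vertex. So the legs and the two diagonals remain. -/
theorem edge_inter_half {k i j cx ax cy ay : ℕ} (hX : cx = i ∧ ax = i + 1 ∨ cx = i + 1 ∧ ax = i)
    (hY : cy = j ∧ ay = j + 1 ∨ cy = j + 1 ∧ ay = j) (hk : k < 4096) {x : Space}
    (hx : x ∈ G.edge h k)
    (hT : x ∈ triangle (G.pt h (cx, cy)) (G.pt h (ax, cy)) (G.pt h (cx, ay))) :
    (∃ v, x = G.pt h v ∧ (v = src k ∨ v = tgt k) ∧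
      (v = (cx, cy) ∨ v = (ax, cy) ∨ v = (cx, ay))) ∨
      k = code 0 i cy ∨ k = code 1 cx j ∨ k = code 2 i j ∨ k = code 3 i j := by
  have dx : G.gx ax - G.gx cx ≠ 0 := sub_ne_zero.mpr fun e => by
    have := G.hx.injective e; omega
  have dy : G.gy ay - G.gy cy ≠ 0 := sub_ne_zero.mpr fun e => by
    have := G.hy.injective e; omega
  have hc : x.1 ∈ G.cell i j := by
    refine triangle_subset_cell ?_ ?_ ?_ hT <;> refine ⟨?_, ?_⟩ <;> simp only <;> omega
  obtain ⟨s, t, s0, t0, hst, e⟩ := mem_triangle.mp hT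
  have e1 : x.1.1 = G.gx cx + s * (G.gx ax - G.gx cx) := by rw [e]; simp [pt]
  have e2 : x.1.2 = G.gy cy + t * (G.gy ay - G.gy cy) := by rw [e]; simp [pt]
  have far_y : x.1.2 = G.gy ay → x.1.1 = G.gx cx := fun h => by
    have : (t - 1) * (G.gy ay - G.gy cy) = 0 := by linear_combination h - e2
    have ht := (mul_eq_zero.mp this).resolve_right dy
    rw [e1, show s = 0 by linarith]; ring
  have far_x : x.1.1 = G.gx ax → x.1.2 = G.gy cy := fun h => by
    have : (s - 1) * (G.gx ax - G.gx cx) = 0 := by linear_combination h - e1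
    have ht := (mul_eq_zero.mp this).resolve_right dx
    rw [e2, show t = 0 by linarith]; ring
  rcases edge_inter_cell hk hx hc with ⟨v, rfl, hv, hv'⟩ | ⟨rfl, h1⟩ | ⟨rfl, h1⟩ | ⟨rfl, h1⟩ |
    ⟨rfl, h1⟩ | rfl | rfl
  · refine Or.inl ⟨v, rfl, hv, ?_⟩
    obtain ⟨v1, v2⟩ := v
    obtain ⟨h1, h2⟩ := hv'
    simp only [pt] at far_x far_y h1 h2
    simp only [Prod.mk.injEq]
    by_cases h3 : v2 = ay
    · have := G.hx.injective (far_y (by rw [h3]))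
      omega
    · omega
  all_goals right
  · by_cases h3 : cy = j
    · left; rw [h3]
    · exfalso
      simp only [Inner, OfNat.zero_ne_ofNat, zero_ne_one, false_and, or_false, true_and] at h1
      exact h1.1.ne G.hx _ (far_y (by rw [h1.2]; congr 1; omega))
  · by_cases h3 : cy = j
    · exfalso
      simp only [Inner, OfNat.zero_ne_ofNat, zero_ne_one, false_and, or_false, true_and] at h1
      exact h1.1.ne G.hx _ (far_y (by rw [h1.2]; congr 1; omega))
    · left; congr 1; omega
  · by_cases h3 : cx = i
    · right; left; rw [h3]
    · exfalso
      simp only [Inner, OfNat.one_ne_ofNat, one_ne_zero, false_and, or_false, true_and,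
        false_or] at h1
      exact h1.2.ne G.hy _ (far_x (by rw [h1.1]; congr 1; omega))
  · by_cases h3 : cx = i
    · exfalso
      simp only [Inner, OfNat.one_ne_ofNat, one_ne_zero, false_and, or_false, true_and,
        false_or] at h1
      exact h1.2.ne G.hy _ (far_x (by rw [h1.1]; congr 1; omega))
    · right; left; congr 1; omega
  · right; right; left; rfl
  · right; right; right; rfl

end Grid

/-- The triangle `uvw` is half of a cell without punctures; `kuv`, `kuw`, `kwv` are the codes of
its sides and `ko` is the code of the other diagonal of the cell. -/
structure Half (n : ℕ) (G : Grid) (u v w : ℕ × ℕ) (kuv kuw kwv ko : ℕ) : Prop where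
  nondeg : Nondeg (G.pt flat u) (G.pt flat v) (G.pt flat w)
  sub : triangle (G.pt flat u) (G.pt flat v) (G.pt flat w) ⊆ thickened n
  uv : G.edge flat kuv = segment ℝ (G.pt flat u) (G.pt flat v)
  uw : G.edge flat kuw = segment ℝ (G.pt flat u) (G.pt flat w)
  wv : G.edge flat kwv = segment ℝ (G.pt flat w) (G.pt flat v)
  lt : kuv < 4096 ∧ kuw < 4096 ∧ kwv < 4096
  ne : kuv ≠ kuw ∧ kuv ≠ kwv ∧ kuw ≠ kwv
  inter : ∀ k < 4096, ∀ x ∈ G.edge flat k,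
    x ∈ triangle (G.pt flat u) (G.pt flat v) (G.pt flat w) →
    (∃ y, x = G.pt flat y ∧ (y = src k ∨ y = tgt k) ∧ (y = u ∨ y = v ∨ y = w)) ∨
      k = kuv ∨ k = kuw ∨ k = kwv ∨ k = ko

namespace Half

variable {n : ℕ} {G : Grid} {u v w : ℕ × ℕ} {kuv kuw kwv ko : ℕ}

theorem rotate (H : Half n G u v w kuv kuw kwv ko) : Half n G v w u kwv kuv kuw ko where
  nondeg := H.nondeg.rotate
  sub := by rw [← triangle_rotate]; exact H.sub
  uv := by rw [H.wv, segment_symm]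
  uw := by rw [H.uv, segment_symm]
  wv := H.uw
  lt := ⟨H.lt.2.2, H.lt.1, H.lt.2.1⟩
  ne := ⟨H.ne.2.1.symm, H.ne.2.2.symm, H.ne.1⟩
  inter := by
    intro k hk x hx hT
    rw [← triangle_rotate] at hT
    rcases H.inter k hk x hx hT with ⟨y, h1, h2, h3⟩ | h
    · exact Or.inl ⟨y, h1, h2, by tauto⟩
    · right; tauto

variable {R : Type*} [CommRing R] {r : Rˣ} {S S' : ℕ} {x : Skein n r}

/-- The hypothesis `hw` says that no edge of `S` ends at `w`. Together with the absence of the other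
diagonal this forces `S` to meet the triangle in `uv` alone, as a `Δ`-move requires. -/
theorem isotopic_down (H : Half n G u v w kuv kuw kwv ko) (h1 : S.testBit kuv = true)
    (h2 : S.testBit kuw = false) (h3 : S.testBit kwv = false) (h4 : S.testBit ko = false)
    (hw : ∀ k < 4096, S.testBit k = true → ¬ (w = src k ∨ w = tgt k))
    (hS : ∀ k, S'.testBit k = (S.testBit k ^^ decide (k = kuv ∨ k = kuw ∨ k = kwv)))
    (hR : Rep r G S x) : Rep r G S' x := by
  obtain ⟨L, hL, rfl⟩ := hR
  have f : ∀ y, (G.pt flat y).2 = 1 / 2 := fun _ => rfl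
  obtain ⟨n1, n2, n3⟩ := H.ne
  have key : ∀ k < 4096, S.testBit k = true → ∀ y ∈ G.edge flat k,
      y ∈ triangle (G.pt flat u) (G.pt flat v) (G.pt flat w) →
      k = kuv ∨ y = G.pt flat u ∨ y = G.pt flat v := by
    intro k hk hkS y hy hT
    rcases H.inter k hk y hy hT with ⟨z, rfl, hz, hz'⟩ | rfl | rfl | rfl | rfl
    · rcases hz' with rfl | rfl | rfl
      · exact Or.inr (Or.inl rfl)
      · exact Or.inr (Or.inr rfl)
      · exact absurd hz (hw k hk hkS)
    · exact Or.inl rfl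
    all_goals simp_all
  refine (exists_delta L (Y := G.real flat S') H.nondeg H.sub ?_
    (fun y hy => Grid.real_flat (hL ▸ hy)) (fun y hy => Grid.triangle_flat (f _) (f _) (f _) hy) ?_
    (Grid.isCompact_real _ _)).imp fun L' e => ⟨e.1, (toSkein_eq r e.2).symm⟩
  · refine Subset.antisymm ?_ fun y hy => ⟨?_, (sides_subset_triangle _ _ _).1 hy⟩
    · rintro y ⟨hy, hT⟩
      rw [hL] at hy
      obtain ⟨k, hk, hkS, hy⟩ := hy
      rcases key k hk hkS y hy hT with rfl | rfl | rfl
      · rwa [← H.uv]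
      · exact left_mem_segment ℝ _ _
      · exact right_mem_segment ℝ _ _
    · rw [hL]; exact ⟨kuv, H.lt.1, h1, by rwa [H.uv]⟩
  · ext y
    rw [hL]
    constructor
    · rintro ⟨k, hk, hkS, hy⟩
      rw [hS] at hkS
      by_cases e1 : k = kuw
      · right; left; rw [← H.uw, ← e1]; exact hy
      by_cases e2 : k = kwv
      · right; right; rw [← H.wv, ← e2]; exact hy
      by_cases e3 : k = kuv
      · subst e3; simp [h1] at hkS
      simp only [e1, e2, e3, or_false, decide_false, Bool.xor_false] at hkS
      -- Removing the closed segment also removes its endpoints, which the two new sides restore.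
      by_cases hyT : y ∈ segment ℝ (G.pt flat u) (G.pt flat v)
      · right
        rcases key k hk hkS y hy ((sides_subset_triangle _ _ _).1 hyT) with h | rfl | rfl
        · exact absurd h e3
        · exact Or.inl (left_mem_segment ℝ _ _)
        · exact Or.inr (right_mem_segment ℝ _ _)
      · exact Or.inl ⟨⟨k, hk, hkS, hy⟩, hyT⟩
    · rintro (⟨⟨k, hk, hkS, hy⟩, hyT⟩ | hy | hy)
      · refine ⟨k, hk, ?_, hy⟩
        have e3 : k ≠ kuv := by rintro rfl; exact hyT (by rwa [← H.uv])
        have e1 : k ≠ kuw := by rintro rfl; simp_all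
        have e2 : k ≠ kwv := by rintro rfl; simp_all
        rw [hS]; simp [e1, e2, e3, hkS]
      · exact ⟨kuw, H.lt.2.1, by rw [hS, h2]; simp, by rwa [H.uw]⟩
      · exact ⟨kwv, H.lt.2.2, by rw [hS, h3]; simp, by rwa [H.wv]⟩

/-- The inverse move: the edges of `S` at `w` can only be the two sides that are removed, so `w`
disappears from the curve. -/
theorem isotopic_up (H : Half n G u v w kuv kuw kwv ko) (h1 : S.testBit kuv = false)
    (h2 : S.testBit kuw = true) (h3 : S.testBit kwv = true) (h4 : S.testBit ko = false)
    (hw : ∀ k < 4096, S.testBit k = true → w = src k ∨ w = tgt k → k = kuw ∨ k = kwv)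
    (hS : ∀ k, S'.testBit k = (S.testBit k ^^ decide (k = kuv ∨ k = kuw ∨ k = kwv)))
    (hR : Rep r G S x) : Rep r G S' x := by
  obtain ⟨L, hL, rfl⟩ := hR
  have f : ∀ y, (G.pt flat y).2 = 1 / 2 := fun _ => rfl
  obtain ⟨n1, n2, n3⟩ := H.ne
  have key : ∀ k < 4096, S.testBit k = true → ∀ y ∈ G.edge flat k,
      y ∈ triangle (G.pt flat u) (G.pt flat v) (G.pt flat w) →
      k = kuw ∨ k = kwv ∨ y = G.pt flat u ∨ y = G.pt flat v := by
    intro k hk hkS y hy hT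
    rcases H.inter k hk y hy hT with ⟨z, rfl, hz, hz'⟩ | rfl | rfl | rfl | rfl
    · rcases hz' with rfl | rfl | rfl
      · simp
      · simp
      · rcases hw k hk hkS hz with h | h <;> simp [h]
    all_goals simp_all
  obtain ⟨-, Tuw, Twv⟩ := sides_subset_triangle (G.pt flat u) (G.pt flat v) (G.pt flat w)
  refine (exists_delta_symm L (Y := G.real flat S') H.nondeg H.sub ?_
    (fun y hy => Grid.real_flat (hL ▸ hy)) (fun y hy => Grid.triangle_flat (f _) (f _) (f _) hy) ?_
    (Grid.isCompact_real _ _)).imp fun L' e => ⟨e.1, (toSkein_eq r e.2).symm⟩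
  · refine Subset.antisymm ?_ ?_
    · rintro y ⟨hy, hT⟩
      rw [hL] at hy
      obtain ⟨k, hk, hkS, hy⟩ := hy
      rcases key k hk hkS y hy hT with rfl | rfl | rfl | rfl
      · left; rwa [← H.uw]
      · right; rwa [← H.wv]
      · exact Or.inl (left_mem_segment ℝ _ _)
      · exact Or.inr (right_mem_segment ℝ _ _)
    · rintro y (hy | hy)
      · exact ⟨by rw [hL]; exact ⟨kuw, H.lt.2.1, h2, by rwa [H.uw]⟩, Tuw hy⟩
      · exact ⟨by rw [hL]; exact ⟨kwv, H.lt.2.2, h3, by rwa [H.wv]⟩, Twv hy⟩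
  · ext y
    rw [hL]
    constructor
    · rintro ⟨k, hk, hkS, hy⟩
      rw [hS] at hkS
      by_cases e3 : k = kuv
      · right; rw [← H.uv, ← e3]; exact hy
      by_cases e1 : k = kuw
      · subst e1; simp [h2] at hkS
      by_cases e2 : k = kwv
      · subst e2; simp [h3] at hkS
      simp only [e1, e2, e3, or_false, decide_false, Bool.xor_false] at hkS
      by_cases hyT : y ∈ triangle (G.pt flat u) (G.pt flat v) (G.pt flat w)
      · right
        rcases key k hk hkS y hy hyT with h | h | rfl | rfl
        · exact absurd h e1
        · exact absurd h e2
        · exact left_mem_segment ℝ _ _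
        · exact right_mem_segment ℝ _ _
      · exact Or.inl ⟨⟨k, hk, hkS, hy⟩, fun h => hyT (h.elim (fun h => Tuw h) fun h => Twv h)⟩
    · rintro (⟨⟨k, hk, hkS, hy⟩, hyT⟩ | hy)
      · refine ⟨k, hk, ?_, hy⟩
        have e1 : k ≠ kuw := by rintro rfl; exact hyT (Or.inl (by rwa [← H.uw]))
        have e2 : k ≠ kwv := by rintro rfl; exact hyT (Or.inr (by rwa [← H.wv]))
        have e3 : k ≠ kuv := by rintro rfl; simp_all
        rw [hS]; simp [e1, e2, e3, hkS]
      · exact ⟨kuv, H.lt.1, by rw [hS, h1]; simp, by rwa [H.uv]⟩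

end Half

/-- The four cases of `hc` are the four corners at which the right angle can lie. The hypotenuse
`ky` joins the two neighbouring corners, and `ko` is the diagonal through the right angle. -/
theorem half_base {n : ℕ} {G : Grid} {i j cx ax cy ay ky ko : ℕ} (hi : i < 62) (hj : j < 14)
    (hs : G.cell i j ⊆ surface n)
    (hc : (cx = i ∧ ax = i + 1 ∧ cy = j ∧ ay = j + 1 ∧ ky = code 3 i j ∧ ko = code 2 i j) ∨
      (cx = i + 1 ∧ ax = i ∧ cy = j + 1 ∧ ay = j ∧ ky = code 3 i j ∧ ko = code 2 i j) ∨
      (cx = i ∧ ax = i + 1 ∧ cy = j + 1 ∧ ay = j ∧ ky = code 2 i j ∧ ko = code 3 i j) ∨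
      (cx = i + 1 ∧ ax = i ∧ cy = j ∧ ay = j + 1 ∧ ky = code 2 i j ∧ ko = code 3 i j)) :
    Half n G (cx, cy) (ax, cy) (cx, ay) (code 0 i cy) (code 1 cx j) ky ko := by
  have hX : cx = i ∧ ax = i + 1 ∨ cx = i + 1 ∧ ax = i := by omega
  have hY : cy = j ∧ ay = j + 1 ∨ cy = j + 1 ∧ ay = j := by omega
  refine ⟨nondeg_of_det ?_, ?_, ?_, ?_, ?_, ?_, ?_, ?_⟩
  · have dx : G.gx ax - G.gx cx ≠ 0 := sub_ne_zero.mpr fun e => by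
      have := G.hx.injective e; omega
    have dy : G.gy ay - G.gy cy ≠ 0 := sub_ne_zero.mpr fun e => by
      have := G.hy.injective e; omega
    simp only [Grid.pt, sub_self, mul_zero, zero_mul, sub_zero]
    exact mul_ne_zero dx dy
  · intro x hx
    refine ⟨hs (Grid.triangle_subset_cell ?_ ?_ ?_ hx), ?_⟩
    · exact ⟨by simp only; omega, by simp only; omega⟩
    · exact ⟨by simp only; omega, by simp only; omega⟩
    · exact ⟨by simp only; omega, by simp only; omega⟩
    · rw [Grid.triangle_flat rfl rfl rfl hx]; norm_num
  · rw [Grid.edge, src_code (by omega) (by omega) (by omega), tgt_code (by omega) (by omega) (by omega)]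
    rcases hX with ⟨rfl, rfl⟩ | ⟨rfl, rfl⟩ <;> simp
    rw [segment_symm]
  · rw [Grid.edge, src_code (by omega) (by omega) (by omega), tgt_code (by omega) (by omega) (by omega)]
    rcases hY with ⟨rfl, rfl⟩ | ⟨rfl, rfl⟩ <;> simp
    rw [segment_symm]
  · rcases hc with ⟨rfl, rfl, rfl, rfl, rfl, rfl⟩ | ⟨rfl, rfl, rfl, rfl, rfl, rfl⟩ |
      ⟨rfl, rfl, rfl, rfl, rfl, rfl⟩ | ⟨rfl, rfl, rfl, rfl, rfl, rfl⟩ <;>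
    rw [Grid.edge, src_code (by omega) (by omega) (by omega),
      tgt_code (by omega) (by omega) (by omega)] <;> simp
    · rw [segment_symm]
    · rw [segment_symm]
  · rcases hc with h | h | h | h <;> simp only [h, code] <;> omega
  · rcases hc with h | h | h | h <;> simp only [h, code] <;> omega
  · intro k hk x hx hT
    rcases Grid.edge_inter_half hX hY hk hx hT with h | h | h | h | h
    · exact Or.inl h
    all_goals right
    · exact Or.inl h
    · exact Or.inr (Or.inl h)
    · rcases hc with h' | h' | h' | h' <;> simp [h, h']
    · rcases hc with h' | h' | h' | h' <;> simp [h, h']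

end PlanarSkein

namespace PlanarSkein

/-! ### Moving curves on the grid by computation -/

namespace Engine

/-- The set that consists of the edge with code `c`. -/
def bit (c : ℕ) : ℕ := Nat.shiftLeft 1 c

/-- The edges at the vertex `(a, b)`. -/
def around (a b : ℕ) : ℕ :=
  Nat.lor (bit (code 0 a b)) <| Nat.lor (bit (code 1 a b)) <| Nat.lor (bit (code 2 a b)) <|
  Nat.lor (bit (code 0 (a - 1) b)) <| Nat.lor (bit (code 1 a (b - 1))) <|
  Nat.lor (bit (code 2 (a - 1) (b - 1))) <| Nat.lor (bit (code 3 (a - 1) b))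
    (bit (code 3 a (b - 1)))

/-- In `W`, the side `e` of a triangle may be exchanged with the sides `f`, `g`, which meet in the
vertex `(a, b)`; the other diagonal `o` is not in `W`. -/
def ok (W a b e f g o : ℕ) : Bool :=
  let A := Nat.land W (Nat.lor (around a b) (Nat.lor (bit e) (Nat.lor (Nat.lor (bit f) (bit g))
    (bit o))))
  Nat.beq A (bit e) || Nat.beq A (Nat.lor (bit f) (bit g))

/-- The sides of the triangle that is the cell `(1, 1)` without the corner number `c`. -/
def mask : ℕ → ℕ
  | 0 => Nat.lor (bit (code 0 1 2)) (Nat.lor (bit (code 1 2 1)) (bit (code 3 1 1)))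
  | 1 => Nat.lor (bit (code 0 1 2)) (Nat.lor (bit (code 1 1 1)) (bit (code 2 1 1)))
  | 2 => Nat.lor (bit (code 0 1 1)) (Nat.lor (bit (code 1 2 1)) (bit (code 2 1 1)))
  | _ => Nat.lor (bit (code 0 1 1)) (Nat.lor (bit (code 1 1 1)) (bit (code 3 1 1)))

/-- The sides of a triangle `ABC` with right angle at `C` may be exchanged in `W`. -/
def legalAt (W cx ax cy ay p s y o : ℕ) : Bool :=
  ok W cx ay p s y o || ok W cx cy y p s o || ok W ax cy s y p o

/-- The sides of the triangle that is the cell `(1, 1)` without the corner number `c` may be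
exchanged in `W`. -/
def legal (W : ℕ) : ℕ → Bool
  | 0 => legalAt W 2 1 2 1 (code 0 1 2) (code 1 2 1) (code 3 1 1) (code 2 1 1)
  | 1 => legalAt W 1 2 2 1 (code 0 1 2) (code 1 1 1) (code 2 1 1) (code 3 1 1)
  | 2 => legalAt W 2 1 1 2 (code 0 1 1) (code 1 2 1) (code 2 1 1) (code 3 1 1)
  | _ => legalAt W 1 2 1 2 (code 0 1 1) (code 1 1 1) (code 3 1 1) (code 2 1 1)

/-- The boundary of the cell `(1, 1)` may be exchanged in `W`. -/
def flippable (W : ℕ) : Bool :=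
  (legal W 2 && legal (Nat.xor W (mask 2)) 1) || (legal W 1 && legal (Nat.xor W (mask 1)) 2) ||
  (legal W 3 && legal (Nat.xor W (mask 3)) 0) || (legal W 0 && legal (Nat.xor W (mask 0)) 3)

/-- The boundary of the cell `(1, 1)`. -/
def square : ℕ := Nat.xor (mask 1) (mask 2)

/-- The cell with number `64 * j + i` contains no puncture. -/
def free (k : ℕ) : Bool :=
  Nat.ble 1 (k % 64) && (Nat.ble (k % 64) 61 && (Nat.ble 1 (k / 64) && (Nat.ble (k / 64) 13 &&
    -- In row `6` the columns `2` modulo `6` hold the punctures of the slots. The columns `5` modulo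
    -- `6` are the gaps between consecutive slots, which may contain further punctures.
    (!Nat.beq (k / 64) 6 || !Nat.beq (k % 64 % 3) 2))))

/-- Exchange the boundaries of the cells in a list, where this is possible and `p` holds for the
neighbourhood of the cell. The result contains the list of the remaining cells. -/
def pass (p : ℕ → Bool) (S : ℕ) : List ℕ → List ℕ → ℕ × List ℕ
  | [], rest => (S, rest)
  | k :: ks, rest =>
    bif p (Nat.shiftRight S (k - 65)) && (free k && flippable (Nat.shiftRight S (k - 65))) then
      pass p (Nat.xor S (Nat.shiftLeft square (k - 65))) ks rest
    else pass p S ks (k :: rest)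

/-- Repeat `pass` until no cell remains. -/
def loop (p : ℕ → Bool) : ℕ → ℕ → List ℕ → ℕ
  | 0, S, _ => S
  | m + 1, S, l =>
    match pass p S l [] with
    | (S', []) => S'
    | (S', k :: ks) => loop p m S' (k :: ks)

/-- The cells inside a curve without diagonal edges. -/
def inside (E : ℕ) : ℕ :=
  -- A cell is inside if the number of horizontal edges below it in its column is odd. The parities
  -- are prefix sums over the `16` rows, computed by doubling the shift.
  let h0 := Nat.mod E (2 ^ 1024)
  let h1 := Nat.xor h0 (Nat.shiftLeft h0 64)
  let h2 := Nat.xor h1 (Nat.shiftLeft h1 128)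
  let h3 := Nat.xor h2 (Nat.shiftLeft h2 256)
  Nat.mod (Nat.xor h3 (Nat.shiftLeft h3 512)) (2 ^ 1024)

/-- The list of binary digits of `m`. -/
def digits : ℕ → ℕ → List ℕ → List ℕ
  | 0, _, acc => acc
  | t + 1, m, acc => bif Nat.beq m 0 then acc else
    let k := Nat.log2 m
    digits t (Nat.xor m (Nat.shiftLeft 1 k)) (k :: acc)

/-- The curves `S` and `T` are isotopic, by moves inside `S + T`. -/
def chase (S T : ℕ) : Bool :=
  Nat.beq (loop (fun _ => true) 60 S (digits 1024 (inside (Nat.xor S T)) [])) T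

/-- Exactly three sides of the cell `(1, 1)` are in `W`. -/
def three (W : ℕ) : Bool :=
  let B := Nat.land W (Nat.lor (Nat.lor (bit (code 0 1 1)) (bit (code 1 1 1)))
    (Nat.lor (bit (code 0 1 2)) (bit (code 1 2 1))))
  Nat.beq (Nat.xor B (bit (code 0 1 1))) square || (Nat.beq (Nat.xor B (bit (code 1 1 1))) square ||
    (Nat.beq (Nat.xor B (bit (code 0 1 2))) square || Nat.beq (Nat.xor B (bit (code 1 2 1))) square))

/-- Shorten a curve. -/
def relax (m S : ℕ) : ℕ := loop three m S (digits 1024 (2 ^ 640 - 2 ^ 64) [])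

end Engine

open Engine

/-- The tests are written with the primitive operations on `Nat`, which evaluate by binary
arithmetic; their proofs use the notation. -/
theorem nat_land (x y : ℕ) : Nat.land x y = x &&& y := rfl
theorem nat_lor (x y : ℕ) : Nat.lor x y = x ||| y := rfl
theorem nat_xor (x y : ℕ) : Nat.xor x y = x ^^^ y := rfl
theorem nat_shiftRight (x y : ℕ) : Nat.shiftRight x y = x >>> y := rfl
theorem nat_shiftLeft (x y : ℕ) : Nat.shiftLeft x y = x <<< y := rfl

theorem testBit_bit (c k : ℕ) : (bit c).testBit k = decide (k = c) := by
  rw [bit, nat_shiftLeft, Nat.one_shiftLeft, Nat.testBit_two_pow]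
  exact decide_eq_decide.mpr eq_comm

theorem testBit_around (a b c : ℕ) : (around a b).testBit c = true ↔
    c = code 0 a b ∨ c = code 1 a b ∨ c = code 2 a b ∨ c = code 0 (a - 1) b ∨
    c = code 1 a (b - 1) ∨ c = code 2 (a - 1) (b - 1) ∨ c = code 3 (a - 1) b ∨
    c = code 3 a (b - 1) := by
  simp only [around, nat_lor, Nat.testBit_or, testBit_bit, Bool.or_eq_true, decide_eq_true_eq]

theorem testBit_shiftLeft_add (m off k : ℕ) :
    (m <<< off).testBit k = true ↔ ∃ c, k = off + c ∧ m.testBit c = true := by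
  rw [Nat.testBit_shiftLeft]
  simp only [ge_iff_le, Bool.and_eq_true, decide_eq_true_eq]
  constructor
  · rintro ⟨h1, h2⟩; exact ⟨k - off, by omega, h2⟩
  · rintro ⟨c, rfl, h⟩; exact ⟨by omega, by simpa using h⟩

/-- Codes are additive in the position of the cell. Shifting the number by `64 (j - 1) + (i - 1)`
thus carries the cell `(i, j)` to the cell `(1, 1)`, and all edges at its corners still have
nonnegative codes there. -/
theorem exists_around {i j a b k : ℕ} (hi : 1 ≤ i ∧ i ≤ 61) (hj : 1 ≤ j ∧ j ≤ 13)
    (ha : 1 ≤ a ∧ a ≤ 2) (hb : 1 ≤ b ∧ b ≤ 2) (hk : k < 4096)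
    (h : (i - 1 + a, j - 1 + b) = src k ∨ (i - 1 + a, j - 1 + b) = tgt k) :
    ∃ c, k = 64 * (j - 1) + (i - 1) + c ∧ (around a b).testBit c = true := by
  obtain ⟨d, i', j', hd, hi', hj', rfl⟩ := exists_code hk
  rw [src_code hd hi' hj', tgt_code hd hi' hj'] at h
  refine ⟨code d (i' + 1 - i) (j' + 1 - j), ?_, (testBit_around _ _ _).mpr ?_⟩
  · interval_cases d <;> simp at h <;> unfold code <;> omega
  · interval_cases d <;> simp at h <;> simp only [code] <;> omega

/-- The grid avoids the punctures in the cells that the engine uses. -/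
def FreeGrid (n : ℕ) (G : Grid) : Prop :=
  ∀ i j, (j ≠ 6 ∨ i % 3 ≠ 2) → G.cell i j ⊆ surface n

section Soundness

variable {R : Type*} [CommRing R] {n : ℕ} (r : Rˣ) (G : Grid)

/-- `S` and `T` are curves that represent the same class. -/
def Iso (S T : ℕ) : Prop := ∀ x : Skein n r, Rep r G S x ↔ Rep r G T x

variable {r G}

/-- Adding the three sides interchanges the two patterns that the test accepts, `e` alone and `f, g`
alone. So a legal move can be reversed by a legal move. -/
theorem ok_symm {W a b e f g o m : ℕ} (hd : [e, f, g, o].Nodup)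
    (hm : ∀ c, m.testBit c = decide (c = e ∨ c = f ∨ c = g)) (h : ok W a b e f g o = true) :
    ok (W ^^^ m) a b e f g o = true := by
  simp only [List.nodup_cons, List.mem_cons, not_or, List.not_mem_nil, not_false_eq_true,
    and_true, List.nodup_nil] at hd
  obtain ⟨⟨d1, d2, d3⟩, ⟨d4, d5⟩, d6⟩ := hd
  simp only [ok, nat_land, nat_lor, Nat.beq_eq_true_eq, Bool.or_eq_true, Nat.beq_eq] at h ⊢
  rcases h with h | h
  · right
    refine Nat.eq_of_testBit_eq fun c => ?_
    have := congrArg (fun x => Nat.testBit x c) h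
    simp only [Nat.testBit_and, Nat.testBit_or, Nat.testBit_xor, testBit_bit, hm] at this ⊢
    by_cases c1 : c = e <;> by_cases c2 : c = f <;> by_cases c3 : c = g <;> simp_all
  · left
    refine Nat.eq_of_testBit_eq fun c => ?_
    have := congrArg (fun x => Nat.testBit x c) h
    simp only [Nat.testBit_and, Nat.testBit_or, Nat.testBit_xor, testBit_bit, hm] at this ⊢
    by_cases c1 : c = e <;> by_cases c2 : c = f <;> by_cases c3 : c = g <;> simp_all

/-- The test compares the window with one of the two patterns on all edges at the apex, the three
sides and the other diagonal. Reading off single bits gives the hypotheses of `isotopic_down` or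
`isotopic_up`. By `he` the side `e` does not end at the apex, so in the first pattern the apex is
free. -/
theorem ok_sound {u v w : ℕ × ℕ} {off a b e f g o m S : ℕ}
    (H : Half n G u v w (off + e) (off + f) (off + g) (off + o))
    (hw : ∀ k < 4096, w = src k ∨ w = tgt k → ∃ c, k = off + c ∧ (around a b).testBit c = true)
    (he : (around a b).testBit e = false) (hd : [e, f, g, o].Nodup)
    (hm : ∀ c, m.testBit c = decide (c = e ∨ c = f ∨ c = g)) (h : ok (S >>> off) a b e f g o = true)
    {x : Skein n r} (hx : Rep r G S x) : Rep r G (S ^^^ (m <<< off)) x := by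
  simp only [List.nodup_cons, List.mem_cons, not_or, List.not_mem_nil, not_false_eq_true,
    and_true, List.nodup_nil] at hd
  obtain ⟨⟨d1, d2, d3⟩, ⟨d4, d5⟩, d6⟩ := hd
  have hS : ∀ k, (S ^^^ (m <<< off)).testBit k =
      (S.testBit k ^^ decide (k = off + e ∨ k = off + f ∨ k = off + g)) := by
    intro k
    rw [Nat.testBit_xor]
    congr 1
    rw [Bool.eq_iff_iff, testBit_shiftLeft_add]
    simp only [hm, decide_eq_true_eq]
    constructor
    · rintro ⟨c, rfl, rfl | rfl | rfl⟩ <;> simp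
    · rintro (rfl | rfl | rfl)
      exacts [⟨e, rfl, by simp⟩, ⟨f, rfl, by simp⟩, ⟨g, rfl, by simp⟩]
  simp only [ok, nat_land, nat_lor, Bool.or_eq_true, Nat.beq_eq] at h
  rcases h with h | h
  · have h : ∀ c, _ := fun c => congrArg (fun x => Nat.testBit x c) h
    simp only [Nat.testBit_and, Nat.testBit_or, testBit_bit, Nat.testBit_shiftRight] at h
    refine H.isotopic_down ?_ ?_ ?_ ?_ ?_ hS hx
    · simpa using h e
    · have := h f; simp_all [Ne.symm d1]
    · have := h g; simp_all [Ne.symm d2]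
    · have := h o; simp_all [Ne.symm d3]
    · intro k hk hkS hkw
      obtain ⟨c, rfl, hc⟩ := hw k hk hkw
      have := h c
      simp only [hkS, hc, Bool.true_or, Bool.and_true] at this
      rw [eq_comm, decide_eq_true_eq] at this
      rw [this, he] at hc
      cases hc
  · have h : ∀ c, _ := fun c => congrArg (fun x => Nat.testBit x c) h
    simp only [Nat.testBit_and, Nat.testBit_or, testBit_bit, Nat.testBit_shiftRight] at h
    refine H.isotopic_up ?_ ?_ ?_ ?_ ?_ hS hx
    · have := h e; simp_all
    · have := h f; simp_all
    · have := h g; simp_all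
    · have := h o; simp_all [Ne.symm d5, Ne.symm d6]
    · intro k hk hkS hkw
      obtain ⟨c, rfl, hc⟩ := hw k hk hkw
      have := h c
      simp only [hkS, hc, Bool.true_or, Bool.and_true] at this
      rw [eq_comm, Bool.or_eq_true, decide_eq_true_eq, decide_eq_true_eq] at this
      rcases this with rfl | rfl <;> simp

/-- Each corner of the triangle may play the role of the apex, whence the rotations. The symmetry of
the test yields both directions of the equivalence. -/
theorem legalAt_sound {i j cx ax cy ay p s y o m S : ℕ} (hi : 1 ≤ i ∧ i ≤ 61) (hj : 1 ≤ j ∧ j ≤ 13)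
    (H : Half n G (i - 1 + cx, j - 1 + cy) (i - 1 + ax, j - 1 + cy) (i - 1 + cx, j - 1 + ay)
      (64 * (j - 1) + (i - 1) + p) (64 * (j - 1) + (i - 1) + s) (64 * (j - 1) + (i - 1) + y)
      (64 * (j - 1) + (i - 1) + o))
    (hc : 1 ≤ cx ∧ cx ≤ 2) (ha : 1 ≤ ax ∧ ax ≤ 2) (hc' : 1 ≤ cy ∧ cy ≤ 2) (ha' : 1 ≤ ay ∧ ay ≤ 2)
    (h1 : (around cx ay).testBit p = false) (h2 : (around cx cy).testBit y = false)
    (h3 : (around ax cy).testBit s = false) (hd : [p, s, y, o].Nodup)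
    (hm : ∀ c, m.testBit c = decide (c = p ∨ c = s ∨ c = y))
    (h : legalAt (S >>> (64 * (j - 1) + (i - 1))) cx ax cy ay p s y o = true) :
    Iso (n := n) r G S (S ^^^ (m <<< (64 * (j - 1) + (i - 1)))) := by
  have aux : ∀ {T : ℕ}, legalAt (T >>> (64 * (j - 1) + (i - 1))) cx ax cy ay p s y o = true →
      (∀ x : Skein n r, Rep r G T x → Rep r G (T ^^^ (m <<< (64 * (j - 1) + (i - 1)))) x) ∧
      legalAt ((T ^^^ (m <<< (64 * (j - 1) + (i - 1)))) >>> (64 * (j - 1) + (i - 1)))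
        cx ax cy ay p s y o = true := by
    intro T hT
    have hd2 : [y, p, s, o].Nodup := by
      simp only [List.nodup_cons, List.mem_cons, List.not_mem_nil] at hd ⊢; tauto
    have hd3 : [s, y, p, o].Nodup := by
      simp only [List.nodup_cons, List.mem_cons, List.not_mem_nil] at hd ⊢; tauto
    have hm2 : ∀ c, m.testBit c = decide (c = y ∨ c = p ∨ c = s) := fun c => by
      rw [hm]; exact decide_eq_decide.mpr (by tauto)
    have hm3 : ∀ c, m.testBit c = decide (c = s ∨ c = y ∨ c = p) := fun c => by
      rw [hm]; exact decide_eq_decide.mpr (by tauto)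
    have e : (T ^^^ (m <<< (64 * (j - 1) + (i - 1)))) >>> (64 * (j - 1) + (i - 1)) =
        T >>> (64 * (j - 1) + (i - 1)) ^^^ m := by
      rw [Nat.shiftRight_xor_distrib, Nat.shiftLeft_shiftRight]
    rw [e]
    simp only [legalAt, Bool.or_eq_true] at hT ⊢
    rcases hT with (hT | hT) | hT
    · exact ⟨fun x => ok_sound H (fun k hk hw => exists_around hi hj hc ha' hk hw) h1 hd hm hT,
        Or.inl (Or.inl (ok_symm hd hm hT))⟩
    · exact ⟨fun x => ok_sound H.rotate (fun k hk hw => exists_around hi hj hc hc' hk hw) h2 hd2 hm2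
        hT, Or.inl (Or.inr (ok_symm hd2 hm2 hT))⟩
    · exact ⟨fun x => ok_sound H.rotate.rotate (fun k hk hw => exists_around hi hj ha hc' hk hw) h3
        hd3 hm3 hT, Or.inr (ok_symm hd3 hm3 hT)⟩
  intro x
  refine ⟨(aux h).1 x, fun hx => ?_⟩
  -- The same exchange, applied once more, restores `S`.
  have := (aux (aux h).2).1 x hx
  rwa [Nat.xor_assoc, Nat.xor_self, Nat.xor_zero] at this

theorem legal_sound (hG : FreeGrid n G) {S k c : ℕ} (hk : free k = true)
    (h : legal (Nat.shiftRight S (k - 65)) c = true) :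
    Iso (n := n) r G S (Nat.xor S (Nat.shiftLeft (mask c) (k - 65))) := by
  simp only [free, Bool.and_eq_true, Nat.ble_eq, Bool.or_eq_true, Bool.not_eq_true',
    ← Bool.not_eq_true, Nat.beq_eq] at hk
  obtain ⟨hi, hi', hj, hj', hf⟩ := hk
  obtain ⟨i, j, rfl, ei, ej⟩ : ∃ i j, k = 64 * j + i ∧ k % 64 = i ∧ k / 64 = j :=
    ⟨k % 64, k / 64, by omega, rfl, rfl⟩
  rw [ei] at hi hi' hf
  rw [ej] at hj hj' hf
  -- `65` is the number of the cell `(1, 1)`, to which the cell `k` is shifted.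
  have off : 64 * j + i - 65 = 64 * (j - 1) + (i - 1) := by omega
  rw [off] at h ⊢
  have hs := hG i j hf
  have base := fun cx ax cy ay ky ko => half_base (n := n) (G := G) (i := i) (j := j)
    (cx := cx) (ax := ax) (cy := cy) (ay := ay) (ky := ky) (ko := ko) (by omega) (by omega) hs
  match c with
  | 0 =>
    refine legalAt_sound ⟨hi, hi'⟩ ⟨hj, hj'⟩ ?_ ?_ ?_ ?_ ?_ ?_ ?_ ?_ ?_ ?_ h
    · convert base (i + 1) i (j + 1) j _ _ (Or.inr (Or.inl ⟨rfl, rfl, rfl, rfl, rfl, rfl⟩)) using 2 <;>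
        first | (unfold code; omega) | omega
    all_goals first
      | (intro c; simp only [mask, nat_lor, Nat.testBit_or, testBit_bit, Bool.decide_or])
      | decide +kernel
  | 1 =>
    refine legalAt_sound ⟨hi, hi'⟩ ⟨hj, hj'⟩ ?_ ?_ ?_ ?_ ?_ ?_ ?_ ?_ ?_ ?_ h
    · convert base i (i + 1) (j + 1) j _ _ (Or.inr (Or.inr (Or.inl ⟨rfl, rfl, rfl, rfl, rfl, rfl⟩)))
        using 2 <;> first | (unfold code; omega) | omega
    all_goals first
      | (intro c; simp only [mask, nat_lor, Nat.testBit_or, testBit_bit, Bool.decide_or])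
      | decide +kernel
  | 2 =>
    refine legalAt_sound ⟨hi, hi'⟩ ⟨hj, hj'⟩ ?_ ?_ ?_ ?_ ?_ ?_ ?_ ?_ ?_ ?_ h
    · convert base (i + 1) i j (j + 1) _ _ (Or.inr (Or.inr (Or.inr ⟨rfl, rfl, rfl, rfl, rfl, rfl⟩)))
        using 2 <;> first | (unfold code; omega) | omega
    all_goals first
      | (intro c; simp only [mask, nat_lor, Nat.testBit_or, testBit_bit, Bool.decide_or])
      | decide +kernel
  | c + 3 =>
    refine legalAt_sound ⟨hi, hi'⟩ ⟨hj, hj'⟩ ?_ ?_ ?_ ?_ ?_ ?_ ?_ ?_ ?_ ?_ h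
    · convert base i (i + 1) j (j + 1) _ _ (Or.inl ⟨rfl, rfl, rfl, rfl, rfl, rfl⟩) using 2 <;>
        first | (unfold code; omega) | omega
    all_goals first
      | (intro c; simp only [mask, nat_lor, Nat.testBit_or, testBit_bit, Bool.decide_or])
      | decide +kernel

theorem Iso.refl (S : ℕ) : Iso (n := n) r G S S := fun _ => Iff.rfl

theorem Iso.trans {S T U : ℕ} (h : Iso (n := n) r G S T) (h' : Iso (n := n) r G T U) :
    Iso (n := n) r G S U := fun x => (h x).trans (h' x)

theorem Iso.symm {S T : ℕ} (h : Iso (n := n) r G S T) : Iso (n := n) r G T S := fun x => (h x).symm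

/-- The boundary of the cell is the sum of the boundaries of two halves with a common diagonal, so
it is exchanged by two triangle moves. The four alternatives are the two diagonals and the two
orders. -/
theorem flippable_sound (hG : FreeGrid n G) {S k : ℕ} (hk : free k = true)
    (h : flippable (Nat.shiftRight S (k - 65)) = true) :
    Iso (n := n) r G S (Nat.xor S (Nat.shiftLeft square (k - 65))) := by
  have aux : ∀ c d, (legal (Nat.shiftRight S (k - 65)) c &&
      legal (Nat.xor (Nat.shiftRight S (k - 65)) (mask c)) d) = true →
      mask c ^^^ mask d = square → Iso (n := n) r G S (Nat.xor S (Nat.shiftLeft square (k - 65))) := by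
    intro c d hcd e
    rw [Bool.and_eq_true] at hcd
    have h1 := legal_sound (r := r) hG hk hcd.1
    have h2 := legal_sound (r := r) hG (S := Nat.xor S (Nat.shiftLeft (mask c) (k - 65))) hk (c := d)
      (by
        simp only [nat_xor, nat_shiftRight, nat_shiftLeft] at hcd ⊢
        rw [Nat.shiftRight_xor_distrib, Nat.shiftLeft_shiftRight]; exact hcd.2)
    refine (h1.trans h2).trans ?_
    simp only [nat_xor, nat_shiftRight, nat_shiftLeft]
    rw [Nat.xor_assoc, ← Nat.shiftLeft_xor_distrib, e]
    exact Iso.refl _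
  simp only [flippable, Bool.or_eq_true] at h
  rcases h with ((h | h) | h) | h
  · exact aux 2 1 h (by decide +kernel)
  · exact aux 1 2 h (by decide +kernel)
  · exact aux 3 0 h (by decide +kernel)
  · exact aux 0 3 h (by decide +kernel)

theorem pass_sound (hG : FreeGrid n G) (p : ℕ → Bool) (l : List ℕ) : ∀ S rest,
    Iso (n := n) r G S (pass p S l rest).1 := by
  induction l with
  | nil => exact fun S _ => Iso.refl S
  | cons k ks ih =>
    intro S rest
    rw [Engine.pass.eq_2]
    cases h : (p (Nat.shiftRight S (k - 65)) && (free k && flippable (Nat.shiftRight S (k - 65))))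
    · exact ih _ _
    · simp only [Bool.and_eq_true] at h
      exact (flippable_sound hG h.2.1 h.2.2).trans (ih _ _)

theorem loop_sound (hG : FreeGrid n G) (p : ℕ → Bool) (m : ℕ) : ∀ S l,
    Iso (n := n) r G S (loop p m S l) := by
  induction m with
  | zero => exact fun S _ => Iso.refl S
  | succ m ih =>
    intro S l
    have h := pass_sound (r := r) hG p l S []
    rw [loop]
    split
    · rename_i S' e; rw [e] at h; exact h
    · rename_i S' k ks e; rw [e] at h; exact h.trans (ih _ _)

/-- Every flip that is carried out is an isotopy, and the final equality is part of the test. So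
nothing has to be proved about `inside`, `digits` or the order of the search. -/
theorem chase_sound (hG : FreeGrid n G) {S T : ℕ} (h : chase S T = true) :
    Iso (n := n) r G S T := by
  have := loop_sound (r := r) hG (fun _ => true) 60 S (digits 1024 (inside (Nat.xor S T)) [])
  rwa [Nat.eq_of_beq_eq_true h] at this

theorem relax_sound (hG : FreeGrid n G) (m S : ℕ) : Iso (n := n) r G S (relax m S) :=
  loop_sound hG _ _ _ _

end Soundness

end PlanarSkein

namespace PlanarSkein
open Engine

/-! ### Smoothing a crossing on the grid -/

/-- The triangles `abc` and `acd` over a parallelogram form a graph. -/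
theorem roof_injOn {a b c d : Space} (hp : c.1 - a.1 = (b.1 - a.1) + (d.1 - a.1))
    (hd : (b.1.1 - a.1.1) * (d.1.2 - a.1.2) - (b.1.2 - a.1.2) * (d.1.1 - a.1.1) ≠ 0) :
    InjOn Prod.fst (triangle a b c ∪ triangle a c d) := by
  set u : ℝ × ℝ := b.1 - a.1 with hu
  set w : ℝ × ℝ := d.1 - a.1 with hw
  have indep : ∀ s t : ℝ, s • u + t • w = 0 → s = 0 ∧ t = 0 := by
    intro s t e
    have e1 := congrArg Prod.fst e
    have e2 := congrArg Prod.snd e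
    simp only [hu, hw, Prod.fst_add, Prod.snd_add, Prod.smul_fst, Prod.smul_snd, Prod.fst_sub,
      Prod.snd_sub, smul_eq_mul, Prod.fst_zero, Prod.snd_zero] at e1 e2
    constructor
    · refine (mul_eq_zero.mp ?_).resolve_right hd
      linear_combination (d.1.2 - a.1.2) * e1 - (d.1.1 - a.1.1) * e2
    · refine (mul_eq_zero.mp ?_).resolve_right hd
      linear_combination (b.1.1 - a.1.1) * e2 - (b.1.2 - a.1.2) * e1
  have mixed : ∀ x ∈ triangle a b c, ∀ y ∈ triangle a c d, x.1 = y.1 → x = y := by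
    intro x hx y hy e
    obtain ⟨s, t, s0, t0, -, rfl⟩ := Grid.mem_triangle.mp hx
    obtain ⟨s', t', s0', t0', -, rfl⟩ := Grid.mem_triangle.mp hy
    simp only [Prod.fst_add, Prod.smul_fst, Prod.fst_sub, hp, ← hu, ← hw] at e
    obtain ⟨h1, h2⟩ := indep (s + t - s') (t - s' - t') (by
      rw [← sub_eq_zero] at e; rw [← e]; module)
    rw [show s = 0 by linarith, show t' = 0 by linarith, show t = s' by linarith]
    module
  rintro x (hx | hx) y (hy | hy) e
  · obtain ⟨s, t, s0, t0, -, rfl⟩ := Grid.mem_triangle.mp hx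
    obtain ⟨s', t', s0', t0', -, rfl⟩ := Grid.mem_triangle.mp hy
    simp only [Prod.fst_add, Prod.smul_fst, Prod.fst_sub, hp, ← hu, ← hw] at e
    obtain ⟨h1, h2⟩ := indep (s + t - s' - t') (t - t') (by
      rw [← sub_eq_zero] at e; rw [← e]; module)
    rw [show s = s' by linarith, show t = t' by linarith]
  · exact mixed x hx y hy e
  · exact (mixed y hy x hx e.symm).symm
  · obtain ⟨s, t, s0, t0, -, rfl⟩ := Grid.mem_triangle.mp hx
    obtain ⟨s', t', s0', t0', -, rfl⟩ := Grid.mem_triangle.mp hy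
    simp only [Prod.fst_add, Prod.smul_fst, Prod.fst_sub, hp, ← hu, ← hw] at e
    obtain ⟨h1, h2⟩ := indep (s - s') (s + t - s' - t') (by
      rw [← sub_eq_zero] at e; rw [← e]; module)
    rw [show s = s' by linarith, show t = t' by linarith]

theorem segment_height {a b : Space} {z : ℝ} (ha : a.2 = z) (hb : b.2 = z) {x : Space}
    (hx : x ∈ segment ℝ a b) : x.2 = z := by
  rw [segment_eq_image'] at hx
  obtain ⟨t, -, rfl⟩ := hx
  simp [ha, hb]

/-- The diagonals lie at the constant heights `3/4` and `1/4` and are disjoint. Two opposite sides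
of the parallelogram have disjoint projections because they are parallel. The remaining pairs are
sides of nondegenerate triangles. -/
theorem tetraIndep_of {a b c d : Space} (hp : c.1 - a.1 = (b.1 - a.1) + (d.1 - a.1))
    (hd : (b.1.1 - a.1.1) * (d.1.2 - a.1.2) - (b.1.2 - a.1.2) * (d.1.1 - a.1.1) ≠ 0)
    (ha : a.2 = 3 / 4) (hb : b.2 = 1 / 4) (hc : c.2 = 3 / 4) (hd' : d.2 = 1 / 4) :
    TetraIndep a b c d := by
  have p1 := congrArg Prod.fst hp
  have p2 := congrArg Prod.snd hp
  simp only [Prod.fst_add, Prod.snd_add, Prod.fst_sub, Prod.snd_sub] at p1 p2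
  have abc : Nondeg c b a := nondeg_of_det fun e => hd (by
    linear_combination -e + (b.1.2 - a.1.2) * p1 - (b.1.1 - a.1.1) * p2)
  have bcd : Nondeg b c d := nondeg_of_det fun e => hd (by
    linear_combination e - (d.1.2 - b.1.2) * p1 + (d.1.1 - b.1.1) * p2)
  have acd : Nondeg a d c := nondeg_of_det fun e => hd (by
    linear_combination -e + (d.1.1 - a.1.1) * p2 - (d.1.2 - a.1.2) * p1)
  have abd : Nondeg d a b := nondeg_of_det fun e => hd (by linear_combination e)
  refine ⟨abc.ab.symm, abd.ab, abc.ca, abd.ca, ?_, ?_, ?_, ?_, ?_, ?_⟩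
  · have := abc.at_a
    rwa [segment_symm ℝ c b, segment_symm ℝ c a] at this
  · exact bcd.at_a
  · have := acd.at_a
    rwa [segment_symm ℝ a d] at this
  · have := abd.at_a
    rwa [segment_symm ℝ d b] at this
  · rw [Set.disjoint_left]
    intro x h1 h2
    have := (segment_height ha hc h1).symm.trans (segment_height hb hd' h2)
    norm_num at this
  · rw [Set.disjoint_left]
    intro x h1 h2
    rw [segment_eq_image'] at h1 h2
    obtain ⟨s, -, rfl⟩ := h1
    obtain ⟨t, -, e⟩ := h2
    have e1 := congrArg (fun y : Space => y.1.1) e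
    have e2 := congrArg (fun y : Space => y.1.2) e
    simp only [Prod.fst_add, Prod.snd_add, Prod.smul_fst, Prod.smul_snd, Prod.fst_sub, Prod.snd_sub,
      smul_eq_mul] at e1 e2
    apply hd
    linear_combination (d.1.1 - a.1.1) * e2 - (d.1.2 - a.1.2) * e1 +
      s * ((d.1.1 - a.1.1) * p2 - (d.1.2 - a.1.2) * p1)

section RepAt

variable {R : Type*} [CommRing R] {n : ℕ} (r : Rˣ) (G : Grid)

/-- `x` is the class of the link that consists of the edges in `S`, lifted to the height `h`. -/
def RepAt (h : ℕ × ℕ → ℝ) (S : ℕ) (x : Skein n r) : Prop :=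
  ∃ L : Link n, L.carrier = G.real h S ∧ L.toSkein r = x

variable {r G}

/-- `ac` is the overcrossing diagonal and `bd` the undercrossing diagonal of the cell `(i, j)`. -/
structure Quad (i j : ℕ) (a b c d : ℕ × ℕ) (kac kbd kab kbc kcd kda : ℕ) : Prop where
  corner : ∀ v, Grid.Corner i j v ↔ v = a ∨ v = b ∨ v = c ∨ v = d
  codes : ∀ k, (k = kac ∨ k = kbd ∨ k = kab ∨ k = kbc ∨ k = kcd ∨ k = kda) ↔
    k = code 0 i j ∨ k = code 0 i (j + 1) ∨ k = code 1 i j ∨ k = code 1 (i + 1) j ∨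
      k = code 2 i j ∨ k = code 3 i j
  nodup : [kac, kbd, kab, kbc, kcd, kda].Nodup
  lt : kac < 4096 ∧ kbd < 4096 ∧ kab < 4096 ∧ kbc < 4096 ∧ kcd < 4096 ∧ kda < 4096
  edges : ∀ (G : Grid) h, G.edge h kac = segment ℝ (G.pt h a) (G.pt h c) ∧
    G.edge h kbd = segment ℝ (G.pt h b) (G.pt h d) ∧ G.edge h kab = segment ℝ (G.pt h a) (G.pt h b) ∧
    G.edge h kbc = segment ℝ (G.pt h b) (G.pt h c) ∧ G.edge h kcd = segment ℝ (G.pt h c) (G.pt h d) ∧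
    G.edge h kda = segment ℝ (G.pt h d) (G.pt h a)
  par : ∀ (G : Grid) h, (G.pt h c).1 - (G.pt h a).1 =
    ((G.pt h b).1 - (G.pt h a).1) + ((G.pt h d).1 - (G.pt h a).1)

/-- The corners are in counterclockwise order starting at the lower left. With the rising diagonal
on top, the smoothing `bc, da` with coefficient `q^{1/2}` consists of the vertical sides. -/
theorem quad_rising {i j : ℕ} (hi : i < 62) (hj : j < 14) :
    Quad i j (i, j) (i + 1, j) (i + 1, j + 1) (i, j + 1) (code 2 i j) (code 3 i j) (code 0 i j)
      (code 1 (i + 1) j) (code 0 i (j + 1)) (code 1 i j) where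
  corner v := by obtain ⟨v1, v2⟩ := v; simp only [Grid.Corner, Prod.mk.injEq]; omega
  codes k := by tauto
  nodup := by simp only [code, List.nodup_cons, List.mem_cons, List.not_mem_nil, or_false,
    not_false_eq_true, List.nodup_nil, and_true]; omega
  lt := by simp only [code]; omega
  edges G h := by
    simp only [Grid.edge]
    refine ⟨?_, ?_, ?_, ?_, ?_, ?_⟩ <;>
      rw [src_code (by omega) (by omega) (by omega), tgt_code (by omega) (by omega) (by omega)] <;>
      simp
    · exact segment_symm _ _ _
    · exact segment_symm _ _ _
  par G h := by simp [Grid.pt]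

/-- Starting at the lower right instead, the falling diagonal is on top, and `bc, da` are the
horizontal sides. -/
theorem quad_falling {i j : ℕ} (hi : i < 62) (hj : j < 14) :
    Quad i j (i + 1, j) (i + 1, j + 1) (i, j + 1) (i, j) (code 3 i j) (code 2 i j)
      (code 1 (i + 1) j) (code 0 i (j + 1)) (code 1 i j) (code 0 i j) where
  corner v := by obtain ⟨v1, v2⟩ := v; simp only [Grid.Corner, Prod.mk.injEq]; omega
  codes k := by tauto
  nodup := by simp only [code, List.nodup_cons, List.mem_cons, List.not_mem_nil, or_false,
    not_false_eq_true, List.nodup_nil, and_true]; omega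
  lt := by simp only [code]; omega
  edges G h := by
    simp only [Grid.edge]
    refine ⟨?_, ?_, ?_, ?_, ?_, ?_⟩ <;>
      rw [src_code (by omega) (by omega) (by omega), tgt_code (by omega) (by omega) (by omega)] <;>
      simp
    · exact segment_symm _ _ _
    · exact segment_symm _ _ _
    · exact segment_symm _ _ _
  par G h := by simp [Grid.pt]

theorem det_rising (G : Grid) (h : ℕ × ℕ → ℝ) (i j : ℕ) :
    0 < ((G.pt h (i + 1, j)).1.1 - (G.pt h (i, j)).1.1) *
        ((G.pt h (i, j + 1)).1.2 - (G.pt h (i, j)).1.2) -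
      ((G.pt h (i + 1, j)).1.2 - (G.pt h (i, j)).1.2) *
        ((G.pt h (i, j + 1)).1.1 - (G.pt h (i, j)).1.1) := by
  have hx := sub_pos.mpr (G.hx (Nat.lt_succ_self i))
  have hy := sub_pos.mpr (G.hy (Nat.lt_succ_self j))
  simp only [Grid.pt, sub_self, mul_zero, sub_zero]
  exact mul_pos hx hy

theorem det_falling (G : Grid) (h : ℕ × ℕ → ℝ) (i j : ℕ) :
    0 < ((G.pt h (i + 1, j + 1)).1.1 - (G.pt h (i + 1, j)).1.1) *
        ((G.pt h (i, j)).1.2 - (G.pt h (i + 1, j)).1.2) -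
      ((G.pt h (i + 1, j + 1)).1.2 - (G.pt h (i + 1, j)).1.2) *
        ((G.pt h (i, j)).1.1 - (G.pt h (i + 1, j)).1.1) := by
  have hx := sub_pos.mpr (G.hx (Nat.lt_succ_self i))
  have hy := sub_pos.mpr (G.hy (Nat.lt_succ_self j))
  simp only [Grid.pt, Nat.succ_eq_add_one, sub_self, zero_mul, zero_sub] at hx hy ⊢
  nlinarith [mul_pos hx hy]

theorem tetra_swap (a b c d : Space) : tetra a b c d = tetra a d c b := by
  simp only [tetra]; congr 1; ext; simp; tauto

/-- An edge that enters the tetrahedron projects into the cell. It is therefore one of the six edges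
of the cell, or it meets the cell in a corner, and all four corners lie on the new sides. -/
theorem real_smoothing {G : Grid} {h : ℕ × ℕ → ℝ} {i j : ℕ} {a b c d : ℕ × ℕ}
    {kac kbd kab kbc kcd kda : ℕ} (Q : Quad i j a b c d kac kbd kab kbc kcd kda) {S S' : ℕ}
    (hab : S.testBit kab = false) (hbc : S.testBit kbc = false) (hcd : S.testBit kcd = false)
    (hda : S.testBit kda = false)
    (hS : ∀ k, S'.testBit k = ((S.testBit k && !decide (k = kac ∨ k = kbd)) ||
      decide (k = kbc ∨ k = kda))) :
    G.real h S' = (G.real h S \ tetra (G.pt h a) (G.pt h b) (G.pt h c) (G.pt h d)) ∪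
      (segment ℝ (G.pt h b) (G.pt h c) ∪ segment ℝ (G.pt h d) (G.pt h a)) := by
  obtain ⟨e1, e2, e3, e4, e5, e6⟩ := Q.edges G h
  obtain ⟨T1, T2, -, -⟩ := tetra_segments (G.pt h a) (G.pt h b) (G.pt h c) (G.pt h d)
  ext x
  constructor
  · rintro ⟨k, hk, hkS, hx⟩
    by_cases h1 : k = kbc
    · right; left; rw [← e4, ← h1]; exact hx
    by_cases h2 : k = kda
    · right; right; rw [← e6, ← h2]; exact hx
    rw [hS] at hkS
    simp only [h1, h2, or_false, decide_false, Bool.or_false, Bool.and_eq_true, Bool.not_eq_true',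
      decide_eq_false_iff_not, not_or] at hkS
    obtain ⟨hkS, h3, h4⟩ := hkS
    by_cases hT : x ∈ tetra (G.pt h a) (G.pt h b) (G.pt h c) (G.pt h d)
    · have hc : x.1 ∈ G.cell i j := by
        refine convexHull_min ?_ (Grid.convex_cell (G := G) i j) hT
        rintro _ (rfl | rfl | rfl | rfl) <;> exact Grid.pt_mem_cell ((Q.corner _).mpr (by simp))
      rcases Grid.edge_inter_cell hk hx hc with ⟨v, rfl, -, hv⟩ | h5
      · right
        rcases (Q.corner v).mp hv with rfl | rfl | rfl | rfl
        exacts [Or.inr (right_mem_segment _ _ _), Or.inl (left_mem_segment _ _ _),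
          Or.inl (right_mem_segment _ _ _), Or.inr (left_mem_segment _ _ _)]
      · exfalso
        have := (Q.codes k).mpr (by tauto)
        rcases this with rfl | rfl | rfl | rfl | rfl | rfl <;> simp_all
    · exact Or.inl ⟨⟨k, hk, hkS, hx⟩, hT⟩
  · rintro (⟨⟨k, hk, hkS, hx⟩, hT⟩ | hx | hx)
    · refine ⟨k, hk, ?_, hx⟩
      have h1 : k ≠ kac := by rintro rfl; exact hT (T1 (by rwa [← e1]))
      have h2 : k ≠ kbd := by rintro rfl; exact hT (T2 (by rwa [← e2]))
      rw [hS, hkS]; simp [h1, h2]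
    · exact ⟨kbc, Q.lt.2.2.2.1, by rw [hS]; simp, by rwa [e4]⟩
    · exact ⟨kda, Q.lt.2.2.2.2.2, by rw [hS]; simp, by rwa [e6]⟩

/-- Exchanging `b` and `d` exchanges the two smoothings, so `real_smoothing` and
`polygonal_smoothing` serve for both. -/
theorem Quad.swap {i j : ℕ} {a b c d : ℕ × ℕ} {kac kbd kab kbc kcd kda : ℕ}
    (Q : Quad i j a b c d kac kbd kab kbc kcd kda) : Quad i j a d c b kac kbd kda kcd kbc kab where
  corner v := by rw [Q.corner]; tauto
  codes k := by rw [← Q.codes]; tauto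
  nodup := by
    have := Q.nodup
    simp only [List.nodup_cons, List.mem_cons, List.not_mem_nil, or_false, not_false_eq_true,
      List.nodup_nil, and_true, not_or] at this ⊢
    obtain ⟨⟨h1, h2, h3, h4, h5⟩, ⟨k1, k2, k3, k4⟩, ⟨l1, l2, l3⟩, ⟨m1, m2⟩, m3⟩ := this
    exact ⟨⟨h1, h5, h4, h3, h2⟩, ⟨k4, k3, k2, k1⟩, ⟨Ne.symm m3, Ne.symm m2, Ne.symm l3⟩,
      ⟨Ne.symm m1, Ne.symm l2⟩, Ne.symm l1⟩
  lt := by have := Q.lt; tauto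
  edges G h := by
    obtain ⟨e1, e2, e3, e4, e5, e6⟩ := Q.edges G h
    exact ⟨e1, by rw [e2, segment_symm], by rw [e6, segment_symm], by rw [e5, segment_symm],
      by rw [e4, segment_symm], by rw [e3, segment_symm]⟩
  par G h := by rw [Q.par, add_comm]

/-- The heights `3/4` and `1/4` at the corners turn the cell with its two diagonals into the
tetrahedron of a skein triple. By `det` the corners `a, b, c, d` are in counterclockwise order,
which fixes the smoothing with coefficient `r`. -/
theorem smoothing {G : Grid} {h : ℕ × ℕ → ℝ} {i j : ℕ} {a b c d : ℕ × ℕ}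
    {kac kbd kab kbc kcd kda : ℕ} (Q : Quad i j a b c d kac kbd kab kbc kcd kda)
    (det : 0 < ((G.pt h b).1.1 - (G.pt h a).1.1) * ((G.pt h d).1.2 - (G.pt h a).1.2) -
      ((G.pt h b).1.2 - (G.pt h a).1.2) * ((G.pt h d).1.1 - (G.pt h a).1.1))
    (hs : G.cell i j ⊆ surface n) (ha : h a = 3 / 4) (hb : h b = 1 / 4) (hc : h c = 3 / 4)
    (hd : h d = 1 / 4) {S S1 S0 : ℕ} (hac : S.testBit kac = true) (hbd : S.testBit kbd = true)
    (hab : S.testBit kab = false) (hbc : S.testBit kbc = false) (hcd : S.testBit kcd = false)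
    (hda : S.testBit kda = false)
    (hS1 : ∀ k, S1.testBit k = ((S.testBit k && !decide (k = kac ∨ k = kbd)) ||
      decide (k = kbc ∨ k = kda)))
    (hS0 : ∀ k, S0.testBit k = ((S.testBit k && !decide (k = kac ∨ k = kbd)) ||
      decide (k = kab ∨ k = kcd))) {x : Skein n r} (hx : RepAt r G h S x) :
    ∃ x1 x0, RepAt r G h S1 x1 ∧ RepAt r G h S0 x0 ∧ x = (r : R) • x1 + (↑r⁻¹ : R) • x0 := by
  obtain ⟨L, hL, rfl⟩ := hx
  obtain ⟨e1, e2, e3, e4, e5, e6⟩ := Q.edges G h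
  have cor : ∀ {v}, (v = a ∨ v = b ∨ v = c ∨ v = d) → (G.pt h v).1 ∈ G.cell i j :=
    fun hv => Grid.pt_mem_cell ((Q.corner _).mpr hv)
  have par := Q.par G h
  have ha' : (G.pt h a).2 = 3 / 4 := ha
  have hb' : (G.pt h b).2 = 1 / 4 := hb
  have hc' : (G.pt h c).2 = 3 / 4 := hc
  have hd' : (G.pt h d).2 = 1 / 4 := hd
  have R1 : G.real h S1 = _ := real_smoothing Q hab hbc hcd hda hS1
  have R0 : G.real h S0 = _ := real_smoothing Q.swap hda hcd hbc hab fun k => by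
    rw [hS0 k]; congr 2; exact propext or_comm
  rw [← hL] at R1 R0
  set pa := G.pt h a
  set pb := G.pt h b
  set pc := G.pt h c
  set pd := G.pt h d
  have T : ∀ x ∈ tetra pa pb pc pd, x.1 ∈ G.cell i j := by
    intro x hx
    refine convexHull_min ?_ (Grid.convex_cell (G := G) i j) hx
    rintro _ (rfl | rfl | rfl | rfl) <;> exact cor (by simp)
  obtain ⟨T1, T2, T3, T4⟩ := tetra_segments pa pb pc pd
  obtain ⟨T5, T6, T7, T8⟩ := tetra_segments pa pd pc pb
  rw [← tetra_swap] at T5 T6 T7 T8 R0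
  have tsub : tetra pa pb pc pd ⊆ thickened n := by
    intro x hx
    refine ⟨hs (T x hx), ?_⟩
    have : x ∈ {y : Space | y.2 ∈ Icc (1 / 4 : ℝ) (3 / 4)} := by
      refine convexHull_min ?_ ((convex_Icc _ _).linear_preimage (LinearMap.snd ℝ (ℝ × ℝ) ℝ)) hx
      rintro _ (rfl | rfl | rfl | rfl)
      · exact ⟨by change _ ≤ pa.2; linarith, by change pa.2 ≤ _; linarith⟩
      · exact ⟨by change _ ≤ pb.2; linarith, by change pb.2 ≤ _; linarith⟩
      · exact ⟨by change _ ≤ pc.2; linarith, by change pc.2 ≤ _; linarith⟩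
      · exact ⟨by change _ ≤ pd.2; linarith, by change pd.2 ≤ _; linarith⟩
    exact ⟨by linarith [this.1], by linarith [this.2]⟩
  -- No side of the cell is in `S`, so over the cell the link consists of the two diagonals only.
  have inT : ∀ k < 4096, S.testBit k = true → ∀ x ∈ G.edge h k, x.1 ∈ G.cell i j →
      x ∈ segment ℝ pa pc ∪ segment ℝ pb pd := by
    intro k hk hkS x hx hxc
    rcases Grid.edge_inter_cell hk hx hxc with ⟨v, rfl, -, hv⟩ | h5
    · rcases (Q.corner v).mp hv with rfl | rfl | rfl | rfl
      exacts [Or.inl (left_mem_segment _ _ _), Or.inr (left_mem_segment _ _ _),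
          Or.inl (right_mem_segment _ _ _), Or.inr (right_mem_segment _ _ _)]
    · rcases (Q.codes k).mpr (by tauto) with rfl | rfl | rfl | rfl | rfl | rfl
      · left; rwa [← e1]
      · right; rwa [← e2]
      all_goals simp_all
  have hLT : L.carrier ∩ tetra pa pb pc pd = segment ℝ pa pc ∪ segment ℝ pb pd := by
    refine Subset.antisymm ?_ ?_
    · rintro x ⟨hx, hxT⟩
      rw [hL] at hx
      obtain ⟨k, hk, hkS, hx⟩ := hx
      exact inT k hk hkS x hx (T x hxT)
    · rintro x (hx | hx)
      · exact ⟨by rw [hL]; exact ⟨kac, Q.lt.1, hac, by rwa [e1]⟩, T1 hx⟩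
      · exact ⟨by rw [hL]; exact ⟨kbd, Q.lt.2.1, hbd, by rwa [e2]⟩, T2 hx⟩
  have roofT : triangle pa pb pc ∪ triangle pa pc pd ⊆ tetra pa pb pc pd := by
    refine union_subset (convexHull_mono ?_) (convexHull_mono ?_)
    · rintro _ (rfl | rfl | rfl) <;> simp
    · rintro _ (rfl | rfl | rfl) <;> simp
  -- Outside the tetrahedron the link can have double points only over centres of cells, which are
  -- finitely many. The roof is a graph over the parallelogram, and the rest of the link does not
  -- project into it.
  have loc : LocInj ((L.carrier \ tetra pa pb pc pd) ∪ (triangle pa pb pc ∪ triangle pa pc pd)) := by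
    refine locInj_of_finite (Set.Finite.subset (s := ⋃ k ∈ Finset.range 4096,
      {x ∈ G.edge h k | x.1 = ((G.gx (k % 64) + G.gx (k % 64 + 1)) / 2,
        (G.gy (k / 64 % 16) + G.gy (k / 64 % 16 + 1)) / 2)}) ?_ ?_)
    · refine Set.Finite.biUnion (Finset.finite_toSet _) fun k hk => Set.Subsingleton.finite ?_
      rintro x ⟨hx, hx'⟩ y ⟨hy, hy'⟩
      exact Grid.injOn_edge (by simpa using hk) hx hy (hx'.trans hy'.symm)
    · have mixed : ∀ x ∈ L.carrier \ tetra pa pb pc pd,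
          ∀ y ∈ triangle pa pb pc ∪ triangle pa pc pd, y.1 ≠ x.1 := by
        rintro x ⟨hx, hxT⟩ y hy e
        rw [hL] at hx
        obtain ⟨k, hk, hkS, hx⟩ := hx
        exact hxT ((inT k hk hkS x hx (e ▸ T y (roofT hy))).elim (fun h => T1 h) fun h => T2 h)
      rintro x ⟨hx | hx, y, hy | hy, hne, hxy⟩
      · have hx := hx.1
        have hy := hy.1
        rw [hL] at hx hy
        obtain ⟨k, hk, hkS, hx⟩ := hx
        obtain ⟨k', hk', hkS', hy⟩ := hy
        simp only [mem_iUnion]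
        refine ⟨k, by simpa using hk, hx, ?_⟩
        rcases Grid.edge_inter hk hk' hx hy hxy.symm with ⟨v, rfl, rfl, -⟩ | rfl | h4
        · exact absurd rfl hne
        · exact absurd (Grid.injOn_edge hk hy hx hxy) hne
        · obtain ⟨i', hi', j', hj', hcase, h5⟩ := h4
          have : k % 64 = i' ∧ k / 64 % 16 = j' := by
            rcases hcase with ⟨rfl, -⟩ | ⟨rfl, -⟩ <;> simp only [code] <;> omega
          rw [this.1, this.2]; exact h5
      · exact absurd hxy (mixed x hx y hy)
      · exact absurd hxy.symm (mixed y hy x hx)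
      · exact absurd (roof_injOn par det.ne' hy hx hxy) hne
  have ti : TetraIndep pa pb pc pd := tetraIndep_of par det.ne' ha' hb' hc' hd'
  have ti' : TetraIndep pa pd pc pb := tetraIndep_of (by rw [par, add_comm])
    (fun e => det.ne' (by linear_combination -e)) ha' hd' hc' hb'
  have sub1 : ∀ {X}, X ⊆ tetra pa pb pc pd → (L.carrier \ tetra pa pb pc pd) ∪ X ⊆ thickened n :=
    fun hX => union_subset (sdiff_subset.trans L.subset) (hX.trans tsub)
  have s1 : segment ℝ pb pc ⊆ triangle pa pb pc :=
    (convex_convexHull ℝ _).segment_subset (subset_convexHull ℝ _ (by simp))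
      (subset_convexHull ℝ _ (by simp))
  have s2 : segment ℝ pd pa ⊆ triangle pa pc pd :=
    (convex_convexHull ℝ _).segment_subset (subset_convexHull ℝ _ (by simp))
      (subset_convexHull ℝ _ (by simp))
  have s3 : segment ℝ pb pa ⊆ triangle pa pb pc :=
    (convex_convexHull ℝ _).segment_subset (subset_convexHull ℝ _ (by simp))
      (subset_convexHull ℝ _ (by simp))
  have s4 : segment ℝ pd pc ⊆ triangle pa pc pd :=
    (convex_convexHull ℝ _).segment_subset (subset_convexHull ℝ _ (by simp))
      (subset_convexHull ℝ _ (by simp))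
  let L1 : Link n := ⟨G.real h S1, Grid.isCompact_real _ _, by
      rw [R1]; exact sub1 (union_subset T3 T4),
    by rw [R1]; exact polygonal_smoothing L ti hLT,
    by rw [R1]; exact loc.mono (union_subset_union_right _ (union_subset_union s1 s2))⟩
  let L0 : Link n := ⟨G.real h S0, Grid.isCompact_real _ _, by
      rw [R0]; exact sub1 (union_subset T7 T8),
    by
      rw [R0, tetra_swap]
      refine polygonal_smoothing L ti' ?_
      rw [← tetra_swap, hLT, segment_symm ℝ pb pd],
    by
      rw [R0, union_comm (segment ℝ pd pc)]
      exact loc.mono (union_subset_union_right _ (union_subset_union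
        s3 s4))⟩
  refine ⟨L1.toSkein r, L0.toSkein r, ⟨L1, rfl, rfl⟩, ⟨L0, rfl, rfl⟩, toSkein_crossing r
    ⟨pa, pb, pc, pd, tsub, ?_, ?_, hLT, R1, ?_, loc⟩⟩
  · have p1 := congrArg Prod.fst par
    have p2 := congrArg Prod.snd par
    simp only [Prod.fst_add, Prod.snd_add, Prod.fst_sub, Prod.snd_sub] at p1 p2
    -- The diagonals of a parallelogram bisect each other, so the crossing lies over the common
    -- midpoint.
    refine ⟨(1 / 2 : ℝ) • pa + (1 / 2 : ℝ) • pc, ⟨1 / 2, 1 / 2, by norm_num, by norm_num, by norm_num,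
      rfl⟩, (1 / 2 : ℝ) • pb + (1 / 2 : ℝ) • pd, ⟨1 / 2, 1 / 2, by norm_num, by norm_num, by norm_num,
      rfl⟩, ?_, ?_⟩
    · simp only [Prod.fst_add, Prod.smul_fst]
      refine Prod.ext ?_ ?_ <;> simp only [Prod.fst_add, Prod.snd_add, Prod.smul_fst,
        Prod.smul_snd, smul_eq_mul] <;> linarith
    · simp only [Prod.snd_add, Prod.smul_snd, smul_eq_mul, ha', hb', hc', hd']; norm_num
  · have p1 := congrArg Prod.fst par
    have p2 := congrArg Prod.snd par
    simp only [Prod.fst_add, Prod.snd_add, Prod.fst_sub, Prod.snd_sub] at p1 p2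
    rw [p1, p2]
    linarith [det]
  · change G.real h S0 = _
    rw [R0, segment_symm ℝ pd pc, segment_symm ℝ pb pa, union_comm (segment ℝ pc pd)]

end RepAt

end PlanarSkein

/-! ### Products as diagrams on the grid, and their states -/

namespace PlanarSkein

namespace Engine

/-- The vertices of a curve; `64 * j + i` stands for the vertex `(i, j)`. -/
def vertices (S : ℕ) : ℕ :=
  let h := Nat.mod S (2 ^ 1024)
  let v := Nat.mod (Nat.shiftRight S 1024) (2 ^ 1024)
  let d := Nat.mod (Nat.shiftRight S 2048) (2 ^ 1024)
  let a := Nat.mod (Nat.shiftRight S 3072) (2 ^ 1024)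
  Nat.lor (Nat.lor (Nat.lor h (Nat.shiftLeft h 1)) (Nat.lor v (Nat.shiftLeft v 64)))
    (Nat.lor (Nat.lor d (Nat.shiftLeft d 65)) (Nat.lor (Nat.shiftLeft a 1) (Nat.shiftLeft a 64)))

/-- The curves `A` and `B` have no common vertex. -/
def apart (A B : ℕ) : Bool := Nat.beq (Nat.land (vertices A) (vertices B)) 0

/-- No cell contains two diagonals. -/
def plain (S : ℕ) : Bool := Nat.beq (Nat.land (Nat.shiftRight S 2048) (Nat.shiftRight S 3072)) 0

/-- Both diagonals and two opposite sides (the vertical ones if `b` holds) of the cell `(0, 0)`. -/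
def smoothMask (b : Bool) : ℕ :=
  Nat.lor (Nat.lor (bit 2048) (bit 3072))
    (bif b then Nat.lor (bit 1024) (bit 1025) else Nat.lor (bit 0) (bit 64))

/-- Replace the diagonals of a cell by opposite sides, the vertical ones if `b` holds. -/
def smooth (b : Bool) (S k : ℕ) : ℕ := Nat.xor S (Nat.shiftLeft (smoothMask b) k)

/-- `S` contains both diagonals and no side of the cell `k`. Exactly the endpoints of its rising
diagonal (if `b` holds; otherwise those of its falling diagonal) are in `V`. -/
def crossing (b : Bool) (S V k : ℕ) : Bool :=
  free k && (Nat.beq (Nat.land (Nat.shiftRight S k) (Nat.lor (smoothMask true) (smoothMask false)))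
    (Nat.lor (bit 2048) (bit 3072)) &&
  Nat.beq (Nat.land (Nat.shiftRight V k) (Nat.lor (Nat.lor (bit 0) (bit 1))
    (Nat.lor (bit 64) (bit 65))))
    (bif b then Nat.lor (bit 0) (bit 65) else Nat.lor (bit 1) (bit 64)))

/-- All crossings are in the list. -/
def good (V : ℕ) : List (ℕ × Bool) → ℕ → Bool
  | [], S => plain S
  | (k, b) :: l, S => crossing b S V k && (good V l (smooth true S k) && good V l (smooth false S k))

/-- All smoothings of the crossings in the list. -/
def leaves : List (ℕ × Bool) → ℕ → List ℕ
  | [], S => [S]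
  | (k, _) :: l, S => leaves l (smooth true S k) ++ leaves l (smooth false S k)

/-- Replace the diagonals in the cells of a list by two sides, where this is possible. -/
def strip : List ℕ → ℕ → ℕ
  | [], S => S
  | k :: l, S =>
    bif free k && legal (Nat.shiftRight S (k - 65)) 0 then
      strip l (Nat.xor S (Nat.shiftLeft (mask 0) (k - 65))) else
    bif free k && legal (Nat.shiftRight S (k - 65)) 1 then
      strip l (Nat.xor S (Nat.shiftLeft (mask 1) (k - 65))) else
    bif free k && legal (Nat.shiftRight S (k - 65)) 2 then
      strip l (Nat.xor S (Nat.shiftLeft (mask 2) (k - 65))) else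
    bif free k && legal (Nat.shiftRight S (k - 65)) 3 then
      strip l (Nat.xor S (Nat.shiftLeft (mask 3) (k - 65))) else strip l S

/-- The other crossings: the diagonals exchange their roles. -/
def mirror (l : List (ℕ × Bool)) : List (ℕ × Bool) := l.map fun x => (x.1, !x.2)

/-- `P` above `Q` is a diagram of the product of `A` and `B`, with crossings `l`. -/
def diagram (A B P Q : ℕ) (l : List (ℕ × Bool)) : Bool :=
  chase A (strip (l.map Prod.fst) P) && (chase B (strip (l.map Prod.fst) Q) && (apart P Q &&
    (good (vertices P) l (Nat.lor P Q) && good (vertices Q) (mirror l) (Nat.lor P Q))))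

/-- The boundary of the cell `k` is disjoint from `U`. -/
def isolated (U k : ℕ) : Bool :=
  free k && (Nat.beq (Nat.land (Nat.shiftRight U (k - 65)) (Nat.lor (Nat.lor (around 1 1)
    (around 2 1)) (Nat.lor (around 1 2) (around 2 2)))) 0 &&
  legal (Nat.shiftRight (Nat.xor U (Nat.shiftLeft square (k - 65))) (k - 65)) 0)

end Engine

open Engine

section Products

variable {R : Type*} [CommRing R] {n : ℕ} (r : Rˣ) (G : Grid)

open Classical in
/-- The class of the link at height `1/2` that consists of the edges in `S`. -/
noncomputable def cl (S : ℕ) : Skein n r := if h : ∃ x : Skein n r, Rep r G S x then h.choose else 0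

variable {r G}

theorem Rep.unique {S : ℕ} {x y : Skein n r} (hx : Rep r G S x) (hy : Rep r G S y) : x = y := by
  obtain ⟨L, hL, rfl⟩ := hx
  obtain ⟨M, hM, rfl⟩ := hy
  rw [Link.ext (hL.trans hM.symm)]

theorem Rep.cl_eq {S : ℕ} {x : Skein n r} (hx : Rep r G S x) : cl r G S = x := by
  have h : ∃ x : Skein n r, Rep r G S x := ⟨x, hx⟩
  rw [cl, dif_pos h]
  exact h.choose_spec.unique hx

/-- Isotopic sets are either both represented by a link or both not; in the second case both classes
have the default value `0`. -/
theorem Iso.cl_eq {S T : ℕ} (h : Iso (n := n) r G S T) : (cl r G S : Skein n r) = cl r G T := by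
  by_cases hS : ∃ x : Skein n r, Rep r G S x
  · obtain ⟨x, hx⟩ := hS
    rw [hx.cl_eq, ((h x).mp hx).cl_eq]
  · have hT : ¬ ∃ x : Skein n r, Rep r G T x := fun ⟨x, hx⟩ => hS ⟨x, (h x).mpr hx⟩
    rw [cl, cl, dif_neg hS, dif_neg hT]

theorem testBit_mod_shiftRight {S c m : ℕ} (hc : c < 1024) :
    (Nat.mod (Nat.shiftRight S m) (2 ^ 1024)).testBit c = S.testBit (m + c) := by
  change ((S >>> m) % 2 ^ 1024).testBit c = _
  rw [Nat.testBit_mod_two_pow, Nat.testBit_shiftRight]; simp [hc]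

theorem testBit_vertices {S k : ℕ} (hk : k < 4096) (hS : S.testBit k = true) {v : ℕ × ℕ}
    (hv : v = src k ∨ v = tgt k) : (vertices S).testBit (64 * v.2 + v.1) = true := by
  obtain ⟨d, i, j, hd, hi, hj, rfl⟩ := exists_code hk
  rw [src_code hd hi hj, tgt_code hd hi hj] at hv
  have h0 : (Nat.mod S (2 ^ 1024)).testBit (64 * j + i) = S.testBit (64 * j + i) := by
    have := testBit_mod_shiftRight (S := S) (c := 64 * j + i) (m := 0) (by omega)
    rwa [zero_add] at this
  have hm : ∀ m, (Nat.mod (Nat.shiftRight S m) (2 ^ 1024)).testBit (64 * j + i) =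
      S.testBit (m + (64 * j + i)) := fun m => testBit_mod_shiftRight (by omega)
  have hsh : ∀ m X : ℕ, (X <<< m).testBit (m + (64 * j + i)) = X.testBit (64 * j + i) := by
    intro m X; rw [Nat.testBit_shiftLeft]; simp
  have g : ∀ {m X t : ℕ}, t = m + (64 * j + i) → X.testBit (64 * j + i) = true →
      (X <<< m).testBit t = true := by rintro m X t rfl h; rwa [hsh]
  have e1 : 1024 * 0 + 64 * j + i = 64 * j + i := by omega
  have e : ∀ d, code d i j = 1024 * d + (64 * j + i) := fun d => by unfold code; omega
  rw [e] at hS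
  simp only [vertices, nat_lor, nat_shiftLeft, Nat.testBit_or, Bool.or_eq_true]
  interval_cases d
  · simp only [if_false, if_true, OfNat.zero_ne_ofNat] at hv
    rw [mul_zero, zero_add, ← h0] at hS
    rcases hv with rfl | rfl
    · exact Or.inl (Or.inl (Or.inl hS))
    · exact Or.inl (Or.inl (Or.inr (g (by simp only; omega) hS)))
  · simp only [OfNat.one_ne_ofNat, one_ne_zero, if_false] at hv
    rw [mul_one, ← hm] at hS
    rcases hv with rfl | rfl
    · exact Or.inl (Or.inr (Or.inl hS))
    · exact Or.inl (Or.inr (Or.inr (g (by simp only; omega) hS)))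
  · simp only [show ¬ (2 = 3) by omega, OfNat.ofNat_ne_zero, if_false, if_true] at hv
    rw [show 1024 * 2 = 2048 by rfl, ← hm] at hS
    rcases hv with rfl | rfl
    · exact Or.inr (Or.inl (Or.inl hS))
    · exact Or.inr (Or.inl (Or.inr (g (by simp only; omega) hS)))
  · simp only [show ¬ (3 = 2) by omega, OfNat.ofNat_ne_zero, if_false, if_true] at hv
    rw [show 1024 * 3 = 3072 by rfl, ← hm] at hS
    rcases hv with rfl | rfl
    · exact Or.inr (Or.inr (Or.inl (g (by simp only; omega) hS)))
    · exact Or.inr (Or.inr (Or.inr (g (by simp only; omega) hS)))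

theorem apart_spec {A B k k' : ℕ} (h : apart A B = true) (hk : k < 4096) (hk' : k' < 4096)
    (hA : A.testBit k = true) (hB : B.testBit k' = true) {v : ℕ × ℕ} (hv : v = src k ∨ v = tgt k) :
    ¬ (v = src k' ∨ v = tgt k') := by
  intro hv'
  have h := congrArg (fun x => Nat.testBit x (64 * v.2 + v.1)) (Nat.eq_of_beq_eq_true h)
  simp only [nat_land, Nat.testBit_and, Nat.zero_testBit, testBit_vertices hk hA hv,
    testBit_vertices hk' hB hv', Bool.and_self, Bool.true_eq_false] at h

theorem apart_symm {A B : ℕ} (h : apart A B = true) : apart B A = true := by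
  simp only [apart, nat_land] at h ⊢
  rwa [Nat.land_comm]

theorem plain_spec {S i j : ℕ} (h : plain S = true) (h1 : S.testBit (code 2 i j) = true)
    (h2 : S.testBit (code 3 i j) = true) : False := by
  have h := congrArg (fun x => Nat.testBit x (64 * j + i)) (Nat.eq_of_beq_eq_true h)
  simp only [nat_land, nat_shiftRight, Nat.testBit_and, Nat.zero_testBit,
    Nat.testBit_shiftRight] at h
  rw [show 2048 + (64 * j + i) = code 2 i j by unfold code; omega,
    show 3072 + (64 * j + i) = code 3 i j by unfold code; omega, h1, h2] at h
  simp at h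

theorem real_lor (h : ℕ × ℕ → ℝ) (A B : ℕ) : G.real h (A ||| B) = G.real h A ∪ G.real h B := by
  ext x
  simp only [Grid.mem_real, Nat.testBit_or, Bool.or_eq_true, mem_union]
  constructor
  · rintro ⟨k, hk, h1 | h1, h2⟩
    exacts [Or.inl ⟨k, hk, h1, h2⟩, Or.inr ⟨k, hk, h1, h2⟩]
  · rintro (⟨k, hk, h1, h2⟩ | ⟨k, hk, h1, h2⟩)
    exacts [⟨k, hk, Or.inl h1, h2⟩, ⟨k, hk, Or.inr h1, h2⟩]

/-- Two edges can only meet in a common vertex, which `apart` excludes, or as the two diagonals of a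
cell, which `plain` excludes. Hence the curves are disjoint and their product is the flat union. -/
theorem Rep.union {A B : ℕ} {x y : Skein n r} (hx : Rep r G A x) (hy : Rep r G B y)
    (h : apart A B = true) (hp : plain (A ||| B) = true) : Rep r G (A ||| B) (x * y) := by
  obtain ⟨L, hL, rfl⟩ := hx
  obtain ⟨M, hM, rfl⟩ := hy
  obtain ⟨N, hN, hN'⟩ := exists_union (L := L) (M := M)
    (fun p hp => Grid.real_flat (hL ▸ hp)) (fun p hp => Grid.real_flat (hM ▸ hp)) (by
      rw [hL, hM, Set.disjoint_left]
      rintro p ⟨k, hk, hkA, hpk⟩ ⟨k', hk', hkB, hpk'⟩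
      rcases Grid.edge_inter hk hk' hpk hpk' rfl with ⟨v, -, -, h1, h2⟩ | rfl |
        ⟨i, hi, j, hj, ⟨rfl, rfl⟩ | ⟨rfl, rfl⟩, -⟩
      · exact apart_spec h hk hk' hkA hkB h1 h2
      · exact apart_spec h hk hk' hkA hkB (Or.inl rfl) (Or.inl rfl)
      · exact plain_spec (i := i) (j := j) hp (by simp [hkA]) (by simp [hkB])
      · exact plain_spec (i := i) (j := j) hp (by simp [hkB]) (by simp [hkA]))
  exact ⟨N, by rw [hN, hL, hM, real_lor], by rw [← toSkein_stack, toSkein_eq r hN']⟩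

/-- Both products are the class of the same flat union. -/
theorem Rep.comm {A B : ℕ} {x y : Skein n r} (hx : Rep r G A x) (hy : Rep r G B y)
    (h : apart A B = true) (hp : plain (A ||| B) = true) : x * y = y * x := by
  have h1 := hx.union hy h hp
  have h2 := hy.union hx (apart_symm h) (by rwa [Nat.lor_comm])
  rw [Nat.lor_comm] at h2
  exact h1.unique h2

/-- If no cell contains two diagonals, the projection is injective on the lifted curve, and the
heights are irrelevant. -/
theorem RepAt.flatten {h : ℕ × ℕ → ℝ} {S : ℕ} {x : Skein n r} (hx : RepAt r G h S x)
    (hp : plain S = true) : Rep r G S x := by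
  obtain ⟨L, hL, rfl⟩ := hx
  obtain ⟨M, hM, hM'⟩ := exists_flatten L (by
    rw [hL]
    rintro p ⟨k, hk, hkS, hpk⟩ q ⟨k', hk', hkS', hqk⟩ e
    rcases Grid.edge_inter hk hk' hpk hqk e with ⟨v, rfl, rfl, -⟩ | rfl |
        ⟨i, hi, j, hj, ⟨rfl, rfl⟩ | ⟨rfl, rfl⟩, -⟩
    · rfl
    · exact Grid.injOn_edge hk hpk hqk e
    · exact (plain_spec hp hkS hkS').elim
    · exact (plain_spec hp hkS' hkS).elim)
  refine ⟨M, ?_, (toSkein_eq r hM').symm⟩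
  rw [hM, hL]
  have e : ∀ k, rescale 0 (1 / 2) '' G.edge h k = G.edge flat k := fun k => by
    rw [Grid.edge, rescale_segment]
    simp only [rescale, Grid.pt, zero_mul, zero_add]
    rfl
  ext p
  constructor
  · rintro ⟨q, ⟨k, hk, hkS, hq⟩, rfl⟩
    exact ⟨k, hk, hkS, by rw [← e]; exact ⟨q, hq, rfl⟩⟩
  · rintro ⟨k, hk, hkS, hq⟩
    rw [← e] at hq
    obtain ⟨q, hq, rfl⟩ := hq
    exact ⟨q, ⟨k, hk, hkS, hq⟩, rfl⟩

/-- Height `3/4` at the vertices in `V` and height `1/4` elsewhere. -/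
noncomputable def heightOf (V : ℕ) (v : ℕ × ℕ) : ℝ := if V.testBit (64 * v.2 + v.1) then 3 / 4 else 1 / 4

/-- Stacking two links of height `1/2` puts them at the heights `3/4` and `1/4`. The curves have no
common vertex, so these heights are a function on the vertices. -/
theorem Rep.stack {P Q : ℕ} {x y : Skein n r} (hx : Rep r G P x) (hy : Rep r G Q y)
    (h : apart P Q = true) : RepAt r G (heightOf (vertices P)) (P ||| Q) (x * y) := by
  obtain ⟨L, hL, rfl⟩ := hx
  obtain ⟨M, hM, rfl⟩ := hy
  refine ⟨L.stack M, ?_, toSkein_stack r L M⟩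
  have aux : ∀ {S : ℕ} {c d : ℝ}, (∀ k < 4096, S.testBit k = true → ∀ v, v = src k ∨ v = tgt k →
      heightOf (vertices P) v = c * (1 / 2) + d) →
      rescale c d '' G.real flat S = G.real (heightOf (vertices P)) S := by
    intro S c d hS
    have e : ∀ k < 4096, S.testBit k = true →
        rescale c d '' G.edge flat k = G.edge (heightOf (vertices P)) k := by
      intro k hk hkS
      rw [Grid.edge, rescale_segment]
      simp only [rescale, Grid.pt, flat, Grid.edge, hS k hk hkS _ (Or.inl rfl),
        hS k hk hkS _ (Or.inr rfl)]
    ext p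
    constructor
    · rintro ⟨q, ⟨k, hk, hkS, hq⟩, rfl⟩
      exact ⟨k, hk, hkS, by rw [← e k hk hkS]; exact ⟨q, hq, rfl⟩⟩
    · rintro ⟨k, hk, hkS, hq⟩
      rw [← e k hk hkS] at hq
      obtain ⟨q, hq, rfl⟩ := hq
      exact ⟨q, ⟨k, hk, hkS, hq⟩, rfl⟩
  rw [real_lor]
  change up '' L.carrier ∪ down '' M.carrier = _
  rw [hL, hM, aux, aux]
  · intro k hk hkS v hv
    have : ¬ (vertices P).testBit (64 * v.2 + v.1) = true := fun h' => by
      have h := congrArg (fun x => Nat.testBit x (64 * v.2 + v.1)) (Nat.eq_of_beq_eq_true h)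
      simp only [nat_land, Nat.testBit_and, Nat.zero_testBit, testBit_vertices hk hkS hv, h',
        Bool.and_self, Bool.true_eq_false] at h
    rw [heightOf, if_neg this]; norm_num
  · intro k hk hkS v hv
    rw [heightOf, if_pos (testBit_vertices hk hkS hv)]; norm_num

theorem testBit_smoothMask (b : Bool) (c : ℕ) : (smoothMask b).testBit c =
    decide (c = 2048 ∨ c = 3072 ∨ (bif b then (c = 1024 ∨ c = 1025 : Bool) else (c = 0 ∨ c = 64 : Bool))) := by
  cases b <;> simp [smoothMask, nat_lor, Nat.testBit_or, testBit_bit, Bool.decide_or, or_assoc, Bool.or_assoc]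

theorem testBit_smooth (b : Bool) (S k c : ℕ) : (smooth b S k).testBit c =
    (S.testBit c ^^ (decide (k ≤ c) && (smoothMask b).testBit (c - k))) := by
  rw [smooth, nat_xor, nat_shiftLeft, Nat.testBit_xor, Nat.testBit_shiftLeft]

/-- The coefficient `q^{1/2}` belongs to the vertical sides if the rising diagonal is on top and to
the horizontal sides if the falling one is. In both cases this is `smooth b`. -/
theorem crossing_sound (hG : FreeGrid n G) {b : Bool} {S V k : ℕ} (h : crossing b S V k = true)
    {x : Skein n r} (hx : RepAt r G (heightOf V) S x) :
    ∃ x1 x0 : Skein n r, RepAt r G (heightOf V) (smooth b S k) x1 ∧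
      RepAt r G (heightOf V) (smooth (!b) S k) x0 ∧ x = (r : R) • x1 + (↑r⁻¹ : R) • x0 := by
  simp only [crossing, Bool.and_eq_true] at h
  obtain ⟨hk, h1, h2⟩ := h
  simp only [free, Bool.and_eq_true, Nat.ble_eq, Bool.or_eq_true, Bool.not_eq_true',
    ← Bool.not_eq_true, Nat.beq_eq] at hk
  obtain ⟨hi, hi', hj, hj', hf⟩ := hk
  obtain ⟨i, j, rfl, ei, ej⟩ : ∃ i j, k = 64 * j + i ∧ k % 64 = i ∧ k / 64 = j :=
    ⟨k % 64, k / 64, by omega, rfl, rfl⟩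
  rw [ei] at hi hi' hf
  rw [ej] at hj hj' hf
  have hs := hG i j hf
  have h1 : ∀ c, _ := fun c => congrArg (fun x => Nat.testBit x c) (Nat.eq_of_beq_eq_true h1)
  have h2 : ∀ c, _ := fun c => congrArg (fun x => Nat.testBit x c) (Nat.eq_of_beq_eq_true h2)
  simp only [nat_land, nat_lor, nat_shiftRight, Nat.testBit_and, Nat.testBit_or, testBit_bit,
    Nat.testBit_shiftRight, testBit_smoothMask] at h1 h2
  have sD : S.testBit (code 2 i j) = true := by
    have := h1 2048
    rw [show 64 * j + i + 2048 = code 2 i j by unfold code; omega] at this; simpa using this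
  have sA : S.testBit (code 3 i j) = true := by
    have := h1 3072
    rw [show 64 * j + i + 3072 = code 3 i j by unfold code; omega] at this; simpa using this
  have sb : S.testBit (code 0 i j) = false := by
    have := h1 0
    rw [show 64 * j + i + 0 = code 0 i j by unfold code; omega] at this; simpa using this
  have st : S.testBit (code 0 i (j + 1)) = false := by
    have := h1 64
    rw [show 64 * j + i + 64 = code 0 i (j + 1) by unfold code; omega] at this; simpa using this
  have sl : S.testBit (code 1 i j) = false := by
    have := h1 1024
    rw [show 64 * j + i + 1024 = code 1 i j by unfold code; omega] at this; simpa using this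
  have sr : S.testBit (code 1 (i + 1) j) = false := by
    have := h1 1025
    rw [show 64 * j + i + 1025 = code 1 (i + 1) j by unfold code; omega] at this; simpa using this
  have v00 := h2 0
  have v10 := h2 1
  have v01 := h2 64
  have v11 := h2 65
  have e00 : 64 * j + i + 0 = 64 * ((i, j) : ℕ × ℕ).2 + ((i, j) : ℕ × ℕ).1 := rfl
  have e10 : 64 * j + i + 1 = 64 * ((i + 1, j) : ℕ × ℕ).2 + ((i + 1, j) : ℕ × ℕ).1 := by
    simp only; omega
  have e01 : 64 * j + i + 64 = 64 * ((i, j + 1) : ℕ × ℕ).2 + ((i, j + 1) : ℕ × ℕ).1 := by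
    simp only; omega
  have e11 : 64 * j + i + 65 = 64 * ((i + 1, j + 1) : ℕ × ℕ).2 + ((i + 1, j + 1) : ℕ × ℕ).1 := by
    simp only; omega
  rw [e00] at v00
  rw [e10] at v10
  rw [e01] at v01
  rw [e11] at v11
  have cD : 64 * j + i + 2048 = code 2 i j := by unfold code; omega
  -- The mask is added modulo 2. It removes the two diagonals, which are present, and inserts two
  -- sides, which are absent.
  have sm : ∀ (b : Bool) (k u v : ℕ), (∀ c, (smoothMask b).testBit c =
      decide (c = 2048 ∨ c = 3072 ∨ c = u ∨ c = v)) →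
      S.testBit (64 * j + i + u) = false → S.testBit (64 * j + i + v) = false →
      u ≠ 2048 → u ≠ 3072 → v ≠ 2048 → v ≠ 3072 →
      (smooth b S (64 * j + i)).testBit k = ((S.testBit k && !decide (k = code 2 i j ∨ k = code 3 i j)) ||
        decide (k = 64 * j + i + u ∨ k = 64 * j + i + v)) := by
    intro b k u v hm hu hv n1 n2 n3 n4
    have c2 : code 2 i j = 64 * j + i + 2048 := by unfold code; omega
    have c3 : code 3 i j = 64 * j + i + 3072 := by unfold code; omega
    rw [c2] at sD ⊢
    rw [c3] at sA ⊢
    rw [testBit_smooth, hm]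
    by_cases hk : 64 * j + i ≤ k
    · obtain ⟨c, rfl⟩ := Nat.exists_eq_add_of_le hk
      simp only [Nat.add_sub_cancel_left, add_right_inj, hk, decide_true, Bool.true_and]
      by_cases k1 : c = 2048
      · subst k1; simp [sD, Ne.symm n1, Ne.symm n3]
      by_cases k2 : c = 3072
      · subst k2; simp [sA, Ne.symm n2, Ne.symm n4]
      by_cases k3 : c = u
      · subst k3; simp [hu]
      by_cases k4 : c = v
      · subst k4; simp [hv]
      simp [k1, k2, k3, k4]
    · have : ∀ c, k ≠ 64 * j + i + c := fun c => by omega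
      simp [hk, this]
  have smV := fun k => sm true k 1024 1025 (fun c => by simp [testBit_smoothMask])
    (by rw [show 64 * j + i + 1024 = code 1 i j by unfold code; omega]; exact sl)
    (by rw [show 64 * j + i + 1025 = code 1 (i + 1) j by unfold code; omega]; exact sr)
    (by norm_num) (by norm_num) (by norm_num) (by norm_num)
  have smH := fun k => sm false k 0 64 (fun c => by simp [testBit_smoothMask])
    (by rw [show 64 * j + i + 0 = code 0 i j by unfold code; omega]; exact sb)
    (by rw [show 64 * j + i + 64 = code 0 i (j + 1) by unfold code; omega]; exact st)
    (by norm_num) (by norm_num) (by norm_num) (by norm_num)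
  rw [show 64 * j + i + 1024 = code 1 i j by unfold code; omega,
    show 64 * j + i + 1025 = code 1 (i + 1) j by unfold code; omega] at smV
  rw [show 64 * j + i + 0 = code 0 i j by unfold code; omega,
    show 64 * j + i + 64 = code 0 i (j + 1) by unfold code; omega] at smH
  have H1 : ∀ {v : ℕ × ℕ}, V.testBit (64 * v.2 + v.1) = true → heightOf V v = 3 / 4 :=
    fun hv => by rw [heightOf, if_pos hv]
  have H0 : ∀ {v : ℕ × ℕ}, V.testBit (64 * v.2 + v.1) = false → heightOf V v = 1 / 4 :=
    fun hv => by rw [heightOf, if_neg (by rw [hv]; simp)]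
  have swap : ∀ {k a b : ℕ}, decide (k = a ∨ k = b) = decide (k = b ∨ k = a) :=
    fun {k a b} => by rw [decide_eq_decide, or_comm]
  cases b
  · simp only [cond_false, Nat.testBit_or, testBit_bit] at v00 v10 v01 v11
    norm_num at v00 v10 v01 v11
    refine smoothing (quad_falling (i := i) (j := j) (by omega) (by omega)) (det_falling G _ i j) hs
      (H1 v10) (H0 v11) (H1 v01) (H0 v00) sA sD sr st sl sb ?_ ?_ hx
    · intro k; rw [smH k, swap (a := code 2 i j), swap (a := code 0 i j)]
    · intro k; rw [Bool.not_false, smV k, swap (a := code 2 i j), swap (a := code 1 i j)]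
  · simp only [cond_true, Nat.testBit_or, testBit_bit] at v00 v10 v01 v11
    norm_num at v00 v10 v01 v11
    refine smoothing (quad_rising (i := i) (j := j) (by omega) (by omega)) (det_rising G _ i j) hs
      (H1 v00) (H0 v10) (H1 v11) (H0 v01) sD sA sb sr st sl ?_ ?_ hx
    · intro k; rw [smV k, swap (a := code 1 i j)]
    · intro k; rw [Bool.not_true, smH k]

variable (r G) in
/-- The value of a diagram with crossings in a list by the skein relations. -/
noncomputable def expansion : List (ℕ × Bool) → ℕ → Skein n r
  | [], S => cl r G S
  | (k, b) :: l, S => (r : R) • expansion l (smooth b S k) + (↑r⁻¹ : R) • expansion l (smooth (!b) S k)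

/-- The second conclusion records that every state is an actual link. This provides curves around
four and five punctures, for which no generator is given. -/
theorem good_sound (hG : FreeGrid n G) {V : ℕ} (l : List (ℕ × Bool)) : ∀ {S : ℕ} {x : Skein n r},
    good V l S = true → RepAt r G (heightOf V) S x →
      x = expansion r G l S ∧ ∀ T ∈ leaves l S, ∃ y : Skein n r, Rep r G T y := by
  induction l with
  | nil =>
    intro S x h hx
    have := hx.flatten h
    exact ⟨this.cl_eq.symm, fun T hT => ⟨x, by rw [List.mem_singleton.mp hT]; exact this⟩⟩
  | cons kb l ih =>
    obtain ⟨k, b⟩ := kb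
    intro S x h hx
    simp only [good, Bool.and_eq_true] at h
    obtain ⟨h1, h2, h3⟩ := h
    obtain ⟨x1, x0, hx1, hx0, rfl⟩ := crossing_sound hG h1 hx
    have hb : good V l (smooth b S k) = true ∧ good V l (smooth (!b) S k) = true := by
      cases b <;> simp [h2, h3]
    obtain ⟨e1, t1⟩ := ih hb.1 hx1
    obtain ⟨e0, t0⟩ := ih hb.2 hx0
    refine ⟨by rw [expansion, ← e1, ← e0], fun T hT => ?_⟩
    rw [leaves, List.mem_append] at hT
    -- In `leaves` the vertical smoothing always comes first, whichever diagonal is on top, so one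
    -- list of states serves both orders of a product.
    cases b
    · exact hT.elim (t0 T) (t1 T)
    · exact hT.elim (t1 T) (t0 T)

theorem strip_sound (hG : FreeGrid n G) (l : List ℕ) : ∀ S, Iso (n := n) r G S (strip l S) := by
  induction l with
  | nil => exact fun S => Iso.refl S
  | cons k l ih =>
    intro S
    have step : ∀ c, (free k && legal (Nat.shiftRight S (k - 65)) c) = true →
        Iso (n := n) r G S (strip l (Nat.xor S (Nat.shiftLeft (mask c) (k - 65)))) := by
      intro c h
      rw [Bool.and_eq_true] at h
      exact (legal_sound hG h.1 h.2).trans (ih _)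
    rw [strip]
    cases h0 : (free k && legal (Nat.shiftRight S (k - 65)) 0)
    · cases h1 : (free k && legal (Nat.shiftRight S (k - 65)) 1)
      · cases h2 : (free k && legal (Nat.shiftRight S (k - 65)) 2)
        · cases h3 : (free k && legal (Nat.shiftRight S (k - 65)) 3)
          · exact ih S
          · exact step 3 h3
        · exact step 2 h2
      · exact step 1 h1
    · exact step 0 h0

/-- One drawing is read with `P` on top and with `Q` on top. The states are the same, and the list
of crossings changes to its mirror. -/
theorem diagram_sound (hG : FreeGrid n G) {A B P Q : ℕ} {l : List (ℕ × Bool)}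
    (h : diagram A B P Q l = true) {a b : Skein n r} (ha : Rep r G A a) (hb : Rep r G B b) :
    a * b = expansion r G l (Nat.lor P Q) ∧ b * a = expansion r G (mirror l) (Nat.lor P Q) ∧
      ∀ T ∈ leaves l (Nat.lor P Q), ∃ y : Skein n r, Rep r G T y := by
  simp only [diagram, Bool.and_eq_true] at h
  obtain ⟨h1, h2, h3, h4, h5⟩ := h
  have hP := ((chase_sound hG h1).trans (strip_sound hG _ P).symm a).mp ha
  have hQ := ((chase_sound hG h2).trans (strip_sound hG _ Q).symm b).mp hb
  have k1 := good_sound hG l h4 (hP.stack hQ h3)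
  have k2 := hQ.stack hP (apart_symm h3)
  rw [Nat.lor_comm] at k2
  exact ⟨k1.1, (good_sound hG _ h5 k2).1, k1.2⟩

/-- The skein relation removes the boundary of a triangle. One triangle move turns the boundary of
the cell into the boundary of one of its halves, disjoint from `U`. -/
theorem circle_sound (hG : FreeGrid n G) {U k : ℕ} (h : isolated U k = true) {x : Skein n r}
    (hx : Rep r G U x) (hy : ∃ y : Skein n r, Rep r G (Nat.xor U (Nat.shiftLeft square (k - 65))) y) :
    cl r G (Nat.xor U (Nat.shiftLeft square (k - 65))) = -alpha r • x := by
  obtain ⟨y, hy⟩ := hy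
  simp only [isolated, Bool.and_eq_true] at h
  obtain ⟨hk, h1, h2⟩ := h
  have hz := (legal_sound (r := r) hG hk h2 y).mp hy
  -- The boundary of the cell plus that of the half without corner `0` is the boundary of the half
  -- without corner `3`.
  have e : Nat.xor (Nat.xor U (Nat.shiftLeft square (k - 65))) (Nat.shiftLeft (mask 0) (k - 65)) =
      U ^^^ (mask 3 <<< (k - 65)) := by
    simp only [nat_xor, nat_shiftLeft]
    rw [Nat.xor_assoc, ← Nat.shiftLeft_xor_distrib,
      show square ^^^ mask 0 = mask 3 by decide +kernel]
  rw [e] at hz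
  rw [hy.cl_eq]
  simp only [free, Bool.and_eq_true, Nat.ble_eq, Bool.or_eq_true, Bool.not_eq_true',
    ← Bool.not_eq_true, Nat.beq_eq] at hk
  obtain ⟨hi, hi', hj, hj', hf⟩ := hk
  obtain ⟨i, j, rfl, ei, ej⟩ : ∃ i j, k = 64 * j + i ∧ k % 64 = i ∧ k / 64 = j :=
    ⟨k % 64, k / 64, by omega, rfl, rfl⟩
  rw [ei] at hi hi' hf
  rw [ej] at hj hj' hf
  rw [show 64 * j + i - 65 = 64 * (j - 1) + (i - 1) by omega] at *
  have hs := hG i j hf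
  have H := half_base (n := n) (G := G) (i := i) (j := j) (by omega) (by omega) hs
    (Or.inl ⟨rfl, rfl, rfl, rfl, rfl, rfl⟩)
  have h1 : ∀ c, _ := fun c => congrArg (fun x => Nat.testBit x c) (Nat.eq_of_beq_eq_true h1)
  simp only [nat_land, nat_lor, nat_shiftRight, Nat.testBit_and, Nat.testBit_or,
    Nat.testBit_shiftRight, Nat.zero_testBit] at h1
  have clear : ∀ a b, 1 ≤ a ∧ a ≤ 2 → 1 ≤ b ∧ b ≤ 2 → ∀ c, (around a b).testBit c = true →
      U.testBit (64 * (j - 1) + (i - 1) + c) = false := by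
    intro a b ha hb c hc
    have h := h1 c
    have : a = 1 ∨ a = 2 := by omega
    have : b = 1 ∨ b = 2 := by omega
    rcases ‹a = 1 ∨ a = 2› with rfl | rfl <;> rcases ‹b = 1 ∨ b = 2› with rfl | rfl <;>
      simpa [hc] using h
  have cb : code 0 i j = 64 * (j - 1) + (i - 1) + code 0 1 1 := by unfold code; omega
  have cl' : code 1 i j = 64 * (j - 1) + (i - 1) + code 1 1 1 := by unfold code; omega
  have ca : code 3 i j = 64 * (j - 1) + (i - 1) + code 3 1 1 := by unfold code; omega
  have cd : code 2 i j = 64 * (j - 1) + (i - 1) + code 2 1 1 := by unfold code; omega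
  have ub : U.testBit (code 0 i j) = false := by
    rw [cb]; exact clear 1 1 (by omega) (by omega) _ (by decide +kernel)
  have ul : U.testBit (code 1 i j) = false := by
    rw [cl']; exact clear 1 1 (by omega) (by omega) _ (by decide +kernel)
  have ua : U.testBit (code 3 i j) = false := by
    rw [ca]; exact clear 2 1 (by omega) (by omega) _ (by decide +kernel)
  have ud : U.testBit (code 2 i j) = false := by
    rw [cd]; exact clear 1 1 (by omega) (by omega) _ (by decide +kernel)
  obtain ⟨L, hL, rfl⟩ := hx
  obtain ⟨M, hM, rfl⟩ := hz
  have hT : ∀ k, (U ^^^ (mask 3 <<< (64 * (j - 1) + (i - 1)))).testBit k =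
      (U.testBit k || decide (k = code 0 i j ∨ k = code 1 i j ∨ k = code 3 i j)) := by
    intro k
    have e : (mask 3 <<< (64 * (j - 1) + (i - 1))).testBit k =
        decide (k = code 0 i j ∨ k = code 1 i j ∨ k = code 3 i j) := by
      rw [Bool.eq_iff_iff, testBit_shiftLeft_add, decide_eq_true_eq, cb, cl', ca]
      simp only [mask, nat_lor, Nat.testBit_or, testBit_bit, Bool.or_eq_true, decide_eq_true_eq]
      constructor
      · rintro ⟨c, rfl, rfl | rfl | rfl⟩ <;> simp
      · rintro (rfl | rfl | rfl)
        exacts [⟨_, rfl, by simp⟩, ⟨_, rfl, by simp⟩, ⟨_, rfl, by simp⟩]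
    rw [Nat.testBit_xor, e]
    by_cases k1 : k = code 0 i j
    · simp [k1, ub]
    by_cases k2 : k = code 1 i j
    · simp [k2, ul]
    by_cases k3 : k = code 3 i j
    · simp [k3, ua]
    simp [k1, k2, k3]
  refine toSkein_circle r ⟨_, _, _, H.sub, locInj_of_injOn (injOn_fst_of_flat fun x hx =>
    Grid.triangle_flat rfl rfl rfl hx), ?_, ?_⟩
  · rw [hL, Set.disjoint_left]
    rintro x ⟨k, hk, hkU, hx⟩ hxT
    rcases H.inter k hk x hx hxT with ⟨y, rfl, hy1, hy2⟩ | rfl | rfl | rfl | rfl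
    · have : ∃ a b, (1 ≤ a ∧ a ≤ 2) ∧ (1 ≤ b ∧ b ≤ 2) ∧ y = (i - 1 + a, j - 1 + b) := by
        rcases hy2 with rfl | rfl | rfl
        · exact ⟨1, 1, by omega, by omega, Prod.ext (by simp only; omega) (by simp only; omega)⟩
        · exact ⟨2, 1, by omega, by omega, Prod.ext (by simp only; omega) (by simp only; omega)⟩
        · exact ⟨1, 2, by omega, by omega, Prod.ext (by simp only; omega) (by simp only; omega)⟩
      obtain ⟨a, b, ha, hb, rfl⟩ := this
      obtain ⟨c, rfl, hc⟩ := exists_around (i := i) (j := j) ⟨hi, hi'⟩ ⟨hj, hj'⟩ ha hb hk hy1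
      rw [clear a b ha hb c hc] at hkU
      cases hkU
    · rw [ub] at hkU; cases hkU
    · rw [ul] at hkU; cases hkU
    · rw [ua] at hkU; cases hkU
    · rw [ud] at hkU; cases hkU
  · rw [hM, hL]
    have e1 := H.uv
    have e2 := H.uw
    have e3 := H.wv
    ext x
    constructor
    · rintro ⟨k, hk, hkT, hx⟩
      rw [hT, Bool.or_eq_true, decide_eq_true_eq] at hkT
      rcases hkT with h | rfl | rfl | rfl
      · exact Or.inl ⟨k, hk, h, hx⟩
      · rw [e1] at hx; exact Or.inr (Or.inl (Or.inl hx))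
      · rw [e2, segment_symm] at hx; exact Or.inr (Or.inr hx)
      · rw [e3, segment_symm] at hx; exact Or.inr (Or.inl (Or.inr hx))
    · rintro (⟨k, hk, h, hx⟩ | (hx | hx) | hx)
      · exact ⟨k, hk, by rw [hT, h]; rfl, hx⟩
      · exact ⟨_, H.lt.1, by rw [hT]; simp, by rwa [e1]⟩
      · exact ⟨_, H.lt.2.2, by rw [hT]; simp, by rw [e3, segment_symm]; exact hx⟩
      · exact ⟨_, H.lt.2.1, by rw [hT]; simp, by rw [e2, segment_symm]; exact hx⟩

end Products

end PlanarSkein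

/-! ### Combs and the diagrams of their products -/

namespace PlanarSkein

namespace Engine

/-- The horizontal line from `(x, y)` to `(x', y)`. -/
def hline (x x' y : ℕ) : ℕ := Nat.shiftLeft (Nat.sub (Nat.shiftLeft 1 (x' - x)) 1) (64 * y + x)

/-- The vertical line of length `m` that goes up from `(x, y)`. -/
def vline (x y : ℕ) : ℕ → ℕ
  | 0 => 0
  | m + 1 => Nat.xor (bit (code 1 x (y + m))) (vline x y m)

/-- The boundary of a rectangle. -/
def rect (x y x' y' : ℕ) : ℕ :=
  Nat.xor (Nat.xor (hline x x' y) (hline x x' y')) (Nat.xor (vline x y (y' - y)) (vline x' y (y' - y)))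

/-- Rectangles around the punctures in a list. -/
def teeth (w top cap : ℕ) : List ℕ → ℕ
  | [] => 0
  | k :: K => Nat.xor (rect (6 * k + w) top (6 * k + 5 - w) cap) (teeth w top cap K)

def first : List ℕ → ℕ
  | [] => 0
  | k :: _ => k

def final : List ℕ → ℕ
  | [] => 0
  | [k] => k
  | _ :: K => final K

/-- The boundary of a comb with teeth at the punctures in the increasing list `K`. -/
def comb (w bot top cap : ℕ) (K : List ℕ) : ℕ :=
  Nat.xor (rect (6 * first K + w) bot (6 * final K + 5 - w) top) (teeth w top cap K)

/-- Combs of various sizes. -/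
def shape : ℕ → List ℕ → ℕ
  -- Shape `1` fits inside shape `0`. The body of shape `2` lies just below the punctures and above
  -- the bodies of all other shapes. The body of shape `3` lies above that of shape `4`.
  | 0 => comb 0 1 4 9
  | 1 => comb 1 2 3 8
  | 2 => comb 2 5 6 7
  | 3 => comb 1 3 4 8
  | _ => comb 0 1 2 9

/-- The sum of the edges with the codes in a list. -/
def sum : List ℕ → ℕ
  | [] => 0
  | c :: l => Nat.xor (bit c) (sum l)

def isIn (k : ℕ) : List ℕ → Bool
  | [] => false
  | i :: I => Nat.beq k i || isIn k I

/-- The large comb `P` at `I` and the small comb `Q` at `J`, deformed near their crossings, and the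
list of crossings. -/
def teethCross (I : List ℕ) (lo hi : ℕ) : List ℕ → ℕ × ℕ × List (ℕ × Bool)
  | [] => (0, 0, [])
  | k :: J =>
    match teethCross I lo hi J with
    | (P, Q, l) =>
      let a := 6 * k + 1
      let b := 6 * k + 2
      let c := 6 * k + 3
      let d := 6 * k + 4
      -- Beyond the ends of the large comb the body of the small one is thickened up to level `4`.
      -- Its overlap with the tooth is added once more, so that it counts an odd number of times.
      bif Nat.blt k lo || Nat.blt hi k then (P, Nat.xor (rect a 3 d 4) Q, l) else
      -- The small tooth lies inside a large tooth and crosses nothing. In the remaining case it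
      -- leaves the large body through the top, with one crossing on either side of the tooth.
      bif isIn k I then (P, Q, l) else
      (Nat.xor (Nat.xor (rect b 3 c 4) (sum [code 0 a 4, code 1 b 3, code 3 a 3, code 0 c 4,
          code 1 c 3, code 2 c 3])) P,
        Nat.xor (Nat.xor (Nat.xor (rect a 3 d 8) (rect b 3 c 7)) (sum [code 0 a 3, code 1 b 3,
          code 2 a 3, code 0 c 3, code 1 c 3, code 3 c 3])) Q,
        (64 * 3 + a, false) :: (64 * 3 + c, true) :: l)

/-- If `J` reaches further to the right than `I`, the small body leaves the large one through its
right end, with crossings in the rows `3` and `1`. Outside it is thickened from the levels `2, 3` to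
the levels `1, 4`. `leftCross` is the mirror image. -/
def rightCross (hi m : ℕ) : ℕ × ℕ × List (ℕ × Bool) :=
  bif Nat.ble m hi then (0, 0, []) else
  let s := 6 * hi + 5
  let e := 6 * m + 4
  (Nat.xor (rect s 2 (s + 1) 3) (sum [code 1 s 3, code 0 s 3, code 3 s 3, code 1 s 1, code 0 s 2,
      code 2 s 1]),
    Nat.xor (Nat.xor (rect (s + 1) 3 e 4) (rect (s + 1) 1 e 2)) (sum [code 0 s 3, code 1 (s + 1) 3,
      code 2 s 3, code 0 s 2, code 1 (s + 1) 1, code 3 s 1]),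
    [(64 * 3 + s, false), (64 * 1 + s, true)])

def leftCross (lo m : ℕ) : ℕ × ℕ × List (ℕ × Bool) :=
  bif Nat.ble lo m then (0, 0, []) else
  let s := 6 * lo
  let e := 6 * m + 1
  (Nat.xor (rect (s - 1) 2 s 3) (sum [code 1 s 3, code 0 (s - 1) 3, code 2 (s - 1) 3, code 1 s 1,
      code 0 (s - 1) 2, code 3 (s - 1) 1]),
    Nat.xor (Nat.xor (rect e 3 (s - 1) 4) (rect e 1 (s - 1) 2)) (sum [code 0 (s - 1) 3,
      code 1 (s - 1) 3, code 3 (s - 1) 3, code 0 (s - 1) 2, code 1 (s - 1) 1, code 2 (s - 1) 1]),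
    [(64 * 3 + (s - 1), true), (64 * 1 + (s - 1), false)])

def plus (x y : ℕ × ℕ × List (ℕ × Bool)) : ℕ × ℕ × List (ℕ × Bool) :=
  (Nat.xor x.1 y.1, Nat.xor x.2.1 y.2.1, x.2.2 ++ y.2.2)

/-- A diagram of the product of the combs at `I` and `J`: the two curves and the crossings. -/
def cross (I J : List ℕ) : ℕ × ℕ × List (ℕ × Bool) :=
  plus (shape 0 I, shape 1 J, []) (plus (teethCross I (first I) (final I) J)
    (plus (rightCross (final I) (final J)) (leftCross (first I) (first J))))

/-- The curves `S` and `T` are isotopic, by moves between them after they have been shortened. -/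
def same (S T : ℕ) : Bool :=
  chase S T || (chase (relax 30 S) T || chase (relax 30 S) (relax 30 T))

/-- The union of some combs. -/
def union : List (ℕ × List ℕ) → ℕ
  | [] => 0
  | (t, K) :: l => Nat.lor (shape t K) (union l)

/-- `union l` is a disjoint union of combs that are isotopic to large ones. -/
def disjointUnion : List (ℕ × List ℕ) → Bool
  | [] => true
  | (t, K) :: l => same (shape t K) (shape 0 K) && (apart (shape t K) (union l) &&
      (plain (union ((t, K) :: l)) && disjointUnion l))

/-- The states in the first list are the unions of combs in the second list, where this is not
empty. -/
def match' : List ℕ → List (List (ℕ × List ℕ)) → Bool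
  | [], [] => true
  | S :: l, [] :: m => match' l m
  | S :: l, (p :: ps) :: m => same S (union (p :: ps)) && (disjointUnion (p :: ps) && match' l m)
  | _, _ => false

def table (I J : List ℕ) (m : List (List (ℕ × List ℕ))) : Bool :=
  match cross I J with
  | (P, Q, l) => diagram (shape 0 I) (shape 0 J) P Q l && match' (leaves l (Nat.lor P Q)) m

end Engine

end PlanarSkein

/-! ### Evaluation of products of combs -/

namespace PlanarSkein

namespace Engine

/-- The smoothing of the crossings in a list that is described by a list of Booleans. -/
def leaf : List (ℕ × Bool) → List Bool → ℕ → ℕ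
  | (k, _) :: l, b :: s, S => leaf l s (smooth b S k)
  | _, _, S => S

/-- A state of the diagram of the product of the combs at `I` and `J`. -/
def state (I J : List ℕ) (s : List Bool) : ℕ :=
  leaf (cross I J).2.2 s (Nat.lor (cross I J).1 (cross I J).2.1)

/-- A curve around four punctures with a gap below the puncture `k`. -/
def channel (k x w : ℕ) : ℕ :=
  let b := 6 * k + 4
  Nat.xor (Nat.xor (shape 0 [1, 2, 3, 4]) (rect (6 * k + 1) 2 b 8))
    (Nat.xor (rect x 3 (x + w) 4) (bif Nat.ble b x then rect b 2 (x + w) 3 else rect x 2 (6 * k + 1) 3))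

/-- The combs at `I` and `J` can be made disjoint. -/
def separate (t : ℕ) (I : List ℕ) (u : ℕ) (J : List ℕ) : Bool :=
  same (shape 0 I) (shape t I) && (same (shape 0 J) (shape u J) &&
    (apart (shape t I) (shape u J) && plain (Nat.lor (shape t I) (shape u J))))

/-- `K` is an increasing list of at most three numbers among `1, …, m`. -/
def small (m : ℕ) : List ℕ → Bool
  | [i] => Nat.blt 0 i && Nat.ble i m
  | [i, j] => Nat.blt 0 i && (Nat.blt i j && Nat.ble j m)
  | [i, j, k] => Nat.blt 0 i && (Nat.blt i j && (Nat.blt j k && Nat.ble k m))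
  | _ => false

/-- The curves around four and around five punctures are needed only as components of states. -/
def allowed (m : ℕ) (K : List ℕ) : Bool :=
  small m K || ((Nat.ble 4 m && decide (K = [1, 2, 3, 4])) || (Nat.ble 5 m && decide (K = [1, 2, 3, 4, 5])))

def allowedAll (m : ℕ) : List (List (ℕ × List ℕ)) → Bool
  | [] => true
  | ps :: l => ps.all (fun p => allowed m p.2) && allowedAll m l

end Engine

open Engine

section Tables

variable {R : Type*} [CommRing R] {n : ℕ} {r : Rˣ} {G : Grid}

theorem same_sound (hG : FreeGrid n G) {S T : ℕ} (h : same S T = true) : Iso (n := n) r G S T := by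
  simp only [same, Bool.or_eq_true] at h
  rcases h with h | h | h
  · exact chase_sound hG h
  · exact (relax_sound hG _ _).trans (chase_sound hG h)
  · exact (relax_sound hG _ _).trans ((chase_sound hG h).trans (relax_sound hG _ _).symm)

variable (r G) in
/-- The class of the comb at `K`. -/
noncomputable def combClass (K : List ℕ) : Skein n r := cl r G (shape 0 K)

variable (n r G) in
/-- All curves around at most three of `m` punctures are there. -/
def Present (m : ℕ) : Prop := ∀ K, small m K = true → ∃ x : Skein n r, Rep r G (shape 0 K) x

variable {m : ℕ}

theorem diagram_cross (hG : FreeGrid n G) (hP : Present n r G m) {I J : List ℕ} (hI : small m I = true) (hJ : small m J = true)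
    (h : diagram (shape 0 I) (shape 0 J) (cross I J).1 (cross I J).2.1 (cross I J).2.2 = true) :
    combClass r G I * combClass r G J =
        (expansion r G (cross I J).2.2 (Nat.lor (cross I J).1 (cross I J).2.1) : Skein n r) ∧
      combClass r G J * combClass r G I =
        (expansion r G (mirror (cross I J).2.2) (Nat.lor (cross I J).1 (cross I J).2.1) : Skein n r) ∧
      ∀ T ∈ leaves (cross I J).2.2 (Nat.lor (cross I J).1 (cross I J).2.1),
        ∃ y : Skein n r, Rep r G T y := by
  obtain ⟨x, hx⟩ := hP I hI
  obtain ⟨y, hy⟩ := hP J hJ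
  have := diagram_sound hG h hx hy
  rwa [← hx.cl_eq, ← hy.cl_eq] at this

/-- Each state of a valid diagram is a link, so a comb that is isotopic to a state is represented by
one. -/
theorem exists_of_state (hG : FreeGrid n G) (hP : Present n r G m) {I J K : List ℕ} (s : ℕ) (hI : small m I = true) (hJ : small m J = true)
    (h : (diagram (shape 0 I) (shape 0 J) (cross I J).1 (cross I J).2.1 (cross I J).2.2 &&
      (decide (s < (leaves (cross I J).2.2 (Nat.lor (cross I J).1 (cross I J).2.1)).length) &&
      same ((leaves (cross I J).2.2 (Nat.lor (cross I J).1 (cross I J).2.1)).getD s 0)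
        (shape 0 K))) = true) : ∃ x : Skein n r, Rep r G (shape 0 K) x := by
  simp only [Bool.and_eq_true, decide_eq_true_eq] at h
  obtain ⟨h1, h2, h3⟩ := h
  rw [List.getD_eq_getElem _ _ h2] at h3
  obtain ⟨y, hy⟩ := (diagram_cross hG hP hI hJ h1).2.2 _ (List.getElem_mem h2)
  exact ⟨y, (same_sound hG h3 y).mp hy⟩

theorem exists_of_allowed (hG : FreeGrid n G) (hP : Present n r G m) {K : List ℕ} (hK : allowed m K = true) :
    ∃ x : Skein n r, Rep r G (shape 0 K) x := by
  have mono : ∀ {k} {K : List ℕ}, k ≤ m → small k K = true → small m K = true := by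
    intro k K hk h
    match K, h with
    | [i], h => simp only [small, Bool.and_eq_true, Nat.ble_eq, Nat.blt_eq] at h ⊢; omega
    | [i, j], h => simp only [small, Bool.and_eq_true, Nat.ble_eq, Nat.blt_eq] at h ⊢; omega
    | [i, j, l], h => simp only [small, Bool.and_eq_true, Nat.ble_eq, Nat.blt_eq] at h ⊢; omega
  simp only [allowed, Bool.or_eq_true, Bool.and_eq_true, Nat.ble_eq, decide_eq_true_eq] at hK
  rcases hK with h | ⟨h, rfl⟩ | ⟨h, rfl⟩
  · exact hP K h
  -- State `7` has one vertical smoothing followed by three horizontal ones, and is isotopic to the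
  -- comb around all four punctures; the same state serves for five punctures.
  · exact exists_of_state hG hP (I := [1, 3]) (J := [2, 4]) 7 (mono h (by decide))
      (mono h (by decide)) (by decide +kernel)
  · exact exists_of_state hG hP (I := [1, 3]) (J := [2, 4, 5]) 7 (mono h (by decide))
      (mono h (by decide)) (by decide +kernel)

theorem union_sound (hG : FreeGrid n G) (hP : Present n r G m) {l : List (ℕ × List ℕ)} (h : disjointUnion l = true) (hl : l ≠ [])
    (ha : ∀ p ∈ l, allowed m p.2 = true) :
    Rep r G (union l) (l.map fun p => (combClass r G p.2 : Skein n r)).prod := by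
  induction l with
  | nil => exact absurd rfl hl
  | cons p l ih =>
    obtain ⟨t, K⟩ := p
    simp only [disjointUnion, Bool.and_eq_true] at h
    obtain ⟨h1, h2, h3, h4⟩ := h
    obtain ⟨x, hx⟩ := exists_of_allowed hG hP (ha _ List.mem_cons_self)
    have h5 : Rep r G (shape t K) (combClass r G K : Skein n r) := by
      rw [combClass, hx.cl_eq]
      exact (same_sound hG h1 x).mpr hx
    rcases eq_or_ne l [] with rfl | hl
    · simpa [union, nat_lor] using h5
    · rw [List.map_cons, List.prod_cons, union]
      exact h5.union (ih h4 hl fun p hp => ha p (List.mem_cons_of_mem _ hp)) h2 h3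

variable (n r G) in
/-- The class of the state `S`, which is the union of the combs in a list if this is not empty. -/
noncomputable def value (S : ℕ) : List (ℕ × List ℕ) → Skein n r
  | [] => cl r G S
  | p :: l => ((p :: l).map fun p => combClass r G p.2).prod

theorem match_sound (hG : FreeGrid n G) (hP : Present n r G m) {l : List ℕ} : ∀ {m' : List (List (ℕ × List ℕ))}, match' l m' = true →
    allowedAll m m' = true → List.Forall₂ (fun S ps => cl r G S = value n r G S ps) l m' := by
  induction l with
  | nil =>
    intro m' h ha
    cases m' with
    | nil => exact List.Forall₂.nil
    | cons => simp [match'] at h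
  | cons S l ih =>
    intro m' h ha
    match m', h, ha with
    | [], h, _ => simp [match'] at h
    | [] :: m', h, ha =>
      simp only [allowedAll, Bool.and_eq_true] at ha
      exact List.Forall₂.cons rfl (ih h ha.2)
    | (p :: ps) :: m', h, ha =>
      simp only [allowedAll, Bool.and_eq_true, List.all_eq_true] at ha
      simp only [match', Bool.and_eq_true] at h
      obtain ⟨h1, h2, h3⟩ := h
      refine List.Forall₂.cons ?_ (ih h3 ha.2)
      rw [(same_sound hG h1).cl_eq, value]
      exact (union_sound hG hP h2 (List.cons_ne_nil _ _) ha.1).cl_eq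

/-- The square of the parameter of a crossing. -/
def turn (r : Rˣ) (b : Bool) : R := bif b then (r : R) ^ 2 else (↑r⁻¹ : R) ^ 2

theorem turn_mul (r : Rˣ) : turn r true * turn r false = 1 := by
  simp only [turn, cond_true, cond_false, ← mul_pow, Units.mul_inv, one_pow]

/-- At two crossings with opposite diagonals on top, equal smoothings have coefficients `r` and
`r⁻¹`, with product `1`. Different smoothings have twice the same coefficient, with product `q` or
`q⁻¹`. -/
theorem expansion_pair {k k' : ℕ} {b : Bool} {l : List (ℕ × Bool)} (S : ℕ) :
    (expansion r G ((k, b) :: (k', !b) :: l) S : Skein n r) =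
      expansion r G l (smooth true (smooth true S k) k') +
      turn r b • expansion r G l (smooth false (smooth true S k) k') +
      turn r (!b) • expansion r G l (smooth true (smooth false S k) k') +
      expansion r G l (smooth false (smooth false S k) k') := by
  have h := r.mul_inv
  cases b <;> simp only [expansion, turn, Bool.not_true, Bool.not_false, cond_true, cond_false]
  · match_scalars <;> grind
  · match_scalars <;> grind

/-- The product of two combs that cross twice. -/
theorem table_two (hG : FreeGrid n G) (hP : Present n r G m) {I J : List ℕ}
    {p₁ p₂ p₃ p₄ : List (ℕ × List ℕ)} {k k' : ℕ} {b : Bool}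
    (h : (small m I && (small m J && (allowedAll m [p₁, p₂, p₃, p₄] &&
      (decide ((cross I J).2.2 = [(k, b), (k', !b)]) && table I J [p₁, p₂, p₃, p₄])))) = true) :
    combClass r G I * combClass r G J = value n r G (state I J [true, true]) p₁ +
        turn r b • value n r G (state I J [true, false]) p₂ +
        turn r (!b) • value n r G (state I J [false, true]) p₃ +
        value n r G (state I J [false, false]) p₄ ∧
      combClass r G J * combClass r G I = value n r G (state I J [true, true]) p₁ +
        turn r (!b) • value n r G (state I J [true, false]) p₂ +
        turn r b • value n r G (state I J [false, true]) p₃ +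
        value n r G (state I J [false, false]) p₄ := by
  simp only [Bool.and_eq_true, decide_eq_true_eq] at h
  obtain ⟨hI, hJ, ha, hc, ht⟩ := h
  unfold table at ht
  simp only [Bool.and_eq_true] at ht
  obtain ⟨h1, h2⟩ := ht
  obtain ⟨e1, e2, -⟩ := diagram_cross hG hP hI hJ h1
  have hm := match_sound hG hP h2 ha
  rw [hc] at hm e1 e2
  simp only [leaves, List.cons_append, List.nil_append, List.forall₂_cons] at hm
  obtain ⟨v1, v2, v3, v4, -⟩ := hm
  simp only [state, hc, leaf]
  rw [← v1, ← v2, ← v3, ← v4, e1, e2]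
  refine ⟨expansion_pair _, ?_⟩
  -- The opposite product has the mirrored crossings, that is, the same formula with `!b` in place
  -- of `b`.
  have := expansion_pair (n := n) (r := r) (G := G) (k := k) (k' := k') (b := !b) (l := [])
    (Nat.lor (cross I J).1 (cross I J).2.1)
  simp only [Bool.not_not] at this
  simp only [mirror, List.map, Bool.not_not]
  exact this

/-- The product of two combs that cross four times. -/
theorem table_four (hG : FreeGrid n G) (hP : Present n r G m) {I J : List ℕ}
    {p : List (List (ℕ × List ℕ))} {k k' l l' : ℕ} {b c : Bool}
    (h : (small m I && (small m J && (allowedAll m p &&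
      (decide ((cross I J).2.2 = [(k, b), (k', !b), (l, c), (l', !c)]) && table I J p)))) = true) :
    let v (s₁ s₂ s₃ s₄ : Bool) (i : ℕ) := value n r G (state I J [s₁, s₂, s₃, s₄]) (p.getD i [])
    let w (b c : Bool) : Skein n r :=
      (v true true true true 0 + turn r c • v true true true false 1 +
          turn r (!c) • v true true false true 2 + v true true false false 3) +
        turn r b • (v true false true true 4 + turn r c • v true false true false 5 +
          turn r (!c) • v true false false true 6 + v true false false false 7) +
        turn r (!b) • (v false true true true 8 + turn r c • v false true true false 9 +
          turn r (!c) • v false true false true 10 + v false true false false 11) +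
        (v false false true true 12 + turn r c • v false false true false 13 +
          turn r (!c) • v false false false true 14 + v false false false false 15)
    combClass r G I * combClass r G J = w b c ∧ combClass r G J * combClass r G I = w (!b) (!c) := by
  simp only [Bool.and_eq_true, decide_eq_true_eq] at h
  obtain ⟨hI, hJ, ha, hc, ht⟩ := h
  unfold table at ht
  simp only [Bool.and_eq_true] at ht
  obtain ⟨h1, h2⟩ := ht
  obtain ⟨e1, e2, -⟩ := diagram_cross hG hP hI hJ h1
  have hm := match_sound hG hP h2 ha
  rw [hc] at hm e1 e2
  simp only [leaves, List.cons_append, List.nil_append, List.forall₂_cons_left_iff] at hm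
  obtain ⟨_, _, v1, ⟨_, _, v2, ⟨_, _, v3, ⟨_, _, v4, ⟨_, _, v5, ⟨_, _, v6, ⟨_, _, v7, ⟨_, _, v8,
    ⟨_, _, v9, ⟨_, _, v10, ⟨_, _, v11, ⟨_, _, v12, ⟨_, _, v13, ⟨_, _, v14, ⟨_, _, v15, ⟨_, _, v16, hm, rfl⟩,
    rfl⟩, rfl⟩, rfl⟩, rfl⟩, rfl⟩, rfl⟩, rfl⟩, rfl⟩, rfl⟩, rfl⟩, rfl⟩, rfl⟩, rfl⟩, rfl⟩, rfl⟩ := hm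
  simp only [state, hc, leaf, List.getD_cons_zero, List.getD_cons_succ]
  rw [← v1, ← v2, ← v3, ← v4, ← v5, ← v6, ← v7, ← v8, ← v9, ← v10, ← v11, ← v12, ← v13, ← v14,
    ← v15, ← v16, e1, e2]
  have H : ∀ b c, (expansion r G [(k, b), (k', !b), (l, c), (l', !c)]
      (Nat.lor (cross I J).1 (cross I J).2.1) : Skein n r) = _ := fun b c => by
    rw [expansion_pair, expansion_pair, expansion_pair, expansion_pair, expansion_pair]
  refine ⟨H b c, ?_⟩
  have := H (!b) (!c)
  simp only [Bool.not_not] at this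
  simp only [mirror, List.map, Bool.not_not]
  exact this

theorem separate_sound (hG : FreeGrid n G) (hP : Present n r G m) {I J : List ℕ} (t u : ℕ)
    (h : (small m I && (small m J && separate t I u J)) = true) :
    (combClass r G I * combClass r G J : Skein n r) = combClass r G J * combClass r G I := by
  simp only [separate, Bool.and_eq_true] at h
  obtain ⟨hI, hJ, h1, h2, h3, h4⟩ := h
  obtain ⟨x, hx⟩ := hP I hI
  obtain ⟨y, hy⟩ := hP J hJ
  rw [combClass, combClass, hx.cl_eq, hy.cl_eq]
  exact ((same_sound hG h1 x).mp hx).comm ((same_sound hG h2 y).mp hy) h3 h4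

end Tables

end PlanarSkein

/-! ### Products of curves that cross twice -/

namespace PlanarSkein

open Engine

/-- `x` and `y` occur in the products of `A` and `B` with coefficients `q` and `q'`. -/
def Bigon {R S : Type*} [CommRing R] [Ring S] [Algebra R S] (q q' : R) (A B x y E : S) : Prop :=
  A * B = q • x + q' • y + E ∧ B * A = q' • x + q • y + E

section Facts

variable {R : Type*} [CommRing R] {n : ℕ} {r : Rˣ} {G : Grid}

local notation "C" => combClass (n := n) r G

variable (n r G) in
/-- The class of a state of a product of two combs that intersect twice. -/
noncomputable def connected (I J : List ℕ) (b : Bool) : Skein n r := cl r G (state I J [b, !b])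

local notation "X" => connected n r G

local notation "u" => turn r true

local notation "v" => turn r false

/-- Equal smoothings of the two crossings give the disjoint unions in `E`. Of the two mixed states
one is a comb, and the other one, `connected`, stays anonymous. The three products are the cyclic
rotations of one. -/
theorem combs_three (hG : FreeGrid n G) (hP : Present n r G 3) :
    Bigon u v (C [2, 3]) (C [1, 2]) (C [1, 3]) (X [1, 2] [2, 3] false)
        (C [1] * C [3] + C [1, 2, 3] * C [2]) ∧
      Bigon u v (C [1, 3]) (C [2, 3]) (C [1, 2]) (X [1, 3] [2, 3] true)
        (C [1] * C [2] + C [1, 2, 3] * C [3]) ∧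
      Bigon u v (C [1, 2]) (C [1, 3]) (C [2, 3]) (X [1, 2] [1, 3] true)
        (C [2] * C [3] + C [1, 2, 3] * C [1]) := by
  -- The crossing cells are numbered `64 * j + i`: here `209` and `81` are the cells `(17, 3)` and
  -- `(17, 1)` at the right end of the large comb.
  have h1 := table_two hG hP (I := [1, 2]) (J := [2, 3]) (p₁ := [(0, [1]), (2, [3])]) (p₂ := [(1, [1, 3])])
    (p₃ := []) (p₄ := [(0, [1, 2, 3]), (1, [2])]) (k := 209) (k' := 81) (b := false) (by decide +kernel)
  have h2 := table_two hG hP (I := [1, 3]) (J := [2, 3]) (p₁ := [(0, [1]), (1, [2])]) (p₂ := [])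
    (p₃ := [(1, [1, 2])]) (p₄ := [(0, [1, 2, 3]), (1, [3])]) (k := 205) (k' := 207) (b := false) (by decide +kernel)
  have h3 := table_two hG hP (I := [1, 2]) (J := [1, 3]) (p₁ := [(1, [2]), (0, [3])]) (p₂ := [])
    (p₃ := [(1, [2, 3])]) (p₄ := [(0, [1, 2, 3]), (1, [1])]) (k := 209) (k' := 81) (b := false) (by decide +kernel)
  simp only [value, List.map, List.prod_cons, List.prod_nil, mul_one, Bool.not_false, Bool.not_true]
    at h1 h2 h3
  simp only [Bigon, connected, h1, h2, h3, Bool.not_false, Bool.not_true]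
  refine ⟨⟨?_, ?_⟩, ⟨?_, ?_⟩, ⟨?_, ?_⟩⟩ <;> module

/-- A triple and a pair with one common puncture, in the four rotations of `(234)(12)`. The second
term of `E` contains the curve around all four punctures, which is later eliminated. -/
theorem combs_four_left (hG : FreeGrid n G) (hP : Present n r G 4) :
    Bigon u v (C [2, 3, 4]) (C [1, 2]) (C [1, 3, 4]) (X [1, 2] [2, 3, 4] false)
        (C [3, 4] * C [1] + C [1, 2, 3, 4] * C [2]) ∧
      Bigon u v (C [1, 3, 4]) (C [2, 3]) (C [1, 2, 4]) (X [1, 3, 4] [2, 3] true)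
        (C [2] * C [1, 4] + C [1, 2, 3, 4] * C [3]) ∧
      Bigon u v (C [1, 2, 4]) (C [3, 4]) (C [1, 2, 3]) (X [1, 2, 4] [3, 4] true)
        (C [1, 2] * C [3] + C [1, 2, 3, 4] * C [4]) ∧
      Bigon u v (C [1, 2, 3]) (C [1, 4]) (C [2, 3, 4]) (X [1, 2, 3] [1, 4] true)
        (C [2, 3] * C [4] + C [1, 2, 3, 4] * C [1]) := by
  have h1 := table_two hG hP (I := [1, 2]) (J := [2, 3, 4]) (p₁ := [(0, [3, 4]), (2, [1])]) (p₂ := [(1, [1, 3, 4])])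
    (p₃ := []) (p₄ := [(0, [1, 2, 3, 4]), (1, [2])]) (k := 209) (k' := 81) (b := false) (by decide +kernel)
  have h2 := table_two hG hP (I := [1, 3, 4]) (J := [2, 3]) (p₁ := [(2, [2]), (1, [1, 4])]) (p₂ := [])
    (p₃ := [(1, [1, 2, 4])]) (p₄ := [(0, [1, 2, 3, 4]), (1, [3])]) (k := 205) (k' := 207) (b := false) (by decide +kernel)
  have h3 := table_two hG hP (I := [1, 2, 4]) (J := [3, 4]) (p₁ := [(0, [1, 2]), (1, [3])]) (p₂ := [])
    (p₃ := [(1, [1, 2, 3])]) (p₄ := [(0, [1, 2, 3, 4]), (1, [4])]) (k := 211) (k' := 213) (b := false) (by decide +kernel)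
  have h4 := table_two hG hP (I := [1, 2, 3]) (J := [1, 4]) (p₁ := [(1, [2, 3]), (0, [4])]) (p₂ := [])
    (p₃ := [(1, [2, 3, 4])]) (p₄ := [(0, [1, 2, 3, 4]), (1, [1])]) (k := 215) (k' := 87) (b := false) (by decide +kernel)
  simp only [value, List.map, List.prod_cons, List.prod_nil, mul_one, Bool.not_false, Bool.not_true]
    at h1 h2 h3 h4
  simp only [Bigon, connected, h1, h2, h3, h4, Bool.not_false, Bool.not_true]
  refine ⟨⟨?_, ?_⟩, ⟨?_, ?_⟩, ⟨?_, ?_⟩, ⟨?_, ?_⟩⟩ <;> module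

/-- The four rotations of `(12)(134)`, where the common puncture is the other one of the pair. Its
anonymous states are needed for the commutators below as well. -/
theorem combs_four_right (hG : FreeGrid n G) (hP : Present n r G 4) :
    Bigon u v (C [1, 2]) (C [1, 3, 4]) (C [2, 3, 4]) (X [1, 3, 4] [1, 2] false)
        (C [2] * C [3, 4] + C [1, 2, 3, 4] * C [1]) ∧
      Bigon u v (C [2, 3]) (C [1, 2, 4]) (C [1, 3, 4]) (X [1, 2, 4] [2, 3] false)
        (C [3] * C [1, 4] + C [1, 2, 3, 4] * C [2]) ∧
      Bigon u v (C [3, 4]) (C [1, 2, 3]) (C [1, 2, 4]) (X [1, 2, 3] [3, 4] false)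
        (C [1, 2] * C [4] + C [1, 2, 3, 4] * C [3]) ∧
      Bigon u v (C [1, 4]) (C [2, 3, 4]) (C [1, 2, 3]) (X [2, 3, 4] [1, 4] true)
        (C [1] * C [2, 3] + C [1, 2, 3, 4] * C [4]) := by
  have h1 := table_two hG hP (I := [1, 3, 4]) (J := [1, 2]) (p₁ := [(1, [2]), (0, [3, 4])]) (p₂ := [(1, [2, 3, 4])])
    (p₃ := []) (p₄ := [(0, [1, 2, 3, 4]), (1, [1])]) (k := 205) (k' := 207) (b := false) (by decide +kernel)
  have h2 := table_two hG hP (I := [1, 2, 4]) (J := [2, 3]) (p₁ := [(2, [3]), (1, [1, 4])]) (p₂ := [(1, [1, 3, 4])])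
    (p₃ := []) (p₄ := [(0, [1, 2, 3, 4]), (1, [2])]) (k := 211) (k' := 213) (b := false) (by decide +kernel)
  have h3 := table_two hG hP (I := [1, 2, 3]) (J := [3, 4]) (p₁ := [(0, [1, 2]), (2, [4])]) (p₂ := [(1, [1, 2, 4])])
    (p₃ := []) (p₄ := [(0, [1, 2, 3, 4]), (1, [3])]) (k := 215) (k' := 87) (b := false) (by decide +kernel)
  have h4 := table_two hG hP (I := [2, 3, 4]) (J := [1, 4]) (p₁ := [(0, [1]), (1, [2, 3])]) (p₂ := [])
    (p₃ := [(1, [1, 2, 3])]) (p₄ := [(0, [1, 2, 3, 4]), (1, [4])]) (k := 203) (k' := 75) (b := true) (by decide +kernel)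
  simp only [value, List.map, List.prod_cons, List.prod_nil, mul_one, Bool.not_false, Bool.not_true]
    at h1 h2 h3 h4
  simp only [Bigon, connected, h1, h2, h3, h4, Bool.not_false, Bool.not_true]
  refine ⟨⟨?_, ?_⟩, ⟨?_, ?_⟩, ⟨?_, ?_⟩, ⟨?_, ?_⟩⟩ <;> module

/-- States with equal smoothings have coefficient `1` in both orders and cancel. The two mixed
states are not combs, but they are isotopic to the anonymous states of the preceding products, which
expresses the commutator through those. -/
theorem combs_four_commutator (hG : FreeGrid n G) (hP : Present n r G 4) :
    C [1, 2, 4] * C [1, 3] - C [1, 3] * C [1, 2, 4] =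
        (u - v) • (X [1, 2, 3] [1, 4] true - X [1, 3, 4] [1, 2] false) ∧
      C [1, 2, 3] * C [2, 4] - C [2, 4] * C [1, 2, 3] =
        (u - v) • (X [1, 2] [2, 3, 4] false - X [1, 2, 4] [2, 3] false) ∧
      C [2, 3, 4] * C [1, 3] - C [1, 3] * C [2, 3, 4] =
        (u - v) • (X [1, 3, 4] [2, 3] true - X [1, 2, 3] [3, 4] false) ∧
      C [1, 3, 4] * C [2, 4] - C [2, 4] * C [1, 3, 4] =
        (u - v) • (X [1, 2, 4] [3, 4] true - X [2, 3, 4] [1, 4] true) := by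
  have h1 := table_two hG hP (I := [1, 2, 4]) (J := [1, 3]) (p₁ := []) (p₂ := [])
    (p₃ := []) (p₄ := []) (k := 211) (k' := 213) (b := false) (by decide +kernel)
  simp only [value, Bool.not_false, Bool.not_true] at h1
  -- Where the direct comparison of two states is not made, both are compared with an explicit
  -- curve, a `channel`.
  rw [((same_sound hG (S := state [1, 2, 4] [1, 3] [false, true])
      (T := channel 1 22 2) (by decide +kernel)).trans (same_sound hG
      (S := state [1, 2, 3] [1, 4] [true, false]) (by decide +kernel)).symm).cl_eq,
    ((same_sound hG (S := state [1, 2, 4] [1, 3] [true, false])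
      (T := channel 1 16 2) (by decide +kernel)).trans (same_sound hG
      (S := state [1, 3, 4] [1, 2] [false, true]) (by decide +kernel)).symm).cl_eq] at h1
  have h2 := table_two hG hP (I := [1, 2, 3]) (J := [2, 4]) (p₁ := []) (p₂ := [])
    (p₃ := []) (p₄ := []) (k := 215) (k' := 87) (b := false) (by decide +kernel)
  simp only [value, Bool.not_false, Bool.not_true] at h2
  rw [(same_sound hG (S := state [1, 2, 3] [2, 4] [false, true])
      (T := state [1, 2] [2, 3, 4] [false, true]) (by decide +kernel)).cl_eq,
    ((same_sound hG (S := state [1, 2, 3] [2, 4] [true, false])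
      (T := channel 2 22 2) (by decide +kernel)).trans (same_sound hG
      (S := state [1, 2, 4] [2, 3] [false, true]) (by decide +kernel)).symm).cl_eq] at h2
  have h3 := table_two hG hP (I := [2, 3, 4]) (J := [1, 3]) (p₁ := []) (p₂ := [])
    (p₃ := []) (p₄ := []) (k := 203) (k' := 75) (b := true) (by decide +kernel)
  simp only [value, Bool.not_false, Bool.not_true] at h3
  rw [((same_sound hG (S := state [2, 3, 4] [1, 3] [true, false])
      (T := channel 3 11 2) (by decide +kernel)).trans (same_sound hG
      (S := state [1, 3, 4] [2, 3] [true, false]) (by decide +kernel)).symm).cl_eq,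
    (same_sound hG (S := state [2, 3, 4] [1, 3] [false, true])
      (T := state [1, 2, 3] [3, 4] [false, true]) (by decide +kernel)).cl_eq] at h3
  have h4 := table_two hG hP (I := [1, 3, 4]) (J := [2, 4]) (p₁ := []) (p₂ := [])
    (p₃ := []) (p₄ := []) (k := 205) (k' := 207) (b := false) (by decide +kernel)
  simp only [value, Bool.not_false, Bool.not_true] at h4
  rw [((same_sound hG (S := state [1, 3, 4] [2, 4] [false, true])
      (T := channel 4 17 2) (by decide +kernel)).trans (same_sound hG
      (S := state [1, 2, 4] [3, 4] [true, false]) (by decide +kernel)).symm).cl_eq,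
    ((same_sound hG (S := state [1, 3, 4] [2, 4] [true, false])
      (T := channel 4 11 2) (by decide +kernel)).trans (same_sound hG
      (S := state [2, 3, 4] [1, 4] [true, false]) (by decide +kernel)).symm).cl_eq] at h4
  simp only [connected, h1, h2, h3, h4, Bool.not_false, Bool.not_true]
  refine ⟨?_, ?_, ?_, ?_⟩ <;> module

end Facts

end PlanarSkein

/-! ### Products of curves that cross four times, and disjoint curves -/

namespace PlanarSkein

open Engine

section MoreFacts

variable {R : Type*} [CommRing R] {n : ℕ} {r : Rˣ} {G : Grid}

local notation "C" => combClass (n := n) r G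

local notation "u" => turn r true

local notation "v" => turn r false

/-- With all four crossings smoothed horizontally, a small circle splits off from the curve around
the four punctures. -/
theorem comb_four_circle (hG : FreeGrid n G) (hP : Present n r G 4) :
    cl r G (state [1, 3] [2, 4] [false, false, false, false]) = -alpha r • C [1, 2, 3, 4] := by
  obtain ⟨x, hx⟩ := exists_of_allowed hG hP (K := [1, 2, 3, 4]) (by decide +kernel)
  -- `145 = 64 * 2 + 17` is the number of the cell `(17, 2)`, whose boundary represents the circle.
  have hs := same_sound (r := r) hG (S := state [1, 3] [2, 4] [false, false, false, false])
    (T := Nat.xor (shape 0 [1, 2, 3, 4]) (Nat.shiftLeft square (145 - 65))) (by decide +kernel)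
  have ht := (diagram_cross hG hP (I := [1, 3]) (J := [2, 4]) (by decide +kernel) (by decide +kernel)
    (by decide +kernel)).2.2 (state [1, 3] [2, 4] [false, false, false, false]) (by decide +kernel)
  obtain ⟨y, hy⟩ := ht
  rw [hs.cl_eq, circle_sound hG (U := shape 0 [1, 2, 3, 4]) (by decide +kernel) hx ⟨y, (hs y).mp hy⟩,
    combClass, hx.cl_eq]

/-- Five of the sixteen states contain the curve around all punctures. Four have the coefficients
`q, q, q⁻¹, q⁻¹`, and the one with a circle contributes `-α`, so the total is `α`. -/
theorem combs_four_cross (hG : FreeGrid n G) (hP : Present n r G 4) :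
    C [1, 3] * C [2, 4] = alpha r • C [1, 2, 3, 4] + C [1] * (C [2] * (C [3] * C [4])) +
        (C [1] * C [2, 3, 4] + C [2] * C [1, 3, 4] + C [3] * C [1, 2, 4] + C [1, 2, 3] * C [4]) +
        u • (C [1] * (C [2] * C [3, 4]) + C [1, 2] * (C [3] * C [4])) +
        v • (C [1] * (C [2, 3] * C [4]) + C [2] * (C [3] * C [1, 4])) +
        u ^ 2 • (C [1, 2] * C [3, 4]) + v ^ 2 • (C [2, 3] * C [1, 4]) ∧
      C [2, 4] * C [1, 3] = alpha r • C [1, 2, 3, 4] + C [1] * (C [2] * (C [3] * C [4])) +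
        (C [1] * C [2, 3, 4] + C [2] * C [1, 3, 4] + C [3] * C [1, 2, 4] + C [1, 2, 3] * C [4]) +
        v • (C [1] * (C [2] * C [3, 4]) + C [1, 2] * (C [3] * C [4])) +
        u • (C [1] * (C [2, 3] * C [4]) + C [2] * (C [3] * C [1, 4])) +
        v ^ 2 • (C [1, 2] * C [3, 4]) + u ^ 2 • (C [2, 3] * C [1, 4]) := by
  have h := table_four hG hP (I := [1, 3]) (J := [2, 4])
    (p := [[(0, [1]), (1, [2]), (1, [3]), (0, [4])],
      [(2, [2]), (2, [3]), (1, [1, 4])],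
      [(0, [1]), (1, [2]), (1, [3, 4])],
      [(2, [2]), (1, [1, 3, 4])],
      [(0, [1]), (1, [2, 3]), (0, [4])],
      [(3, [2, 3]), (4, [1, 4])],
      [(0, [1]), (1, [2, 3, 4])],
      [(0, [1, 2, 3, 4])],
      [(1, [1, 2]), (1, [3]), (0, [4])],
      [(2, [3]), (1, [1, 2, 4])],
      [(1, [1, 2]), (1, [3, 4])],
      [(0, [1, 2, 3, 4])],
      [(0, [1, 2, 3]), (0, [4])],
      [(0, [1, 2, 3, 4])],
      [(0, [1, 2, 3, 4])],
      []])
    (k := 205) (k' := 207) (l := 215) (l' := 87) (b := false) (c := false) (by decide +kernel)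
  simp only [value, List.map, List.prod_cons, List.prod_nil, mul_one, Bool.not_false, Bool.not_true,
    List.getD_cons_zero, List.getD_cons_succ] at h
  rw [comb_four_circle hG hP] at h
  have ha : alpha r = u + v := rfl
  have huv : u * v = 1 := turn_mul r
  simp only [h, ha]
  constructor <;> match_scalars <;> grind

/-- States with coefficient `1` in both orders cancel in the commutator; they are left unidentified
by an empty list. The curve around five punctures occurs with `q, q, q⁻¹, q⁻¹`, which is symmetric,
and cancels too. The four statements that follow are the other rotations. -/
theorem combs_five_cross_one (hG : FreeGrid n G) (hP : Present n r G 5) :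
    C [2, 4, 5] * C [1, 3] - C [1, 3] * C [2, 4, 5] =
        (v - u) • (C [1] * (C [2] * C [3, 4, 5]) + C [1, 2] * (C [3] * C [4, 5]) -
          C [2] * (C [3] * C [1, 4, 5]) - C [1] * (C [2, 3] * C [4, 5])) +
        (v ^ 2 - u ^ 2) • (C [1, 2] * C [3, 4, 5] - C [2, 3] * C [1, 4, 5]) := by
  have h := table_four hG hP (I := [1, 3]) (J := [2, 4, 5])
    (p := [[],
      [(2, [2]), (2, [3]), (1, [1, 4, 5])],
      [(0, [1]), (1, [2]), (1, [3, 4, 5])],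
      [],
      [(0, [1]), (1, [2, 3]), (0, [4, 5])],
      [(3, [2, 3]), (4, [1, 4, 5])],
      [],
      [(0, [1, 2, 3, 4, 5])],
      [(1, [1, 2]), (1, [3]), (0, [4, 5])],
      [],
      [(1, [1, 2]), (1, [3, 4, 5])],
      [(0, [1, 2, 3, 4, 5])],
      [],
      [(0, [1, 2, 3, 4, 5])],
      [(0, [1, 2, 3, 4, 5])],
      []])
    (k := 205) (k' := 207) (l := 215) (l' := 87) (b := false) (c := false) (by decide +kernel)
  simp only [value, List.map, List.prod_cons, List.prod_nil, mul_one, Bool.not_false, Bool.not_true,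
    List.getD_cons_zero, List.getD_cons_succ] at h
  have huv : u * v = 1 := turn_mul r
  simp only [h]
  match_scalars <;> grind

theorem combs_five_cross_two (hG : FreeGrid n G) (hP : Present n r G 5) :
    C [1, 3, 5] * C [2, 4] - C [2, 4] * C [1, 3, 5] =
        (v - u) • (C [2] * (C [3] * C [1, 4, 5]) + C [2, 3] * (C [4] * C [1, 5]) -
          C [3] * (C [4] * C [1, 2, 5]) - C [2] * (C [3, 4] * C [1, 5])) +
        (v ^ 2 - u ^ 2) • (C [2, 3] * C [1, 4, 5] - C [3, 4] * C [1, 2, 5]) := by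
  have h := table_four hG hP (I := [1, 3, 5]) (J := [2, 4])
    (p := [[],
      [(2, [2]), (2, [3]), (1, [1, 4, 5])],
      [(2, [2]), (3, [3, 4]), (4, [1, 5])],
      [],
      [(3, [2, 3]), (2, [4]), (4, [1, 5])],
      [(3, [2, 3]), (4, [1, 4, 5])],
      [],
      [(0, [1, 2, 3, 4, 5])],
      [(2, [3]), (2, [4]), (1, [1, 2, 5])],
      [],
      [(3, [3, 4]), (4, [1, 2, 5])],
      [(0, [1, 2, 3, 4, 5])],
      [],
      [(0, [1, 2, 3, 4, 5])],
      [(0, [1, 2, 3, 4, 5])],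
      []])
    (k := 205) (k' := 207) (l := 217) (l' := 219) (b := false) (c := false) (by decide +kernel)
  simp only [value, List.map, List.prod_cons, List.prod_nil, mul_one, Bool.not_false, Bool.not_true,
    List.getD_cons_zero, List.getD_cons_succ] at h
  have huv : u * v = 1 := turn_mul r
  simp only [h]
  match_scalars <;> grind

theorem combs_five_cross_three (hG : FreeGrid n G) (hP : Present n r G 5) :
    C [1, 2, 4] * C [3, 5] - C [3, 5] * C [1, 2, 4] =
        (v - u) • (C [3] * (C [4] * C [1, 2, 5]) + C [1, 2] * (C [3, 4] * C [5]) -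
          C [1, 2, 3] * (C [4] * C [5]) - C [1, 2] * (C [3] * C [4, 5])) +
        (v ^ 2 - u ^ 2) • (C [3, 4] * C [1, 2, 5] - C [1, 2, 3] * C [4, 5]) := by
  have h := table_four hG hP (I := [1, 2, 4]) (J := [3, 5])
    (p := [[],
      [(2, [3]), (2, [4]), (1, [1, 2, 5])],
      [(0, [1, 2]), (1, [3]), (1, [4, 5])],
      [],
      [(0, [1, 2]), (1, [3, 4]), (0, [5])],
      [(3, [3, 4]), (4, [1, 2, 5])],
      [],
      [(0, [1, 2, 3, 4, 5])],
      [(1, [1, 2, 3]), (1, [4]), (0, [5])],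
      [],
      [(1, [1, 2, 3]), (1, [4, 5])],
      [(0, [1, 2, 3, 4, 5])],
      [],
      [(0, [1, 2, 3, 4, 5])],
      [(0, [1, 2, 3, 4, 5])],
      []])
    (k := 211) (k' := 213) (l := 221) (l' := 93) (b := false) (c := false) (by decide +kernel)
  simp only [value, List.map, List.prod_cons, List.prod_nil, mul_one, Bool.not_false, Bool.not_true,
    List.getD_cons_zero, List.getD_cons_succ] at h
  have huv : u * v = 1 := turn_mul r
  simp only [h]
  match_scalars <;> grind

theorem combs_five_cross_four (hG : FreeGrid n G) (hP : Present n r G 5) :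
    C [2, 3, 5] * C [1, 4] - C [1, 4] * C [2, 3, 5] =
        (v - u) • (C [1, 2, 3] * (C [4] * C [5]) + C [1] * (C [2, 3] * C [4, 5]) -
          C [1] * (C [2, 3, 4] * C [5]) - C [2, 3] * (C [4] * C [1, 5])) +
        (v ^ 2 - u ^ 2) • (C [1, 2, 3] * C [4, 5] - C [2, 3, 4] * C [1, 5]) := by
  -- The second pair of crossings lies at the left end of the large comb, where the kinds occur in
  -- the opposite order. Hence the states `5` and `10`, instead of `6` and `9`, have coefficient
  -- `1`.
  have h := table_four hG hP (I := [2, 3, 5]) (J := [1, 4])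
    (p := [[],
      [(3, [2, 3]), (2, [4]), (4, [1, 5])],
      [(1, [1, 2, 3]), (1, [4]), (0, [5])],
      [],
      [(0, [1]), (1, [2, 3]), (1, [4, 5])],
      [],
      [(1, [1, 2, 3]), (1, [4, 5])],
      [(0, [1, 2, 3, 4, 5])],
      [(0, [1]), (1, [2, 3, 4]), (0, [5])],
      [(3, [2, 3, 4]), (4, [1, 5])],
      [],
      [(0, [1, 2, 3, 4, 5])],
      [],
      [(0, [1, 2, 3, 4, 5])],
      [(0, [1, 2, 3, 4, 5])],
      []])
    (k := 217) (k' := 219) (l := 203) (l' := 75) (b := false) (c := true) (by decide +kernel)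
  simp only [value, List.map, List.prod_cons, List.prod_nil, mul_one, Bool.not_false, Bool.not_true,
    List.getD_cons_zero, List.getD_cons_succ] at h
  have huv : u * v = 1 := turn_mul r
  simp only [h]
  match_scalars <;> grind

theorem combs_five_cross_five (hG : FreeGrid n G) (hP : Present n r G 5) :
    C [1, 3, 4] * C [2, 5] - C [2, 5] * C [1, 3, 4] =
        (v - u) • (C [1] * (C [2, 3, 4] * C [5]) + C [2] * (C [3, 4] * C [1, 5]) -
          C [1] * (C [2] * C [3, 4, 5]) - C [1, 2] * (C [3, 4] * C [5])) +
        (v ^ 2 - u ^ 2) • (C [2, 3, 4] * C [1, 5] - C [1, 2] * C [3, 4, 5]) := by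
  have h := table_four hG hP (I := [1, 3, 4]) (J := [2, 5])
    (p := [[],
      [(2, [2]), (3, [3, 4]), (4, [1, 5])],
      [(0, [1]), (1, [2]), (1, [3, 4, 5])],
      [],
      [(0, [1]), (1, [2, 3, 4]), (0, [5])],
      [(3, [2, 3, 4]), (4, [1, 5])],
      [],
      [(0, [1, 2, 3, 4, 5])],
      [(1, [1, 2]), (1, [3, 4]), (0, [5])],
      [],
      [(1, [1, 2]), (1, [3, 4, 5])],
      [(0, [1, 2, 3, 4, 5])],
      [],
      [(0, [1, 2, 3, 4, 5])],
      [(0, [1, 2, 3, 4, 5])],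
      []])
    (k := 205) (k' := 207) (l := 221) (l' := 93) (b := false) (c := false) (by decide +kernel)
  simp only [value, List.map, List.prod_cons, List.prod_nil, mul_one, Bool.not_false, Bool.not_true,
    List.getD_cons_zero, List.getD_cons_succ] at h
  have huv : u * v = 1 := turn_mul r
  simp only [h]
  match_scalars <;> grind

/-- The two numbers select shapes that make the combs disjoint. Shapes `0` and `1` are nested; two
combs of shape `0` stand side by side; a comb of shape `2` fits above the body of a comb of shape
`0`, between its teeth. -/
theorem combs_three_comm (hG : FreeGrid n G) (hP : Present n r G 3) :
    C [1, 2, 3] * C [1, 2] = C [1, 2] * C [1, 2, 3] ∧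
      C [1, 2, 3] * C [1, 3] = C [1, 3] * C [1, 2, 3] ∧
      C [1, 2, 3] * C [2, 3] = C [2, 3] * C [1, 2, 3] :=
  ⟨separate_sound hG hP 0 1 (by decide +kernel),
    separate_sound hG hP 0 1 (by decide +kernel),
    separate_sound hG hP 0 1 (by decide +kernel)⟩

theorem combs_four_comm (hG : FreeGrid n G) (hP : Present n r G 4) :
    C [1, 2] * C [3, 4] = C [3, 4] * C [1, 2] ∧
      C [1, 4] * C [2, 3] = C [2, 3] * C [1, 4] :=
  ⟨separate_sound hG hP 0 0 (by decide +kernel),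
    separate_sound hG hP 0 2 (by decide +kernel)⟩

theorem combs_five_comm (hG : FreeGrid n G) (hP : Present n r G 5) :
    C [1, 2] * C [3, 4, 5] = C [3, 4, 5] * C [1, 2] ∧
      C [2, 3] * C [1, 4, 5] = C [1, 4, 5] * C [2, 3] ∧
      C [3, 4] * C [1, 2, 5] = C [1, 2, 5] * C [3, 4] ∧
      C [4, 5] * C [1, 2, 3] = C [1, 2, 3] * C [4, 5] ∧
      C [1, 5] * C [2, 3, 4] = C [2, 3, 4] * C [1, 5] :=
  ⟨separate_sound hG hP 0 0 (by decide +kernel),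
    separate_sound hG hP 2 0 (by decide +kernel),
    separate_sound hG hP 2 0 (by decide +kernel),
    separate_sound hG hP 0 0 (by decide +kernel),
    separate_sound hG hP 0 2 (by decide +kernel)⟩

theorem combs_six_comm (hG : FreeGrid n G) (hP : Present n r G 6) :
    C [1, 2, 3] * C [4, 5, 6] = C [4, 5, 6] * C [1, 2, 3] ∧
      C [2, 3, 4] * C [1, 5, 6] = C [1, 5, 6] * C [2, 3, 4] ∧
      C [3, 4, 5] * C [1, 2, 6] = C [1, 2, 6] * C [3, 4, 5] :=
  ⟨separate_sound hG hP 0 0 (by decide +kernel),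
    separate_sound hG hP 2 0 (by decide +kernel),
    separate_sound hG hP 2 0 (by decide +kernel)⟩

end MoreFacts

end PlanarSkein

/-! ### Slanted combs, the target of the straightening -/

namespace PlanarSkein

namespace Engine

/-- A tooth with slanted sides at the puncture `k`. -/
def tooth (k : ℕ) : ℕ :=
  Nat.lor (bit (code 2 (6 * k) 6)) (Nat.lor (hline (6 * k + 1) (6 * k + 4) 7) (bit (code 3 (6 * k + 4) 6)))

/-- The teeth at the punctures in an increasing list, joined by horizontal lines. -/
def ridge : List ℕ → ℕ
  | [] => 0
  | [k] => tooth k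
  | k :: l :: K => Nat.lor (tooth k) (Nat.lor (hline (6 * k + 5) (6 * l) 6) (ridge (l :: K)))

/-- A comb whose teeth have slanted sides. -/
def slanted (K : List ℕ) : ℕ :=
  Nat.lor (Nat.lor (bit (code 1 (6 * first K) 5)) (bit (code 1 (6 * final K + 5) 5)))
    (Nat.lor (hline (6 * first K) (6 * final K + 5) 5) (ridge K))

/-- The cells that contain the slanted sides of the teeth. They have to be cleared of diagonals
before the cells inside a curve can be read off from its horizontal edges. -/
def slantedCells : List ℕ → List ℕ
  | [] => []
  | k :: K => (64 * 6 + 6 * k) :: (64 * 6 + (6 * k + 4)) :: slantedCells K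

/-- The isotopy passes through a comb whose body reaches up to level `6`: bottom and teeth are first
extended, and then the top of the body is lowered to level `4`. -/
def slantedCheck (K : List ℕ) : Bool := chase (strip (slantedCells K) (slanted K)) (comb 0 1 6 9 K) &&
  chase (comb 0 1 6 9 K) (shape 0 K)

/-- `p` holds for the increasing lists of at most three numbers among `1, …, 6`. -/
def forSmall (p : List ℕ → Bool) : Bool :=
  (List.range 7).all fun i => (!small 6 [i] || p [i]) &&
    (List.range 7).all fun j => (!small 6 [i, j] || p [i, j]) &&
      (List.range 7).all fun k => !small 6 [i, j, k] || p [i, j, k]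

theorem forSmall_slantedCheck : forSmall slantedCheck = true := by decide +kernel

end Engine

open Engine

theorem of_forSmall {p : List ℕ → Bool} (h : forSmall p = true) {m : ℕ} (hm : m ≤ 6) {K : List ℕ}
    (hK : small m K = true) : p K = true := by
  simp only [forSmall, List.all_eq_true, List.mem_range, Bool.and_eq_true, Bool.or_eq_true,
    Bool.not_eq_true'] at h
  have h6 : small 6 K = true := by
    match K, hK with
    | [i], hK => simp only [small, Bool.and_eq_true, Nat.ble_eq, Nat.blt_eq] at hK ⊢; omega
    | [i, j], hK => simp only [small, Bool.and_eq_true, Nat.ble_eq, Nat.blt_eq] at hK ⊢; omega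
    | [i, j, k], hK => simp only [small, Bool.and_eq_true, Nat.ble_eq, Nat.blt_eq] at hK ⊢; omega
  match K, h6 with
  | [i], h6 =>
    refine (h i ?_).1.resolve_left (by rw [h6]; simp)
    simp only [small, Bool.and_eq_true, Nat.ble_eq, Nat.blt_eq] at h6; omega
  | [i, j], h6 =>
    have h7 := h6
    simp only [small, Bool.and_eq_true, Nat.ble_eq, Nat.blt_eq] at h7
    exact ((h i (by omega)).2 j (by omega)).1.resolve_left (by rw [h6]; simp)
  | [i, j, k], h6 =>
    have h7 := h6
    simp only [small, Bool.and_eq_true, Nat.ble_eq, Nat.blt_eq] at h7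
    exact (((h i (by omega)).2 j (by omega)).2 k (by omega)).resolve_left (by rw [h6]; simp)

section Slanted

variable {G : Grid}

theorem real_bit {k : ℕ} (hk : k < 4096) (h : ℕ × ℕ → ℝ) : G.real h (bit k) = G.edge h k := by
  ext x
  simp only [Grid.mem_real, testBit_bit, decide_eq_true_eq]
  constructor
  · rintro ⟨_, -, rfl, hx⟩; exact hx
  · exact fun hx => ⟨k, hk, rfl, hx⟩

theorem hline_succ (x m y : ℕ) : hline x (x + (m + 1)) y = hline x (x + m) y ||| bit (64 * y + (x + m)) := by
  apply Nat.eq_of_testBit_eq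
  intro k
  have e : ∀ m, (hline x (x + m) y).testBit k = (decide (64 * y + x ≤ k) && decide (k - (64 * y + x) < m)) := by
    intro m
    simp only [hline, nat_shiftLeft, Nat.add_sub_cancel_left, Nat.testBit_shiftLeft, ge_iff_le]
    congr 1
    change ((1 <<< m) - 1).testBit _ = _
    rw [Nat.one_shiftLeft, Nat.testBit_two_pow_sub_one]
  rw [Nat.testBit_or, e, e, testBit_bit]
  rw [Bool.eq_iff_iff]
  simp only [Bool.or_eq_true, Bool.and_eq_true, decide_eq_true_eq]
  omega

/-- Collinear grid edges add up to one segment. The straightened curve has such long segments, while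
the set of bits has single edges. -/
theorem real_hline {x m y : ℕ} (hm : x + m < 63) (hy : y < 16) :
    G.real flat (hline x (x + (m + 1)) y) = segment ℝ (G.pt flat (x, y)) (G.pt flat (x + (m + 1), y)) := by
  have e : ∀ k, k < 63 → G.edge flat (64 * y + k) = segment ℝ (G.pt flat (k, y)) (G.pt flat (k + 1, y)) := by
    intro k hk
    have : 64 * y + k = code 0 k y := by unfold code; omega
    rw [this, Grid.edge, src_code (by omega) (by omega) hy, tgt_code (by omega) (by omega) hy]
    simp
  induction m with
  | zero =>
    have h0 : hline x (x + 0) y = 0 := by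
      simp only [hline, nat_shiftLeft, Nat.add_sub_cancel_left]
      exact Nat.zero_shiftLeft _
    rw [hline_succ, h0, Nat.zero_or, real_bit (by omega), add_zero, e x (by omega)]
  | succ m ih =>
    rw [hline_succ, real_lor, ih (by omega), real_bit (by omega), e _ (by omega)]
    have hp : G.pt flat (x + (m + 1), y) ∈
        segment ℝ (G.pt flat (x, y)) (G.pt flat (x + (m + 1 + 1), y)) := by
      have h1 := G.hx (show x < x + (m + 1) by omega)
      have h2 := G.hx (show x + (m + 1) < x + (m + 1 + 1) by omega)
      rw [segment_eq_image']
      refine ⟨(G.gx (x + (m + 1)) - G.gx x) / (G.gx (x + (m + 1 + 1)) - G.gx x),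
        ⟨div_nonneg (by linarith) (by linarith), (div_le_one (by linarith)).mpr (by linarith)⟩, ?_⟩
      have : G.gx (x + (m + 1 + 1)) - G.gx x ≠ 0 := by linarith
      simp only [Grid.pt, Prod.ext_iff, Prod.fst_add, Prod.snd_add, Prod.smul_fst, Prod.smul_snd,
        Prod.fst_sub, Prod.snd_sub, smul_eq_mul, flat]
      refine ⟨⟨?_, by ring⟩, by ring⟩
      field_simp
      ring
    rw [segment_symm ℝ (G.pt flat (x, y))]
    exact segment_union_of_mem hp

end Slanted

end PlanarSkein

namespace PlanarSkein

open Engine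

/-! ### A chart -/

section Chart

/-- The offsets of the vertical lines near a puncture. -/
noncomputable def offset (η : ℝ) (s : ℕ) : ℝ :=
  if s = 0 then -(1 / 2 - η / 4) else if s = 1 then -((1 - η) / 2) else if s = 2 then -η else
  if s = 3 then η else if s = 4 then (1 - η) / 2 else 1 / 2 - η / 4

/-- The punctures lie in row `6`, between `-η` and `η`. Level `5` is the height of the lower arc of
`t_I` at the distance `1/2 - η/4` outside the extreme punctures. Likewise the upper arc has height
`η` at the distance `(1 - η)/2` from a puncture in `I`. So these corners of the slanted comb lie on
`t_I` from the beginning. -/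
noncomputable def level (η : ℝ) (j : ℕ) : ℝ :=
  if j ≤ 4 then j - 8 else if j = 5 then -2 - η / 2 else if j = 6 then -η else if j = 7 then η else j - 7

/-- A grid with six vertical lines near each of the points `p k`. -/
noncomputable def chart (p : ℕ → ℤ) (hp : StrictMono p) (η : ℝ) (h0 : 0 < η) (h1 : η ≤ 1 / 5) : Grid where
  gx i := p (i / 6) + offset η (i % 6)
  gy := level η
  hx := by
    refine strictMono_nat_of_lt_succ fun i => ?_
    obtain ⟨k, s, hs, rfl⟩ : ∃ k s, s < 6 ∧ i = 6 * k + s := ⟨i / 6, i % 6, by omega, by omega⟩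
    rw [show (6 * k + s) / 6 = k by omega, show (6 * k + s) % 6 = s by omega]
    have := hp (Nat.lt_succ_self k)
    have h2 : (p k : ℝ) + 1 ≤ p (k + 1) := by exact_mod_cast this
    by_cases h5 : s = 5
    · subst h5
      rw [show (6 * k + 5 + 1) / 6 = k + 1 by omega, show (6 * k + 5 + 1) % 6 = 0 by omega]
      norm_num [offset]; linarith
    · rw [show (6 * k + s + 1) / 6 = k by omega, show (6 * k + s + 1) % 6 = s + 1 by omega]
      have : s < 5 := by omega
      interval_cases s <;> norm_num [offset] <;> linarith
  hy := by
    refine strictMono_nat_of_lt_succ fun j => ?_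
    unfold level
    by_cases h8 : 8 ≤ j
    · rw [if_neg (by omega), if_neg (by omega), if_neg (by omega), if_neg (by omega),
        if_neg (by omega), if_neg (by omega), if_neg (by omega), if_neg (by omega)]
      push_cast; linarith
    · interval_cases j <;> norm_num <;> linarith

variable {p : ℕ → ℤ} {hp : StrictMono p} {η : ℝ} {h0 : 0 < η} {h1 : η ≤ 1 / 5}

theorem chart_gx (k s : ℕ) (hs : s < 6) : (chart p hp η h0 h1).gx (6 * k + s) = p k + offset η s := by
  change (p ((6 * k + s) / 6) : ℝ) + offset η ((6 * k + s) % 6) = _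
  rw [show (6 * k + s) / 6 = k by omega, show (6 * k + s) % 6 = s by omega]

/-- Height `0` occurs in row `6` only. There a column that is not `2` modulo `3` lies within
distance less than `1` of the integer `p l` and does not contain it, so it contains no integer at
all. -/
theorem freeGrid_chart (n : ℕ) : FreeGrid n (chart p hp η h0 h1) := by
  intro i j hij q hq k hk
  subst hk
  obtain ⟨⟨a1, a2⟩, b1, b2⟩ := hq
  simp only at a1 a2 b1 b2
  have gy6 : (chart p hp η h0 h1).gy 6 = -η := by change level η 6 = _; norm_num [level]
  have gy7 : (chart p hp η h0 h1).gy 7 = η := by change level η 7 = _; norm_num [level]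
  have hj : j = 6 := by
    by_contra hne
    rcases Nat.lt_or_gt_of_ne hne with h | h
    · have := (chart p hp η h0 h1).hy.monotone (show j + 1 ≤ 6 by omega)
      rw [gy6] at this; linarith
    · have := (chart p hp η h0 h1).hy.monotone (show 7 ≤ j by omega)
      rw [gy7] at this; linarith
  have hi : i % 3 ≠ 2 := hij.resolve_left (by simp [hj])
  obtain ⟨l, s, hs, rfl⟩ : ∃ l s, s < 6 ∧ i = 6 * l + s := ⟨i / 6, i % 6, by omega, by omega⟩
  have hs5 : s < 5 := by omega
  rw [chart_gx l s hs] at a1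
  rw [show 6 * l + s + 1 = 6 * l + (s + 1) by ring, chart_gx l (s + 1) (by omega)] at a2
  have hk : pos k = (((k : ℕ) + 1 : ℤ) : ℝ) := by simp [pos]
  rw [hk] at a1 a2
  -- Both coordinates are integers, so a difference strictly between `-1` and `1` vanishes; the
  -- puncture would have to be `p l` itself.
  have c1 : -(1 : ℝ) < (((k : ℕ) + 1 - p l : ℤ) : ℝ) := by
    push_cast at a1 a2 ⊢
    interval_cases s <;> norm_num [offset] at a1 a2 hi <;> linarith
  have c2 : (((k : ℕ) + 1 - p l : ℤ) : ℝ) < 1 := by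
    push_cast at a1 a2 ⊢
    interval_cases s <;> norm_num [offset] at a1 a2 hi <;> linarith
  have e : ((k : ℕ) + 1 - p l : ℤ) = 0 := by
    have d1 : (-1 : ℤ) < ((k : ℕ) + 1 - p l : ℤ) := by exact_mod_cast c1
    have d2 : ((k : ℕ) + 1 - p l : ℤ) < 1 := by exact_mod_cast c2
    omega
  have e : (((k : ℕ) + 1 : ℤ) : ℝ) = p l := by exact_mod_cast sub_eq_zero.mp e
  rw [e] at a1 a2
  interval_cases s <;> norm_num [offset] at a1 a2 hi <;> first | linarith | omega

end Chart

/-! ### Flat moves -/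

section Flat

/-- Half planes are convex, so it suffices to test the vertices. Such linear bounds separate the
triangles of the straightening from the punctures and from the rest of the link. -/
theorem triangle_le {a b c : Space} {u v w : ℝ} (ha : u * a.1.1 + v * a.1.2 ≤ w)
    (hb : u * b.1.1 + v * b.1.2 ≤ w) (hc : u * c.1.1 + v * c.1.2 ≤ w) {x : Space}
    (hx : x ∈ triangle a b c) : u * x.1.1 + v * x.1.2 ≤ w := by
  have hconv : Convex ℝ {x : Space | u * x.1.1 + v * x.1.2 ≤ w} := by
    intro x hx y hy s t hs ht hst
    simp only [mem_setOf_eq, Prod.fst_add, Prod.smul_fst, Prod.snd_add, Prod.smul_snd, smul_eq_mul] at *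
    calc u * (s * x.1.1 + t * y.1.1) + v * (s * x.1.2 + t * y.1.2)
        = s * (u * x.1.1 + v * x.1.2) + t * (u * y.1.1 + v * y.1.2) := by ring
      _ ≤ s * w + t * w := add_le_add (mul_le_mul_of_nonneg_left hx hs) (mul_le_mul_of_nonneg_left hy ht)
      _ = w := by rw [← add_mul, hst, one_mul]
  refine convexHull_min ?_ hconv hx
  rintro _ (rfl | rfl | rfl)
  exacts [ha, hb, hc]

theorem segment_le {a b : Space} {u v w : ℝ} (ha : u * a.1.1 + v * a.1.2 ≤ w)
    (hb : u * b.1.1 + v * b.1.2 ≤ w) {x : Space} (hx : x ∈ segment ℝ a b) :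
    u * x.1.1 + v * x.1.2 ≤ w :=
  triangle_le ha hb ha ((sides_subset_triangle a b a).1 hx)

variable {n : ℕ} (L : Link n) {a b c : Space} {Z : Set Space}

/-- A `Δ`-move in the form needed for long curves: `Z` is the part that does not change, and it may
touch the triangle only in the ends of `ab`. -/
theorem insert_vertex (cZ : IsClosed Z) (hL : L.carrier = Z ∪ segment ℝ a b)
    (hf : ∀ x ∈ L.carrier, x.2 = 1 / 2) (hc : c.2 = 1 / 2)
    (hd : (b.1.1 - a.1.1) * (c.1.2 - a.1.2) - (b.1.2 - a.1.2) * (c.1.1 - a.1.1) ≠ 0)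
    (hs : ∀ x ∈ triangle a b c, x.1 ∈ surface n) (hZ : ∀ x ∈ Z, x ∈ triangle a b c → x = a ∨ x = b) :
    ∃ M : Link n, M.carrier = Z ∪ (segment ℝ a c ∪ segment ℝ c b) ∧ L ≈ M := by
  have ha : a.2 = 1 / 2 := hf a (by rw [hL]; exact Or.inr (left_mem_segment ℝ a b))
  have hb : b.2 = 1 / 2 := hf b (by rw [hL]; exact Or.inr (right_mem_segment ℝ a b))
  have hT : ∀ x ∈ triangle a b c, x.2 = 1 / 2 := fun x hx => Grid.triangle_flat ha hb hc hx
  obtain ⟨t1, t2, t3⟩ := sides_subset_triangle a b c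
  refine exists_delta L (nondeg_of_det hd) (fun x hx => ⟨hs x hx, by rw [hT x hx]; norm_num⟩) ?_ hf hT
    ?_ ((L.isCompact.of_isClosed_subset cZ (by rw [hL]; exact subset_union_left)).union
      ((isCompact_segment a c).union (isCompact_segment c b)))
  · ext x
    rw [hL]
    constructor
    · rintro ⟨h | h, h'⟩
      · rcases hZ x h h' with rfl | rfl
        exacts [left_mem_segment ℝ _ _, right_mem_segment ℝ _ _]
      · exact h
    · exact fun h => ⟨Or.inr h, t1 h⟩
  · ext x
    rw [hL]
    simp only [mem_union, mem_sdiff]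
    by_cases h : x ∈ segment ℝ a b
    · constructor
      · rintro (h' | h')
        · rcases hZ x h' (t1 h) with rfl | rfl
          exacts [Or.inr (Or.inl (left_mem_segment ℝ _ _)), Or.inr (Or.inr (right_mem_segment ℝ _ _))]
        · exact Or.inr h'
      · rintro (h' | h')
        exacts [absurd h h'.2, Or.inr h']
    · simp [h]

theorem remove_vertex (cZ : IsClosed Z) (hL : L.carrier = Z ∪ (segment ℝ a c ∪ segment ℝ c b))
    (hf : ∀ x ∈ L.carrier, x.2 = 1 / 2)
    (hd : (b.1.1 - a.1.1) * (c.1.2 - a.1.2) - (b.1.2 - a.1.2) * (c.1.1 - a.1.1) ≠ 0)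
    (hs : ∀ x ∈ triangle a b c, x.1 ∈ surface n) (hZ : ∀ x ∈ Z, x ∈ triangle a b c → x = a ∨ x = b) :
    ∃ M : Link n, M.carrier = Z ∪ segment ℝ a b ∧ L ≈ M := by
  have ha : a.2 = 1 / 2 := hf a (by rw [hL]; exact Or.inr (Or.inl (left_mem_segment ℝ a c)))
  have hb : b.2 = 1 / 2 := hf b (by rw [hL]; exact Or.inr (Or.inr (right_mem_segment ℝ c b)))
  have hc : c.2 = 1 / 2 := hf c (by rw [hL]; exact Or.inr (Or.inr (left_mem_segment ℝ c b)))
  have hT : ∀ x ∈ triangle a b c, x.2 = 1 / 2 := fun x hx => Grid.triangle_flat ha hb hc hx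
  obtain ⟨t1, t2, t3⟩ := sides_subset_triangle a b c
  refine exists_delta_symm L (nondeg_of_det hd) (fun x hx => ⟨hs x hx, by rw [hT x hx]; norm_num⟩) ?_
    hf hT ?_ ((L.isCompact.of_isClosed_subset cZ (by rw [hL]; exact subset_union_left)).union
      (isCompact_segment a b))
  · ext x
    rw [hL]
    constructor
    · rintro ⟨h | h, h'⟩
      · rcases hZ x h h' with rfl | rfl
        exacts [Or.inl (left_mem_segment ℝ _ _), Or.inr (right_mem_segment ℝ _ _)]
      · exact h
    · exact fun h => ⟨Or.inr h, h.elim (fun h => t2 h) fun h => t3 h⟩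
  · ext x
    rw [hL]
    simp only [mem_union, mem_sdiff]
    by_cases h : x ∈ segment ℝ a c ∨ x ∈ segment ℝ c b
    · constructor
      · rintro (h' | h')
        · rcases hZ x h' (h.elim (fun h => t2 h) fun h => t3 h) with rfl | rfl
          exacts [Or.inr (left_mem_segment ℝ _ _), Or.inr (right_mem_segment ℝ _ _)]
        · exact Or.inr h'
      · rintro (h' | h')
        exacts [absurd h h'.2, Or.inr h']
    · simp [h]

end Flat

end PlanarSkein

namespace PlanarSkein

/-! ### Straightening the curves `t_I` -/

noncomputable def pl (x y : ℝ) : Space := ((x, y), 1 / 2)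

theorem eq_pl {z : Space} {x y : ℝ} (h1 : z.1.1 = x) (h2 : z.1.2 = y) (h3 : z.2 = 1 / 2) : z = pl x y :=
  Prod.ext (Prod.ext h1 h2) h3

def graphOn (f : ℝ → ℝ) (s t : ℝ) : Set Space :=
  {p | s ≤ p.1.1 ∧ p.1.1 ≤ t ∧ p.1.2 = f p.1.1 ∧ p.2 = 1 / 2}

theorem isClosed_graphOn {f : ℝ → ℝ} (hf : Continuous f) (s t : ℝ) : IsClosed (graphOn f s t) := by
  have c1 : IsClosed {p : Space | s ≤ p.1.1} := isClosed_le (by fun_prop) (by fun_prop)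
  have c2 : IsClosed {p : Space | p.1.1 ≤ t} := isClosed_le (by fun_prop) (by fun_prop)
  have c3 : IsClosed {p : Space | p.1.2 = f p.1.1} := isClosed_eq (by fun_prop) (by fun_prop)
  have c4 : IsClosed {p : Space | p.2 = 1 / 2} := isClosed_eq (by fun_prop) (by fun_prop)
  exact c1.inter (c2.inter (c3.inter c4))

theorem graphOn_union {f : ℝ → ℝ} {s t u : ℝ} (h1 : s ≤ t) (h2 : t ≤ u) :
    graphOn f s u = graphOn f s t ∪ graphOn f t u := by
  ext p
  constructor
  · rintro ⟨a, b, c, d⟩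
    rcases le_total p.1.1 t with h | h
    exacts [Or.inl ⟨a, h, c, d⟩, Or.inr ⟨h, b, c, d⟩]
  · rintro (⟨a, b, c, d⟩ | ⟨a, b, c, d⟩)
    exacts [⟨a, b.trans h2, c, d⟩, ⟨h1.trans a, b, c, d⟩]

theorem graphOn_eq_segment {f : ℝ → ℝ} {s t a b : ℝ} (hst : s < t) (k : ℝ)
    (hf : ∀ x, s ≤ x → x ≤ t → f x = a + k * (x - s)) (hb : b = a + k * (t - s)) :
    graphOn f s t = segment ℝ (pl s a) (pl t b) := by
  subst hb
  ext ⟨⟨x, y⟩, z⟩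
  rw [segment_eq_image']
  constructor
  · rintro ⟨h1, h2, h3, h4⟩
    simp only at h1 h2 h3 h4
    have : t - s ≠ 0 := by linarith
    refine ⟨(x - s) / (t - s), ⟨div_nonneg (by linarith) (by linarith),
      (div_le_one (by linarith)).mpr (by linarith)⟩, ?_⟩
    rw [h3, hf x h1 h2, h4]
    simp only [pl, Prod.ext_iff, Prod.fst_add, Prod.snd_add, Prod.smul_fst, Prod.smul_snd,
      Prod.fst_sub, Prod.snd_sub, smul_eq_mul]
    refine ⟨⟨?_, ?_⟩, by ring⟩ <;> field_simp <;> ring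
  · rintro ⟨u, ⟨u0, u1⟩, e⟩
    simp only [pl, Prod.ext_iff, Prod.fst_add, Prod.snd_add, Prod.smul_fst, Prod.smul_snd,
      Prod.fst_sub, Prod.snd_sub, smul_eq_mul] at e
    obtain ⟨⟨e1, e2⟩, e3⟩ := e
    have a1 : s ≤ x := by nlinarith
    have a2 : x ≤ t := by nlinarith
    refine ⟨a1, a2, ?_, by simp only; linarith⟩
    simp only
    rw [hf x a1 a2, ← e1, ← e2]; ring

/-- A point of a segment where a linear function is maximal. -/
theorem eq_of_segment_max {a b x : Space} (u v : ℝ) (hx : x ∈ segment ℝ a b)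
    (h : u * a.1.1 + v * a.1.2 < u * b.1.1 + v * b.1.2)
    (h' : u * b.1.1 + v * b.1.2 ≤ u * x.1.1 + v * x.1.2) : x = b := by
  rw [segment_eq_image'] at hx
  obtain ⟨t, ⟨t0, t1⟩, rfl⟩ := hx
  simp only [Prod.fst_add, Prod.snd_add, Prod.smul_fst, Prod.smul_snd, Prod.fst_sub, Prod.snd_sub,
    smul_eq_mul] at h'
  have : t = 1 := le_antisymm t1 (by nlinarith)
  rw [this]; simp

theorem segment_flat {a b x : Space} (ha : a.2 = 1 / 2) (hb : b.2 = 1 / 2) (hx : x ∈ segment ℝ a b) :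
    x.2 = 1 / 2 := Grid.flat_segment ha hb hx

section Curves

variable {n : ℕ} {I : Finset (Fin n)} {hI : I.Nonempty}

theorem upper_eq {i : Fin n} (hi : i ∈ I) {x : ℝ} (h : ∀ l ∈ I, |x - pos i| ≤ |x - pos l|) :
    upper I hI x = 1 - 2 * |x - pos i| :=
  le_antisymm (Finset.sup'_le hI _ fun l hl => by linarith [h l hl]) (le_upper I hI hi x)

theorem upper_near {i : Fin n} (hi : i ∈ I) {x : ℝ} (h : |x - pos i| ≤ 1 / 2) :
    upper I hI x = 1 - 2 * |x - pos i| := by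
  refine upper_eq hi fun l hl => ?_
  by_cases e : i = l
  · rw [e]
  · have h1 := one_le_abs_pos e
    have h2 : |pos l - pos i| ≤ |x - pos i| + |x - pos l| := by
      rw [abs_sub_comm x (pos l)]
      have := abs_add_le (x - pos i) (pos l - x)
      rwa [show x - pos i + (pos l - x) = pos l - pos i by ring] at this
    linarith

theorem pos_le_pos {i j : Fin n} (h : i ≤ j) : (pos i : ℝ) ≤ pos j := by
  have : ((i : ℕ) : ℝ) ≤ (j : ℕ) := by exact_mod_cast h
  simp only [pos]; linarith

theorem lower_le {i j : Fin n} (hi : i ∈ I) (hj : j ∈ I) (x : ℝ) :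
    lower I hI x ≤ -3 + 2 * max (pos i - x) (x - pos j) := by
  have h1 := pos_min_le I hI hi
  have h2 := pos_le_max I hI hj
  have h3 : max (pos (I.min' hI) - x) (x - pos (I.max' hI)) ≤ max (pos i - x) (x - pos j) :=
    max_le_max (by linarith) (by linarith)
  rw [lower_eq]; linarith

theorem lower_le_neg_one {x : ℝ} (h1 : pos (I.min' hI) - 1 ≤ x) (h2 : x ≤ pos (I.max' hI) + 1) :
    lower I hI x ≤ -1 := by
  have : max (pos (I.min' hI) - x) (x - pos (I.max' hI)) ≤ 1 := max_le (by linarith) (by linarith)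
  rw [lower_eq]; linarith

/-- The upper arc is above the lower one exactly over the interval that extends by one unit beyond
the extreme punctures. So `t_I` is the union of two graphs, which can be cut at any abscissa. -/
theorem curve_eq : curve I hI =
    graphOn (upper I hI) (pos (I.min' hI) - 1) (pos (I.max' hI) + 1) ∪
      graphOn (lower I hI) (pos (I.min' hI) - 1) (pos (I.max' hI) + 1) := by
  have hmm := pos_min_le I hI (I.max'_mem hI)
  have key : ∀ x, lower I hI x ≤ upper I hI x ↔ pos (I.min' hI) - 1 ≤ x ∧ x ≤ pos (I.max' hI) + 1 := by
    intro x
    rcases le_total x (pos (I.min' hI)) with h | h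
    · rw [lower_left I hI h, upper_left I hI h]
      constructor
      · intro; constructor <;> linarith
      · rintro ⟨_, _⟩; linarith
    · rcases le_total (pos (I.max' hI)) x with h' | h'
      · rw [lower_right I hI h', upper_right I hI h']
        constructor
        · intro; constructor <;> linarith
        · rintro ⟨_, _⟩; linarith
      · exact ⟨fun _ => ⟨by linarith, by linarith⟩, fun _ => (lower_lt_upper I hI h h').le⟩
  ext p
  simp only [curve, graphOn, mem_union, mem_setOf_eq]
  constructor
  · rintro ⟨h1, h2, h3, h4⟩
    obtain ⟨k1, k2⟩ := (key p.1.1).mp (h1.trans h2)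
    exact h3.elim (fun h => Or.inr ⟨k1, k2, h, h4⟩) fun h => Or.inl ⟨k1, k2, h, h4⟩
  · rintro (⟨k1, k2, h, h4⟩ | ⟨k1, k2, h, h4⟩)
    · exact ⟨by rw [h]; exact (key _).mpr ⟨k1, k2⟩, h.le, Or.inr h, h4⟩
    · exact ⟨h.ge, by rw [h]; exact (key _).mpr ⟨k1, k2⟩, Or.inl h, h4⟩

/-- The part of `t_I` to the left of `s` has been replaced by `N`. -/
structure Partial (I : Finset (Fin n)) (hI : I.Nonempty) (η s : ℝ) (N : Set Space) : Prop where
  closed : IsClosed N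
  flat : ∀ x ∈ N, x.2 = 1 / 2
  -- The finished part lies to the left of `s`, except for the point where the upper arc continues.
  -- By `above` it lies above level `5`, except for the corner where the bottom will be attached. So
  -- triangles to the right of `s`, or below that level, meet it in an end only.
  left : ∀ x ∈ N, x.1.1 < s ∨ x = pl s η
  above : ∀ x ∈ N, -2 - η / 2 < x.1.2 ∨ x = pl (pos (I.min' hI) - (1 / 2 - η / 4)) (-2 - η / 2)
  link : ∃ L : Link n, tLink I hI ≈ L ∧ L.carrier = N ∪ (graphOn (upper I hI) s (pos (I.max' hI) + 1) ∪
    graphOn (lower I hI) (pos (I.min' hI) - (1 / 2 - η / 4)) (pos (I.max' hI) + 1))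

variable {η : ℝ}

theorem mem_surface {z : ℝ × ℝ} (h : ∀ k : Fin n, z.1 = pos k → z.2 = 0 → False) : z ∈ surface n :=
  fun k e => h k (by rw [e]) (by rw [e])

theorem graphOn_flat {f : ℝ → ℝ} {s t : ℝ} : ∀ x ∈ graphOn f s t, x.2 = 1 / 2 := fun _ h => h.2.2.2

/-- The leftmost vertex `V` of `t_I` is replaced by the vertical side `WB`: the vertex `W` is
inserted between `P` and `V`, and then `V` is removed from the path `W V B`. The points `P` and `B`
already lie on `t_I`. -/
theorem partial_left (h0 : 0 < η) (h1 : η ≤ 1 / 5) :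
    Partial I hI η (pos (I.min' hI) - (1 - η) / 2)
      (segment ℝ (pl (pos (I.min' hI) - (1 - η) / 2) η) (pl (pos (I.min' hI) - (1 / 2 - η / 4)) (-η)) ∪
        segment ℝ (pl (pos (I.min' hI) - (1 / 2 - η / 4)) (-η))
          (pl (pos (I.min' hI) - (1 / 2 - η / 4)) (-2 - η / 2))) := by
  have hmm := pos_min_le I hI (I.max'_mem hI)
  have cu := continuous_upper I hI
  have cl := continuous_lower I hI
  set m := pos (I.min' hI) with hm
  set M := pos (I.max' hI) with hM
  have hup : ∀ x, x ≤ m → upper I hI x = 1 - 2 * (m - x) := fun x hx => upper_left I hI hx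
  have hlo : ∀ x, x ≤ m → lower I hI x = -3 + 2 * (m - x) := fun x hx => lower_left I hI hx
  set P := pl (m - (1 - η) / 2) η with hP
  set W := pl (m - (1 / 2 - η / 4)) (-η) with hW
  set B := pl (m - (1 / 2 - η / 4)) (-2 - η / 2) with hB
  set V := pl (m - 1) (-1) with hV
  have e0 : (tLink I hI).carrier = (graphOn (upper I hI) (m - (1 - η) / 2) (M + 1) ∪
      (segment ℝ V B ∪ graphOn (lower I hI) (m - (1 / 2 - η / 4)) (M + 1))) ∪ segment ℝ P V := by
    change curve I hI = _
    rw [curve_eq, graphOn_union (s := m - 1) (t := m - (1 - η) / 2) (by linarith) (by linarith),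
      graphOn_union (f := lower I hI) (s := m - 1) (t := m - (1 / 2 - η / 4)) (by linarith) (by linarith),
      graphOn_eq_segment (f := upper I hI) (a := -1) (b := η) (by linarith) 2
        (fun x _ hx => by rw [hup x (by linarith)]; ring) (by ring),
      graphOn_eq_segment (f := lower I hI) (a := -1) (b := -2 - η / 2) (by linarith) (-2)
        (fun x _ hx => by rw [hlo x (by linarith)]; ring) (by ring), segment_symm ℝ P V]
    ext x; simp only [mem_union]; tauto
  obtain ⟨L1, hL1, i1⟩ := insert_vertex (tLink I hI) (a := P) (b := V) (c := W)
    (Z := graphOn (upper I hI) (m - (1 - η) / 2) (M + 1) ∪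
      (segment ℝ V B ∪ graphOn (lower I hI) (m - (1 / 2 - η / 4)) (M + 1)))
    ((isClosed_graphOn cu _ _).union ((isClosed_segment _ _).union (isClosed_graphOn cl _ _)))
    e0 (fun x hx => hx.2.2.2) rfl (by
      simp only [hP, hV, hW, pl]
      nlinarith)
    (fun x hx => mem_surface fun k hk hk0 => by
      -- The line of slope `4` through `V` bounds the triangle on the left. It meets height `0` at
      -- `m - 3/4`, to the right of every puncture that precedes `m`.
      have a1 := triangle_le (u := -4) (v := 1) (w := -4 * (m - 1) - 1)
        (by simp only [hP, pl]; linarith) (by simp only [hV, pl]; linarith)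
        (by simp only [hW, pl]; linarith) hx
      have a2 := triangle_le (u := 1) (v := 0) (w := m - (1 - η) / 2)
        (by simp only [hP, pl]; linarith) (by simp only [hV, pl]; linarith)
        (by simp only [hW, pl]; linarith) hx
      have hne : I.min' hI ≠ k := by rintro rfl; rw [hk, ← hm] at a2; linarith
      have := one_le_abs_pos hne
      rw [← hk, ← hm] at this
      rw [hk0] at a1
      rw [abs_of_nonpos (by linarith)] at this
      linarith)
    (by
      intro x hx hT
      have a2 := triangle_le (u := 1) (v := 0) (w := m - (1 - η) / 2)
        (by simp only [hP, pl]; linarith) (by simp only [hV, pl]; linarith)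
        (by simp only [hW, pl]; linarith) hT
      have a3 := triangle_le (u := 0) (v := -1) (w := 1)
        (by simp only [hP, pl]; linarith) (by simp only [hV, pl]; linarith)
        (by simp only [hW, pl]; linarith) hT
      rcases hx with ⟨b1, b2, b3, b4⟩ | hx | ⟨b1, b2, b3, b4⟩
      · have hx1 : x.1.1 = m - (1 - η) / 2 := by linarith
        exact Or.inl (eq_pl hx1 (by rw [b3, hx1, hup _ (by linarith)]; ring) b4)
      · rw [segment_symm] at hx
        exact Or.inr (eq_of_segment_max 0 1 hx (by simp only [hB, hV, pl]; linarith)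
          (by simp only [hV, pl]; linarith))
      · rw [hlo _ (by linarith)] at b3
        linarith)
  obtain ⟨L2, hL2, i2⟩ := remove_vertex L1 (a := W) (b := B) (c := V)
    (Z := graphOn (upper I hI) (m - (1 - η) / 2) (M + 1) ∪
      (segment ℝ P W ∪ graphOn (lower I hI) (m - (1 / 2 - η / 4)) (M + 1)))
    ((isClosed_graphOn cu _ _).union ((isClosed_segment _ _).union (isClosed_graphOn cl _ _)))
    (by rw [hL1]; ext x; simp only [mem_union]; tauto)
    (by
      rw [hL1]
      rintro x ((hx | hx | hx) | hx | hx)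
      exacts [graphOn_flat x hx, segment_flat rfl rfl hx, graphOn_flat x hx, segment_flat rfl rfl hx,
        segment_flat rfl rfl hx])
    (by
      simp only [hB, hV, hW, pl]
      nlinarith)
    (fun x hx => mem_surface fun k hk hk0 => by
      have a1 := triangle_le (u := 0) (v := 1) (w := -η)
        (by simp only [hW, pl]; linarith) (by simp only [hB, pl]; linarith)
        (by simp only [hV, pl]; linarith) hx
      linarith)
    (by
      intro x hx hT
      have a2 := triangle_le (u := 1) (v := 0) (w := m - (1 / 2 - η / 4))
        (by simp only [hW, pl]; linarith) (by simp only [hB, pl]; linarith)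
        (by simp only [hV, pl]; linarith) hT
      rcases hx with ⟨b1, b2, b3, b4⟩ | hx | ⟨b1, b2, b3, b4⟩
      · linarith
      · exact Or.inl (eq_of_segment_max (-1) 0 hx (by simp only [hP, hW, pl]; linarith)
          (by simp only [hW, pl]; linarith))
      · have hx1 : x.1.1 = m - (1 / 2 - η / 4) := by linarith
        exact Or.inr (eq_pl hx1 (by rw [b3, hx1, hlo _ (by linarith)]; ring) b4))
  refine ⟨(isClosed_segment _ _).union (isClosed_segment _ _), ?_, ?_, ?_, L2, Setoid.trans i1 i2, ?_⟩
  · rintro x (hx | hx)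
    exacts [segment_flat rfl rfl hx, segment_flat rfl rfl hx]
  · rintro x (hx | hx)
    · rcases lt_or_ge x.1.1 (m - (1 - η) / 2) with h | h
      · exact Or.inl h
      · rw [segment_symm] at hx
        exact Or.inr (eq_of_segment_max 1 0 hx (by simp only [hP, hW, pl]; linarith)
          (by simp only [hP, pl]; linarith))
    · have := segment_le (u := 1) (v := 0) (w := m - (1 / 2 - η / 4))
        (by simp only [hW, pl]; linarith) (by simp only [hB, pl]; linarith) hx
      exact Or.inl (by linarith)
  · rintro x (hx | hx)
    · have := segment_le (u := 0) (v := -1) (w := η)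
        (by simp only [hP, pl]; linarith) (by simp only [hW, pl]; linarith) hx
      exact Or.inl (by linarith)
    · rcases lt_or_ge (-2 - η / 2) x.1.2 with h | h
      · exact Or.inl h
      · exact Or.inr (eq_of_segment_max 0 (-1) hx (by simp only [hB, hW, pl]; linarith)
          (by simp only [hB, pl]; linarith))
  · rw [hL2]; ext x; simp only [mem_union]; tauto

/-- The tip at height `1` is cut off at height `η`. The triangle lies above height `0` and hence
contains no puncture, while the lower arc stays below `-1`. -/
theorem Partial.tooth (h0 : 0 < η) (h1 : η ≤ 1 / 5) {i : Fin n} (hi : i ∈ I) {N : Set Space}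
    (h : Partial I hI η (pos i - (1 - η) / 2) N) : Partial I hI η (pos i + (1 - η) / 2)
      (N ∪ segment ℝ (pl (pos i - (1 - η) / 2) η) (pl (pos i + (1 - η) / 2) η)) := by
  have hm := pos_min_le I hI hi
  have hM := pos_le_max I hI hi
  have cu := continuous_upper I hI
  have cl := continuous_lower I hI
  obtain ⟨cN, fN, lN, aN, L, iL, eL⟩ := h
  have hup : ∀ x, |x - pos i| ≤ 1 / 2 → upper I hI x = 1 - 2 * |x - pos i| := fun x hx => upper_near hi hx
  set p := pos i with hp
  set a := pl (p - (1 - η) / 2) η with ha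
  set b := pl (p + (1 - η) / 2) η with hb
  set c := pl p 1 with hc
  obtain ⟨L1, hL1, i1⟩ := remove_vertex L (a := a) (b := b) (c := c)
    (Z := N ∪ (graphOn (upper I hI) (p + (1 - η) / 2) (pos (I.max' hI) + 1) ∪
      graphOn (lower I hI) (pos (I.min' hI) - (1 / 2 - η / 4)) (pos (I.max' hI) + 1)))
    (cN.union ((isClosed_graphOn cu _ _).union (isClosed_graphOn cl _ _)))
    (by
      rw [eL, graphOn_union (s := p - (1 - η) / 2) (t := p) (by linarith) (by linarith),
        graphOn_union (s := p) (t := p + (1 - η) / 2) (by linarith) (by linarith),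
        graphOn_eq_segment (a := η) (b := 1) (by linarith) 2 (fun x k1 k2 => by
          rw [hup x (by rw [abs_of_nonpos (by linarith)]; linarith), abs_of_nonpos (by linarith)]
          ring) (by ring),
        graphOn_eq_segment (a := 1) (b := η) (by linarith) (-2) (fun x k1 k2 => by
          rw [hup x (by rw [abs_of_nonneg (by linarith)]; linarith), abs_of_nonneg (by linarith)]
          ring) (by ring)]
      ext x; simp only [mem_union]; tauto)
    (by
      rw [eL]
      rintro x (hx | hx | hx)
      exacts [fN x hx, graphOn_flat x hx, graphOn_flat x hx])
    (by
      simp only [ha, hb, hc, pl]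
      nlinarith)
    (fun x hx => mem_surface fun k hk hk0 => by
      have := triangle_le (u := 0) (v := -1) (w := -η)
        (by simp only [ha, pl]; linarith) (by simp only [hb, pl]; linarith)
        (by simp only [hc, pl]; linarith) hx
      linarith)
    (by
      intro x hx hT
      have a1 := triangle_le (u := 0) (v := -1) (w := -η)
        (by simp only [ha, pl]; linarith) (by simp only [hb, pl]; linarith)
        (by simp only [hc, pl]; linarith) hT
      have a2 := triangle_le (u := 1) (v := 0) (w := p + (1 - η) / 2)
        (by simp only [ha, pl]; linarith) (by simp only [hb, pl]; linarith)
        (by simp only [hc, pl]; linarith) hT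
      have a3 := triangle_le (u := -1) (v := 0) (w := -(p - (1 - η) / 2))
        (by simp only [ha, pl]; linarith) (by simp only [hb, pl]; linarith)
        (by simp only [hc, pl]; linarith) hT
      rcases hx with hx | ⟨b1, b2, b3, b4⟩ | ⟨b1, b2, b3, b4⟩
      · exact Or.inl ((lN x hx).resolve_left (by linarith))
      · have hx1 : x.1.1 = p + (1 - η) / 2 := by linarith
        refine Or.inr (eq_pl hx1 ?_ b4)
        rw [b3, hx1, hup _ (by rw [abs_of_nonneg (by linarith)]; linarith), abs_of_nonneg (by linarith)]
        ring
      · have := lower_le_neg_one (I := I) (hI := hI) (x := x.1.1) (by linarith) b2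
        linarith)
  refine ⟨cN.union (isClosed_segment _ _), ?_, ?_, ?_, L1, Setoid.trans iL i1, ?_⟩
  · rintro x (hx | hx)
    exacts [fN x hx, segment_flat rfl rfl hx]
  · rintro x (hx | hx)
    · rcases lN x hx with h | rfl
      · exact Or.inl (by linarith)
      · exact Or.inl (by simp only [ha, pl]; linarith)
    · rcases lt_or_ge x.1.1 (p + (1 - η) / 2) with h | h
      · exact Or.inl h
      · exact Or.inr (eq_of_segment_max 1 0 hx (by simp only [ha, hb, pl]; linarith)
          (by simp only [hb, pl]; linarith))
  · rintro x (hx | hx)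
    · exact aN x hx
    · have := segment_le (u := 0) (v := -1) (w := η)
        (by simp only [ha, pl]; linarith) (by simp only [hb, pl]; linarith) hx
      exact Or.inl (by linarith)
  · rw [hL1]; ext x; simp only [mem_union]; tauto

end Curves

end PlanarSkein

namespace PlanarSkein

section Gap

variable {n : ℕ} {I : Finset (Fin n)} {hI : I.Nonempty} {η : ℝ}

-- Between two consecutive elements of `I` the upper arc descends from `P` to a lowest vertex `v`
-- and rises to `Q`. The corners `A` and `B` at height `-η` are inserted on the two slopes, and then
-- `v` is removed.
set_option maxHeartbeats 2000000 in
theorem Partial.gap (h0 : 0 < η) (h1 : η ≤ 1 / 5) {i j : Fin n} (hi : i ∈ I) (hj : j ∈ I) (hij : i < j)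
    (hc : ∀ l ∈ I, l ≤ i ∨ j ≤ l) {N : Set Space} (h : Partial I hI η (pos i + (1 - η) / 2) N) :
    Partial I hI η (pos j - (1 - η) / 2)
      (N ∪ (segment ℝ (pl (pos i + (1 - η) / 2) η) (pl (pos i + (1 / 2 - η / 4)) (-η)) ∪
        (segment ℝ (pl (pos i + (1 / 2 - η / 4)) (-η)) (pl (pos j - (1 / 2 - η / 4)) (-η)) ∪
        segment ℝ (pl (pos j - (1 / 2 - η / 4)) (-η)) (pl (pos j - (1 - η) / 2) η)))) := by
  have hm := pos_min_le I hI hi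
  have hM := pos_le_max I hI hj
  have cu := continuous_upper I hI
  have cl := continuous_lower I hI
  have hd : (pos j : ℝ) - pos i = 1 ∨ (2 : ℝ) ≤ pos j - pos i := by
    rcases (Nat.succ_le_of_lt (Fin.lt_def.mp hij)).eq_or_lt with e | e
    · left
      have : ((j : ℕ) : ℝ) = (i : ℕ) + 1 := by exact_mod_cast e.symm
      simp only [pos]; linarith
    · right
      have : ((i : ℕ) : ℝ) + 1 + 1 ≤ (j : ℕ) := by exact_mod_cast e
      simp only [pos]; linarith
  have hd1 : (1 : ℝ) ≤ pos j - pos i := by rcases hd with h | h <;> linarith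
  have hlo : ∀ x, lower I hI x ≤ -3 + 2 * max (pos i - x) (x - pos j) := lower_le hi hj
  obtain ⟨cN, fN, lN, aN, L, iL, eL⟩ := h
  have hui : ∀ x, pos i ≤ x → x ≤ (pos i + pos j) / 2 → upper I hI x = 1 - 2 * (x - pos i) := by
    intro x k1 k2
    rw [upper_eq hi (x := x), abs_of_nonneg (by linarith)]
    intro l hl
    rw [abs_of_nonneg (a := x - pos i) (by linarith)]
    rcases hc l hl with h | h
    · have := pos_le_pos h; exact le_trans (by linarith) (le_abs_self _)
    · have := pos_le_pos h; exact le_trans (by linarith) (neg_le_abs _)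
  have huj : ∀ x, (pos i + pos j) / 2 ≤ x → x ≤ pos j → upper I hI x = 1 - 2 * (pos j - x) := by
    intro x k1 k2
    rw [upper_eq hj (x := x), abs_of_nonpos (by linarith)]
    · ring
    intro l hl
    rw [abs_of_nonpos (a := x - pos j) (by linarith)]
    rcases hc l hl with h | h
    · have := pos_le_pos h; exact le_trans (by linarith) (le_abs_self _)
    · have := pos_le_pos h; exact le_trans (by linarith) (neg_le_abs _)
  have hpk : ∀ k : Fin n, ¬ (pos i < pos k ∧ (pos k : ℝ) < pos i + 1) := by
    rintro k ⟨k1, k2⟩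
    have hne : i ≠ k := by rintro rfl; exact lt_irrefl _ k1
    have := one_le_abs_pos hne
    rw [abs_of_nonneg (by linarith)] at this; linarith
  have hpk' : ∀ k : Fin n, ¬ (pos j - 1 < pos k ∧ (pos k : ℝ) < pos j) := by
    rintro k ⟨k1, k2⟩
    have hne : j ≠ k := by rintro rfl; exact lt_irrefl _ k2
    have := one_le_abs_pos hne
    rw [abs_of_nonpos (by linarith)] at this; linarith
  set p := pos i with hp
  set p' := pos j with hp'
  set P := pl (p + (1 - η) / 2) η with hP
  set A := pl (p + (1 / 2 - η / 4)) (-η) with hA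
  set B := pl (p' - (1 / 2 - η / 4)) (-η) with hB
  set Q := pl (p' - (1 - η) / 2) η with hQ
  set v := pl ((p + p') / 2) (1 - (p' - p)) with hv
  set R := graphOn (upper I hI) (p' - (1 - η) / 2) (pos (I.max' hI) + 1) with hR
  set Lo := graphOn (lower I hI) (pos (I.min' hI) - (1 / 2 - η / 4)) (pos (I.max' hI) + 1) with hLo
  have cR : IsClosed R := isClosed_graphOn cu _ _
  have cLo : IsClosed Lo := isClosed_graphOn cl _ _
  have fR : ∀ x ∈ R, x.2 = 1 / 2 := graphOn_flat
  have fLo : ∀ x ∈ Lo, x.2 = 1 / 2 := graphOn_flat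
  -- On the lower arc one of the two sums in question is at most `-3`, whereas both are at least
  -- `-1` on the triangles.
  have low : ∀ x ∈ Lo, p ≤ x.1.1 → x.1.1 ≤ p' →
      -1 ≤ 2 * (x.1.1 - p) + x.1.2 → -1 ≤ 2 * (p' - x.1.1) + x.1.2 → False := by
    rintro x ⟨-, -, b3, -⟩ k1 k2 k3 k4
    have := hlo x.1.1
    rcases max_choice (p - x.1.1) (x.1.1 - p') with h | h <;> rw [h] at this <;> linarith
  have e0 : L.carrier = (N ∪ (segment ℝ v Q ∪ (R ∪ Lo))) ∪ segment ℝ P v := by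
    rw [eL, graphOn_union (s := p + (1 - η) / 2) (t := (p + p') / 2) (by linarith) (by linarith),
      graphOn_union (s := (p + p') / 2) (t := p' - (1 - η) / 2) (by linarith) (by linarith),
      graphOn_eq_segment (a := η) (b := 1 - (p' - p)) (by linarith) (-2) (fun x k1 k2 => by
        rw [hui x (by linarith) (by linarith)]; ring) (by ring),
      graphOn_eq_segment (a := 1 - (p' - p)) (b := η) (by linarith) 2 (fun x k1 k2 => by
        rw [huj x (by linarith) (by linarith)]; ring) (by ring)]
    ext x; simp only [mem_union]; tauto
  have f0 : ∀ x ∈ L.carrier, x.2 = 1 / 2 := by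
    rw [e0]
    rintro x ((hx | hx | hx | hx) | hx)
    exacts [fN x hx, segment_flat rfl rfl hx, fR x hx, fLo x hx, segment_flat rfl rfl hx]
  obtain ⟨L1, hL1, i1⟩ := insert_vertex L (a := P) (b := v) (c := A)
    (cN.union ((isClosed_segment _ _).union (cR.union cLo))) e0 f0 rfl
    (by
      simp only [hP, hA, hv, pl]
      nlinarith)
    (fun x hx => mem_surface fun k hk hk0 => by
      have a1 := triangle_le (u := 2) (v := 1) (w := 1 + 2 * p)
        (by simp only [hP, pl]; linarith) (by simp only [hv, pl]; linarith)
        (by simp only [hA, pl]; linarith) hx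
      have a2 := triangle_le (u := -1) (v := 0) (w := -(p + (1 - η) / 2))
        (by simp only [hP, pl]; linarith) (by simp only [hv, pl]; linarith)
        (by simp only [hA, pl]; linarith) hx
      exact hpk k ⟨by linarith, by linarith⟩)
    (by
      intro x hx hT
      have a1 := triangle_le (u := -2) (v := -1) (w := 1 - 2 * p)
        (by simp only [hP, pl]; linarith) (by simp only [hv, pl]; linarith)
        (by simp only [hA, pl]; linarith) hT
      have a2 := triangle_le (u := -1) (v := 0) (w := -(p + (1 - η) / 2))
        (by simp only [hP, pl]; linarith) (by simp only [hv, pl]; linarith)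
        (by simp only [hA, pl]; linarith) hT
      have a3 := triangle_le (u := 1) (v := 0) (w := (p + p') / 2)
        (by simp only [hP, pl]; linarith) (by simp only [hv, pl]; linarith)
        (by simp only [hA, pl]; linarith) hT
      rcases hx with hx | hx | hx | hx
      · exact Or.inl ((lN x hx).resolve_left (by linarith))
      · rw [segment_symm] at hx
        exact Or.inr (eq_of_segment_max (-1) 0 hx (by simp only [hQ, hv, pl]; linarith)
          (by simp only [hv, pl]; linarith))
      · have := hx.1; linarith
      · exact (low x hx (by linarith) (by linarith) (by linarith) (by linarith)).elim)
  obtain ⟨L2, hL2, i2⟩ := insert_vertex L1 (a := v) (b := Q) (c := B)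
    (Z := N ∪ (segment ℝ P A ∪ (segment ℝ A v ∪ (R ∪ Lo))))
    (cN.union ((isClosed_segment _ _).union ((isClosed_segment _ _).union (cR.union cLo))))
    (by rw [hL1]; ext x; simp only [mem_union]; tauto)
    (by
      rw [hL1]
      rintro x ((hx | hx | hx | hx) | hx | hx)
      exacts [fN x hx, segment_flat rfl rfl hx, fR x hx, fLo x hx, segment_flat rfl rfl hx,
        segment_flat rfl rfl hx]) rfl
    (by
      simp only [hB, hQ, hv, pl]
      nlinarith)
    (fun x hx => mem_surface fun k hk hk0 => by
      have a1 := triangle_le (u := -2) (v := 1) (w := 1 - 2 * p')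
        (by simp only [hv, pl]; linarith) (by simp only [hQ, pl]; linarith)
        (by simp only [hB, pl]; linarith) hx
      have a2 := triangle_le (u := 1) (v := 0) (w := p' - (1 - η) / 2)
        (by simp only [hv, pl]; linarith) (by simp only [hQ, pl]; linarith)
        (by simp only [hB, pl]; linarith) hx
      exact hpk' k ⟨by linarith, by linarith⟩)
    (by
      intro x hx hT
      have a1 := triangle_le (u := 2) (v := -1) (w := 1 + 2 * p')
        (by simp only [hv, pl]; linarith) (by simp only [hQ, pl]; linarith)
        (by simp only [hB, pl]; linarith) hT
      have a2 := triangle_le (u := 1) (v := 0) (w := p' - (1 - η) / 2)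
        (by simp only [hv, pl]; linarith) (by simp only [hQ, pl]; linarith)
        (by simp only [hB, pl]; linarith) hT
      have a3 := triangle_le (u := -1) (v := 0) (w := -((p + p') / 2))
        (by simp only [hv, pl]; linarith) (by simp only [hQ, pl]; linarith)
        (by simp only [hB, pl]; linarith) hT
      rcases hx with hx | hx | hx | hx | hx
      · rcases lN x hx with h | rfl
        · linarith
        · simp only [hP, pl] at a3; linarith
      · have := segment_le (u := 1) (v := 0) (w := p + (1 / 2 - η / 4))
          (by simp only [hP, pl]; linarith) (by simp only [hA, pl]; linarith) hx
        linarith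
      · exact Or.inl (eq_of_segment_max 1 0 hx (by simp only [hA, hv, pl]; linarith)
          (by simp only [hv, pl]; linarith))
      · have hx1 : x.1.1 = p' - (1 - η) / 2 := by have := hx.1; linarith
        refine Or.inr (eq_pl hx1 ?_ (fR x hx))
        rw [hx.2.2.1, hx1, huj _ (by linarith) (by linarith)]; ring
      · exact (low x hx (by linarith) (by linarith) (by linarith) (by linarith)).elim)
  obtain ⟨L3, hL3, i3⟩ := remove_vertex L2 (a := A) (b := B) (c := v)
    (Z := N ∪ (segment ℝ P A ∪ (segment ℝ B Q ∪ (R ∪ Lo))))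
    (cN.union ((isClosed_segment _ _).union ((isClosed_segment _ _).union (cR.union cLo))))
    (by rw [hL2]; ext x; simp only [mem_union]; tauto)
    (by
      rw [hL2]
      rintro x ((hx | hx | hx | hx | hx) | hx | hx)
      exacts [fN x hx, segment_flat rfl rfl hx, segment_flat rfl rfl hx, fR x hx, fLo x hx,
        segment_flat rfl rfl hx, segment_flat rfl rfl hx])
    (by
      have e1 : p' - (1 / 2 - η / 4) - (p + (1 / 2 - η / 4)) ≠ 0 := by linarith
      have e2 : 1 - (p' - p) + η ≠ 0 := by rcases hd with h | h <;> linarith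
      simp only [hA, hB, hv, pl]
      intro e
      exact mul_ne_zero e1 e2 (by linear_combination e))
    (fun x hx => mem_surface fun k hk hk0 => by
      have a2 := triangle_le (u := 1) (v := 0) (w := p' - (1 / 2 - η / 4))
        (by simp only [hA, pl]; linarith) (by simp only [hB, pl]; linarith)
        (by simp only [hv, pl]; linarith) hx
      have a3 := triangle_le (u := -1) (v := 0) (w := -(p + (1 / 2 - η / 4)))
        (by simp only [hA, pl]; linarith) (by simp only [hB, pl]; linarith)
        (by simp only [hv, pl]; linarith) hx
      -- For neighbouring punctures `v` has height `0`, but no puncture lies strictly between them.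
      -- Otherwise `v` has height at most `-1`, and the triangle lies below `-η`.
      rcases hd with h | h
      · exact hpk k ⟨by linarith, by linarith⟩
      · have := triangle_le (u := 0) (v := 1) (w := -η)
          (by simp only [hA, pl]; linarith) (by simp only [hB, pl]; linarith)
          (by simp only [hv, pl]; linarith) hx
        linarith)
    (by
      intro x hx hT
      have a1 := triangle_le (u := 2) (v := -1) (w := 1 + 2 * p')
        (by simp only [hA, pl]; linarith) (by simp only [hB, pl]; linarith)
        (by simp only [hv, pl]; linarith) hT
      have a1' := triangle_le (u := -2) (v := -1) (w := 1 - 2 * p)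
        (by simp only [hA, pl]; linarith) (by simp only [hB, pl]; linarith)
        (by simp only [hv, pl]; linarith) hT
      have a2 := triangle_le (u := 1) (v := 0) (w := p' - (1 / 2 - η / 4))
        (by simp only [hA, pl]; linarith) (by simp only [hB, pl]; linarith)
        (by simp only [hv, pl]; linarith) hT
      have a3 := triangle_le (u := -1) (v := 0) (w := -(p + (1 / 2 - η / 4)))
        (by simp only [hA, pl]; linarith) (by simp only [hB, pl]; linarith)
        (by simp only [hv, pl]; linarith) hT
      rcases hx with hx | hx | hx | hx | hx
      · rcases lN x hx with h | rfl
        · linarith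
        · simp only [hP, pl] at a3; linarith
      · exact Or.inl (eq_of_segment_max 1 0 hx (by simp only [hP, hA, pl]; linarith)
          (by simp only [hA, pl]; linarith))
      · rw [segment_symm] at hx
        exact Or.inr (eq_of_segment_max (-1) 0 hx (by simp only [hQ, hB, pl]; linarith)
          (by simp only [hB, pl]; linarith))
      · have := hx.1; linarith
      · exact (low x hx (by linarith) (by linarith) (by linarith) (by linarith)).elim)
  refine ⟨cN.union ((isClosed_segment _ _).union ((isClosed_segment _ _).union (isClosed_segment _ _))),
    ?_, ?_, ?_, L3, Setoid.trans iL (Setoid.trans i1 (Setoid.trans i2 i3)), ?_⟩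
  · rintro x (hx | hx | hx | hx)
    exacts [fN x hx, segment_flat rfl rfl hx, segment_flat rfl rfl hx, segment_flat rfl rfl hx]
  · rintro x (hx | hx | hx | hx)
    · rcases lN x hx with h | rfl
      · exact Or.inl (by linarith)
      · exact Or.inl (by simp only [hP, pl]; linarith)
    · have := segment_le (u := 1) (v := 0) (w := p + (1 / 2 - η / 4))
        (by simp only [hP, pl]; linarith) (by simp only [hA, pl]; linarith) hx
      exact Or.inl (by linarith)
    · have := segment_le (u := 1) (v := 0) (w := p' - (1 / 2 - η / 4))
        (by simp only [hA, pl]; linarith) (by simp only [hB, pl]; linarith) hx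
      exact Or.inl (by linarith)
    · rcases lt_or_ge x.1.1 (p' - (1 - η) / 2) with h | h
      · exact Or.inl h
      · exact Or.inr (eq_of_segment_max 1 0 hx (by simp only [hB, hQ, pl]; linarith)
          (by simp only [hQ, pl]; linarith))
  · have aux : ∀ {a b : Space}, -η ≤ a.1.2 → -η ≤ b.1.2 → ∀ x ∈ segment ℝ a b, -2 - η / 2 < x.1.2 :=
      fun ha hb x hx => by
        have := segment_le (u := 0) (v := -1) (w := η) (by linarith) (by linarith) hx
        linarith
    rintro x (hx | hx | hx | hx)
    · exact aN x hx
    · exact Or.inl (aux (by simp only [hP, pl]; linarith) le_rfl x hx)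
    · exact Or.inl (aux le_rfl le_rfl x hx)
    · exact Or.inl (aux le_rfl (by simp only [hQ, pl]; linarith) x hx)
  · rw [hL3]; ext x; simp only [mem_union]; tauto

-- The right end is treated as the left one. Finally the lowest vertex `c` of the lower arc is cut
-- off, which leaves the horizontal bottom `B'B`; that triangle lies below all punctures.
set_option maxHeartbeats 1000000 in
theorem Partial.right (h0 : 0 < η) (h1 : η ≤ 1 / 5) {N : Set Space}
    (h : Partial I hI η (pos (I.max' hI) + (1 - η) / 2) N) :
    ∃ L : Link n, tLink I hI ≈ L ∧ L.carrier = N ∪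
      (segment ℝ (pl (pos (I.max' hI) + (1 - η) / 2) η) (pl (pos (I.max' hI) + (1 / 2 - η / 4)) (-η)) ∪
      (segment ℝ (pl (pos (I.max' hI) + (1 / 2 - η / 4)) (-η))
        (pl (pos (I.max' hI) + (1 / 2 - η / 4)) (-2 - η / 2)) ∪
      segment ℝ (pl (pos (I.min' hI) - (1 / 2 - η / 4)) (-2 - η / 2))
        (pl (pos (I.max' hI) + (1 / 2 - η / 4)) (-2 - η / 2)))) := by
  have hmm := pos_min_le I hI (I.max'_mem hI)
  have cu := continuous_upper I hI
  have cl := continuous_lower I hI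
  obtain ⟨cN, fN, lN, aN, L, iL, eL⟩ := h
  have hup : ∀ x, pos (I.max' hI) ≤ x → upper I hI x = 1 - 2 * (x - pos (I.max' hI)) :=
    fun x hx => upper_right I hI hx
  have hlo : ∀ x, pos (I.max' hI) ≤ x → lower I hI x = -3 + 2 * (x - pos (I.max' hI)) :=
    fun x hx => lower_right I hI hx
  have hl1 : ∀ x, x ≤ (pos (I.min' hI) + pos (I.max' hI)) / 2 →
      lower I hI x = -3 + 2 * (pos (I.min' hI) - x) := fun x hx => by
    rw [lower_eq, max_eq_left (by linarith)]
  have hl2 : ∀ x, (pos (I.min' hI) + pos (I.max' hI)) / 2 ≤ x →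
      lower I hI x = -3 + 2 * (x - pos (I.max' hI)) := fun x hx => by
    rw [lower_eq, max_eq_right (by linarith)]
  set m := pos (I.min' hI) with hm
  set M := pos (I.max' hI) with hM
  set P := pl (M + (1 - η) / 2) η with hP
  set W := pl (M + (1 / 2 - η / 4)) (-η) with hW
  set B := pl (M + (1 / 2 - η / 4)) (-2 - η / 2) with hB
  set B' := pl (m - (1 / 2 - η / 4)) (-2 - η / 2) with hB'
  set V := pl (M + 1) (-1) with hV
  set c := pl ((m + M) / 2) (-3 - (M - m)) with hc
  set Lo := graphOn (lower I hI) (m - (1 / 2 - η / 4)) (M + (1 / 2 - η / 4)) with hLo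
  have cLo : IsClosed Lo := isClosed_graphOn cl _ _
  have fLo : ∀ x ∈ Lo, x.2 = 1 / 2 := graphOn_flat
  have e0 : L.carrier = (N ∪ (segment ℝ B V ∪ Lo)) ∪ segment ℝ P V := by
    rw [eL, graphOn_union (f := lower I hI) (s := m - (1 / 2 - η / 4)) (t := M + (1 / 2 - η / 4))
        (by linarith) (by linarith),
      graphOn_eq_segment (f := upper I hI) (a := η) (b := -1) (by linarith) (-2)
        (fun x hx _ => by rw [hup x (by linarith)]; ring) (by ring),
      graphOn_eq_segment (f := lower I hI) (s := M + (1 / 2 - η / 4)) (a := -2 - η / 2) (b := -1)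
        (by linarith) 2 (fun x hx _ => by rw [hlo x (by linarith)]; ring) (by ring)]
    ext x; simp only [mem_union]; tauto
  obtain ⟨L1, hL1, i1⟩ := insert_vertex L (a := P) (b := V) (c := W)
    (cN.union ((isClosed_segment _ _).union cLo)) e0
    (by
      rw [e0]
      rintro x ((hx | hx | hx) | hx)
      exacts [fN x hx, segment_flat rfl rfl hx, fLo x hx, segment_flat rfl rfl hx]) rfl
    (by
      simp only [hP, hV, hW, pl]
      nlinarith)
    (fun x hx => mem_surface fun k hk hk0 => by
      have a1 := triangle_le (u := 4) (v := 1) (w := 4 * (M + 1) - 1)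
        (by simp only [hP, pl]; linarith) (by simp only [hV, pl]; linarith)
        (by simp only [hW, pl]; linarith) hx
      have a2 := triangle_le (u := -1) (v := 0) (w := -(M + (1 - η) / 2))
        (by simp only [hP, pl]; linarith) (by simp only [hV, pl]; linarith)
        (by simp only [hW, pl]; linarith) hx
      have hne : I.max' hI ≠ k := by rintro rfl; rw [hk, ← hM] at a2; linarith
      have := one_le_abs_pos hne
      rw [← hk, ← hM] at this
      rw [hk0] at a1
      rw [abs_of_nonneg (by linarith)] at this
      linarith)
    (by
      intro x hx hT
      have a2 := triangle_le (u := -1) (v := 0) (w := -(M + (1 - η) / 2))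
        (by simp only [hP, pl]; linarith) (by simp only [hV, pl]; linarith)
        (by simp only [hW, pl]; linarith) hT
      have a3 := triangle_le (u := 0) (v := -1) (w := 1)
        (by simp only [hP, pl]; linarith) (by simp only [hV, pl]; linarith)
        (by simp only [hW, pl]; linarith) hT
      rcases hx with hx | hx | ⟨b1, b2, b3, b4⟩
      · exact Or.inl ((lN x hx).resolve_left (by linarith))
      · exact Or.inr (eq_of_segment_max 0 1 hx (by simp only [hB, hV, pl]; linarith)
          (by simp only [hV, pl]; linarith))
      · rw [hlo _ (by linarith)] at b3
        linarith)
  obtain ⟨L2, hL2, i2⟩ := remove_vertex L1 (a := W) (b := B) (c := V) (Z := N ∪ (segment ℝ P W ∪ Lo))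
    (cN.union ((isClosed_segment _ _).union cLo))
    (by rw [hL1, segment_symm ℝ B V]; ext x; simp only [mem_union]; tauto)
    (by
      rw [hL1]
      rintro x ((hx | hx | hx) | hx | hx)
      exacts [fN x hx, segment_flat rfl rfl hx, fLo x hx, segment_flat rfl rfl hx,
        segment_flat rfl rfl hx])
    (by
      simp only [hB, hV, hW, pl]
      nlinarith)
    (fun x hx => mem_surface fun k hk hk0 => by
      have a1 := triangle_le (u := 0) (v := 1) (w := -η)
        (by simp only [hW, pl]; linarith) (by simp only [hB, pl]; linarith)
        (by simp only [hV, pl]; linarith) hx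
      linarith)
    (by
      intro x hx hT
      have a2 := triangle_le (u := -1) (v := 0) (w := -(M + (1 / 2 - η / 4)))
        (by simp only [hW, pl]; linarith) (by simp only [hB, pl]; linarith)
        (by simp only [hV, pl]; linarith) hT
      rcases hx with hx | hx | ⟨b1, b2, b3, b4⟩
      · rcases lN x hx with h | rfl
        · linarith
        · simp only [hP, pl] at a2; linarith
      · exact Or.inl (eq_of_segment_max 1 0 hx (by simp only [hP, hW, pl]; linarith)
          (by simp only [hW, pl]; linarith))
      · have hx1 : x.1.1 = M + (1 / 2 - η / 4) := by linarith
        exact Or.inr (eq_pl hx1 (by rw [b3, hx1, hlo _ (by linarith)]; ring) b4))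
  obtain ⟨L3, hL3, i3⟩ := remove_vertex L2 (a := B') (b := B) (c := c)
    (Z := N ∪ (segment ℝ P W ∪ segment ℝ W B))
    (cN.union ((isClosed_segment _ _).union (isClosed_segment _ _)))
    (by
      rw [hL2, hLo, graphOn_union (f := lower I hI) (s := m - (1 / 2 - η / 4)) (t := (m + M) / 2)
        (by linarith) (by linarith),
      graphOn_eq_segment (f := lower I hI) (a := -2 - η / 2) (b := -3 - (M - m)) (by linarith) (-2)
        (fun x _ hx => by rw [hl1 x (by linarith)]; ring) (by ring),
      graphOn_eq_segment (f := lower I hI) (a := -3 - (M - m)) (b := -2 - η / 2)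
        (by linarith) 2 (fun x hx _ => by rw [hl2 x (by linarith)]; ring) (by ring)]
      ext x; simp only [mem_union]; tauto)
    (by
      rw [hL2]
      rintro x ((hx | hx | hx) | hx)
      exacts [fN x hx, segment_flat rfl rfl hx, fLo x hx, segment_flat rfl rfl hx])
    (by
      simp only [hB, hB', hc, pl]
      nlinarith)
    (fun x hx => mem_surface fun k hk hk0 => by
      have a1 := triangle_le (u := 0) (v := 1) (w := -2 - η / 2)
        (by simp only [hB', pl]; linarith) (by simp only [hB, pl]; linarith)
        (by simp only [hc, pl]; linarith) hx
      linarith)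
    (by
      intro x hx hT
      have a1 := triangle_le (u := 0) (v := 1) (w := -2 - η / 2)
        (by simp only [hB', pl]; linarith) (by simp only [hB, pl]; linarith)
        (by simp only [hc, pl]; linarith) hT
      rcases hx with hx | hx | hx
      · exact Or.inl ((aN x hx).resolve_left (by linarith))
      · have := segment_le (u := 0) (v := -1) (w := η)
          (by simp only [hP, pl]; linarith) (by simp only [hW, pl]; linarith) hx
        linarith
      · exact Or.inr (eq_of_segment_max 0 (-1) hx (by simp only [hB, hW, pl]; linarith)
          (by simp only [hB, pl]; linarith)))
  refine ⟨L3, Setoid.trans iL (Setoid.trans i1 (Setoid.trans i2 i3)), ?_⟩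
  rw [hL3]; ext x; simp only [mem_union]; tauto

end Gap

end PlanarSkein

/-! ### The generators as combs in a chart -/

namespace PlanarSkein

open Engine

section Charted

variable {n : ℕ} {p : ℕ → ℤ} {hp : StrictMono p} {η : ℝ} {h0 : 0 < η} {h1 : η ≤ 1 / 5}

theorem chart_pt {i : Fin n} {k : ℕ} (hk : p k = (i : ℕ) + 1) {s : ℕ} (hs : s < 6) (j : ℕ) :
    (chart p hp η h0 h1).pt flat (6 * k + s, j) = pl (pos i + offset η s) (level η j) := by
  have : (p k : ℝ) = pos i := by rw [hk]; simp [pos]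
  simp only [Grid.pt, chart_gx k s hs, this, flat, pl]
  rfl

theorem chart_slant {i : Fin n} {k : ℕ} (hk : p k = (i : ℕ) + 1) :
    (chart p hp η h0 h1).pt flat (6 * k, 5) = pl (pos i - (1 / 2 - η / 4)) (-2 - η / 2) ∧
    (chart p hp η h0 h1).pt flat (6 * k, 6) = pl (pos i - (1 / 2 - η / 4)) (-η) ∧
    (chart p hp η h0 h1).pt flat (6 * k + 1, 7) = pl (pos i - (1 - η) / 2) η ∧
    (chart p hp η h0 h1).pt flat (6 * k + 4, 7) = pl (pos i + (1 - η) / 2) η ∧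
    (chart p hp η h0 h1).pt flat (6 * k + 5, 6) = pl (pos i + (1 / 2 - η / 4)) (-η) ∧
    (chart p hp η h0 h1).pt flat (6 * k + 5, 5) = pl (pos i + (1 / 2 - η / 4)) (-2 - η / 2) := by
  have h := fun s hs j => chart_pt (hp := hp) (h0 := h0) (h1 := h1) hk (s := s) hs j
  have e5 : level η 5 = -2 - η / 2 := by norm_num [level]
  have e6 : level η 6 = -η := by norm_num [level]
  have e7 : level η 7 = η := by norm_num [level]
  have f0 : offset η 0 = -(1 / 2 - η / 4) := by norm_num [offset]
  have f1 : offset η 1 = -((1 - η) / 2) := by norm_num [offset]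
  have f4 : offset η 4 = (1 - η) / 2 := by norm_num [offset]
  have f5 : offset η 5 = 1 / 2 - η / 4 := by norm_num [offset]
  have k0 := fun j => h 0 (by omega) j
  simp only [add_zero] at k0
  refine ⟨?_, ?_, ?_, ?_, ?_, ?_⟩
  · rw [k0, f0, e5, ← sub_eq_add_neg]
  · rw [k0, f0, e6, ← sub_eq_add_neg]
  · rw [h 1 (by omega), f1, e7, ← sub_eq_add_neg]
  · rw [h 4 (by omega), f4, e7]
  · rw [h 5 (by omega), f5, e6]
  · rw [h 5 (by omega), f5, e5]

theorem real_code {G : Grid} {d i j : ℕ} (hd : d < 4) (hi : i < 64) (hj : j < 16) :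
    G.real flat (bit (code d i j)) = segment ℝ (G.pt flat (if d = 3 then (i + 1, j) else (i, j)))
      (G.pt flat (if d = 0 then (i + 1, j) else if d = 2 then (i + 1, j + 1) else (i, j + 1))) := by
  rw [real_bit (by unfold code; omega), Grid.edge, src_code hd hi hj, tgt_code hd hi hj]

theorem real_line {G : Grid} {x x' y : ℕ} (h : x < x') (hx : x' ≤ 63) (hy : y < 16) :
    G.real flat (hline x x' y) = segment ℝ (G.pt flat (x, y)) (G.pt flat (x', y)) := by
  obtain ⟨m, rfl⟩ : ∃ m, x' = x + (m + 1) := ⟨x' - x - 1, by omega⟩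
  exact real_hline (by omega) hy

theorem real_tooth {i : Fin n} {k : ℕ} (hk : p k = (i : ℕ) + 1) (hk' : k < 10) :
    (chart p hp η h0 h1).real flat (tooth k) =
      segment ℝ (pl (pos i - (1 / 2 - η / 4)) (-η)) (pl (pos i - (1 - η) / 2) η) ∪
        (segment ℝ (pl (pos i - (1 - η) / 2) η) (pl (pos i + (1 - η) / 2) η) ∪
        segment ℝ (pl (pos i + (1 - η) / 2) η) (pl (pos i + (1 / 2 - η / 4)) (-η))) := by
  obtain ⟨-, e2, e3, e4, e5, -⟩ := chart_slant (hp := hp) (h0 := h0) (h1 := h1) hk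
  rw [tooth, nat_lor, nat_lor, real_lor, real_lor, real_code (by omega) (by omega) (by omega),
    real_code (by omega) (by omega) (by omega), real_line (by omega) (by omega) (by omega)]
  simp only [Nat.reduceEqDiff, reduceIte, Nat.add_assoc, Nat.reduceAdd]
  rw [e2, e3, e4, e5, segment_symm ℝ (pl (pos i + (1 / 2 - η / 4)) (-η))]

theorem real_frame {i j : Fin n} {k l : ℕ} (hk : p k = (i : ℕ) + 1) (hl : p l = (j : ℕ) + 1)
    (hkl : k ≤ l) (hl' : l < 10) (ρ : ℕ) :
    (chart p hp η h0 h1).real flat (Nat.lor (Nat.lor (bit (code 1 (6 * k) 5)) (bit (code 1 (6 * l + 5) 5)))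
      (Nat.lor (hline (6 * k) (6 * l + 5) 5) ρ)) =
      (segment ℝ (pl (pos i - (1 / 2 - η / 4)) (-η)) (pl (pos i - (1 / 2 - η / 4)) (-2 - η / 2)) ∪
        segment ℝ (pl (pos j + (1 / 2 - η / 4)) (-η)) (pl (pos j + (1 / 2 - η / 4)) (-2 - η / 2))) ∪
      (segment ℝ (pl (pos i - (1 / 2 - η / 4)) (-2 - η / 2)) (pl (pos j + (1 / 2 - η / 4)) (-2 - η / 2)) ∪
        (chart p hp η h0 h1).real flat ρ) := by
  obtain ⟨e1, e2, -, -, -, -⟩ := chart_slant (hp := hp) (h0 := h0) (h1 := h1) hk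
  obtain ⟨-, -, -, -, f5, f6⟩ := chart_slant (hp := hp) (h0 := h0) (h1 := h1) hl
  simp only [nat_lor]
  rw [real_lor, real_lor, real_lor, real_code (by omega) (by omega) (by omega),
    real_code (by omega) (by omega) (by omega), real_line (by omega) (by omega) (by omega)]
  simp only [Nat.reduceEqDiff, reduceIte, Nat.add_assoc, Nat.reduceAdd]
  rw [e1, e2, f5, f6, segment_symm ℝ (pl _ (-2 - η / 2)) (pl (pos i - (1 / 2 - η / 4)) (-η)),
    segment_symm ℝ (pl _ (-2 - η / 2)) (pl (pos j + (1 / 2 - η / 4)) (-η))]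

theorem real_gap {i j : Fin n} {k l : ℕ} (hk : p k = (i : ℕ) + 1) (hl : p l = (j : ℕ) + 1)
    (hkl : k < l) (hl' : l < 10) : (chart p hp η h0 h1).real flat (hline (6 * k + 5) (6 * l) 6) =
      segment ℝ (pl (pos i + (1 / 2 - η / 4)) (-η)) (pl (pos j - (1 / 2 - η / 4)) (-η)) := by
  rw [real_line (by omega) (by omega) (by omega),
    (chart_slant (hp := hp) (h0 := h0) (h1 := h1) hk).2.2.2.2.1,
    (chart_slant (hp := hp) (h0 := h0) (h1 := h1) hl).2.1]

theorem min'_eq {I : Finset (Fin n)} {hI : I.Nonempty} {i : Fin n} (hi : i ∈ I) (h : ∀ j ∈ I, i ≤ j) :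
    I.min' hI = i := le_antisymm (I.min'_le i hi) (I.le_min' hI i h)

theorem max'_eq {I : Finset (Fin n)} {hI : I.Nonempty} {i : Fin n} (hi : i ∈ I) (h : ∀ j ∈ I, j ≤ i) :
    I.max' hI = i := le_antisymm (I.max'_le hI i h) (I.le_max' i hi)

theorem Partial.right_of_eq (h0 : 0 < η) (h1 : η ≤ 1 / 5) {I : Finset (Fin n)} {hI : I.Nonempty}
    {i j : Fin n} (hi : I.min' hI = i) (hj : I.max' hI = j) {N : Set Space}
    (h : Partial I hI η (pos j + (1 - η) / 2) N) :
    ∃ L : Link n, tLink I hI ≈ L ∧ L.carrier = N ∪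
      (segment ℝ (pl (pos j + (1 - η) / 2) η) (pl (pos j + (1 / 2 - η / 4)) (-η)) ∪
      (segment ℝ (pl (pos j + (1 / 2 - η / 4)) (-η)) (pl (pos j + (1 / 2 - η / 4)) (-2 - η / 2)) ∪
      segment ℝ (pl (pos i - (1 / 2 - η / 4)) (-2 - η / 2)) (pl (pos j + (1 / 2 - η / 4)) (-2 - η / 2)))) := by
  subst hi hj
  exact h.right h0 h1

variable {R : Type*} [CommRing R] {r : Rˣ}

theorem Rep.of_slanted {G : Grid} (hG : FreeGrid n G) {K : List ℕ} (hK : small 6 K = true) {x : Skein n r}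
    (hx : Rep r G (slanted K) x) : Rep r G (shape 0 K) x := by
  have h := of_forSmall forSmall_slantedCheck le_rfl hK
  rw [slantedCheck, Bool.and_eq_true] at h
  exact (((strip_sound hG _ _).trans (chase_sound hG h.1)).trans (chase_sound hG h.2) x).mp hx

/-- The straightened pieces, a left end, a tooth and a right end, are exactly the segments of the
slanted comb. For two and three punctures, gaps and further teeth are put in between. -/
theorem rep_one {i : Fin n} {k : ℕ} (hi : p k = (i : ℕ) + 1) (hk : 0 < k) (hk' : k ≤ 6) :
    Rep r (chart p hp η h0 h1) (shape 0 [k]) (t₁ r i) := by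
  refine Rep.of_slanted (freeGrid_chart n) (by
    simp only [small, Bool.and_eq_true, Nat.ble_eq, Nat.blt_eq]; omega) ?_
  have hmin : ({i} : Finset (Fin n)).min' (by simp) = i := min'_eq (by simp) (by simp)
  have hmax : ({i} : Finset (Fin n)).max' (by simp) = i := max'_eq (by simp) (by simp)
  have s0 := partial_left (I := {i}) (hI := by simp) h0 h1
  rw [hmin] at s0
  have s1 := s0.tooth h0 h1 (by simp)
  obtain ⟨L, iL, eL⟩ := s1.right_of_eq h0 h1 hmin hmax
  refine ⟨L, ?_, (toSkein_eq r iL).symm⟩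
  rw [eL, slanted, first, final, real_frame hi hi le_rfl (by omega), ridge,
    real_tooth hi (by omega), segment_symm ℝ (pl (pos i - (1 - η) / 2) η) (pl _ (-η))]
  ac_rfl

theorem rep_two {i j : Fin n} {k l : ℕ} (hi : p k = (i : ℕ) + 1) (hj : p l = (j : ℕ) + 1) (hk : 0 < k)
    (hkl : k < l) (hl : l ≤ 6) : Rep r (chart p hp η h0 h1) (shape 0 [k, l]) (t₂ r i j) := by
  have hij : i < j := by
    have := hp hkl
    rw [hi, hj] at this
    exact Fin.lt_def.mpr (by omega)
  refine Rep.of_slanted (freeGrid_chart n) (by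
    simp only [small, Bool.and_eq_true, Nat.ble_eq, Nat.blt_eq]; omega) ?_
  have hmin : ({i, j} : Finset (Fin n)).min' (by simp) = i := min'_eq (by simp) (by simp [hij.le])
  have hmax : ({i, j} : Finset (Fin n)).max' (by simp) = j := max'_eq (by simp) (by simp [hij.le])
  have s0 := partial_left (I := {i, j}) (hI := by simp) h0 h1
  rw [hmin] at s0
  have s1 := (((s0.tooth h0 h1 (by simp)).gap h0 h1 (by simp) (by simp) hij (by simp)).tooth h0 h1
    (by simp))
  obtain ⟨L, iL, eL⟩ := s1.right_of_eq h0 h1 hmin hmax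
  refine ⟨L, ?_, (toSkein_eq r iL).symm⟩
  have f : final [k, l] = l := rfl
  rw [eL, slanted, first, f, real_frame hi hj hkl.le (by omega), ridge, nat_lor, nat_lor,
    real_lor, real_lor, real_gap hi hj hkl (by omega), ridge,
    real_tooth hi (by omega), real_tooth hj (by omega),
    segment_symm ℝ (pl (pos i - (1 - η) / 2) η) (pl _ (-η))]
  ac_rfl

theorem rep_three {i j m : Fin n} {k l o : ℕ} (hi : p k = (i : ℕ) + 1) (hj : p l = (j : ℕ) + 1)
    (hm : p o = (m : ℕ) + 1) (hk : 0 < k) (hkl : k < l) (hlo : l < o) (ho : o ≤ 6) :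
    Rep r (chart p hp η h0 h1) (shape 0 [k, l, o]) (t₃ r i j m) := by
  have hij : i < j := by
    have := hp hkl
    rw [hi, hj] at this
    exact Fin.lt_def.mpr (by omega)
  have hjm : j < m := by
    have := hp hlo
    rw [hm, hj] at this
    exact Fin.lt_def.mpr (by omega)
  refine Rep.of_slanted (freeGrid_chart n) (by
    simp only [small, Bool.and_eq_true, Nat.ble_eq, Nat.blt_eq]; omega) ?_
  have hmin : ({i, j, m} : Finset (Fin n)).min' (by simp) = i :=
    min'_eq (by simp) (by simp [hij.le, (hij.trans hjm).le])
  have hmax : ({i, j, m} : Finset (Fin n)).max' (by simp) = m :=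
    max'_eq (by simp) (by simp [hjm.le, (hij.trans hjm).le])
  have s0 := partial_left (I := {i, j, m}) (hI := by simp) h0 h1
  rw [hmin] at s0
  have s1 := (((((s0.tooth h0 h1 (by simp)).gap h0 h1 (by simp) (by simp) hij (by simp [hjm.le])).tooth h0 h1
    (by simp)).gap h0 h1 (by simp) (by simp) hjm (by simp [hij.le])).tooth h0 h1 (by simp))
  obtain ⟨L, iL, eL⟩ := s1.right_of_eq h0 h1 hmin hmax
  refine ⟨L, ?_, (toSkein_eq r iL).symm⟩
  have f : final [k, l, o] = o := rfl
  rw [eL, slanted, first, f, real_frame hi hm (hkl.trans hlo).le (by omega),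
    ridge, nat_lor, nat_lor, real_lor, real_lor, real_gap hi hj hkl (by omega), ridge, nat_lor, nat_lor,
    real_lor, real_lor, real_gap hj hm hlo (by omega), ridge,
    real_tooth hi (by omega), real_tooth hj (by omega), real_tooth hm (by omega),
    segment_symm ℝ (pl (pos i - (1 - η) / 2) η) (pl _ (-η))]
  ac_rfl

end Charted

end PlanarSkein

/-! ### Centrality of the elements `t_i` -/

namespace PlanarSkein

open Engine

/-- The square is the boundary of the cell `(8, 6)`, which contains the puncture in slot `1`. -/
theorem chase_box : chase (shape 0 [1]) (rect 8 6 9 7) = true := by decide +kernel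

theorem rect_box : rect 8 6 9 7 = bit (code 0 8 6) ||| (bit (code 0 8 7) ||| (bit (code 1 8 6) |||
    bit (code 1 9 6))) := by decide +kernel

section Central

variable {R : Type*} [CommRing R] {n : ℕ} {r : Rˣ}

/-- The parameter `η` of the chart is at our disposal: the cell around the puncture has half-width
`η` and half-height `η`, and its boundary represents `t_i`. -/
theorem exists_rep_box {η : ℝ} (h0 : 0 < η) (h1 : η ≤ 1 / 5) (i : Fin n) :
    ∃ L : Link n, L.toSkein r = t₁ r i ∧
      ∀ x ∈ L.carrier, |x.1.1 - pos i| ≤ η ∧ |x.1.2| ≤ η := by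
  -- Only slot `1` is used, and it carries the puncture `i`.
  let p : ℕ → ℤ := fun k => (i : ℕ) + k
  have hp : StrictMono p := fun a b h => by simp only [p]; omega
  have hi : p 1 = (i : ℕ) + 1 := by simp [p]
  obtain ⟨L, hL, e⟩ := (chase_sound (freeGrid_chart n) chase_box _).mp
    (rep_one (hp := hp) (h0 := h0) (h1 := h1) (r := r) hi one_pos (by omega))
  refine ⟨L, e, ?_⟩
  have f2 : offset η 2 = -η := by norm_num [offset]
  have f3 : offset η 3 = η := by norm_num [offset]
  have e6 : level η 6 = -η := by norm_num [level]
  have e7 : level η 7 = η := by norm_num [level]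
  have c1 : ∀ j, (chart p hp η h0 h1).pt flat (8, j) = pl (pos i + -η) (level η j) := fun j => by
    have := chart_pt (hp := hp) (h0 := h0) (h1 := h1) hi (s := 2) (by omega) j
    rwa [f2] at this
  have c2 : ∀ j, (chart p hp η h0 h1).pt flat (9, j) = pl (pos i + η) (level η j) := fun j => by
    have := chart_pt (hp := hp) (h0 := h0) (h1 := h1) hi (s := 3) (by omega) j
    rwa [f3] at this
  have key : ∀ {a b : Space}, |a.1.1 - pos i| ≤ η → |a.1.2| ≤ η → |b.1.1 - pos i| ≤ η → |b.1.2| ≤ η →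
      ∀ x ∈ segment ℝ a b, |x.1.1 - pos i| ≤ η ∧ |x.1.2| ≤ η := by
    intro a b a1 a2 b1 b2 x hx
    rw [abs_le] at a1 a2 b1 b2
    have s1 := segment_le (u := 1) (v := 0) (w := pos i + η) (by linarith) (by linarith) hx
    have s2 := segment_le (u := -1) (v := 0) (w := -pos i + η) (by linarith) (by linarith) hx
    have s3 := segment_le (u := 0) (v := 1) (w := η) (by linarith) (by linarith) hx
    have s4 := segment_le (u := 0) (v := -1) (w := η) (by linarith) (by linarith) hx
    rw [abs_le, abs_le]
    exact ⟨⟨by linarith, by linarith⟩, by linarith, by linarith⟩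
  rw [hL, rect_box, real_lor, real_lor, real_lor, real_code (by omega) (by omega) (by omega),
    real_code (by omega) (by omega) (by omega), real_code (by omega) (by omega) (by omega),
    real_code (by omega) (by omega) (by omega)]
  simp only [Nat.reduceEqDiff, reduceIte, Nat.reduceAdd]
  rw [c1, c1, c2, c2, e6, e7]
  have b1 : ∀ {y : ℝ}, |(pl (pos i + -η) y).1.1 - pos i| ≤ η := by
    simp [pl, abs_of_pos h0]
  have b2 : ∀ {y : ℝ}, |(pl (pos i + η) y).1.1 - pos i| ≤ η := by
    simp [pl, abs_of_pos h0]
  have b3 : ∀ {x : ℝ}, |(pl x η).1.2| ≤ η := by simp [pl, abs_of_pos h0]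
  have b4 : ∀ {x : ℝ}, |(pl x (-η)).1.2| ≤ η := by simp [pl, abs_of_pos h0]
  rintro x (hx | hx | hx | hx)
  exacts [key b1 b4 b2 b4 x hx, key b1 b3 b2 b3 x hx, key b1 b4 b1 b3 x hx, key b2 b4 b2 b3 x hx]

/-- The projection of a link is compact and misses the puncture, so a sufficiently small
representative of `t_i` has disjoint projection and `stack_comm` applies. Classes of links span the
algebra. -/
theorem t₁_mul_comm (i : Fin n) (x : Skein n r) : t₁ r i * x = x * t₁ r i := by
  refine skein_induction r (p := fun x => t₁ r i * x = x * t₁ r i) x (fun L => ?_) (fun x y hx hy => by rw [mul_add, add_mul, hx, hy])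
    fun c x hx => by rw [mul_smul_comm, smul_mul_assoc, hx]
  have hc : IsClosed (Prod.fst '' L.carrier) := (L.isCompact.image continuous_fst).isClosed
  have hm : ((pos i, 0) : ℝ × ℝ) ∈ (Prod.fst '' L.carrier)ᶜ := by
    rintro ⟨x, hx, e⟩
    exact (L.subset hx).1 i e
  obtain ⟨ε, hε, h⟩ := Metric.isOpen_iff.mp hc.isOpen_compl _ hm
  have h0 : 0 < min (1 / 5) (ε / 2) := lt_min (by norm_num) (by linarith)
  obtain ⟨M, hM, hM'⟩ := exists_rep_box (r := r) h0 (min_le_left _ _) i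
  rw [← hM, ← toSkein_stack, ← toSkein_stack]
  refine toSkein_eq r (stack_comm fun x hx y hy e => h (a := x.1) ?_ ⟨y, hy, e.symm⟩)
  obtain ⟨k1, k2⟩ := hM' x hx
  have k3 := min_le_right (1 / 5) (ε / 2)
  rw [Metric.mem_ball, Prod.dist_eq, Real.dist_eq, Real.dist_eq, sub_zero]
  exact max_lt (by linarith) (by linarith)

end Central

/-! ### Charts adapted to chosen punctures -/

section Charted

variable {R : Type*} [CommRing R] {n m : ℕ}

/-- A grid in which the combs at the slots `1, …, m` represent the generators with indices `a`. -/
structure Charted (r : Rˣ) (G : Grid) (a : Fin m → Fin n) : Prop where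
  free : FreeGrid n G
  present : Present n r G m
  one : ∀ i : Fin m, combClass r G [i + 1] = t₁ r (a i)
  two : ∀ i j : Fin m, i < j → combClass r G [i + 1, j + 1] = t₂ r (a i) (a j)
  three : ∀ i j k : Fin m, i < j → j < k → combClass r G [i + 1, j + 1, k + 1] = t₃ r (a i) (a j) (a k)

/-- For `m ≤ 6` the combs at the slots `1, …, m` fit into the range of columns for which the engine
is set up. -/
theorem exists_charted (r : Rˣ) {a : Fin m → Fin n} (ha : StrictMono a) (hm : m ≤ 6) :
    ∃ G : Grid, Charted r G a := by
  -- Slot `0` lies to the left of all punctures and the slots after `m` to the right of them, so `p`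
  -- is strictly increasing on all natural numbers.
  let p : ℕ → ℤ := fun k => if h : k - 1 < m ∧ 0 < k then ((a ⟨k - 1, h.1⟩ : ℕ) : ℤ) + 1 else
    if k = 0 then 0 else n + k
  have pa : ∀ i : Fin m, p (i + 1) = ((a i : ℕ) : ℤ) + 1 := fun i => dif_pos (c := (i : ℕ) + 1 - 1 < m ∧ 0 < (i : ℕ) + 1) ⟨i.2, by omega⟩
  have hp : StrictMono p := by
    refine strictMono_nat_of_lt_succ fun k => ?_
    rcases Nat.eq_zero_or_pos k with rfl | hk
    · have : p 0 = 0 := by simp [p]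
      rw [this]
      by_cases h : 0 < m
      · have := pa ⟨0, h⟩
        simp only [zero_add] at this
        rw [zero_add, this]; omega
      · have : p 1 = n + (1 : ℕ) := by simp [p, h]
        rw [zero_add, this]; push_cast; omega
    · obtain ⟨k, rfl⟩ : ∃ l, k = l + 1 := ⟨k - 1, by omega⟩
      by_cases h : k < m
      · rw [pa ⟨k, h⟩]
        by_cases h' : k + 1 < m
        · rw [pa ⟨k + 1, h'⟩]
          have : a ⟨k, h⟩ < a ⟨k + 1, h'⟩ := ha (by simp)
          have := Fin.lt_def.mp this
          omega
        · have e : p (k + 1 + 1) = n + ((k + 1 + 1 : ℕ) : ℤ) := by simp only [p]; simp [h']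
          rw [e]
          have := (a ⟨k, h⟩).2
          omega
      · have e : ∀ l, k ≤ l → p (l + 1) = n + ((l + 1 : ℕ) : ℤ) := fun l hl => by
          have : ¬ l < m := by omega
          simp only [p]; simp [this]
        rw [e k le_rfl, e (k + 1) (by omega)]; push_cast; omega
  have h1 : (1 / 5 : ℝ) ≤ 1 / 5 := le_rfl
  have r1 := fun i : Fin m => rep_one (hp := hp) (h0 := by norm_num) (h1 := h1) (r := r) (pa i)
    (by omega) (by omega)
  have r2 := fun (i j : Fin m) (h : i < j) => rep_two (hp := hp) (h0 := by norm_num) (h1 := h1) (r := r)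
    (pa i) (pa j) (by omega) (by simpa using h) (by omega)
  have r3 := fun (i j k : Fin m) (h : i < j) (h' : j < k) => rep_three (hp := hp) (h0 := by norm_num)
    (h1 := h1) (r := r) (pa i) (pa j) (pa k) (by omega) (by simpa using h) (by simpa using h') (by omega)
  refine ⟨chart p hp (1 / 5) (by norm_num) h1, freeGrid_chart n, fun K hK => ?_, fun i => (r1 i).cl_eq,
    fun i j h => (r2 i j h).cl_eq, fun i j k h h' => (r3 i j k h h').cl_eq⟩
  match K, hK with
  | [i], hK =>
    simp only [small, Bool.and_eq_true, Nat.ble_eq, Nat.blt_eq] at hK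
    obtain ⟨i, rfl⟩ : ∃ l, i = l + 1 := ⟨i - 1, by omega⟩
    exact ⟨_, r1 ⟨i, by omega⟩⟩
  | [i, j], hK =>
    simp only [small, Bool.and_eq_true, Nat.ble_eq, Nat.blt_eq] at hK
    obtain ⟨i, rfl⟩ : ∃ l, i = l + 1 := ⟨i - 1, by omega⟩
    obtain ⟨j, rfl⟩ : ∃ l, j = l + 1 := ⟨j - 1, by omega⟩
    exact ⟨_, r2 ⟨i, by omega⟩ ⟨j, by omega⟩ (Fin.lt_def.mpr (by simp; omega))⟩
  | [i, j, k], hK =>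
    simp only [small, Bool.and_eq_true, Nat.ble_eq, Nat.blt_eq] at hK
    obtain ⟨i, rfl⟩ : ∃ l, i = l + 1 := ⟨i - 1, by omega⟩
    obtain ⟨j, rfl⟩ : ∃ l, j = l + 1 := ⟨j - 1, by omega⟩
    obtain ⟨k, rfl⟩ : ∃ l, k = l + 1 := ⟨k - 1, by omega⟩
    exact ⟨_, r3 ⟨i, by omega⟩ ⟨j, by omega⟩ ⟨k, by omega⟩ (Fin.lt_def.mpr (by simp; omega))
      (Fin.lt_def.mpr (by simp; omega))⟩

end Charted

end PlanarSkein

/-! ### Algebra over the centre: from the `t_I` to the `s_I` -/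

namespace PlanarSkein

section Identities

variable {Z A : Type*} [CommRing Z] [Ring A] [Algebra Z A]

/-- The element `s_{ab}` in terms of `t_a`, `t_b` and `t_{ab}`. -/
def pairShift (β a b : Z) (ab : A) : A := ab + (β * (a * b)) • (1 : A)

/-- The element `s_{abc}` in terms of the elements `t_I`. -/
def tripleShift (β a b c : Z) (ab ac bc abc : A) : A :=
  abc + ((β * a) • bc + (β * b) • ac + (β * c) • ab) + (2 * β ^ 2 * (a * b * c)) • (1 : A)

/-- The element `s_{aa}`. -/
def selfShift (q q' β a : Z) : A := (q + q' - β * a ^ 2) • (1 : A)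

/-- The expansion of the product of two pairs that cross. -/
def crossTerm (q q' a b c d : Z) (ab cd bc ad F abc abd acd bcd : A) : A :=
  (q + q') • F + (a * b * c * d) • (1 : A) + (a • bcd + b • acd + c • abd + d • abc) +
    q • ((a * b) • cd + (c * d) • ab) + q' • ((a * d) • bc + (b * c) • ad) +
    q ^ 2 • (ab * cd) + q' ^ 2 • (bc * ad)

/-- The commutator of a triple with a pair that crosses it. -/
def fiveTerm (q q' a b c : Z) (ab bc de cde ade : A) : A :=
  (q' - q) • ((a * b) • cde + c • (ab * de) - (b * c) • ade - a • (bc * de)) +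
    (q' ^ 2 - q ^ 2) • (ab * cde - bc * ade)

variable {q q' β a b c d e f : Z} {ab ac ad ae bc bd be cd ce de abc abd acd bcd : A}

theorem pairShift_comm (h : cd * ab = ab * cd) :
    pairShift β c d cd * pairShift β a b ab = pairShift β a b ab * pairShift β c d cd := by
  simp only [pairShift, add_mul, mul_add, smul_mul_assoc, mul_smul_comm, one_mul, mul_one, h]
  match_scalars <;> ring

theorem tripleShift_comm_pairShift {cde : A} (h : cde * ab = ab * cde) (h1 : cd * ab = ab * cd)
    (h2 : ce * ab = ab * ce) (h3 : de * ab = ab * de) :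
    tripleShift β c d e cd ce de cde * pairShift β a b ab =
      pairShift β a b ab * tripleShift β c d e cd ce de cde := by
  simp only [pairShift, tripleShift, add_mul, mul_add, smul_mul_assoc, mul_smul_comm, one_mul, mul_one, h,
    h1, h2, h3]
  match_scalars <;> ring

theorem tripleShift_comm {x : A} (h : x * abc = abc * x) (h1 : x * ab = ab * x)
    (h2 : x * ac = ac * x) (h3 : x * bc = bc * x) :
    tripleShift β a b c ab ac bc abc * x = x * tripleShift β a b c ab ac bc abc := by
  simp only [tripleShift, add_mul, mul_add, smul_mul_assoc, mul_smul_comm, one_mul, mul_one, h,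
    h1, h2, h3]

/-- The combination `q AB - q' BA` eliminates `y` and equals `(q² - q'²) x + (q - q') E`. The factor
`q² - q'² = (q - q')(q + q')` and the relation `(q + q') β = 1` bring it to the form with shifts. -/
theorem pair_pair_three (hq : q * q' = 1) (hβ : (q + q') * β = 1) {y : A}
    (h : Bigon q q' bc ab ac y ((a * c) • (1 : A) + b • abc)) :
    q • (pairShift β b c bc * pairShift β a b ab) - q' • (pairShift β a b ab * pairShift β b c bc) =
      (q - q') • (selfShift q q' β b * pairShift β a c ac + b • tripleShift β a b c ab ac bc abc) := by
  simp only [pairShift, tripleShift, selfShift, add_mul, mul_add, smul_mul_assoc, mul_smul_comm, one_mul,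
    mul_one, h.1, h.2]
  match_scalars <;> grind

/-- In the commutator the terms of `crossTerm` that are symmetric in `q` and `q'` cancel, among them
`F`. The shifts absorb the terms with central factors, since `q² - q'² = (q - q') β⁻¹`. -/
theorem pair_pair_four (hq : q * q' = 1) (hβ : (q + q') * β = 1) {F : A}
    (h : ac * bd = crossTerm q q' a b c d ab cd bc ad F abc abd acd bcd)
    (h' : bd * ac = crossTerm q' q a b c d ab cd bc ad F abc abd acd bcd) (hc : ad * bc = bc * ad) :
    pairShift β b d bd * pairShift β a c ac - pairShift β a c ac * pairShift β b d bd =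
      (q ^ 2 - q' ^ 2) • (pairShift β a d ad * pairShift β b c bc -
        pairShift β a b ab * pairShift β c d cd) := by
  simp only [crossTerm] at h h'
  simp only [pairShift, add_mul, mul_add, smul_mul_assoc, mul_smul_comm, one_mul, mul_one, h, h', hc]
  match_scalars <;> grind

/-- As `abc` commutes with `ab`, only the corrections by `β a bc` and `β b ac` contribute. The
anonymous elements `y`, `z` in their commutators with `ab` cancel against the products on the right.
-/
theorem triple_pair_three (hq : q * q' = 1) (hβ : (q + q') * β = 1) {y z : A}
    (h : Bigon q q' bc ab ac y ((a * c) • (1 : A) + b • abc))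
    (h' : Bigon q q' ab ac bc z ((b * c) • (1 : A) + a • abc)) (hc : abc * ab = ab * abc) :
    tripleShift β a b c ab ac bc abc * pairShift β a b ab -
        pairShift β a b ab * tripleShift β a b c ab ac bc abc =
      (β * (q - q')) • (q • b • (pairShift β a b ab * pairShift β a c ac -
          selfShift q q' β a * pairShift β b c bc - a • tripleShift β a b c ab ac bc abc) -
        q' • a • (pairShift β a b ab * pairShift β b c bc -
          selfShift q q' β b * pairShift β a c ac - b • tripleShift β a b c ab ac bc abc)) := by
  simp only [pairShift, tripleShift, selfShift, add_mul, mul_add, smul_mul_assoc, mul_smul_comm, one_mul,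
    mul_one, h.1, h.2, h'.1, h'.2, hc]
  match_scalars <;> grind

/-- The combination eliminates `x` as before and leaves a multiple of `b F`. It is removed by the
product `ac bd`, in which `F` has the coefficient `q + q' = β⁻¹`; this explains the quadratic terms
with the factor `β`. -/
theorem triple_pair_four_left (hq : q * q' = 1) (hβ : (q + q') * β = 1) {F x : A}
    (h : ac * bd = crossTerm q q' a b c d ab cd bc ad F abc abd acd bcd)
    (hx : Bigon q q' bcd ab acd x (a • cd + b • F))
    (hc : cd * ab = ab * cd) (hd : ad * bc = bc * ad)
    {y z : A} (hy : Bigon q q' bc ab ac y ((a * c) • (1 : A) + b • abc))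
    (hz : Bigon q q' bd ab ad z ((a * d) • (1 : A) + b • abd)) :
    q • (tripleShift β b c d bc bd cd bcd * pairShift β a b ab) -
        q' • (pairShift β a b ab * tripleShift β b c d bc bd cd bcd) =
      (q - q') • (selfShift q q' β b * tripleShift β a c d ac ad cd acd +
        β • b • (pairShift β a c ac * pairShift β b d bd +
          (1 - q ^ 2) • (pairShift β a b ab * pairShift β c d cd) -
          q' ^ 2 • (pairShift β a d ad * pairShift β b c bc))) := by
  simp only [crossTerm] at h
  simp only [pairShift, tripleShift, selfShift, add_mul, mul_add, smul_mul_assoc, mul_smul_comm, one_mul,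
    mul_one, h, hx.1, hx.2, hy.1, hy.2, hz.1, hz.2, hc, hd]
  match_scalars <;> grind

/-- The same elimination with `a` as the common puncture; the two orders of the product exchange
their roles. -/
theorem triple_pair_four_right (hq : q * q' = 1) (hβ : (q + q') * β = 1) {F x : A}
    (h : ac * bd = crossTerm q q' a b c d ab cd bc ad F abc abd acd bcd)
    (hx : Bigon q q' ab acd bcd x (b • cd + a • F))
    (hc : cd * ab = ab * cd) (hd : ad * bc = bc * ad)
    {y z : A} (hy : Bigon q q' ab ac bc y ((b * c) • (1 : A) + a • abc))
    (hz : Bigon q q' ab ad bd z ((b * d) • (1 : A) + a • abd)) :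
    q' • (tripleShift β a c d ac ad cd acd * pairShift β a b ab) -
        q • (pairShift β a b ab * tripleShift β a c d ac ad cd acd) =
      (q' - q) • (selfShift q q' β a * tripleShift β b c d bc bd cd bcd +
        β • a • (pairShift β a c ac * pairShift β b d bd +
          (1 - q ^ 2) • (pairShift β a b ab * pairShift β c d cd) -
          q' ^ 2 • (pairShift β a d ad * pairShift β b c bc))) := by
  simp only [crossTerm] at h
  simp only [pairShift, tripleShift, selfShift, add_mul, mul_add, smul_mul_assoc, mul_smul_comm, one_mul,
    mul_one, h, hx.1, hx.2, hy.1, hy.2, hz.1, hz.2, hc, hd]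
  match_scalars <;> grind

/-- The commutator contains the anonymous elements `y` and `z`. They are eliminated by the products
`ad abc` and `ab acd`, and the remaining multiple of `F` by `ac bd`. -/
theorem triple_pair_four_cross (hq : q * q' = 1) (hβ : (q + q') * β = 1) {F y z : A}
    (h : ac * bd = crossTerm q q' a b c d ab cd bc ad F abc abd acd bcd)
    (h' : bd * ac = crossTerm q' q a b c d ab cd bc ad F abc abd acd bcd)
    (hy : Bigon q q' abc ad bcd y (d • bc + a • F)) (hz : Bigon q q' ab acd bcd z (b • cd + a • F))
    (hyz : abd * ac = ac * abd + (q - q') • (y - z)) (hc : cd * ab = ab * cd) (hd : ad * bc = bc * ad)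
    {x₁ x₂ x₃ : A} (h₁ : Bigon q q' ab ac bc x₁ ((b * c) • (1 : A) + a • abc))
    (h₂ : Bigon q q' ac ad cd x₂ ((c * d) • (1 : A) + a • acd))
    (h₃ : Bigon q q' ab ad bd x₃ ((b * d) • (1 : A) + a • abd)) :
    tripleShift β a b d ab ad bd abd * pairShift β a c ac -
        pairShift β a c ac * tripleShift β a b d ab ad bd abd =
      (q - q') • (q' • (pairShift β a d ad * tripleShift β a b c ab ac bc abc) -
        q • (pairShift β a b ab * tripleShift β a c d ac ad cd acd) +
        (q - q') • (selfShift q q' β a * tripleShift β b c d bc bd cd bcd) +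
        β • a • ((q - q') • (pairShift β a c ac * pairShift β b d bd) +
          (q - q' - q ^ 3) • (pairShift β a b ab * pairShift β c d cd) +
          (q' ^ 3 + q - q') • (pairShift β a d ad * pairShift β b c bc))) := by
  simp only [crossTerm] at h h'
  simp only [pairShift, tripleShift, selfShift, add_mul, mul_add, smul_mul_assoc, mul_smul_comm, one_mul,
    mul_one, h, h', hy.1, hy.2, hz.1, hz.2, hyz, hc, hd, h₁.1, h₁.2, h₂.1, h₂.2, h₃.1, h₃.2]
  match_scalars <;> grind

/-- The corrections in the triple contribute the commutators of `ac` with `bd` and `be`, in which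
`F` and `F'` cancel. -/
theorem triple_pair_five (hq : q * q' = 1) (hβ : (q + q') * β = 1) {ade bde cde F F' abe ace bce : A}
    (h : bde * ac = ac * bde + fiveTerm q q' a b c ab bc de cde ade)
    (h₁ : ac * bd = crossTerm q q' a b c d ab cd bc ad F abc abd acd bcd)
    (h₁' : bd * ac = crossTerm q' q a b c d ab cd bc ad F abc abd acd bcd)
    (h₂ : ac * be = crossTerm q q' a b c e ab ce bc ae F' abc abe ace bce)
    (h₂' : be * ac = crossTerm q' q a b c e ab ce bc ae F' abc abe ace bce)
    (hc : de * ac = ac * de) :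
    tripleShift β b d e bd be de bde * pairShift β a c ac -
        pairShift β a c ac * tripleShift β b d e bd be de bde =
      (q ^ 2 - q' ^ 2) • (pairShift β b c bc * tripleShift β a d e ad ae de ade -
        pairShift β a b ab * tripleShift β c d e cd ce de cde) := by
  simp only [crossTerm] at h₁ h₁' h₂ h₂'
  simp only [fiveTerm] at h
  simp only [pairShift, tripleShift, add_mul, mul_add, smul_mul_assoc, mul_smul_comm, one_mul,
    mul_one, h, h₁, h₁', h₂, h₂', hc]
  match_scalars <;> grind

/-- A rotation of the four labels exchanges the two pairs of opposite sides of the quadrilateral,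
and hence `q` and `q'`. Only the commutation of `ab` with `cd` is needed to reorder the products. -/
theorem crossTerm_rotate {F : A} (h : ab * cd = cd * ab) :
    crossTerm q q' a b c d ab cd bc ad F abc abd acd bcd =
      crossTerm q' q b c d a bc ad cd ab F bcd abc abd acd := by
  simp only [crossTerm, h]
  module

variable {R : Type*} [CommRing R] [Algebra R Z] [Algebra R A] [IsScalarTower R Z A] {u v : R}

theorem pairShift_intro : ab + u • ((a • (1 : A)) * (b • (1 : A))) = pairShift (algebraMap R Z u) a b ab := by
  simp only [pairShift, smul_mul_assoc, mul_smul_comm, one_mul, mul_one]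
  match_scalars <;> simp <;> ring

theorem tripleShift_intro : abc + u • ((a • (1 : A)) * bc + (b • (1 : A)) * ac + (c • (1 : A)) * ab) +
      (2 * u ^ 2) • ((a • (1 : A)) * (b • (1 : A)) * (c • (1 : A))) =
    tripleShift (algebraMap R Z u) a b c ab ac bc abc := by
  rw [two_mul (u ^ 2)]
  simp only [tripleShift, smul_mul_assoc, mul_smul_comm, one_mul, mul_one]
  match_scalars <;> simp <;> ring

theorem selfShift_intro {w : R} : algebraMap R A (u + v) - w • (a • (1 : A)) ^ 2 =
    selfShift (algebraMap R Z u) (algebraMap R Z v) (algebraMap R Z w) a := by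
  rw [Algebra.algebraMap_eq_smul_one (A := A)]
  simp only [selfShift, pow_two, smul_mul_assoc, mul_smul_comm, one_mul, mul_one]
  match_scalars <;> simp <;> ring

theorem algebraMap_sub_smul (x : A) : (algebraMap R Z u - algebraMap R Z v) • x = (u - v) • x := by
  rw [← map_sub, algebraMap_smul]

theorem crossTerm_intro {F : A} :
    (u + v) • F + (a • (1 : A)) * ((b • 1) * ((c • 1) * (d • 1))) +
        ((a • (1 : A)) * bcd + (b • (1 : A)) * acd + (c • (1 : A)) * abd + abc * (d • (1 : A))) +
        u • ((a • (1 : A)) * ((b • (1 : A)) * cd) + ab * ((c • 1) * (d • 1))) +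
        v • ((a • (1 : A)) * (bc * (d • (1 : A))) + (b • (1 : A)) * ((c • (1 : A)) * ad)) +
        u ^ 2 • (ab * cd) + v ^ 2 • (bc * ad) =
      crossTerm (algebraMap R Z u) (algebraMap R Z v) a b c d ab cd bc ad F abc abd acd bcd := by
  simp only [crossTerm, smul_mul_assoc, mul_smul_comm, one_mul, mul_one]
  match_scalars <;> simp <;> ring

variable {ade cde : A}

theorem fiveTerm_intro_one :
    (v - u) • ((a • (1 : A)) * ((b • (1 : A)) * cde) + ab * ((c • (1 : A)) * de) -
        (b • (1 : A)) * ((c • (1 : A)) * ade) - (a • (1 : A)) * (bc * de)) +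
      (v ^ 2 - u ^ 2) • (ab * cde - bc * ade) =
      fiveTerm (algebraMap R Z u) (algebraMap R Z v) a b c ab bc de cde ade := by
  simp only [fiveTerm, smul_mul_assoc, mul_smul_comm, one_mul, mul_one]
  match_scalars <;> simp <;> ring

/-- In the rotated cases the combs multiply in an order that differs from the cyclic one. The
required commutations of noncrossing curves are hypotheses. -/
theorem fiveTerm_intro_three (h1 : de * ab = ab * de) (h2 : de * bc = bc * de) (h3 : ade * bc = bc * ade) :
    (v - u) • ((a • (1 : A)) * ((b • (1 : A)) * cde) + de * (ab * (c • (1 : A))) -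
        ade * ((b • (1 : A)) * (c • (1 : A))) - de * ((a • (1 : A)) * bc)) +
      (v ^ 2 - u ^ 2) • (ab * cde - ade * bc) =
      fiveTerm (algebraMap R Z u) (algebraMap R Z v) a b c ab bc de cde ade := by
  simp only [fiveTerm, smul_mul_assoc, mul_smul_comm, one_mul, mul_one, h1, h2, h3]
  match_scalars <;> simp <;> ring

theorem fiveTerm_intro_four (h1 : de * ab = ab * de) (h2 : de * bc = bc * de) (h3 : ade * bc = bc * ade)
    (h4 : cde * ab = ab * cde) :
    (v - u) • (cde * ((a • (1 : A)) * (b • (1 : A))) + (c • (1 : A)) * (de * ab) -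
        (c • (1 : A)) * (ade * (b • (1 : A))) - de * ((a • (1 : A)) * bc)) +
      (v ^ 2 - u ^ 2) • (cde * ab - ade * bc) =
      fiveTerm (algebraMap R Z u) (algebraMap R Z v) a b c ab bc de cde ade := by
  simp only [fiveTerm, smul_mul_assoc, mul_smul_comm, one_mul, mul_one, h1, h2, h3, h4]
  match_scalars <;> simp <;> ring

theorem fiveTerm_intro_five (h1 : de * ab = ab * de) (h4 : cde * ab = ab * cde) :
    (v - u) • ((b • (1 : A)) * (cde * (a • (1 : A))) + (c • (1 : A)) * (de * ab) -
        (b • (1 : A)) * ((c • (1 : A)) * ade) - bc * (de * (a • (1 : A)))) +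
      (v ^ 2 - u ^ 2) • (cde * ab - bc * ade) =
      fiveTerm (algebraMap R Z u) (algebraMap R Z v) a b c ab bc de cde ade := by
  simp only [fiveTerm, smul_mul_assoc, mul_smul_comm, one_mul, mul_one, h1, h4]
  match_scalars <;> simp <;> ring

end Identities

end PlanarSkein

/-! ### Relations among the `t_I` for indices in cyclic order -/

namespace PlanarSkein

section Scalars

variable (R A : Type*) [CommRing R] [Ring A] [Algebra R A]

/-- The center of an algebra, as a ring of scalars. -/
def Scalars : Type _ := Subalgebra.center R A

noncomputable instance : CommRing (Scalars R A) := inferInstanceAs (CommRing (Subalgebra.center R A))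

noncomputable instance : Algebra R (Scalars R A) := inferInstanceAs (Algebra R (Subalgebra.center R A))

noncomputable instance : Algebra (Scalars R A) A :=
  (Subalgebra.center R A).val.toRingHom.toAlgebra' fun c x => (Subalgebra.mem_center_iff.mp c.2 x).symm

instance : IsScalarTower R (Scalars R A) A := IsScalarTower.of_algebraMap_eq fun _ => rfl

end Scalars

section Relations

variable {R : Type*} [CommRing R] {n : ℕ} (r : Rˣ)

theorem toSkein_tLink_congr {I J : Finset (Fin n)} (hI : I.Nonempty) (hJ : J.Nonempty) (h : I = J) :
    (tLink I hI).toSkein r = (tLink J hJ).toSkein r := by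
  subst h
  rfl

theorem t₂_comm (i j : Fin n) : t₂ r i j = t₂ r j i :=
  toSkein_tLink_congr r _ _ (Finset.pair_comm i j)

theorem t₃_rotate (i j k : Fin n) : t₃ r i j k = t₃ r j k i :=
  toSkein_tLink_congr r _ _ (by ext x; simp only [Finset.mem_insert, Finset.mem_singleton]; tauto)

/-- The central element `t_i`. -/
noncomputable def central (i : Fin n) : Scalars R (Skein n r) :=
  ⟨t₁ r i, Subalgebra.mem_center_iff.mpr fun x => (t₁_mul_comm i x).symm⟩

variable (n) in
/-- The scalars `q` and `q⁻¹` in the center. -/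
noncomputable def scalar (b : Bool) : Scalars R (Skein n r) := algebraMap R _ (turn r b)

theorem t₁_eq (i : Fin n) : t₁ r i = central r i • (1 : Skein n r) :=
  (mul_one (t₁ r i)).symm

theorem scalar_smul (b : Bool) (x : Skein n r) : scalar n r b • x = turn r b • x :=
  algebraMap_smul _ _ _

theorem scalar_mul : scalar n r true * scalar n r false = 1 := by
  rw [scalar, scalar, ← map_mul, turn_mul, map_one]

variable {r}

local notation "Q" => scalar n r true

local notation "Q'" => scalar n r false

local notation "z" => central r

theorem Bigon.scalar {A B x y E E' : Skein n r} (h : Bigon (turn r true) (turn r false) A B x y E)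
    (hE : E = E') : Bigon Q Q' A B x y E' := by
  subst hE
  simpa only [Bigon, scalar_smul] using h

variable (r) in
/-- The relations among the generators at three punctures in cyclic order. -/
def ThreeRelations (a b c : Fin n) : Prop :=
  (∃ y : Skein n r, Bigon Q Q' (t₂ r b c) (t₂ r a b) (t₂ r a c) y
    ((z a * z c) • (1 : Skein n r) + z b • t₃ r a b c)) ∧
  (∃ y : Skein n r, Bigon Q Q' (t₂ r a b) (t₂ r a c) (t₂ r b c) y
    ((z b * z c) • (1 : Skein n r) + z a • t₃ r a b c)) ∧
  t₃ r a b c * t₂ r a b = t₂ r a b * t₃ r a b c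

variable (r) in
/-- The relations among the generators at four punctures in cyclic order. -/
def FourRelations (a b c d : Fin n) : Prop :=
  (∃ F x y w : Skein n r, Bigon Q Q' (t₃ r b c d) (t₂ r a b) (t₃ r a c d) x
      (z a • t₂ r c d + z b • F) ∧
    Bigon Q Q' (t₂ r a b) (t₃ r a c d) (t₃ r b c d) w (z b • t₂ r c d + z a • F) ∧
    Bigon Q Q' (t₃ r a b c) (t₂ r a d) (t₃ r b c d) y (z d • t₂ r b c + z a • F) ∧
    t₃ r a b d * t₂ r a c = t₂ r a c * t₃ r a b d + (Q - Q') • (y - w) ∧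
    t₂ r a c * t₂ r b d = crossTerm Q Q' (z a) (z b) (z c) (z d) (t₂ r a b) (t₂ r c d) (t₂ r b c)
      (t₂ r a d) F (t₃ r a b c) (t₃ r a b d) (t₃ r a c d) (t₃ r b c d) ∧
    t₂ r b d * t₂ r a c = crossTerm Q' Q (z a) (z b) (z c) (z d) (t₂ r a b) (t₂ r c d) (t₂ r b c)
      (t₂ r a d) F (t₃ r a b c) (t₃ r a b d) (t₃ r a c d) (t₃ r b c d)) ∧
  t₂ r c d * t₂ r a b = t₂ r a b * t₂ r c d ∧ t₂ r a d * t₂ r b c = t₂ r b c * t₂ r a d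

variable (r) in
/-- The relations among the generators at five punctures in cyclic order. -/
def FiveRelations (a b c d e : Fin n) : Prop :=
  t₃ r b d e * t₂ r a c = t₂ r a c * t₃ r b d e + fiveTerm Q Q' (z a) (z b) (z c) (t₂ r a b) (t₂ r b c)
    (t₂ r d e) (t₃ r c d e) (t₃ r a d e) ∧
  t₃ r c d e * t₂ r a b = t₂ r a b * t₃ r c d e

variable (r) in
/-- The relation between the generators at six punctures in cyclic order. -/
def SixRelations (a b c d e f : Fin n) : Prop := t₃ r a b c * t₃ r d e f = t₃ r d e f * t₃ r a b c

/-- One chart for the increasing triple yields the relations for all rotations, since the combs were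
multiplied for each of them. The curves depend on the set of indices only, so the indices are
brought into increasing order first. -/
theorem threeRelations {a b c : Fin n} (h : a < b ∧ b < c) :
    ThreeRelations r a b c ∧ ThreeRelations r b c a ∧ ThreeRelations r c a b := by
  obtain ⟨h1, h2⟩ := h
  have hm : StrictMono ![a, b, c] := by
    rw [Fin.strictMono_iff_lt_succ]; intro i; fin_cases i <;> assumption
  obtain ⟨G, hG⟩ := exists_charted r hm (by omega)
  have e1 : combClass r G [1] = t₁ r a := hG.one 0
  have e2 : combClass r G [2] = t₁ r b := hG.one 1
  have e3 : combClass r G [3] = t₁ r c := hG.one 2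
  have e12 : combClass r G [1, 2] = t₂ r a b := hG.two 0 1 (by decide)
  have e13 : combClass r G [1, 3] = t₂ r a c := hG.two 0 2 (by decide)
  have e23 : combClass r G [2, 3] = t₂ r b c := hG.two 1 2 (by decide)
  have e123 : combClass r G [1, 2, 3] = t₃ r a b c := hG.three 0 1 2 (by decide) (by decide)
  obtain ⟨f1, f2, f3⟩ := combs_three hG.free hG.present
  obtain ⟨c1, c2, c3⟩ := combs_three_comm hG.free hG.present
  simp only [e1, e2, e3, e12, e13, e23, e123, t₁_eq, smul_mul_assoc, mul_smul_comm,
    mul_one, one_mul] at f1 f2 f3 c1 c2 c3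
  simp only [ThreeRelations, t₃_rotate r c a b, ← t₃_rotate r a b c, t₂_comm r b a, t₂_comm r c a,
    t₂_comm r c b]
  exact ⟨⟨⟨_, f1.scalar (by rw [smul_smul, mul_comm])⟩, ⟨_, f3.scalar (by rw [smul_smul, mul_comm])⟩, c1⟩,
    ⟨⟨_, f2.scalar (by rw [smul_smul, mul_comm])⟩, ⟨_, f1.scalar (by rw [smul_smul, mul_comm])⟩, c3⟩,
    ⟨_, f3.scalar (by rw [smul_smul, mul_comm])⟩, ⟨_, f2.scalar (by rw [smul_smul, mul_comm])⟩, c2⟩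

/-- Each anonymous curve serves for two rotations. The one in the `left` product for `a, b, c, d` is
also the element `y` in the relations for `b, c, d, a`. -/
theorem fourRelations {a b c d : Fin n} (h : a < b ∧ b < c ∧ c < d) :
    FourRelations r a b c d ∧ FourRelations r b c d a ∧ FourRelations r c d a b ∧
      FourRelations r d a b c := by
  obtain ⟨h1, h2, h3⟩ := h
  have hm : StrictMono ![a, b, c, d] := by
    rw [Fin.strictMono_iff_lt_succ]; intro i; fin_cases i <;> assumption
  obtain ⟨G, hG⟩ := exists_charted r hm (by omega)
  have e1 : combClass r G [1] = t₁ r a := hG.one 0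
  have e2 : combClass r G [2] = t₁ r b := hG.one 1
  have e3 : combClass r G [3] = t₁ r c := hG.one 2
  have e4 : combClass r G [4] = t₁ r d := hG.one 3
  have e12 : combClass r G [1, 2] = t₂ r a b := hG.two 0 1 (by decide)
  have e13 : combClass r G [1, 3] = t₂ r a c := hG.two 0 2 (by decide)
  have e14 : combClass r G [1, 4] = t₂ r a d := hG.two 0 3 (by decide)
  have e23 : combClass r G [2, 3] = t₂ r b c := hG.two 1 2 (by decide)
  have e24 : combClass r G [2, 4] = t₂ r b d := hG.two 1 3 (by decide)
  have e34 : combClass r G [3, 4] = t₂ r c d := hG.two 2 3 (by decide)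
  have e123 : combClass r G [1, 2, 3] = t₃ r a b c := hG.three 0 1 2 (by decide) (by decide)
  have e124 : combClass r G [1, 2, 4] = t₃ r a b d := hG.three 0 1 3 (by decide) (by decide)
  have e134 : combClass r G [1, 3, 4] = t₃ r a c d := hG.three 0 2 3 (by decide) (by decide)
  have e234 : combClass r G [2, 3, 4] = t₃ r b c d := hG.three 1 2 3 (by decide) (by decide)
  obtain ⟨f1, f2, f3, f4⟩ := combs_four_left hG.free hG.present
  obtain ⟨g1, g2, g3, g4⟩ := combs_four_right hG.free hG.present
  obtain ⟨k1, k2, k3, k4⟩ := combs_four_commutator hG.free hG.present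
  obtain ⟨l1, l2⟩ := combs_four_cross hG.free hG.present
  obtain ⟨c1, c2⟩ := combs_four_comm hG.free hG.present
  simp only [e1, e2, e3, e4, e12, e13, e14, e23, e24, e34, e123, e124, e134, e234, t₁_eq]
    at f1 f2 f3 f4 g1 g2 g3 g4 k1 k2 k3 k4 l1 l2 c1 c2
  simp only [smul_mul_assoc, mul_smul_comm, mul_one, one_mul] at f1 f2 f3 f4 g1 g2 g3 g4
  have ha : alpha r = turn r true + turn r false := rfl
  have ha' : alpha r = turn r false + turn r true := add_comm _ _
  rw [ha] at l1
  rw [ha'] at l2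
  have l1 := l1.trans (crossTerm_intro (u := turn r true) (v := turn r false) (a := z a) (b := z b) (c := z c) (d := z d)
    (ab := t₂ r a b) (cd := t₂ r c d) (bc := t₂ r b c) (ad := t₂ r a d) (F := combClass r G [1, 2, 3, 4])
    (abc := t₃ r a b c) (abd := t₃ r a b d) (acd := t₃ r a c d) (bcd := t₃ r b c d))
  have l2 := l2.trans (crossTerm_intro (u := turn r false) (v := turn r true) (a := z a) (b := z b) (c := z c) (d := z d)
    (ab := t₂ r a b) (cd := t₂ r c d) (bc := t₂ r b c) (ad := t₂ r a d) (F := combClass r G [1, 2, 3, 4])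
    (abc := t₃ r a b c) (abd := t₃ r a b d) (acd := t₃ r a c d) (bcd := t₃ r b c d))
  -- There are only two products of crossing pairs. Each rotation of the labels expresses them anew
  -- with `q` and `q⁻¹` exchanged.
  have m1 := l1.trans (crossTerm_rotate c1)
  have m2 := l2.trans (crossTerm_rotate c1)
  have key : ∀ x : Skein n r, (Q - Q') • x = (turn r true - turn r false) • x := fun x =>
    algebraMap_sub_smul (R := R) (Z := Scalars R (Skein n r)) (u := turn r true) (v := turn r false) x
  have sub : ∀ {x y w w' : Skein n r}, x - y = (turn r true - turn r false) • (w - w') →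
      x = y + (Q - Q') • (w - w') := fun h =>
    (sub_eq_iff_eq_add'.mp h).trans (congrArg _ (key _).symm)
  simp only [FourRelations, ← t₃_rotate r a b c, ← t₃_rotate r a b d, ← t₃_rotate r a c d,
    ← t₃_rotate r b c d, t₃_rotate r c a b, t₃_rotate r d a b, t₃_rotate r d a c, t₃_rotate r d b c,
    t₂_comm r b a, t₂_comm r c a, t₂_comm r d a, t₂_comm r c b, t₂_comm r d b, t₂_comm r d c]
  refine ⟨⟨⟨_, _, _, _, f1.scalar rfl, g1.scalar rfl, f4.scalar rfl, sub k1, l1, l2⟩, c1.symm, c2⟩,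
    ⟨⟨_, _, _, _, f2.scalar rfl, g2.scalar rfl, f1.scalar rfl, sub k2, m2, m1⟩, c2, c1⟩,
    ⟨⟨_, _, _, _, f3.scalar rfl, g3.scalar rfl, f2.scalar rfl, sub k3,
      m1.trans (crossTerm_rotate c2.symm), m2.trans (crossTerm_rotate c2.symm)⟩,
      c1, c2.symm⟩,
    ⟨⟨_, _, _, _, f4.scalar rfl, g4.scalar rfl, f3.scalar rfl, sub k4,
      (m2.trans (crossTerm_rotate c2.symm)).trans (crossTerm_rotate c1.symm),
      (m1.trans (crossTerm_rotate c2.symm)).trans (crossTerm_rotate c1.symm)⟩,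
      c2.symm, c1.symm⟩⟩

theorem fiveRelations {a b c d e : Fin n} (h : a < b ∧ b < c ∧ c < d ∧ d < e) :
    FiveRelations r a b c d e ∧ FiveRelations r b c d e a ∧ FiveRelations r c d e a b ∧
      FiveRelations r d e a b c ∧ FiveRelations r e a b c d := by
  obtain ⟨h1, h2, h3, h4⟩ := h
  have hm : StrictMono ![a, b, c, d, e] := by
    rw [Fin.strictMono_iff_lt_succ]; intro i; fin_cases i <;> assumption
  obtain ⟨G, hG⟩ := exists_charted r hm (by omega)
  have e1 : combClass r G [1] = t₁ r a := hG.one 0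
  have e2 : combClass r G [2] = t₁ r b := hG.one 1
  have e3 : combClass r G [3] = t₁ r c := hG.one 2
  have e4 : combClass r G [4] = t₁ r d := hG.one 3
  have e5 : combClass r G [5] = t₁ r e := hG.one 4
  have e12 : combClass r G [1, 2] = t₂ r a b := hG.two 0 1 (by decide)
  have e13 : combClass r G [1, 3] = t₂ r a c := hG.two 0 2 (by decide)
  have e14 : combClass r G [1, 4] = t₂ r a d := hG.two 0 3 (by decide)
  have e15 : combClass r G [1, 5] = t₂ r a e := hG.two 0 4 (by decide)
  have e23 : combClass r G [2, 3] = t₂ r b c := hG.two 1 2 (by decide)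
  have e24 : combClass r G [2, 4] = t₂ r b d := hG.two 1 3 (by decide)
  have e25 : combClass r G [2, 5] = t₂ r b e := hG.two 1 4 (by decide)
  have e34 : combClass r G [3, 4] = t₂ r c d := hG.two 2 3 (by decide)
  have e35 : combClass r G [3, 5] = t₂ r c e := hG.two 2 4 (by decide)
  have e45 : combClass r G [4, 5] = t₂ r d e := hG.two 3 4 (by decide)
  have e123 : combClass r G [1, 2, 3] = t₃ r a b c := hG.three 0 1 2 (by decide) (by decide)
  have e124 : combClass r G [1, 2, 4] = t₃ r a b d := hG.three 0 1 3 (by decide) (by decide)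
  have e125 : combClass r G [1, 2, 5] = t₃ r a b e := hG.three 0 1 4 (by decide) (by decide)
  have e134 : combClass r G [1, 3, 4] = t₃ r a c d := hG.three 0 2 3 (by decide) (by decide)
  have e135 : combClass r G [1, 3, 5] = t₃ r a c e := hG.three 0 2 4 (by decide) (by decide)
  have e145 : combClass r G [1, 4, 5] = t₃ r a d e := hG.three 0 3 4 (by decide) (by decide)
  have e234 : combClass r G [2, 3, 4] = t₃ r b c d := hG.three 1 2 3 (by decide) (by decide)
  have e235 : combClass r G [2, 3, 5] = t₃ r b c e := hG.three 1 2 4 (by decide) (by decide)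
  have e245 : combClass r G [2, 4, 5] = t₃ r b d e := hG.three 1 3 4 (by decide) (by decide)
  have e345 : combClass r G [3, 4, 5] = t₃ r c d e := hG.three 2 3 4 (by decide) (by decide)
  have l1 := combs_five_cross_one hG.free hG.present
  have l2 := combs_five_cross_two hG.free hG.present
  have l3 := combs_five_cross_three hG.free hG.present
  have l4 := combs_five_cross_four hG.free hG.present
  have l5 := combs_five_cross_five hG.free hG.present
  obtain ⟨c1, c2, c3, c4, c5⟩ := combs_five_comm hG.free hG.present
  simp only [e1, e2, e3, e4, e5, e12, e13, e14, e15, e23, e24, e25, e34, e35, e45, e123, e124, e125, e134,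
    e135, e145, e234, e235, e245, e345, t₁_eq] at l1 l2 l3 l4 l5 c1 c2 c3 c4 c5
  -- Commutations of disjoint pairs inside the five indices, which reorder the products in the last
  -- three rotations.
  have d1 := (fourRelations (r := r) ⟨h1, h2, h3⟩).1.2
  have d2 := (fourRelations (r := r) ⟨h1, h2, h3.trans h4⟩).1.2
  have d3 := (fourRelations (r := r) ⟨h1, h2.trans h3, h4⟩).1.2
  have d4 := (fourRelations (r := r) ⟨h1.trans h2, h3, h4⟩).1.2
  have d5 := (fourRelations (r := r) ⟨h2, h3, h4⟩).1.2
  simp only [FiveRelations, ← t₃_rotate r a b c, ← t₃_rotate r a b d, ← t₃_rotate r a b e,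
    ← t₃_rotate r a c d, ← t₃_rotate r a c e, ← t₃_rotate r a d e,
    ← t₃_rotate r b c d, ← t₃_rotate r b c e, ← t₃_rotate r b d e, ← t₃_rotate r c d e,
    t₃_rotate r c a b, t₃_rotate r d a b, t₃_rotate r e a b, t₃_rotate r d a c, t₃_rotate r e a c,
    t₃_rotate r e a d, t₃_rotate r d b c, t₃_rotate r e b c, t₃_rotate r e b d, t₃_rotate r e c d,
    t₂_comm r b a, t₂_comm r c a, t₂_comm r d a, t₂_comm r e a, t₂_comm r c b, t₂_comm r d b,
    t₂_comm r e b, t₂_comm r d c, t₂_comm r e c, t₂_comm r e d]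
  simp only [sub_eq_iff_eq_add'] at l1 l2 l3 l4 l5
  refine ⟨⟨l1.trans (congrArg _ (fiveTerm_intro_one (u := turn r true) (v := turn r false) (a := z a) (b := z b)
      (c := z c) (ab := t₂ r a b) (bc := t₂ r b c) (de := t₂ r d e) (cde := t₃ r c d e) (ade := t₃ r a d e))), c1.symm⟩,
    ⟨l2.trans (congrArg _ (fiveTerm_intro_one (u := turn r true) (v := turn r false) (a := z b) (b := z c)
      (c := z d) (ab := t₂ r b c) (bc := t₂ r c d) (de := t₂ r a e) (cde := t₃ r a d e) (ade := t₃ r a b e))), c2.symm⟩,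
    ⟨l3.trans (congrArg _ (fiveTerm_intro_three (u := turn r true) (v := turn r false) (a := z c) (b := z d)
      (c := z e) (ab := t₂ r c d) (bc := t₂ r d e) (de := t₂ r a b) (cde := t₃ r a b e) (ade := t₃ r a b c) d1.1.symm d3.1.symm c4.symm)), c3.symm⟩,
    ⟨l4.trans (congrArg _ (fiveTerm_intro_four (u := turn r true) (v := turn r false) (a := z d) (b := z e)
      (c := z a) (ab := t₂ r d e) (bc := t₂ r a e) (de := t₂ r b c) (cde := t₃ r a b c) (ade := t₃ r b c d) d5.1.symm d2.2.symm c5.symm c4.symm)), c4.symm⟩,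
    ⟨l5.trans (congrArg _ (fiveTerm_intro_five (u := turn r true) (v := turn r false) (a := z e) (b := z a)
      (c := z b) (ab := t₂ r a e) (bc := t₂ r a b) (de := t₂ r c d) (cde := t₃ r b c d) (ade := t₃ r c d e) d4.2.symm c5.symm)), c5.symm⟩⟩

/-- Rotation by three exchanges the two triples and gives the same relation read backwards, so three
rotations suffice. -/
theorem sixRelations {a b c d e f : Fin n} (h : a < b ∧ b < c ∧ c < d ∧ d < e ∧ e < f) :
    SixRelations r a b c d e f ∧ SixRelations r b c d e f a ∧ SixRelations r c d e f a b := by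
  obtain ⟨h1, h2, h3, h4, h5⟩ := h
  have hm : StrictMono ![a, b, c, d, e, f] := by
    rw [Fin.strictMono_iff_lt_succ]; intro i; fin_cases i <;> assumption
  obtain ⟨G, hG⟩ := exists_charted r hm (by omega)
  have e123 : combClass r G [1, 2, 3] = t₃ r a b c := hG.three 0 1 2 (by decide) (by decide)
  have e126 : combClass r G [1, 2, 6] = t₃ r a b f := hG.three 0 1 5 (by decide) (by decide)
  have e156 : combClass r G [1, 5, 6] = t₃ r a e f := hG.three 0 4 5 (by decide) (by decide)
  have e234 : combClass r G [2, 3, 4] = t₃ r b c d := hG.three 1 2 3 (by decide) (by decide)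
  have e345 : combClass r G [3, 4, 5] = t₃ r c d e := hG.three 2 3 4 (by decide) (by decide)
  have e456 : combClass r G [4, 5, 6] = t₃ r d e f := hG.three 3 4 5 (by decide) (by decide)
  have c := combs_six_comm hG.free hG.present
  simp only [e123, e126, e156, e234, e345, e456] at c
  simpa only [SixRelations, ← t₃_rotate r a e f, t₃_rotate r f a b] using c

end Relations

end PlanarSkein

/-! ### Cyclic order as a disjunction of linear orders -/

namespace PlanarSkein

section Cyclic

variable {n : ℕ}

/-- With the rotations written out, cyclic order passes to subsequences by linear arithmetic. -/
def Cyclic₃ (a b c : Fin n) : Prop :=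
  (a < b ∧ b < c) ∨ (b < c ∧ c < a) ∨ (c < a ∧ a < b)

def Cyclic₄ (a b c d : Fin n) : Prop :=
  (a < b ∧ b < c ∧ c < d) ∨ (b < c ∧ c < d ∧ d < a) ∨ (c < d ∧ d < a ∧ a < b) ∨ (d < a ∧ a < b ∧ b < c)

def Cyclic₅ (a b c d e : Fin n) : Prop :=
  (a < b ∧ b < c ∧ c < d ∧ d < e) ∨ (b < c ∧ c < d ∧ d < e ∧ e < a) ∨ (c < d ∧ d < e ∧ e < a ∧ a < b) ∨ (d < e ∧ e < a ∧ a < b ∧ b < c) ∨ (e < a ∧ a < b ∧ b < c ∧ c < d)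

def Cyclic₆ (a b c d e f : Fin n) : Prop :=
  (a < b ∧ b < c ∧ c < d ∧ d < e ∧ e < f) ∨ (b < c ∧ c < d ∧ d < e ∧ e < f ∧ f < a) ∨ (c < d ∧ d < e ∧ e < f ∧ f < a ∧ a < b) ∨ (d < e ∧ e < f ∧ f < a ∧ a < b ∧ b < c) ∨ (e < f ∧ f < a ∧ a < b ∧ b < c ∧ c < d) ∨ (f < a ∧ a < b ∧ b < c ∧ c < d ∧ d < e)

theorem CyclicOrder.cyclic₃ {i : Fin 3 → Fin n} (h : CyclicOrder i) : Cyclic₃ (i 0) (i 1) (i 2) := by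
  obtain ⟨v, hv⟩ := h
  have hv := Fin.strictMono_iff_lt_succ.mp hv
  match v, hv with
  | 0, hv => exact Or.inl ⟨hv 0, hv 1⟩
  | 1, hv => exact Or.inr (Or.inl ⟨hv 0, hv 1⟩)
  | 2, hv => exact Or.inr (Or.inr (⟨hv 0, hv 1⟩))

theorem CyclicOrder.cyclic₄ {i : Fin 4 → Fin n} (h : CyclicOrder i) : Cyclic₄ (i 0) (i 1) (i 2) (i 3) := by
  obtain ⟨v, hv⟩ := h
  have hv := Fin.strictMono_iff_lt_succ.mp hv
  match v, hv with
  | 0, hv => exact Or.inl ⟨hv 0, hv 1, hv 2⟩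
  | 1, hv => exact Or.inr (Or.inl ⟨hv 0, hv 1, hv 2⟩)
  | 2, hv => exact Or.inr (Or.inr (Or.inl ⟨hv 0, hv 1, hv 2⟩))
  | 3, hv => exact Or.inr (Or.inr (Or.inr (⟨hv 0, hv 1, hv 2⟩)))

theorem CyclicOrder.cyclic₅ {i : Fin 5 → Fin n} (h : CyclicOrder i) : Cyclic₅ (i 0) (i 1) (i 2) (i 3) (i 4) := by
  obtain ⟨v, hv⟩ := h
  have hv := Fin.strictMono_iff_lt_succ.mp hv
  match v, hv with
  | 0, hv => exact Or.inl ⟨hv 0, hv 1, hv 2, hv 3⟩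
  | 1, hv => exact Or.inr (Or.inl ⟨hv 0, hv 1, hv 2, hv 3⟩)
  | 2, hv => exact Or.inr (Or.inr (Or.inl ⟨hv 0, hv 1, hv 2, hv 3⟩))
  | 3, hv => exact Or.inr (Or.inr (Or.inr (Or.inl ⟨hv 0, hv 1, hv 2, hv 3⟩)))
  | 4, hv => exact Or.inr (Or.inr (Or.inr (Or.inr (⟨hv 0, hv 1, hv 2, hv 3⟩))))

theorem CyclicOrder.cyclic₆ {i : Fin 6 → Fin n} (h : CyclicOrder i) : Cyclic₆ (i 0) (i 1) (i 2) (i 3) (i 4) (i 5) := by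
  obtain ⟨v, hv⟩ := h
  have hv := Fin.strictMono_iff_lt_succ.mp hv
  match v, hv with
  | 0, hv => exact Or.inl ⟨hv 0, hv 1, hv 2, hv 3, hv 4⟩
  | 1, hv => exact Or.inr (Or.inl ⟨hv 0, hv 1, hv 2, hv 3, hv 4⟩)
  | 2, hv => exact Or.inr (Or.inr (Or.inl ⟨hv 0, hv 1, hv 2, hv 3, hv 4⟩))
  | 3, hv => exact Or.inr (Or.inr (Or.inr (Or.inl ⟨hv 0, hv 1, hv 2, hv 3, hv 4⟩)))
  | 4, hv => exact Or.inr (Or.inr (Or.inr (Or.inr (Or.inl ⟨hv 0, hv 1, hv 2, hv 3, hv 4⟩))))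
  | 5, hv => exact Or.inr (Or.inr (Or.inr (Or.inr (Or.inr (⟨hv 0, hv 1, hv 2, hv 3, hv 4⟩)))))

theorem CyclicOrder.ne {m : ℕ} [NeZero m] {i : Fin m → Fin n} (h : CyclicOrder i) {j k : Fin m} (hjk : j ≠ k) :
    i j ≠ i k := by
  obtain ⟨v, hv⟩ := h
  intro e
  have := hv.injective (a₁ := j - v) (a₂ := k - v) (by simpa using e)
  exact hjk (sub_left_injective this)

variable {R : Type*} [CommRing R] {r : Rˣ}

/-- If a rotation of the triple is increasing, the inverse rotation of the relations for that
increasing triple is the one required. -/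
theorem Cyclic₃.relations {a b c : Fin n} (h : Cyclic₃ a b c) : ThreeRelations r a b c := by
  rcases h with h | h | h
  exacts [(threeRelations h).1, (threeRelations h).2.2, (threeRelations h).2.1]

theorem Cyclic₄.relations {a b c d : Fin n} (h : Cyclic₄ a b c d) : FourRelations r a b c d := by
  rcases h with h | h | h | h
  exacts [(fourRelations h).1, (fourRelations h).2.2.2, (fourRelations h).2.2.1, (fourRelations h).2.1]

theorem Cyclic₅.relations {a b c d e : Fin n} (h : Cyclic₅ a b c d e) : FiveRelations r a b c d e := by
  rcases h with h | h | h | h | h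
  exacts [(fiveRelations h).1, (fiveRelations h).2.2.2.2, (fiveRelations h).2.2.2.1, (fiveRelations h).2.2.1, (fiveRelations h).2.1]

theorem Cyclic₆.relations {a b c d e f : Fin n} (h : Cyclic₆ a b c d e f) : SixRelations r a b c d e f := by
  rcases h with h | h | h | h | h | h
  exacts [(sixRelations h).1, (sixRelations h).2.2.symm, (sixRelations h).2.1.symm, (sixRelations h).1.symm,
    (sixRelations h).2.2, (sixRelations h).2.1]

end Cyclic

/-! ### The shifted generators over the centre -/

section Generators

variable {R : Type*} [CommRing R] {n : ℕ} (r : Rˣ)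

variable (n) in
/-- The scalar `β` in the center. -/
noncomputable def shift : Scalars R (Skein n r) := algebraMap R _ (beta r)

theorem s₂_eq {i j : Fin n} (h : i ≠ j) :
    s₂ r i j = pairShift (shift n r) (central r i) (central r j) (t₂ r i j) := by
  rw [s₂, if_neg h, t₁_eq, t₁_eq]
  exact pairShift_intro (u := beta r) (a := central r i) (b := central r j) (ab := t₂ r i j)

theorem s₂_self (i : Fin n) :
    s₂ r i i = selfShift (scalar n r true) (scalar n r false) (shift n r) (central r i) := by
  rw [s₂, if_pos rfl, t₁_eq]
  exact selfShift_intro (u := turn r true) (v := turn r false) (w := beta r) (a := central r i)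

theorem s₃_eq (i j k : Fin n) :
    s₃ r i j k = tripleShift (shift n r) (central r i) (central r j) (central r k) (t₂ r i j) (t₂ r i k)
      (t₂ r j k) (t₃ r i j k) := by
  rw [s₃, t₁_eq, t₁_eq, t₁_eq]
  exact tripleShift_intro (u := beta r) (a := central r i) (b := central r j) (c := central r k)
    (ab := t₂ r i j) (ac := t₂ r i k) (bc := t₂ r j k) (abc := t₃ r i j k)

theorem t₁_mul (i : Fin n) (x : Skein n r) : t₁ r i * x = central r i • x := by
  rw [t₁_eq, smul_mul_assoc, one_mul]

theorem smul_eq (c : R) (x : Skein n r) : c • x = algebraMap R (Scalars R (Skein n r)) c • x :=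
  (algebraMap_smul _ _ _).symm

/-- `Ring.inverse` gives the true inverse because the hypothesis makes `α` a unit, and inverses are
unique. -/
theorem beta_eq {β : R} (h : (turn r true + turn r false) * β = 1) : beta r = β := by
  have hu : IsUnit (alpha r) := IsUnit.of_mul_eq_one β h
  have h1 : alpha r * beta r = 1 := Ring.mul_inverse_cancel _ hu
  have h2 : alpha r * β = 1 := h
  calc beta r = (alpha r * β) * beta r := by rw [h2, one_mul]
    _ = β * (alpha r * beta r) := by ring
    _ = β := by rw [h1, mul_one]

end Generators

end PlanarSkein

/-! ### The identities in the skein algebra -/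

namespace PlanarSkein

section SkeinIdentities

variable {R : Type*} [CommRing R] {n : ℕ} {r : Rˣ}

local notation "Q" => scalar n r true

local notation "Q'" => scalar n r false

local notation "β" => shift n r

theorem scalar_shift {w : R} (h : (turn r true + turn r false) * w = 1) : (Q + Q') * β = 1 := by
  rw [shift, scalar, scalar, ← map_add, ← map_mul, beta_eq r h, h, map_one]

theorem s₂_comm_s₂ {a b c d : Fin n} (hab : a ≠ b) (hcd : c ≠ d) (h : Cyclic₄ a b c d) :
    s₂ r c d * s₂ r a b = s₂ r a b * s₂ r c d := by
  rw [s₂_eq r hab, s₂_eq r hcd]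
  exact pairShift_comm h.relations.2.1

theorem s₃_comm_s₂ {a b c d e : Fin n} (hab : a ≠ b) (h : Cyclic₅ a b c d e) :
    s₃ r c d e * s₂ r a b = s₂ r a b * s₃ r c d e := by
  -- Subsequences of a cyclically ordered sequence are cyclically ordered. The pairs inside the
  -- triple therefore commute with `t_{ab}` as well.
  have h1 : Cyclic₄ a b c d := by simp only [Cyclic₅, Cyclic₄, Fin.lt_def] at h ⊢; omega
  have h2 : Cyclic₄ a b c e := by simp only [Cyclic₅, Cyclic₄, Fin.lt_def] at h ⊢; omega
  have h3 : Cyclic₄ a b d e := by simp only [Cyclic₅, Cyclic₄, Fin.lt_def] at h ⊢; omega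
  rw [s₂_eq r hab, s₃_eq]
  exact tripleShift_comm_pairShift h.relations.2 h1.relations.2.1 h2.relations.2.1 h3.relations.2.1

-- Every term of one shifted triple commutes with every term of the other: triples with triples by
-- the relations for six indices, triples with pairs by those for five, pairs with pairs by those
-- for four.
set_option maxHeartbeats 2000000 in
theorem s₃_comm_s₃ {a b c d e f : Fin n} (h : Cyclic₆ a b c d e f) :
    s₃ r a b c * s₃ r d e f = s₃ r d e f * s₃ r a b c := by
  have five : ∀ {x y z v w : Fin n}, Cyclic₅ x y z v w → t₃ r z v w * t₂ r x y = t₂ r x y * t₃ r z v w :=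
    fun h => h.relations.2
  have four : ∀ {x y z w : Fin n}, Cyclic₄ x y z w → t₂ r z w * t₂ r x y = t₂ r x y * t₂ r z w :=
    fun h => h.relations.2.1
  have key : ∀ x : Skein n r, t₃ r d e f * x = x * t₃ r d e f → t₂ r d e * x = x * t₂ r d e →
      t₂ r d f * x = x * t₂ r d f → t₂ r e f * x = x * t₂ r e f → s₃ r d e f * x = x * s₃ r d e f := by
    intro x h1 h2 h3 h4
    rw [s₃_eq]
    exact tripleShift_comm h1.symm h2.symm h3.symm h4.symm
  have six : t₃ r d e f * t₃ r a b c = t₃ r a b c * t₃ r d e f := Eq.symm h.relations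
  rw [s₃_eq r a b c]
  refine tripleShift_comm (key (t₃ r a b c) six (five (show Cyclic₅ d e a b c from ?_)).symm (five (show Cyclic₅ d f a b c from ?_)).symm (five (show Cyclic₅ e f a b c from ?_)).symm)
    (key (t₂ r a b) (five (show Cyclic₅ a b d e f from ?_))
      (four (show Cyclic₄ a b d e from ?_)) (four (show Cyclic₄ a b d f from ?_)) (four (show Cyclic₄ a b e f from ?_)))
    (key (t₂ r a c) (five (show Cyclic₅ a c d e f from ?_))
      (four (show Cyclic₄ a c d e from ?_)) (four (show Cyclic₄ a c d f from ?_)) (four (show Cyclic₄ a c e f from ?_)))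
    (key (t₂ r b c) (five (show Cyclic₅ b c d e f from ?_))
      (four (show Cyclic₄ b c d e from ?_)) (four (show Cyclic₄ b c d f from ?_)) (four (show Cyclic₄ b c e f from ?_)))
  all_goals
    simp only [Cyclic₆, Cyclic₅, Cyclic₄, Fin.lt_def] at h ⊢
    rcases h with h | h | h | h | h | h <;> omega

theorem s₂_s₂_three (hβ : (Q + Q') * β = 1) {a b c : Fin n} (hab : a ≠ b) (hac : a ≠ c) (hbc : b ≠ c)
    (h : Cyclic₃ a b c) :
    Q • (s₂ r b c * s₂ r a b) - Q' • (s₂ r a b * s₂ r b c) =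
      (Q - Q') • (s₂ r b b * s₂ r a c + central r b • s₃ r a b c) := by
  obtain ⟨⟨y, hy⟩, -, -⟩ := h.relations (r := r)
  rw [s₂_eq r hab, s₂_eq r hac, s₂_eq r hbc, s₂_self, s₃_eq]
  exact pair_pair_three (scalar_mul r) hβ hy

theorem s₂_s₂_four (hβ : (Q + Q') * β = 1) {a b c d : Fin n} (hab : a ≠ b) (hac : a ≠ c) (had : a ≠ d)
    (hbc : b ≠ c) (hbd : b ≠ d) (hcd : c ≠ d) (h : Cyclic₄ a b c d) :
    s₂ r b d * s₂ r a c - s₂ r a c * s₂ r b d =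
      (Q ^ 2 - Q' ^ 2) • (s₂ r a d * s₂ r b c - s₂ r a b * s₂ r c d) := by
  obtain ⟨⟨F, x, y, w, -, -, -, -, h1, h2⟩, -, h4⟩ := h.relations (r := r)
  rw [s₂_eq r hab, s₂_eq r hac, s₂_eq r had, s₂_eq r hbc, s₂_eq r hbd, s₂_eq r hcd]
  exact pair_pair_four (scalar_mul r) hβ h1 h2 h4

theorem s₃_s₂_three (hβ : (Q + Q') * β = 1) {a b c : Fin n} (hab : a ≠ b) (hac : a ≠ c) (hbc : b ≠ c)
    (h : Cyclic₃ a b c) :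
    s₃ r a b c * s₂ r a b - s₂ r a b * s₃ r a b c =
      (β * (Q - Q')) • (Q • central r b • (s₂ r a b * s₂ r a c - s₂ r a a * s₂ r b c -
          central r a • s₃ r a b c) -
        Q' • central r a • (s₂ r a b * s₂ r b c - s₂ r b b * s₂ r a c - central r b • s₃ r a b c)) := by
  obtain ⟨⟨y, hy⟩, ⟨w, hw⟩, hc⟩ := h.relations (r := r)
  rw [s₂_eq r hab, s₂_eq r hac, s₂_eq r hbc, s₂_self, s₂_self, s₃_eq]
  exact triple_pair_three (scalar_mul r) hβ hy hw hc

theorem s₃_s₂_four_left (hβ : (Q + Q') * β = 1) {a b c d : Fin n} (hab : a ≠ b) (hac : a ≠ c)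
    (had : a ≠ d) (hbc : b ≠ c) (hbd : b ≠ d) (hcd : c ≠ d) (h : Cyclic₄ a b c d) :
    Q • (s₃ r b c d * s₂ r a b) - Q' • (s₂ r a b * s₃ r b c d) =
      (Q - Q') • (s₂ r b b * s₃ r a c d + β • central r b • (s₂ r a c * s₂ r b d +
        (1 - Q ^ 2) • (s₂ r a b * s₂ r c d) - Q' ^ 2 • (s₂ r a d * s₂ r b c))) := by
  obtain ⟨⟨F, x, y, w, hx, -, -, -, h1, -⟩, h3, h4⟩ := h.relations (r := r)
  have k1 : Cyclic₃ a b c := by simp only [Cyclic₃, Cyclic₄, Fin.lt_def] at h ⊢; omega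
  have k2 : Cyclic₃ a b d := by simp only [Cyclic₃, Cyclic₄, Fin.lt_def] at h ⊢; omega
  obtain ⟨⟨y1, hy1⟩, -, -⟩ := k1.relations (r := r)
  obtain ⟨⟨y2, hy2⟩, -, -⟩ := k2.relations (r := r)
  rw [s₂_eq r hab, s₂_eq r hac, s₂_eq r had, s₂_eq r hbc, s₂_eq r hbd, s₂_eq r hcd, s₂_self, s₃_eq, s₃_eq]
  exact triple_pair_four_left (scalar_mul r) hβ h1 hx h3 h4 hy1 hy2

theorem s₃_s₂_four_right (hβ : (Q + Q') * β = 1) {a b c d : Fin n} (hab : a ≠ b) (hac : a ≠ c)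
    (had : a ≠ d) (hbc : b ≠ c) (hbd : b ≠ d) (hcd : c ≠ d) (h : Cyclic₄ a b c d) :
    Q' • (s₃ r a c d * s₂ r a b) - Q • (s₂ r a b * s₃ r a c d) =
      (Q' - Q) • (s₂ r a a * s₃ r b c d + β • central r a • (s₂ r a c * s₂ r b d +
        (1 - Q ^ 2) • (s₂ r a b * s₂ r c d) - Q' ^ 2 • (s₂ r a d * s₂ r b c))) := by
  obtain ⟨⟨F, x, y, w, -, hw, -, -, h1, -⟩, h3, h4⟩ := h.relations (r := r)
  have k1 : Cyclic₃ a b c := by simp only [Cyclic₃, Cyclic₄, Fin.lt_def] at h ⊢; omega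
  have k2 : Cyclic₃ a b d := by simp only [Cyclic₃, Cyclic₄, Fin.lt_def] at h ⊢; omega
  obtain ⟨-, ⟨y1, hy1⟩, -⟩ := k1.relations (r := r)
  obtain ⟨-, ⟨y2, hy2⟩, -⟩ := k2.relations (r := r)
  rw [s₂_eq r hab, s₂_eq r hac, s₂_eq r had, s₂_eq r hbc, s₂_eq r hbd, s₂_eq r hcd, s₂_self, s₃_eq, s₃_eq]
  exact triple_pair_four_right (scalar_mul r) hβ h1 hw h3 h4 hy1 hy2

theorem s₃_s₂_four_cross (hβ : (Q + Q') * β = 1) {a b c d : Fin n} (hab : a ≠ b) (hac : a ≠ c)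
    (had : a ≠ d) (hbc : b ≠ c) (hbd : b ≠ d) (hcd : c ≠ d) (h : Cyclic₄ a b c d) :
    s₃ r a b d * s₂ r a c - s₂ r a c * s₃ r a b d =
      (Q - Q') • (Q' • (s₂ r a d * s₃ r a b c) - Q • (s₂ r a b * s₃ r a c d) +
        (Q - Q') • (s₂ r a a * s₃ r b c d) +
        β • central r a • ((Q - Q') • (s₂ r a c * s₂ r b d) +
          (Q - Q' - Q ^ 3) • (s₂ r a b * s₂ r c d) + (Q' ^ 3 + Q - Q') • (s₂ r a d * s₂ r b c))) := by
  obtain ⟨⟨F, x, y, w, -, hw, hy, hyw, h1, h2⟩, h3, h4⟩ := h.relations (r := r)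
  have k1 : Cyclic₃ a b c := by simp only [Cyclic₃, Cyclic₄, Fin.lt_def] at h ⊢; omega
  have k2 : Cyclic₃ a c d := by simp only [Cyclic₃, Cyclic₄, Fin.lt_def] at h ⊢; omega
  have k3 : Cyclic₃ a b d := by simp only [Cyclic₃, Cyclic₄, Fin.lt_def] at h ⊢; omega
  obtain ⟨-, ⟨y1, hy1⟩, -⟩ := k1.relations (r := r)
  obtain ⟨-, ⟨y2, hy2⟩, -⟩ := k2.relations (r := r)
  obtain ⟨-, ⟨y3, hy3⟩, -⟩ := k3.relations (r := r)
  rw [s₂_eq r hab, s₂_eq r hac, s₂_eq r had, s₂_eq r hbc, s₂_eq r hbd, s₂_eq r hcd, s₂_self, s₃_eq, s₃_eq,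
    s₃_eq, s₃_eq]
  exact triple_pair_four_cross (scalar_mul r) hβ h1 h2 hy hw hyw h3 h4 hy1 hy2 hy3

theorem s₃_s₂_five (hβ : (Q + Q') * β = 1) {a b c d e : Fin n} (hab : a ≠ b) (hac : a ≠ c) (hbc : b ≠ c)
    (h : Cyclic₅ a b c d e) :
    s₃ r b d e * s₂ r a c - s₂ r a c * s₃ r b d e =
      (Q ^ 2 - Q' ^ 2) • (s₂ r b c * s₃ r a d e - s₂ r a b * s₃ r c d e) := by
  have k1 : Cyclic₄ a b c d := by simp only [Cyclic₄, Cyclic₅, Fin.lt_def] at h ⊢; omega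
  have k2 : Cyclic₄ a b c e := by simp only [Cyclic₄, Cyclic₅, Fin.lt_def] at h ⊢; omega
  have k3 : Cyclic₄ a c d e := by simp only [Cyclic₄, Cyclic₅, Fin.lt_def] at h ⊢; omega
  obtain ⟨⟨F, x, y, w, -, -, -, -, h1, h2⟩, -⟩ := k1.relations (r := r)
  obtain ⟨⟨F', x', y', w', -, -, -, -, h1', h2'⟩, -⟩ := k2.relations (r := r)
  rw [s₂_eq r hab, s₂_eq r hac, s₂_eq r hbc, s₃_eq, s₃_eq, s₃_eq]
  exact triple_pair_five (scalar_mul r) hβ h.relations.1 h1 h2 h1' h2' k3.relations.2.1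

end SkeinIdentities

end PlanarSkein

theorem mainTheorem5 {R : Type*} [CommRing R] (n : ℕ) (r : Rˣ) (q q' β : R)
    (hq : q = (r : R) ^ 2) (hq' : q' = (↑r⁻¹ : R) ^ 2) (hβ : (q + q') * β = 1) :
    -- commuting generators
    (∀ (i : Fin n) (x : Skein n r), t₁ r i * x = x * t₁ r i) ∧
    (∀ i : Fin 4 → Fin n, CyclicOrder i →
      s₂ r (i 2) (i 3) * s₂ r (i 0) (i 1) = s₂ r (i 0) (i 1) * s₂ r (i 2) (i 3)) ∧
    (∀ i : Fin 5 → Fin n, CyclicOrder i →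
      s₃ r (i 2) (i 3) (i 4) * s₂ r (i 0) (i 1) = s₂ r (i 0) (i 1) * s₃ r (i 2) (i 3) (i 4)) ∧
    (∀ i : Fin 6 → Fin n, CyclicOrder i →
      s₃ r (i 0) (i 1) (i 2) * s₃ r (i 3) (i 4) (i 5) =
        s₃ r (i 3) (i 4) (i 5) * s₃ r (i 0) (i 1) (i 2)) ∧
    -- commutators of type {2,2}
    (∀ i : Fin 3 → Fin n, CyclicOrder i →
      q • (s₂ r (i 1) (i 2) * s₂ r (i 0) (i 1)) - q' • (s₂ r (i 0) (i 1) * s₂ r (i 1) (i 2)) =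
        (q - q') • (s₂ r (i 1) (i 1) * s₂ r (i 0) (i 2) + t₁ r (i 1) * s₃ r (i 0) (i 1) (i 2))) ∧
    (∀ i : Fin 4 → Fin n, CyclicOrder i →
      s₂ r (i 1) (i 3) * s₂ r (i 0) (i 2) - s₂ r (i 0) (i 2) * s₂ r (i 1) (i 3) =
        (q ^ 2 - q' ^ 2) • (s₂ r (i 0) (i 3) * s₂ r (i 1) (i 2) - s₂ r (i 0) (i 1) * s₂ r (i 2) (i 3))) ∧
    -- commutators of type {2,3}
    (∀ i : Fin 3 → Fin n, CyclicOrder i →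
      s₃ r (i 0) (i 1) (i 2) * s₂ r (i 0) (i 1) - s₂ r (i 0) (i 1) * s₃ r (i 0) (i 1) (i 2) =
        (β * (q - q')) •
          (q • (t₁ r (i 1) * (s₂ r (i 0) (i 1) * s₂ r (i 0) (i 2) - s₂ r (i 0) (i 0) * s₂ r (i 1) (i 2)
              - t₁ r (i 0) * s₃ r (i 0) (i 1) (i 2)))
            - q' • (t₁ r (i 0) * (s₂ r (i 0) (i 1) * s₂ r (i 1) (i 2) - s₂ r (i 1) (i 1) * s₂ r (i 0) (i 2)
              - t₁ r (i 1) * s₃ r (i 0) (i 1) (i 2))))) ∧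
    (∀ i : Fin 4 → Fin n, CyclicOrder i →
      q • (s₃ r (i 1) (i 2) (i 3) * s₂ r (i 0) (i 1)) - q' • (s₂ r (i 0) (i 1) * s₃ r (i 1) (i 2) (i 3)) =
        (q - q') • (s₂ r (i 1) (i 1) * s₃ r (i 0) (i 2) (i 3)
          + β • (t₁ r (i 1) * (s₂ r (i 0) (i 2) * s₂ r (i 1) (i 3)
            + (1 - q ^ 2) • (s₂ r (i 0) (i 1) * s₂ r (i 2) (i 3))
            - q' ^ 2 • (s₂ r (i 0) (i 3) * s₂ r (i 1) (i 2)))))) ∧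
    (∀ i : Fin 4 → Fin n, CyclicOrder i →
      q' • (s₃ r (i 0) (i 2) (i 3) * s₂ r (i 0) (i 1)) - q • (s₂ r (i 0) (i 1) * s₃ r (i 0) (i 2) (i 3)) =
        (q' - q) • (s₂ r (i 0) (i 0) * s₃ r (i 1) (i 2) (i 3)
          + β • (t₁ r (i 0) * (s₂ r (i 0) (i 2) * s₂ r (i 1) (i 3)
            + (1 - q ^ 2) • (s₂ r (i 0) (i 1) * s₂ r (i 2) (i 3))
            - q' ^ 2 • (s₂ r (i 0) (i 3) * s₂ r (i 1) (i 2)))))) ∧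
    (∀ i : Fin 4 → Fin n, CyclicOrder i →
      s₃ r (i 0) (i 1) (i 3) * s₂ r (i 0) (i 2) - s₂ r (i 0) (i 2) * s₃ r (i 0) (i 1) (i 3) =
        (q - q') • (q' • (s₂ r (i 0) (i 3) * s₃ r (i 0) (i 1) (i 2))
          - q • (s₂ r (i 0) (i 1) * s₃ r (i 0) (i 2) (i 3))
          + (q - q') • (s₂ r (i 0) (i 0) * s₃ r (i 1) (i 2) (i 3))
          + β • (t₁ r (i 0) * ((q - q') • (s₂ r (i 0) (i 2) * s₂ r (i 1) (i 3))
            + (q - q' - q ^ 3) • (s₂ r (i 0) (i 1) * s₂ r (i 2) (i 3))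
            + (q' ^ 3 + q - q') • (s₂ r (i 0) (i 3) * s₂ r (i 1) (i 2)))))) ∧
    (∀ i : Fin 5 → Fin n, CyclicOrder i →
      s₃ r (i 1) (i 3) (i 4) * s₂ r (i 0) (i 2) - s₂ r (i 0) (i 2) * s₃ r (i 1) (i 3) (i 4) =
        (q ^ 2 - q' ^ 2) • (s₂ r (i 1) (i 2) * s₃ r (i 0) (i 3) (i 4)
          - s₂ r (i 0) (i 1) * s₃ r (i 2) (i 3) (i 4))) := by
  obtain rfl : q = turn r true := hq
  obtain rfl : q' = turn r false := hq'
  obtain rfl : beta r = β := beta_eq r hβ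
  have hb := scalar_shift hβ (n := n)
  refine ⟨t₁_mul_comm, fun i h => s₂_comm_s₂ (h.ne (by decide)) (h.ne (by decide)) h.cyclic₄,
    fun i h => s₃_comm_s₂ (h.ne (by decide)) h.cyclic₅, fun i h => s₃_comm_s₃ h.cyclic₆,
    fun i h => ?_, fun i h => ?_, fun i h => ?_, fun i h => ?_, fun i h => ?_, fun i h => ?_, fun i h => ?_⟩
  -- All scalars from `R` and all factors `t_i` become scalars from the centre, the form in which
  -- the identities were proved.
  all_goals simp only [smul_eq, map_add, map_sub, map_mul, map_pow, map_one, t₁_mul]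
  · exact s₂_s₂_three hb (h.ne (by decide)) (h.ne (by decide)) (h.ne (by decide)) h.cyclic₃
  · exact s₂_s₂_four hb (h.ne (by decide)) (h.ne (by decide)) (h.ne (by decide)) (h.ne (by decide))
      (h.ne (by decide)) (h.ne (by decide)) h.cyclic₄
  · exact s₃_s₂_three hb (h.ne (by decide)) (h.ne (by decide)) (h.ne (by decide)) h.cyclic₃
  · exact s₃_s₂_four_left hb (h.ne (by decide)) (h.ne (by decide)) (h.ne (by decide)) (h.ne (by decide))
      (h.ne (by decide)) (h.ne (by decide)) h.cyclic₄
  · exact s₃_s₂_four_right hb (h.ne (by decide)) (h.ne (by decide)) (h.ne (by decide)) (h.ne (by decide))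
      (h.ne (by decide)) (h.ne (by decide)) h.cyclic₄
  · exact s₃_s₂_four_cross hb (h.ne (by decide)) (h.ne (by decide)) (h.ne (by decide)) (h.ne (by decide))
      (h.ne (by decide)) (h.ne (by decide)) h.cyclic₄
  · exact s₃_s₂_five hb (h.ne (by decide)) (h.ne (by decide)) (h.ne (by decide)) h.cyclic₅
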